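/- **Setting.** Manifolds are smooth, finite dimensional, Hausdorff, second countable and without boundary. For a manifold $M$ of odd dimension $m$, a *twist* is a triple $(H_3,H_2,F)\in\Omega^3(M)\times\Omega^2(M)\times\Omega^2(M)$ of real forms; the Maurer–Cartan equations are $dH_3+H_2\wedge F=0$, $dH_2=0$, $dF=0$. Put $\langle(X,\xi),(Y,\eta)\rangle=\tfrac12(\xi(Y)+\eta(X))$ on $TM\oplus T^*M$ and $\langle(X_1,f_1,g_1,\xi_1),(X_2,f_2,g_2,\xi_2)\rangle=\tfrac12(\xi_1(X_2)+\xi_2(X_1)+f_1g_2+g_1f_2)$ on $TM\oplus\mathbb R\oplus\mathbb R\oplus T^*M$, let $(X,\xi)\cdot\varphi=\iota_X\varphi+\xi\wedge\varphi$ and $(X,f,g,\xi)\cdot(\varphi,\psi)=((X,\xi)\cdot\varphi+f\psi,\ g\varphi-(X,\xi)\cdot\psi)$ (extended complex linearly), and $$d_{H_3,H_2,F}(\varphi,\psi)=(d\varphi+H_3\wedge\varphi+F\wedge\psi,\ H_2\wedge\varphi-d\psi-H_3\wedge\psi).$$ A *Sekiya quadruple* $S=(\Phi,e_1,e_2,\lambda)$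 consists of smooth $\Phi\in\mathrm{End}(TM\oplus T^*M)$, $e_1,e_2\in\Gamma(TM\oplus T^*M)$, $\lambda\in C^\infty(M)$ with $\langle e_1,e_1\rangle=\langle e_2,e_2\rangle=0$, $\langle e_1,e_2\rangle=\frac12$, $\Phi^*=-\Phi$, $\Phi e_1=\lambda e_1$, $\Phi e_2=-\lambda e_2$, $\Phi^2v=-v+2(1+\lambda^2)(\langle v,e_2\rangle e_1+\langle v,e_1\rangle e_2)$. With $\mu=\sqrt{1+\lambda^2}$ it defines $\mathcal J(v,f,g)=(\Phi v+\mu fe_1+\mu ge_2,\ -2\mu\langle e_2,v\rangle-\lambda f,\ -2\mu\langle e_1,v\rangle+\lambda g)$. A *mixed pair* of $S$ on an open set $U$ is a pair of smooth complex polyforms on $U$, one even and one odd, with $$e_1\cdot\psi=0,\quad \mu e_1\cdot\varphi=(1+i\lambda)\psi,\quad e_2\cdot\varphi=0,\quad \mu e_2\cdot\psi=(1-i\lambda)\varphi,$$ such that $\mathrm{Ann}(\varphi)\cap\mathrm{Ann}(\psi)$ is the $+i$-eigenbundle of $\Phi$ and the length $((\varphi,\psi),(\bar\varphi,-\bar\psi))_M$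 vanishes nowhere; here $((\varphi_1,\psi_1),(\varphi_2,\psi_2))_M=\big((-1)^{|\varphi_1|}\alpha(\varphi_1)\wedge\psi_2+(-1)^{|\psi_1|}\alpha(\psi_1)\wedge\varphi_2\big)_{m}$ and $\alpha$ reverses the order of one-form factors ($(\bar\varphi,-\bar\psi)$ is the pair representing the complex conjugate of $\varphi+i\mathcal A\psi$). $S$ is a *generalised $(H_3,H_2,F)$-contact structure* if the twist satisfies the Maurer–Cartan equations, $S$ has a mixed pair near every point, and every mixed pair $(\varphi,\psi)$ of $S$ on any open set $U$ satisfies $d_{H_3,H_2,F}(\varphi,\psi)=V\cdot(\varphi,\psi)$ for some complex section $V$ over $U$. A *generalised coKähler structure* is a pair $(S_1,S_2)$ of generalised $(H_3,H_2,F)$-contact structures with $\mathcal J_1\mathcal J_2=\mathcal J_2\mathcal J_1$ and $\langle-\mathcal J_1\mathcal J_2\,\cdot,\cdot\rangle$ positive definite. It is *generalised coKähler–Einstein* with constant $c\in\mathbb R$ if it is described by global mixed pairs $(\varphi_j,\psi_j)$ of $S_j$ with $$((\varphi_1,\psi_1),(\bar\varphi_1,-\bar\psi_1))_M=c\,((\varphi_2,\psi_2),(\bar\varphi_2,-\bar\psi_2))_M.$$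 **T-duality.** Let $k\ge0$, let $M,\tilde M\to B$ be principal $T^k$-bundles of odd dimension, and let $P,\tilde P\to B$ be principal $T^{k+1}$-bundles with principal connections $(\mathcal A_0,\dots,\mathcal A_k)$, $(\tilde{\mathcal A}_0,\dots,\tilde{\mathcal A}_k)$ and equivariant maps $q:P\to M$, $\tilde q:\tilde P\to\tilde M$ over $B$ that are the quotients by the circle with index $0$. Let $(H_3,H_2,F)$ and $(\tilde H_3,\tilde H_2,\tilde F)$ be twists on $M$ and $\tilde M$ with $d\mathcal A_0=q^*F$, $d\tilde{\mathcal A}_0=\tilde q^*\tilde F$, and put $H=q^*H_3+\mathcal A_0\wedge q^*H_2$, $\tilde H=\tilde q^*\tilde H_3+\tilde{\mathcal A}_0\wedge\tilde q^*\tilde H_2$. Assume that $P$ and $\tilde P$ are T-dual: on the correspondence space $P\times_B\tilde P$, with projections $p,\tilde p$ to $P,\tilde P$, $$p^*H-\tilde p^*\tilde H=d\mathcal F,\qquad \mathcal F=-\sum_{i=0}^k\mathcal A_i\wedge\tilde{\mathcal A}_i .$$ Let $\tau_{\mathcal F}(\rho)=\int_{T^{k+1}}e^{\mathcal F}\wedge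 p^*\rho$ (integration along the fibres of $\tilde p$). Fix a sign $\varepsilon\in\{1,-1\}$ (an orientation of the dual circle). The *T-dual* of a $T^k$-invariant pair $(\varphi,\psi)$ over an open $U\subseteq B$ is the pair $(\tilde\varphi,\tilde\psi)$ with $\tau_{\mathcal F}(q^*\varphi+i\mathcal A_0\wedge q^*\psi)=\tilde q^*\tilde\varphi+\varepsilon i\tilde{\mathcal A}_0\wedge\tilde q^*\tilde\psi$. A quadruple $\tilde S$ on $\tilde M$ is T-dual to $S$ if over every open subset of $B$ each $T^k$-invariant mixed pair of $S$ has a T-dual pair, which is a $T^k$-invariant mixed pair of $\tilde S$. **Proposition.** 1. For every generalised coKähler structure $(S_1,S_2)$ on $M$ with twist $(H_3,H_2,F)$ and $T^k$-invariant $S_1,S_2$ there is a generalised coKähler structure $(\tilde S_1,\tilde S_2)$ on $\tilde M$ with twist $(\tilde H_3,-\varepsilon\tilde H_2,-\varepsilon\tilde F)$ and $T^k$-invariant $\tilde S_j$ such that $\tilde S_j$ is T-dual to $S_j$, $j=1,2$. (For $\varepsilon=-1$ this is the twist $(\tilde H_3,\tilde H_2,\tilde F)$.) 2. For every $T^k$-invariant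 generalised coKähler–Einstein structure on $M$ with twist $(H_3,H_2,F)$, constant $c$ and invariant mixed pairs $(\varphi_j,\psi_j)$, the T-dual pairs $(\tilde\varphi_j,\tilde\psi_j)$ exist and are invariant mixed pairs of a $T^k$-invariant generalised coKähler–Einstein structure on $\tilde M$ with twist $(\tilde H_3,-\varepsilon\tilde H_2,-\varepsilon\tilde F)$ and the same constant $c$. 3. Statement 2 also holds if, on both sides, the condition that $(S_1,S_2)$ be generalised coKähler is weakened to the condition that $S_1$ and $S_2$ be generalised contact structures; and then, if $S_1,S_2$ have the same sections $e_1,e_2$, so may $\tilde S_1,\tilde S_2$ be chosen. -/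

import Mathlib

/-! Generalised contact and coKähler geometry, and T-duality of principal torus bundles.

Conventions.  All manifolds are smooth, finite dimensional, boundaryless, and modelled on a normed
space `E` through `𝓘(ℝ, E)`.  In Mathlib the tangent space at `x` is the model space `E` (seen
through the preferred chart at `x`), so vectors, covectors and alternating forms at a point are
written as elements of `E`, `E →L[ℝ] ℝ`, `E [⋀^Fin k]→L[ℝ] ℂ`. -/

open scoped Manifold ContDiff

noncomputable section

namespace GenGeom

/-! ### Linear algebra of complex polyforms on a vector space -/

section Linear

variable {V W : Type*} [NormedAddCommGroup V] [NormedSpace ℝ V]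
  [NormedAddCommGroup W] [NormedSpace ℝ W]

/-- Complex polyforms on `V`: one complex-valued alternating form in each degree. -/
abbrev PForm (V : Type*) [NormedAddCommGroup V] [NormedSpace ℝ V] : Type _ :=
  ∀ k : ℕ, V [⋀^Fin k]→L[ℝ] ℂ

/-- The tensor product of a `p`-form and a `q`-form, as a multilinear map in `k = p + q` vectors. -/
def tensor {p q k : ℕ} (h : p + q = k) (a : V [⋀^Fin p]→L[ℝ] ℂ) (b : V [⋀^Fin q]→L[ℝ] ℂ) :
    ContinuousMultilinearMap ℝ (fun _ : Fin k => V) ℂ where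
  toFun v := a (fun i => v (Fin.cast h (Fin.castAdd q i))) *
    b (fun j => v (Fin.cast h (Fin.natAdd p j)))
  map_update_add' := by
    subst h
    intro _ m i x y
    induction i using Fin.addCases with
    | left i =>
      have h1 : ∀ z : V, (fun l : Fin p => Function.update m (Fin.castAdd q i) z
          (Fin.castAdd q l)) = Function.update (fun l => m (Fin.castAdd q l)) i z := by
        intro z; funext l; by_cases hl : l = i
        · subst hl; simp
        · simp [Function.update_of_ne hl]
          rw [Function.update_of_ne]; simpa using hl
      have h2 : ∀ z : V, (fun l : Fin q => Function.update m (Fin.castAdd q i) z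
          (Fin.natAdd p l)) = fun l => m (Fin.natAdd p l) := by
        intro z; funext l
        rw [Function.update_of_ne]; simp [Fin.ext_iff]; omega
      simp only [Fin.cast_refl, id_eq]
      rw [h1, h1, h1, h2, h2, h2, a.map_update_add, add_mul]
    | right i =>
      have h1 : ∀ z : V, (fun l : Fin q => Function.update m (Fin.natAdd p i) z
          (Fin.natAdd p l)) = Function.update (fun l => m (Fin.natAdd p l)) i z := by
        intro z; funext l; by_cases hl : l = i
        · subst hl; simp
        · simp [Function.update_of_ne hl]
          rw [Function.update_of_ne]; simpa using hl
      have h2 : ∀ z : V, (fun l : Fin p => Function.update m (Fin.natAdd p i) z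
          (Fin.castAdd q l)) = fun l => m (Fin.castAdd q l) := by
        intro z; funext l
        rw [Function.update_of_ne]; simp [Fin.ext_iff]; omega
      simp only [Fin.cast_refl, id_eq]
      rw [h1, h1, h1, h2, h2, h2, b.map_update_add, mul_add]
  map_update_smul' := by
    subst h
    intro _ m i c x
    induction i using Fin.addCases with
    | left i =>
      have h1 : ∀ z : V, (fun l : Fin p => Function.update m (Fin.castAdd q i) z
          (Fin.castAdd q l)) = Function.update (fun l => m (Fin.castAdd q l)) i z := by
        intro z; funext l; by_cases hl : l = i
        · subst hl; simp
        · simp [Function.update_of_ne hl]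
          rw [Function.update_of_ne]; simpa using hl
      have h2 : ∀ z : V, (fun l : Fin q => Function.update m (Fin.castAdd q i) z
          (Fin.natAdd p l)) = fun l => m (Fin.natAdd p l) := by
        intro z; funext l
        rw [Function.update_of_ne]; simp [Fin.ext_iff]; omega
      simp only [Fin.cast_refl, id_eq]
      rw [h1, h1, h2, h2, a.map_update_smul, smul_mul_assoc]
    | right i =>
      have h1 : ∀ z : V, (fun l : Fin q => Function.update m (Fin.natAdd p i) z
          (Fin.natAdd p l)) = Function.update (fun l => m (Fin.natAdd p l)) i z := by
        intro z; funext l; by_cases hl : l = i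
        · subst hl; simp
        · simp [Function.update_of_ne hl]
          rw [Function.update_of_ne]; simpa using hl
      have h2 : ∀ z : V, (fun l : Fin p => Function.update m (Fin.natAdd p i) z
          (Fin.castAdd q l)) = fun l => m (Fin.castAdd q l) := by
        intro z; funext l
        rw [Function.update_of_ne]; simp [Fin.ext_iff]; omega
      simp only [Fin.cast_refl, id_eq]
      rw [h1, h1, h2, h2, b.map_update_smul, mul_smul_comm]
  cont := by
    refine Continuous.mul ?_ ?_
    · exact a.cont.comp (continuous_pi fun i => continuous_apply _)
    · exact b.cont.comp (continuous_pi fun i => continuous_apply _)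

/-- The wedge product of a `p`-form and a `q`-form (with `k = p + q`):
`(a ∧ b)(v) = 1/(p! q!) ∑_σ sign σ • a (v_σ(1), …, v_σ(p)) b (v_σ(p+1), …, v_σ(k))`. -/
def wedgeHom {p q k : ℕ} (h : p + q = k) (a : V [⋀^Fin p]→L[ℝ] ℂ) (b : V [⋀^Fin q]→L[ℝ] ℂ) :
    V [⋀^Fin k]→L[ℝ] ℂ :=
  ((p.factorial * q.factorial : ℕ) : ℝ)⁻¹ •
    ContinuousMultilinearMap.alternatization (tensor h a b)

/-- The wedge product of polyforms. -/
def wedge (α β : PForm V) : PForm V := fun k =>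
  ∑ pq ∈ (Finset.HasAntidiagonal.antidiagonal k).attach,
    wedgeHom (Finset.HasAntidiagonal.mem_antidiagonal.1 pq.2) (α pq.1.1) (β pq.1.2)

/-- Interior product with a vector. -/
def iota (X : V) (φ : PForm V) : PForm V := fun k => (φ (k + 1)).curryLeft X

/-- A real `k`-form as a complex polyform. -/
def ofReal (k : ℕ) (η : V [⋀^Fin k]→L[ℝ] ℝ) : PForm V :=
  Pi.single k (Complex.ofRealCLM.compContinuousAlternatingMap η)

/-- A real covector as a complex polyform of degree one. -/
def ofCovector (ξ : V →L[ℝ] ℝ) : PForm V :=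
  ofReal 1 (ContinuousAlternatingMap.ofSubsingleton ℝ V ℝ (0 : Fin 1) ξ)

/-- Complex conjugation of polyforms. -/
def conj (φ : PForm V) : PForm V := fun k =>
  (Complex.conjCLE : ℂ →L[ℝ] ℂ).compContinuousAlternatingMap (φ k)

/-- Pullback of polyforms by a linear map. -/
def pull (f : V →L[ℝ] W) (φ : PForm W) : PForm V := fun k => (φ k).compContinuousLinearMap f

/-- `e^F ∧ φ = ∑_j (1/j!) F ∧ ⋯ ∧ F ∧ φ` for a two-form `F`; in degree `k` the terms with
`j > k` vanish. -/
def expWedge (F φ : PForm V) : PForm V := fun k =>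
  ∑ j ∈ Finset.range (k + 1), ((j.factorial : ℝ)⁻¹) • ((wedge F)^[j] φ) k

/-- `φ ↦ (-1)^{|φ|} α(φ)`, where `α` reverses the order of the factors of a product of one-forms,
i.e. `α(φ) = (-1)^{k(k-1)/2} φ` in degree `k`. -/
def signedReverse (φ : PForm V) : PForm V := fun k =>
  ((-1 : ℝ) ^ k * (-1 : ℝ) ^ (k * (k - 1) / 2)) • φ k

/-- The pairing
`((φ₁,ψ₁),(φ₂,ψ₂)) = ((-1)^{|φ₁|} α(φ₁) ∧ ψ₂ + (-1)^{|ψ₁|} α(ψ₁) ∧ φ₂)_m`, `m = dim V`.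
Up to the factor `i` it is the coefficient of `A` in the Mukai pairing of `φ₁ + i A ψ₁` and
`φ₂ + i A ψ₂` in dimension `m + 1`. -/
def pairing (p₁ p₂ : PForm V × PForm V) : V [⋀^Fin (Module.finrank ℝ V)]→L[ℝ] ℂ :=
  (wedge (signedReverse p₁.1) p₂.2 + wedge (signedReverse p₁.2) p₂.1) (Module.finrank ℝ V)

/-- Complex conjugation of the spinor `φ + i A ∧ ψ` (with `A` real) in terms of pairs: the
conjugate of `(φ, ψ)` is `(φ̄, -ψ̄)`, because `conj (φ + i A ∧ ψ) = φ̄ + i A ∧ (-ψ̄)`. -/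
def conjPair (p : PForm V × PForm V) : PForm V × PForm V := (conj p.1, -conj p.2)

/-- The generalised tangent space `V ⊕ V*`, with elements `(X, ξ)`. -/
abbrev GT (V : Type*) [NormedAddCommGroup V] [NormedSpace ℝ V] : Type _ := V × (V →L[ℝ] ℝ)

/-- The space `V ⊕ ℝ ⊕ ℝ ⊕ V*`, with elements `(X, f, g, ξ)` arranged as `((X, ξ), f, g)`. -/
abbrev CE (V : Type*) [NormedAddCommGroup V] [NormedSpace ℝ V] : Type _ := GT V × ℝ × ℝ

/-- `⟨(X, ξ), (Y, η)⟩ = (ξ(Y) + η(X)) / 2`. -/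
def inGT (v w : GT V) : ℝ := (v.2 w.1 + w.2 v.1) / 2

/-- `⟨(X₁,f₁,g₁,ξ₁), (X₂,f₂,g₂,ξ₂)⟩ = (ξ₁(X₂) + ξ₂(X₁) + f₁ g₂ + g₁ f₂) / 2`. -/
def inCE (a b : CE V) : ℝ := inGT a.1 b.1 + (a.2.1 * b.2.2 + a.2.2 * b.2.1) / 2

/-- Clifford action of `V ⊕ V*` on polyforms: `(X, ξ) · φ = ι_X φ + ξ ∧ φ`. -/
def cliff (v : GT V) (φ : PForm V) : PForm V := iota v.1 φ + wedge (ofCovector v.2) φ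

/-- Clifford action of `a + i b ∈ (V ⊕ V*) ⊗ ℂ`. -/
def cliffC (a b : GT V) (φ : PForm V) : PForm V := cliff a φ + Complex.I • cliff b φ

/-- Clifford action on pairs:
`(X,f,g,ξ) · (φ, ψ) = (ι_X φ + ξ ∧ φ + f ψ, g φ - ι_X ψ - ξ ∧ ψ)`. -/
def cliffPair (a : CE V) (p : PForm V × PForm V) : PForm V × PForm V :=
  (cliff a.1 p.1 + a.2.1 • p.2, a.2.2 • p.1 - cliff a.1 p.2)

end Linear

/-! ### Fields of forms on a manifold -/

section Fields

variable {E H M : Type*} [NormedAddCommGroup E] [NormedSpace ℝ E] [TopologicalSpace H]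
  (I : ModelWithCorners ℝ E H) [TopologicalSpace M] [ChartedSpace H M]

/-- The local expression, in the preferred chart at `x₀`, of a field of `k`-forms. -/
def chartRep {k : ℕ} (η : M → E [⋀^Fin k]→L[ℝ] ℂ) (x₀ : M) (u : E) : E [⋀^Fin k]→L[ℝ] ℂ :=
  (η ((extChartAt I x₀).symm u)).compContinuousLinearMap
    (mfderiv 𝓘(ℝ, E) I (extChartAt I x₀).symm u : E →L[ℝ] E)

/-- A field of polyforms is smooth on the open set `U`. -/
def SmoothFormOn (φ : M → PForm E) (U : Set M) : Prop :=
  ∀ (k : ℕ) (x₀ : M), ContDiffOn ℝ ∞ (chartRep I (fun x => φ x k) x₀)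
    ((extChartAt I x₀).target ∩ (extChartAt I x₀).symm ⁻¹' U)

/-- The exterior derivative of a field of polyforms; at `x` it is computed in the preferred chart
at `x`, whose differential at `x` is the identity of `E`. -/
def extD (φ : M → PForm E) (x : M) : PForm E
  | 0 => 0
  | k + 1 => extDeriv (chartRep I (fun y => φ y k) x) (extChartAt I x x)

end Fields

section Manifold

variable {E M : Type*} [NormedAddCommGroup E] [NormedSpace ℝ E]
  [TopologicalSpace M] [ChartedSpace E M] [IsManifold 𝓘(ℝ, E) ∞ M]

/-- A section `(X, ξ)` of `TM ⊕ T*M` is smooth on the open set `U`. -/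
def SmoothGTOn (v : M → GT E) (U : Set M) : Prop :=
  ContMDiffOn 𝓘(ℝ, E) 𝓘(ℝ, E).tangent ∞
    (fun x => (⟨x, (v x).1⟩ : TangentBundle 𝓘(ℝ, E) M)) U ∧
  SmoothFormOn 𝓘(ℝ, E) (fun x => ofCovector (v x).2) U

/-- A real function is smooth on the open set `U`. -/
def SmoothFunOn (f : M → ℝ) (U : Set M) : Prop := ContMDiffOn 𝓘(ℝ, E) 𝓘(ℝ, ℝ) ∞ f U

/-- A section `(X, f, g, ξ)` of `TM ⊕ ℝ ⊕ ℝ ⊕ T*M` is smooth on the open set `U`. -/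
def SmoothCEOn (a : M → CE E) (U : Set M) : Prop :=
  SmoothGTOn (fun x => (a x).1) U ∧ SmoothFunOn (E := E) (fun x => (a x).2.1) U ∧
    SmoothFunOn (E := E) (fun x => (a x).2.2) U

/-- Pullback of a field of polyforms by a map `f`. -/
def pullback {E' N : Type*} [NormedAddCommGroup E'] [NormedSpace ℝ E'] [TopologicalSpace N]
    [ChartedSpace E' N] (f : N → M) (φ : M → PForm E) (x : N) : PForm E' :=
  pull (V := E') (W := E) (mfderiv 𝓘(ℝ, E') 𝓘(ℝ, E) f x) (φ (f x))

/-! ### Twists, Sekiya quadruples, mixed pairs, generalised contact structures -/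

/-- A triple `(H₃, H₂, F)` of a real three-form and two real two-forms on `M`. -/
structure Twist (E M : Type*) [NormedAddCommGroup E] [NormedSpace ℝ E] where
  H3 : M → E [⋀^Fin 3]→L[ℝ] ℝ
  H2 : M → E [⋀^Fin 2]→L[ℝ] ℝ
  F : M → E [⋀^Fin 2]→L[ℝ] ℝ

namespace Twist

/-- The twist `(H₃, s H₂, s F)`. -/
def scale (s : ℝ) (t : Twist E M) : Twist E M :=
  ⟨t.H3, fun x => s • t.H2 x, fun x => s • t.F x⟩

/-- The three forms are smooth. -/
def Smooth (t : Twist E M) : Prop :=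
  SmoothFormOn 𝓘(ℝ, E) (fun x => ofReal 3 (t.H3 x)) Set.univ ∧
  SmoothFormOn 𝓘(ℝ, E) (fun x => ofReal 2 (t.H2 x)) Set.univ ∧
  SmoothFormOn 𝓘(ℝ, E) (fun x => ofReal 2 (t.F x)) Set.univ

/-- The Maurer–Cartan equations `dH₃ + H₂ ∧ F = 0`, `dH₂ = 0`, `dF = 0`. -/
def MaurerCartan (t : Twist E M) : Prop :=
  ∀ x : M, extD 𝓘(ℝ, E) (fun y => ofReal 3 (t.H3 y)) x +
      wedge (ofReal 2 (t.H2 x)) (ofReal 2 (t.F x)) = 0 ∧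
    extD 𝓘(ℝ, E) (fun y => ofReal 2 (t.H2 y)) x = 0 ∧
    extD 𝓘(ℝ, E) (fun y => ofReal 2 (t.F y)) x = 0

/-- `d_{H₃,H₂,F}(φ, ψ) = (dφ + H₃ ∧ φ + F ∧ ψ, H₂ ∧ φ - dψ - H₃ ∧ ψ)`; these are the components of
`(d + H ∧)(φ + A ∧ ψ)` for `H = H₃ + A ∧ H₂` and `dA = F`. -/
def d (t : Twist E M) (p : M → PForm E × PForm E) (x : M) : PForm E × PForm E :=
  (extD 𝓘(ℝ, E) (fun y => (p y).1) x + wedge (ofReal 3 (t.H3 x)) (p x).1 +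
      wedge (ofReal 2 (t.F x)) (p x).2,
    wedge (ofReal 2 (t.H2 x)) (p x).1 - extD 𝓘(ℝ, E) (fun y => (p y).2) x -
      wedge (ofReal 3 (t.H3 x)) (p x).2)

end Twist

/-- The data `(Φ, e₁, e₂, λ)` with `Φ ∈ End(TM ⊕ T*M)`, `e₁, e₂ ∈ Γ(TM ⊕ T*M)`, `λ : M → ℝ`. -/
structure Quadruple (E M : Type*) [NormedAddCommGroup E] [NormedSpace ℝ E] where
  Φ : M → GT E →ₗ[ℝ] GT E
  e₁ : M → GT E
  e₂ : M → GT E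
  lam : M → ℝ

namespace Quadruple

/-- `μ = √(1 + λ²)`. -/
def mu (S : Quadruple E M) (x : M) : ℝ := Real.sqrt (1 + S.lam x ^ 2)

/-- A Sekiya quadruple: `(Φ, e₁, e₂, λ)` is smooth (an endomorphism field is smooth when it maps
local smooth sections to smooth sections), and
`⟨e₁,e₁⟩ = ⟨e₂,e₂⟩ = 0`, `⟨e₁,e₂⟩ = 1/2`, `Φ* = -Φ`, `Φ e₁ = λ e₁`, `Φ e₂ = -λ e₂`,
`Φ² v = -v + 2(1+λ²)(⟨v,e₂⟩ e₁ + ⟨v,e₁⟩ e₂)`. -/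
structure IsSekiya (S : Quadruple E M) : Prop where
  smooth_Φ : ∀ (U : Set M) (v : M → GT E), IsOpen U → SmoothGTOn v U →
    SmoothGTOn (fun x => S.Φ x (v x)) U
  smooth_e₁ : SmoothGTOn S.e₁ Set.univ
  smooth_e₂ : SmoothGTOn S.e₂ Set.univ
  smooth_lam : SmoothFunOn (E := E) S.lam Set.univ
  e₁_e₁ : ∀ x, inGT (S.e₁ x) (S.e₁ x) = 0
  e₂_e₂ : ∀ x, inGT (S.e₂ x) (S.e₂ x) = 0
  e₁_e₂ : ∀ x, inGT (S.e₁ x) (S.e₂ x) = 1 / 2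
  skew : ∀ x v w, inGT (S.Φ x v) w = -inGT v (S.Φ x w)
  Φ_e₁ : ∀ x, S.Φ x (S.e₁ x) = S.lam x • S.e₁ x
  Φ_e₂ : ∀ x, S.Φ x (S.e₂ x) = -S.lam x • S.e₂ x
  Φ_sq : ∀ x v, S.Φ x (S.Φ x v) =
    -v + (2 * (1 + S.lam x ^ 2)) • (inGT v (S.e₂ x) • S.e₁ x + inGT v (S.e₁ x) • S.e₂ x)

/-- The endomorphism of `TM ⊕ ℝ ⊕ ℝ ⊕ T*M` associated with a quadruple,
`𝒥 (v, f, g) = (Φ v + μ f e₁ + μ g e₂, -2μ⟨e₂, v⟩ - λ f, -2μ⟨e₁, v⟩ + λ g)`. -/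
def J (S : Quadruple E M) (x : M) (a : CE E) : CE E :=
  (S.Φ x a.1 + (S.mu x * a.2.1) • S.e₁ x + (S.mu x * a.2.2) • S.e₂ x,
    -2 * S.mu x * inGT (S.e₂ x) a.1 - S.lam x * a.2.1,
    -2 * S.mu x * inGT (S.e₁ x) a.1 + S.lam x * a.2.2)

/-- `p = (φ, ψ)` is a mixed pair on the open set `U` associated with the quadruple
`(Φ, e₁, e₂, λ)`: the two polyforms are smooth and of opposite parities, the pairing of `(φ, ψ)`
with its conjugate vanishes nowhere, `e₁·ψ = 0`, `μ e₁·φ = (1+iλ) ψ`, `e₂·φ = 0`,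
`μ e₂·ψ = (1-iλ) φ`, and the `+i`-eigenspace of `Φ` (elements `a + i b` with `Φ a = -b`,
`Φ b = a`) is the intersection of the annihilators of `φ` and `ψ`. -/
structure IsMixedPairOn (S : Quadruple E M) (U : Set M) (p : M → PForm E × PForm E) : Prop where
  smooth_fst : SmoothFormOn 𝓘(ℝ, E) (fun x => (p x).1) U
  smooth_snd : SmoothFormOn 𝓘(ℝ, E) (fun x => (p x).2) U
  parity : (∀ x ∈ U, ∀ k, (Odd k → (p x).1 k = 0) ∧ (Even k → (p x).2 k = 0)) ∨
    (∀ x ∈ U, ∀ k, (Even k → (p x).1 k = 0) ∧ (Odd k → (p x).2 k = 0))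
  nondegenerate : ∀ x ∈ U, pairing (p x) (conjPair (p x)) ≠ 0
  e₁_snd : ∀ x ∈ U, cliff (S.e₁ x) (p x).2 = 0
  e₁_fst : ∀ x ∈ U, S.mu x • cliff (S.e₁ x) (p x).1 = (1 + Complex.I * S.lam x) • (p x).2
  e₂_fst : ∀ x ∈ U, cliff (S.e₂ x) (p x).1 = 0
  e₂_snd : ∀ x ∈ U, S.mu x • cliff (S.e₂ x) (p x).2 = (1 - Complex.I * S.lam x) • (p x).1
  eigenspace : ∀ x ∈ U, ∀ a b : GT E, (S.Φ x a = -b ∧ S.Φ x b = a) ↔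
    (cliffC a b (p x).1 = 0 ∧ cliffC a b (p x).2 = 0)

end Quadruple

/-- `p = (φ, ψ)` is `(H₃, H₂, F)`-involutive on the open set `U`:
`d_{H₃,H₂,F}(φ, ψ) = V · (φ, ψ)` for a smooth complex section `V = V₁ + i V₂` of
`(TM ⊕ ℝ ⊕ ℝ ⊕ T*M) ⊗ ℂ` over `U`. -/
def InvolutiveOn (t : Twist E M) (U : Set M) (p : M → PForm E × PForm E) : Prop :=
  ∃ V₁ V₂ : M → CE E, SmoothCEOn V₁ U ∧ SmoothCEOn V₂ U ∧
    ∀ x ∈ U, t.d p x = cliffPair (V₁ x) (p x) + Complex.I • cliffPair (V₂ x) (p x)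

/-- A generalised `(H₃, H₂, F)`-contact structure, given by its Sekiya quadruple: the twist is
smooth and satisfies the Maurer–Cartan equations, the quadruple is locally described by mixed
pairs, and every mixed pair associated with it, on any open set, is `(H₃, H₂, F)`-involutive. -/
structure IsGenContact (t : Twist E M) (S : Quadruple E M) : Prop where
  smooth_twist : t.Smooth
  maurerCartan : t.MaurerCartan
  sekiya : S.IsSekiya
  exists_pair : ∀ x, ∃ (U : Set M) (p : M → PForm E × PForm E), IsOpen U ∧ x ∈ U ∧
    S.IsMixedPairOn U p
  involutive : ∀ (U : Set M) (p : M → PForm E × PForm E), IsOpen U → S.IsMixedPairOn U p →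
    InvolutiveOn t U p

/-- A generalised coKähler structure: two generalised `(H₃, H₂, F)`-contact structures such that
`𝒥₁ 𝒥₂ = 𝒥₂ 𝒥₁` and `𝒢 = -𝒥₁ 𝒥₂` is a generalised metric, i.e. `⟨𝒢 ·, ·⟩` is positive definite. -/
structure IsGenCoKahler (t : Twist E M) (S₁ S₂ : Quadruple E M) : Prop where
  contact₁ : IsGenContact t S₁
  contact₂ : IsGenContact t S₂
  comm : ∀ x a, S₁.J x (S₂.J x a) = S₂.J x (S₁.J x a)
  pos : ∀ x a, a ≠ 0 → 0 < inCE (-(S₁.J x (S₂.J x a))) a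

/-- Two generalised contact structures with globally defined mixed pairs `p₁`, `p₂` whose lengths
are proportional: the pairing of `(φ₁,ψ₁)` with its conjugate is `c` times the pairing of `(φ₂,ψ₂)`
with its conjugate, for a real constant `c`. -/
structure IsEinsteinPair (t : Twist E M) (c : ℝ) (S₁ S₂ : Quadruple E M)
    (p₁ p₂ : M → PForm E × PForm E) : Prop where
  contact₁ : IsGenContact t S₁
  contact₂ : IsGenContact t S₂
  mixed₁ : S₁.IsMixedPairOn Set.univ p₁
  mixed₂ : S₂.IsMixedPairOn Set.univ p₂
  length : ∀ x, pairing (p₁ x) (conjPair (p₁ x)) = c • pairing (p₂ x) (conjPair (p₂ x))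

/-- A generalised coKähler–Einstein structure: a generalised coKähler structure described by two
globally defined mixed pairs with proportional lengths. -/
structure IsGenCoKahlerEinstein (t : Twist E M) (c : ℝ) (S₁ S₂ : Quadruple E M)
    (p₁ p₂ : M → PForm E × PForm E) : Prop where
  coKahler : IsGenCoKahler t S₁ S₂
  einstein : IsEinsteinPair t c S₁ S₂ p₁ p₂

end Manifold

/-! ### Principal torus bundles -/

/-- A smooth principal `Tⁿ`-bundle `P → B`, where `Tⁿ = ℝⁿ/ℤⁿ`: the torus action is given as an
action of `ℝⁿ` all of whose stabilisers are equal to `ℤⁿ`; its orbits are the fibres of the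
projection, which has smooth local sections. -/
structure TorusBundle (n : ℕ) (EP P EB B : Type*)
    [NormedAddCommGroup EP] [NormedSpace ℝ EP] [TopologicalSpace P] [ChartedSpace EP P]
    [NormedAddCommGroup EB] [NormedSpace ℝ EB] [TopologicalSpace B] [ChartedSpace EB B] where
  proj : P → B
  act : (Fin n → ℝ) → P → P
  smooth_proj : ContMDiff 𝓘(ℝ, EP) 𝓘(ℝ, EB) ∞ proj
  smooth_act : ContMDiff (𝓘(ℝ, Fin n → ℝ).prod 𝓘(ℝ, EP)) 𝓘(ℝ, EP) ∞
    (fun z : (Fin n → ℝ) × P => act z.1 z.2)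
  act_zero : ∀ x, act 0 x = x
  act_add : ∀ s t x, act (s + t) x = act s (act t x)
  act_eq_self_iff : ∀ s x, act s x = x ↔ ∀ i, ∃ z : ℤ, s i = z
  proj_eq_iff : ∀ x y, proj x = proj y ↔ ∃ s, act s x = y
  exists_section : ∀ b, ∃ (U : Set B) (σ : B → P), IsOpen U ∧ b ∈ U ∧
    ContMDiffOn 𝓘(ℝ, EB) 𝓘(ℝ, EP) ∞ σ U ∧ ∀ y ∈ U, proj (σ y) = y
  finrank_eq : Module.finrank ℝ EP = Module.finrank ℝ EB + n

namespace TorusBundle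

variable {n : ℕ} {EP P EB B : Type*}
  [NormedAddCommGroup EP] [NormedSpace ℝ EP] [TopologicalSpace P] [ChartedSpace EP P]
  [NormedAddCommGroup EB] [NormedSpace ℝ EB] [TopologicalSpace B] [ChartedSpace EB B]
  (T : TorusBundle n EP P EB B)

/-- The differential of the projection. -/
def dproj (x : P) : EP →L[ℝ] EB := mfderiv 𝓘(ℝ, EP) 𝓘(ℝ, EB) T.proj x

/-- The differential at `x` of the action of `s`. -/
def dact (s : Fin n → ℝ) (x : P) : EP →L[ℝ] EP := mfderiv 𝓘(ℝ, EP) 𝓘(ℝ, EP) (T.act s) x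

/-- The fundamental vector fields `∂₁, …, ∂ₙ` of the action. -/
def gen (i : Fin n) (x : P) : EP :=
  (mfderiv 𝓘(ℝ, Fin n → ℝ) 𝓘(ℝ, EP) (fun s => T.act s x) 0 : (Fin n → ℝ) →L[ℝ] EP)
    (Pi.single i 1)

/-- A principal connection, given by its components: smooth invariant real one-forms
`A₁, …, Aₙ` with `A_i(∂_j) = δ_ij`. -/
structure IsConnection (A : Fin n → P → EP →L[ℝ] ℝ) : Prop where
  smooth : ∀ i, SmoothFormOn 𝓘(ℝ, EP) (fun x => ofCovector (A i x)) Set.univ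
  apply_gen : ∀ i j x, A i x (T.gen j x) = if i = j then 1 else 0
  invariant : ∀ i s x, (A i (T.act s x)).comp (T.dact s x) = A i x

/-- The action of `s` on `TP ⊕ T*P`, from the fibre at `x` to the fibre at `s · x`. -/
def pushGT (s : Fin n → ℝ) (x : P) (v : GT EP) : GT EP :=
  (T.dact s x v.1, v.2.comp (T.dact (-s) (T.act s x)))

/-- A pair of polyforms is invariant on a union `U` of fibres. -/
def InvariantPairOn (U : Set P) (p : P → PForm EP × PForm EP) : Prop :=
  ∀ s, ∀ x ∈ U, pull (T.dact s x) (p (T.act s x)).1 = (p x).1 ∧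
    pull (T.dact s x) (p (T.act s x)).2 = (p x).2

/-- A quadruple `(Φ, e₁, e₂, λ)` is invariant. -/
structure InvariantQuadruple (S : Quadruple EP P) : Prop where
  Φ : ∀ s x v, S.Φ (T.act s x) (T.pushGT s x v) = T.pushGT s x (S.Φ x v)
  e₁ : ∀ s x, S.e₁ (T.act s x) = T.pushGT s x (S.e₁ x)
  e₂ : ∀ s x, S.e₂ (T.act s x) = T.pushGT s x (S.e₂ x)
  lam : ∀ s x, S.lam (T.act s x) = S.lam x

end TorusBundle

/-! ### T-duality -/

section Reduction

variable {k : ℕ} {EB B EM M EP P : Type*}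
  [NormedAddCommGroup EB] [NormedSpace ℝ EB] [TopologicalSpace B] [ChartedSpace EB B]
  [NormedAddCommGroup EM] [NormedSpace ℝ EM] [TopologicalSpace M] [ChartedSpace EM M]
  [NormedAddCommGroup EP] [NormedSpace ℝ EP] [TopologicalSpace P] [ChartedSpace EP P]

/-- The geometry in which a torus-invariant generalised contact structure on `M` is the circle
reduction of a generalised structure on `P`: a principal `T^k`-bundle `M → B`, a principal
`T^{k+1}`-bundle `P → B` with a connection `A₀, …, A_k`, and a smooth map `q : P → M` over `B`,
equivariant for the projection `T^{k+1} → T^k` that forgets the coordinate `0`.  So `q` is the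
quotient by the circle of the coordinate `0`, a principal circle bundle with connection `A₀`. -/
structure Reduction (k : ℕ) (EB B EM M EP P : Type*)
    [NormedAddCommGroup EB] [NormedSpace ℝ EB] [TopologicalSpace B] [ChartedSpace EB B]
    [NormedAddCommGroup EM] [NormedSpace ℝ EM] [TopologicalSpace M] [ChartedSpace EM M]
    [NormedAddCommGroup EP] [NormedSpace ℝ EP] [TopologicalSpace P] [ChartedSpace EP P] where
  TM : TorusBundle k EM M EB B
  TP : TorusBundle (k + 1) EP P EB B
  q : P → M
  smooth_q : ContMDiff 𝓘(ℝ, EP) 𝓘(ℝ, EM) ∞ q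
  proj_q : ∀ x, TM.proj (q x) = TP.proj x
  q_act : ∀ s x, q (TP.act s x) = TM.act (Fin.tail s) (q x)
  A : Fin (k + 1) → P → EP →L[ℝ] ℝ
  connection : TP.IsConnection A

namespace Reduction

/-- The polyform `q^*φ + z A₀ ∧ q^*ψ` on `P`, for a pair `(φ, ψ)` on `M` and `z ∈ ℂ`. -/
def lift (R : Reduction k EB B EM M EP P) (z : ℂ) (p : M → PForm EM × PForm EM) (x : P) :
    PForm EP :=
  pullback R.q (fun y => (p y).1) x +
    z • wedge (ofCovector (R.A 0 x)) (pullback R.q (fun y => (p y).2) x)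

/-- The three-form `H = q^*H₃ + A₀ ∧ q^*H₂` on `P`. -/
def flux (R : Reduction k EB B EM M EP P) (t : Twist EM M) : P → PForm EP :=
  R.lift 1 (fun y => (ofReal 3 (t.H3 y), ofReal 2 (t.H2 y)))

/-- `F` is the curvature of the circle bundle `q : P → M` with connection `A₀`. -/
def IsCurvature (R : Reduction k EB B EM M EP P) (t : Twist EM M) : Prop :=
  ∀ x, extD 𝓘(ℝ, EP) (fun y => ofCovector (R.A 0 y)) x =
    pullback R.q (fun y => ofReal 2 (t.F y)) x

end Reduction

variable {EM' M' EP' P' : Type*}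
  [NormedAddCommGroup EM'] [NormedSpace ℝ EM'] [TopologicalSpace M'] [ChartedSpace EM' M']
  [NormedAddCommGroup EP'] [NormedSpace ℝ EP'] [TopologicalSpace P'] [ChartedSpace EP' P']

/-- The two-form `𝓕 = -∑ A_i ∧ Ã_i` on `P × P'`.  Its restriction to the correspondence space
`P ×_B P' = {(x, y) | π x = π' y}`, with tangent spaces `{(v, w) | dπ v = dπ' w}`, is the form
used for T-duality. -/
def fourierForm (R : Reduction k EB B EM M EP P) (R' : Reduction k EB B EM' M' EP' P')
    (z : P × P') : PForm (EP × EP') :=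
  -∑ i, wedge (pull (ContinuousLinearMap.fst ℝ EP EP') (ofCovector (R.A i z.1)))
    (pull (ContinuousLinearMap.snd ℝ EP EP') (ofCovector (R'.A i z.2)))

/-- The bundles `P` and `P'` with the fluxes `H = q^*H₃ + A₀ ∧ q^*H₂` and
`H' = q'^*H'₃ + A'₀ ∧ q'^*H'₂` are T-dual: `dA₀ = F`, `dA'₀ = F'`, and `p^*H - p'^*H' = d𝓕` on the
correspondence space `P ×_B P'`. -/
structure IsTDual (R : Reduction k EB B EM M EP P) (R' : Reduction k EB B EM' M' EP' P')
    (t : Twist EM M) (t' : Twist EM' M') : Prop where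
  smooth : t.Smooth
  smooth' : t'.Smooth
  curvature : R.IsCurvature t
  curvature' : R'.IsCurvature t'
  flux : ∀ (x : P) (y : P'), R.TP.proj x = R'.TP.proj y →
    ∀ (j : ℕ) (u : Fin j → EP × EP'), (∀ i, R.TP.dproj x (u i).1 = R'.TP.dproj y (u i).2) →
      R.flux t x j (fun i => (u i).1) - R'.flux t' y j (fun i => (u i).2) =
        extD (𝓘(ℝ, EP).prod 𝓘(ℝ, EP')) (fourierForm R R') (x, y) j u

/-- `β = τ_𝓕(ρ) = ∫_{T^{k+1}} e^𝓕 ∧ p^*ρ` over the open set `U ⊆ B`: integration along the fibres of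
`P ×_B P' → P'`.  The fibre over `y` is `{(s · x, y) | s ∈ T^{k+1}}`; the value of the integral on
tangent vectors `w₁, …, w_j` at `y` is the integral over the torus of the contraction of the
integrand with `∂₀, …, ∂_k` and with any vectors `(u_i(s), w_i)` tangent to `P ×_B P'`. -/
def IsFourierTransform (R : Reduction k EB B EM M EP P) (R' : Reduction k EB B EM' M' EP' P')
    (U : Set B) (ρ : P → PForm EP) (β : P' → PForm EP') : Prop :=
  ∀ (x : P) (y : P'), R.TP.proj x = R'.TP.proj y → R'.TP.proj y ∈ U →
    ∀ (j : ℕ) (w : Fin j → EP') (u : (Fin (k + 1) → ℝ) → Fin j → EP),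
      (∀ s i, R.TP.dproj (R.TP.act s x) (u s i) = R'.TP.dproj y (w i)) →
      β y j w = ∫ s in Set.Icc (0 : Fin (k + 1) → ℝ) 1,
        expWedge (fourierForm R R' (R.TP.act s x, y))
            (pull (ContinuousLinearMap.fst ℝ EP EP') (ρ (R.TP.act s x))) (k + 1 + j)
          (Fin.append (fun i => (R.TP.gen i (R.TP.act s x), (0 : EP')))
            (fun i => (u s i, w i)))

/-- The pair `p' = (φ', ψ')` on `M'` is the T-dual over `U ⊆ B` of the pair `p = (φ, ψ)` on `M`:
`τ_𝓕(φ + i A₀ ∧ ψ) = φ' + ε i A'₀ ∧ ψ'`, where the sign `ε` is a choice of orientation of the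
dual circle. -/
def IsTDualPairOn (R : Reduction k EB B EM M EP P) (R' : Reduction k EB B EM' M' EP' P')
    (ε : ℝ) (U : Set B) (p : M → PForm EM × PForm EM) (p' : M' → PForm EM' × PForm EM') : Prop :=
  IsFourierTransform R R' U (R.lift Complex.I p) (R'.lift (ε * Complex.I) p')

/-- The invariant quadruple `S'` on `M'` is the T-dual of the invariant quadruple `S` on `M`: over
every open set of the base, every invariant mixed pair of `S` has a T-dual pair, which is an
invariant mixed pair of `S'`. -/
def IsTDualQuadruple (R : Reduction k EB B EM M EP P) (R' : Reduction k EB B EM' M' EP' P')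
    (ε : ℝ) (S : Quadruple EM M) (S' : Quadruple EM' M') : Prop :=
  ∀ (U : Set B) (p : M → PForm EM × PForm EM), IsOpen U →
    S.IsMixedPairOn (R.TM.proj ⁻¹' U) p → R.TM.InvariantPairOn (R.TM.proj ⁻¹' U) p →
    ∃ p' : M' → PForm EM' × PForm EM', IsTDualPairOn R R' ε U p p' ∧
      S'.IsMixedPairOn (R'.TM.proj ⁻¹' U) p' ∧ R'.TM.InvariantPairOn (R'.TM.proj ⁻¹' U) p'

end Reduction

end GenGeom

end

open scoped Manifold ContDiff

noncomputable section

namespace GenGeom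

variable {V W : Type*} [NormedAddCommGroup V] [NormedSpace ℝ V]
  [NormedAddCommGroup W] [NormedSpace ℝ W]

section PermSum

theorem sum_perm_vecCons {V : Type*} {k : ℕ} (f : (Fin (k + 1) → V) → ℂ) (X : V) (w : Fin k → V) :
    ∑ σ : Equiv.Perm (Fin (k + 1)), Equiv.Perm.sign σ • f (Matrix.vecCons X w ∘ σ) =
      ∑ j : Fin (k + 1), (-1 : ℝ) ^ (j : ℕ) •
        ∑ e : Equiv.Perm (Fin k), Equiv.Perm.sign e • f (j.insertNth X (w ∘ e)) := by
  let g : Fin (k + 1) × Equiv.Perm (Fin k) → Equiv.Perm (Fin (k + 1)) :=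
    fun z => Equiv.Perm.decomposeFin.symm (0, z.2) * z.1.cycleRange
  have hg : Function.Bijective g := by
    rw [Fintype.bijective_iff_injective_and_card]
    constructor
    · rintro ⟨j, e⟩ ⟨j', e'⟩ h
      have h1 : j = j' := by
        have := congrArg (fun σ : Equiv.Perm (Fin (k + 1)) => σ⁻¹ 0) h
        have key : ∀ (a : Fin (k + 1)) (b : Equiv.Perm (Fin k)), (g (a, b))⁻¹ 0 = a := by
          intro a b
          rw [Equiv.Perm.inv_eq_iff_eq]
          simp [g]
        simpa only [key] using this
      subst h1
      have h2 := mul_right_cancel h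
      simpa using Equiv.Perm.decomposeFin.symm.injective h2
    · simp [Fintype.card_perm, Nat.factorial_succ]
  rw [← Fintype.sum_bijective g hg
    (fun z => (-1 : ℝ) ^ (z.1 : ℕ) • (Equiv.Perm.sign z.2 • f (z.1.insertNth X (w ∘ z.2)))) _ ?_,
    Fintype.sum_prod_type]
  · simp only [Finset.smul_sum]
  · rintro ⟨j, e⟩
    have h3 : Matrix.vecCons X w ∘ (g (j, e)) = j.insertNth (α := fun _ => V) X (w ∘ e) := by
      funext i
      refine Fin.succAboveCases j ?_ ?_ i
      · simp [g]
      · intro i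
        simp [g, Fin.cycleRange_succAbove]
    have h4 : Equiv.Perm.sign (g (j, e)) = (-1) ^ (j : ℕ) * Equiv.Perm.sign e := by
      simp [g, Fin.sign_cycleRange, mul_comm]
    rw [h3, h4]
    rcases Nat.even_or_odd (j : ℕ) with h | h <;> simp [h.neg_one_pow]

end PermSum

section Scalars

variable {k : ℕ}

@[simp] theorem form_smul_zero (c : ℂ) : c • (0 : V [⋀^Fin k]→L[ℝ] ℂ) = 0 := by ext; simp
@[simp] theorem form_rsmul_zero (c : ℝ) : c • (0 : V [⋀^Fin k]→L[ℝ] ℂ) = 0 := by ext; simp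
@[simp] theorem pform_smul_zero (c : ℂ) : c • (0 : PForm V) = 0 := by funext k; ext; simp
@[simp] theorem pform_rsmul_zero (c : ℝ) : c • (0 : PForm V) = 0 := by funext k; ext; simp
@[simp] theorem pform_zero_smul (φ : PForm V) : (0 : ℂ) • φ = 0 := zero_smul ℂ φ
@[simp] theorem pform_zero_rsmul (φ : PForm V) : (0 : ℝ) • φ = 0 := zero_smul ℝ φ
theorem pform_neg_one_smul (φ : PForm V) : (-1 : ℂ) • φ = -φ := neg_one_smul ℂ φ
theorem pform_neg_one_rsmul (φ : PForm V) : (-1 : ℝ) • φ = -φ := neg_one_smul ℝ φ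
theorem pform_add_smul (c d : ℂ) (φ : PForm V) : (c + d) • φ = c • φ + d • φ := add_smul c d φ
theorem pform_neg_smul (c : ℂ) (φ : PForm V) : (-c) • φ = -(c • φ) := neg_smul c φ
theorem pform_smul_eq_zero {c : ℂ} {φ : PForm V} : c • φ = 0 ↔ c = 0 ∨ φ = 0 := by
  refine ⟨fun h => or_iff_not_imp_left.2 fun hc => ?_, ?_⟩
  · funext k
    ext v
    have := congrArg (fun a : PForm V => a k v) h
    simpa [hc] using this
  · rintro (rfl | rfl) <;> simp
theorem pform_eq_zero_of_eq_neg {φ : PForm V} (h : φ = -φ) : φ = 0 := by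
  funext k
  ext v
  have := congrArg (fun a : PForm V => a k v) h
  simpa [self_eq_neg] using this

end Scalars

section Wedge

theorem wedgeHom_apply {p q k : ℕ} (h : p + q = k) (a : V [⋀^Fin p]→L[ℝ] ℂ)
    (b : V [⋀^Fin q]→L[ℝ] ℂ) (v : Fin k → V) :
    wedgeHom h a b v = ((p.factorial * q.factorial : ℕ) : ℝ)⁻¹ •
      ∑ σ : Equiv.Perm (Fin k), Equiv.Perm.sign σ •
        (a (fun i => v (σ (Fin.cast h (Fin.castAdd q i)))) *
          b (fun j => v (σ (Fin.cast h (Fin.natAdd p j))))) := by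
  simp only [wedgeHom, ContinuousAlternatingMap.smul_apply,
    ContinuousMultilinearMap.alternatization_apply_apply]
  rfl

/-- The wedge product in degrees `p`, `q`, as a `k`-form that is zero unless `p + q = k`. -/
def wedgeAt (p q k : ℕ) (a : V [⋀^Fin p]→L[ℝ] ℂ) (b : V [⋀^Fin q]→L[ℝ] ℂ) :
    V [⋀^Fin k]→L[ℝ] ℂ :=
  if h : p + q = k then wedgeHom h a b else 0

theorem wedge_eq_sum (α β : PForm V) (k : ℕ) :
    wedge α β k = ∑ pq ∈ Finset.HasAntidiagonal.antidiagonal k, wedgeAt pq.1 pq.2 k (α pq.1) (β pq.2) := by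
  rw [wedge, ← Finset.sum_attach (Finset.HasAntidiagonal.antidiagonal k)]
  refine Finset.sum_congr rfl fun pq _ => ?_
  rw [wedgeAt, dif_pos]

/-- The part of the contraction of a wedge product in which the vector enters the first factor. -/
def curryFst (X : V) : (p q k : ℕ) → (V [⋀^Fin p]→L[ℝ] ℂ) → (V [⋀^Fin q]→L[ℝ] ℂ) →
    V [⋀^Fin k]→L[ℝ] ℂ
  | 0, _, _, _, _ => 0
  | p + 1, q, k, a, b => wedgeAt p q k (a.curryLeft X) b

/-- The part of the contraction of a wedge product in which the vector enters the second factor. -/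
def currySnd (X : V) : (p q k : ℕ) → (V [⋀^Fin p]→L[ℝ] ℂ) → (V [⋀^Fin q]→L[ℝ] ℂ) →
    V [⋀^Fin k]→L[ℝ] ℂ
  | _, 0, _, _, _ => 0
  | p, q + 1, k, a, b => wedgeAt p q k a (b.curryLeft X)

theorem wedgeAt_curryLeft (p q k : ℕ) (h : p + q = k + 1) (a : V [⋀^Fin p]→L[ℝ] ℂ)
    (b : V [⋀^Fin q]→L[ℝ] ℂ) (X : V) :
    (wedgeAt p q (k + 1) a b).curryLeft X =
      curryFst X p q k a b + ((-1 : ℝ) ^ p) • currySnd X p q k a b := by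
  ext w
  rw [wedgeAt, dif_pos h]
  simp only [ContinuousAlternatingMap.curryLeft_apply_apply, ContinuousAlternatingMap.add_apply,
    ContinuousAlternatingMap.smul_apply]
  rw [wedgeHom_apply]
  have hsum := sum_perm_vecCons (fun v : Fin (k + 1) → V =>
    a (fun i => v (Fin.cast h (Fin.castAdd q i))) * b (fun j => v (Fin.cast h (Fin.natAdd p j)))) X w
  simp only [Function.comp_apply] at hsum
  rw [hsum]
  have hsplit : ∀ F : Fin (k + 1) → ℂ, ∑ j, F j = (∑ i : Fin p, F (Fin.cast h (Fin.castAdd q i))) +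
      ∑ i : Fin q, F (Fin.cast h (Fin.natAdd p i)) := by
    intro F
    rw [← Fin.sum_univ_add (fun i => F (Fin.cast h i))]
    exact (Equiv.sum_comp (finCongr h) F).symm
  rw [hsplit, smul_add]
  congr 1
  · cases p with
    | zero => simp [curryFst]
    | succ p =>
      have h' : p + q = k := by omega
      have key : ∀ i : Fin (p + 1), ∀ e : Equiv.Perm (Fin k),
          (-1 : ℝ) ^ (i : ℕ) • (a (fun l => (Fin.cast h (Fin.castAdd q i)).insertNth
              (α := fun _ => V) X (w ∘ e) (Fin.cast h (Fin.castAdd q l))) *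
            b (fun l => (Fin.cast h (Fin.castAdd q i)).insertNth (α := fun _ => V) X (w ∘ e)
              (Fin.cast h (Fin.natAdd (p + 1) l)))) =
          a.curryLeft X (fun l => w (e (Fin.cast h' (Fin.castAdd q l)))) *
            b (fun l => w (e (Fin.cast h' (Fin.natAdd p l)))) := by
        intro i e
        have e1 : (fun l => (Fin.cast h (Fin.castAdd q i)).insertNth
              (α := fun _ => V) X (w ∘ e) (Fin.cast h (Fin.castAdd q l))) =
            i.insertNth (α := fun _ => V) X (fun l => w (e (Fin.cast h' (Fin.castAdd q l)))) := by
          funext l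
          refine Fin.succAboveCases i ?_ ?_ l
          · simp
          · intro l
            have : Fin.cast h (Fin.castAdd q (i.succAbove l)) =
              (Fin.cast h (Fin.castAdd q i)).succAbove (Fin.cast h' (Fin.castAdd q l)) := by
              ext
              simp only [Fin.val_cast, Fin.val_castAdd, Fin.succAbove, Fin.lt_def, Fin.val_castSucc]
              split_ifs <;> simp
            rw [this]
            simp
        have e2 : (fun l => (Fin.cast h (Fin.castAdd q i)).insertNth (α := fun _ => V) X (w ∘ e)
              (Fin.cast h (Fin.natAdd (p + 1) l))) =
            fun l => w (e (Fin.cast h' (Fin.natAdd p l))) := by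
          funext l
          have : Fin.cast h (Fin.natAdd (p + 1) l) =
              (Fin.cast h (Fin.castAdd q i)).succAbove (Fin.cast h' (Fin.natAdd p l)) := by
            ext
            simp only [Fin.val_cast, Fin.val_castAdd, Fin.val_natAdd, Fin.succAbove, Fin.lt_def,
              Fin.val_castSucc]
            have := i.2
            rw [if_neg (by omega)]
            simp; omega
          rw [this]
          simp
        rw [e1, e2, ContinuousAlternatingMap.map_insertNth]
        rcases Nat.even_or_odd (i : ℕ) with hi | hi <;>
          simp [hi.neg_one_pow]
      have hcast : ∀ i : Fin (p + 1), ((Fin.cast h (Fin.castAdd q i) : Fin (k + 1)) : ℕ) = i :=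
        fun i => rfl
      simp only [hcast, Finset.smul_sum, smul_comm ((-1 : ℝ) ^ _) (Equiv.Perm.sign _), key]
      simp only [Finset.sum_const, Finset.card_univ, Fintype.card_fin]
      rw [curryFst, wedgeAt, dif_pos h', wedgeHom_apply, Finset.smul_sum, ← Finset.smul_sum,
        ← Finset.smul_sum, ← Nat.cast_smul_eq_nsmul ℝ, smul_smul]
      congr 1
      rw [Nat.factorial_succ]
      push_cast
      have := Nat.factorial_ne_zero p
      have := Nat.factorial_ne_zero q
      field_simp
  · cases q with
    | zero => simp [currySnd]
    | succ q =>
      have h' : p + q = k := by omega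
      have key : ∀ i : Fin (q + 1), ∀ e : Equiv.Perm (Fin k),
          (-1 : ℝ) ^ (p + i : ℕ) • (a (fun l => (Fin.cast h (Fin.natAdd p i)).insertNth
              (α := fun _ => V) X (w ∘ e) (Fin.cast h (Fin.castAdd (q + 1) l))) *
            b (fun l => (Fin.cast h (Fin.natAdd p i)).insertNth (α := fun _ => V) X (w ∘ e)
              (Fin.cast h (Fin.natAdd p l)))) =
          (-1 : ℝ) ^ p • (a (fun l => w (e (Fin.cast h' (Fin.castAdd q l)))) *
            b.curryLeft X (fun l => w (e (Fin.cast h' (Fin.natAdd p l))))) := by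
        intro i e
        have e1 : (fun l => (Fin.cast h (Fin.natAdd p i)).insertNth
              (α := fun _ => V) X (w ∘ e) (Fin.cast h (Fin.natAdd p l))) =
            i.insertNth (α := fun _ => V) X (fun l => w (e (Fin.cast h' (Fin.natAdd p l)))) := by
          funext l
          refine Fin.succAboveCases i ?_ ?_ l
          · simp
          · intro l
            have : Fin.cast h (Fin.natAdd p (i.succAbove l)) =
              (Fin.cast h (Fin.natAdd p i)).succAbove (Fin.cast h' (Fin.natAdd p l)) := by
              ext
              simp only [Fin.val_cast, Fin.val_natAdd, Fin.succAbove, Fin.lt_def, Fin.val_castSucc]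
              by_cases hl : (l : ℕ) < i
              · rw [if_pos hl, if_pos (by omega)]; simp
              · rw [if_neg hl, if_neg (by omega)]; simp; omega
            rw [this]
            simp
        have e2 : (fun l => (Fin.cast h (Fin.natAdd p i)).insertNth (α := fun _ => V) X (w ∘ e)
              (Fin.cast h (Fin.castAdd (q + 1) l))) =
            fun l => w (e (Fin.cast h' (Fin.castAdd q l))) := by
          funext l
          have : Fin.cast h (Fin.castAdd (q + 1) l) =
              (Fin.cast h (Fin.natAdd p i)).succAbove (Fin.cast h' (Fin.castAdd q l)) := by
            ext
            simp only [Fin.val_cast, Fin.val_castAdd, Fin.val_natAdd, Fin.succAbove, Fin.lt_def,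
              Fin.val_castSucc]
            have := l.2
            rw [if_pos (by omega)]
            simp
          rw [this]
          simp
        rw [e1, e2, ContinuousAlternatingMap.map_insertNth, pow_add]
        rcases Nat.even_or_odd (i : ℕ) with hi | hi <;>
          simp [hi.neg_one_pow]
      have hcast : ∀ i : Fin (q + 1), ((Fin.cast h (Fin.natAdd p i) : Fin (k + 1)) : ℕ) = p + i :=
        fun i => rfl
      simp only [hcast, Finset.smul_sum, smul_comm ((-1 : ℝ) ^ _) (Equiv.Perm.sign _), key]
      simp only [Finset.sum_const, Finset.card_univ, Fintype.card_fin]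
      rw [currySnd, wedgeAt, dif_pos h', wedgeHom_apply]
      simp only [smul_comm (Equiv.Perm.sign _) ((-1 : ℝ) ^ _), ← Finset.smul_sum]
      rw [← Nat.cast_smul_eq_nsmul ℝ, smul_smul, smul_comm ((-1 : ℝ) ^ p), smul_smul, smul_comm,
        smul_smul]
      congr 1
      rw [Nat.factorial_succ]
      push_cast
      have := Nat.factorial_ne_zero p
      have := Nat.factorial_ne_zero q
      field_simp

/-- The grading involution `φ ↦ (-1)^{|φ|} φ`. -/
def gradeInv (φ : PForm V) : PForm V := fun k => ((-1 : ℝ) ^ k) • φ k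

theorem iota_apply (X : V) (φ : PForm V) (k : ℕ) (v : Fin k → V) :
    iota X φ k v = φ (k + 1) (Matrix.vecCons X v) := rfl

theorem gradeInv_apply (φ : PForm V) (k : ℕ) : gradeInv φ k = ((-1 : ℝ) ^ k) • φ k := rfl

theorem iota_wedge (X : V) (α β : PForm V) :
    iota X (wedge α β) = wedge (iota X α) β + wedge (gradeInv α) (iota X β) := by
  funext k
  have h1 : (wedge α β (k + 1)).curryLeft X =
      ∑ pq ∈ Finset.HasAntidiagonal.antidiagonal (k + 1),
        (curryFst X pq.1 pq.2 k (α pq.1) (β pq.2) +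
          ((-1 : ℝ) ^ pq.1) • currySnd X pq.1 pq.2 k (α pq.1) (β pq.2)) := by
    rw [wedge_eq_sum]
    rw [← Finset.sum_congr rfl fun pq hpq => wedgeAt_curryLeft pq.1 pq.2 k
      (Finset.HasAntidiagonal.mem_antidiagonal.1 hpq) (α pq.1) (β pq.2) X]
    ext v
    simp [ContinuousAlternatingMap.sum_apply]
  have h0 : ∀ q, ∀ (a : V [⋀^Fin 0]→L[ℝ] ℂ) (b : V [⋀^Fin q]→L[ℝ] ℂ), curryFst X 0 q k a b = 0 :=
    fun _ _ _ => rfl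
  have h0' : ∀ p, ∀ (a : V [⋀^Fin p]→L[ℝ] ℂ) (b : V [⋀^Fin 0]→L[ℝ] ℂ), currySnd X p 0 k a b = 0 :=
    fun p _ _ => by cases p <;> rfl
  show (wedge α β (k + 1)).curryLeft X = _
  rw [h1, Finset.sum_add_distrib]
  show _ = wedge (iota X α) β k + wedge (gradeInv α) (iota X β) k
  congr 1
  · rw [Finset.Nat.antidiagonal_succ, Finset.sum_cons, Finset.sum_map, h0, zero_add, wedge_eq_sum]
    rfl
  · rw [Finset.Nat.antidiagonal_succ', Finset.sum_cons, Finset.sum_map, h0', form_rsmul_zero, zero_add,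
      wedge_eq_sum]
    refine Finset.sum_congr rfl fun pq _ => ?_
    have : ∀ (p q : ℕ) (c : ℝ) (a : V [⋀^Fin p]→L[ℝ] ℂ) (b : V [⋀^Fin q]→L[ℝ] ℂ),
        wedgeAt p q k (c • a) b = c • wedgeAt p q k a b := by
      intro p q c a b
      unfold wedgeAt
      split_ifs with h
      · ext v
        simp only [wedgeHom_apply, ContinuousAlternatingMap.smul_apply, smul_mul_assoc,
          smul_comm _ c, ← Finset.smul_sum]
      · simp
    show _ = wedgeAt pq.1 pq.2 k (((-1 : ℝ) ^ pq.1) • α pq.1) _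
    rw [this]
    rfl

theorem wedge_zero (α β : PForm V) (v : Fin 0 → V) : wedge α β 0 v = α 0 v * β 0 v := by
  rw [wedge_eq_sum]
  simp only [Finset.Nat.antidiagonal_zero, Finset.sum_singleton]
  rw [wedgeAt, dif_pos rfl, wedgeHom_apply]
  simp only [Nat.factorial_zero, Finset.univ_unique, Finset.sum_singleton]
  simp

theorem form_ext_zero {a b : V [⋀^Fin 0]→L[ℝ] ℂ} (h : a 0 = b 0) : a = b := by
  ext v
  rw [Subsingleton.elim v 0, h]

theorem form_ext_succ {φ ψ : PForm V} {k : ℕ} (h : ∀ X, iota X φ k = iota X ψ k) :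
    φ (k + 1) = ψ (k + 1) := by
  ext v
  have := congrArg (fun a : V [⋀^Fin k]→L[ℝ] ℂ => a (Matrix.vecTail v)) (h (Matrix.vecHead v))
  simpa [iota_apply] using this

section Linearity

variable (X Y : V) (φ ψ χ : PForm V) (c : ℂ) (r : ℝ)

@[simp] theorem iota_add : iota X (φ + ψ) = iota X φ + iota X ψ := rfl
@[simp] theorem iota_sub : iota X (φ - ψ) = iota X φ - iota X ψ := rfl
@[simp] theorem iota_neg : iota X (-φ) = -iota X φ := rfl
@[simp] theorem iota_zero : iota X (0 : PForm V) = 0 := rfl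
@[simp] theorem iota_smul : iota X (c • φ) = c • iota X φ := rfl
@[simp] theorem iota_rsmul : iota X (r • φ) = r • iota X φ := rfl
@[simp] theorem iota_sum {ι : Type*} (s : Finset ι) (f : ι → PForm V) :
    iota X (∑ i ∈ s, f i) = ∑ i ∈ s, iota X (f i) := by
  classical
  induction s using Finset.induction_on with
  | empty => simp
  | insert i s hi ih => rw [Finset.sum_insert hi, Finset.sum_insert hi, iota_add, ih]
theorem iota_vadd : iota (X + Y) φ = iota X φ + iota Y φ := by
  funext k; exact map_add (φ (k + 1)).curryLeft X Y
theorem iota_vsmul : iota (r • X) φ = r • iota X φ := by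
  funext k; exact map_smul (φ (k + 1)).curryLeft r X
@[simp] theorem iota_vzero : iota 0 φ = 0 := by
  funext k; exact map_zero (φ (k + 1)).curryLeft

@[simp] theorem gradeInv_add : gradeInv (φ + ψ) = gradeInv φ + gradeInv ψ := by
  funext k; exact smul_add _ _ _
@[simp] theorem gradeInv_smul : gradeInv (c • φ) = c • gradeInv φ := by
  funext k; exact smul_comm ((-1 : ℝ) ^ k) c (φ k)
@[simp] theorem gradeInv_neg : gradeInv (-φ) = -gradeInv φ := by
  funext k; exact smul_neg _ _
@[simp] theorem gradeInv_gradeInv : gradeInv (gradeInv φ) = φ := by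
  funext k
  simp [gradeInv_apply, smul_smul, ← mul_pow]
theorem iota_gradeInv : iota X (gradeInv φ) = -gradeInv (iota X φ) := by
  funext k
  ext v
  simp [iota_apply, gradeInv_apply, pow_succ]

theorem wedge_add_left : wedge (φ + ψ) χ = wedge φ χ + wedge ψ χ := by
  funext k
  induction k generalizing φ ψ χ with
  | zero => ext v; simp [wedge_zero, add_mul]
  | succ k ih =>
    refine form_ext_succ fun X => ?_
    simp only [iota_wedge, iota_add, gradeInv_add, Pi.add_apply, ih]
    abel

theorem wedge_add_right : wedge φ (ψ + χ) = wedge φ ψ + wedge φ χ := by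
  funext k
  induction k generalizing φ ψ χ with
  | zero => ext v; simp [wedge_zero, mul_add]
  | succ k ih =>
    refine form_ext_succ fun X => ?_
    simp only [iota_wedge, iota_add, Pi.add_apply, ih]
    abel

theorem wedge_smul_left : wedge (c • φ) ψ = c • wedge φ ψ := by
  funext k
  induction k generalizing φ ψ with
  | zero => ext v; simp [wedge_zero, mul_assoc]
  | succ k ih =>
    refine form_ext_succ fun X => ?_
    simp only [iota_wedge, iota_smul, gradeInv_smul, Pi.add_apply, Pi.smul_apply, smul_add, ih]

theorem wedge_smul_right : wedge φ (c • ψ) = c • wedge φ ψ := by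
  funext k
  induction k generalizing φ ψ with
  | zero => ext v; simp [wedge_zero, mul_left_comm]
  | succ k ih =>
    refine form_ext_succ fun X => ?_
    simp only [iota_wedge, iota_smul, Pi.add_apply, Pi.smul_apply, smul_add, ih]

theorem rsmul_eq_smul : r • φ = (r : ℂ) • φ := by
  funext k; ext v; simp

theorem wedge_rsmul_left : wedge (r • φ) ψ = r • wedge φ ψ := by
  rw [rsmul_eq_smul, wedge_smul_left, ← rsmul_eq_smul]
theorem wedge_rsmul_right : wedge φ (r • ψ) = r • wedge φ ψ := by
  rw [rsmul_eq_smul, wedge_smul_right, ← rsmul_eq_smul]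
theorem wedge_neg_left : wedge (-φ) ψ = -wedge φ ψ := by
  rw [← pform_neg_one_smul φ, wedge_smul_left, pform_neg_one_smul]
theorem wedge_neg_right : wedge φ (-ψ) = -wedge φ ψ := by
  rw [← pform_neg_one_smul ψ, wedge_smul_right, pform_neg_one_smul]
@[simp] theorem wedge_zero_left : wedge 0 ψ = 0 := by
  have := wedge_smul_left (0 : PForm V) ψ 0
  rwa [pform_zero_smul, pform_zero_smul] at this
@[simp] theorem wedge_zero_right : wedge φ 0 = 0 := by
  have := wedge_smul_right φ (0 : PForm V) 0
  rwa [pform_zero_smul, pform_zero_smul] at this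
theorem wedge_sum_left {ι : Type*} (s : Finset ι) (f : ι → PForm V) :
    wedge (∑ i ∈ s, f i) ψ = ∑ i ∈ s, wedge (f i) ψ := by
  classical
  induction s using Finset.induction_on with
  | empty => simp
  | insert i s hi ih => rw [Finset.sum_insert hi, Finset.sum_insert hi, wedge_add_left, ih]
theorem wedge_sum_right {ι : Type*} (s : Finset ι) (f : ι → PForm V) :
    wedge φ (∑ i ∈ s, f i) = ∑ i ∈ s, wedge φ (f i) := by
  classical
  induction s using Finset.induction_on with
  | empty => simp
  | insert i s hi ih => rw [Finset.sum_insert hi, Finset.sum_insert hi, wedge_add_right, ih]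

theorem gradeInv_wedge : gradeInv (wedge φ ψ) = wedge (gradeInv φ) (gradeInv ψ) := by
  funext k
  induction k generalizing φ ψ with
  | zero => ext v; simp [wedge_zero, gradeInv_apply]
  | succ k ih =>
    refine form_ext_succ fun X => ?_
    have : gradeInv (iota X (wedge φ ψ)) k = wedge (gradeInv (iota X φ)) (gradeInv ψ) k +
        wedge φ (gradeInv (iota X ψ)) k := by
      rw [iota_wedge, gradeInv_add, Pi.add_apply, ih, ih, gradeInv_gradeInv]
    rw [iota_gradeInv, Pi.neg_apply, this, iota_wedge, iota_gradeInv, iota_gradeInv,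
      gradeInv_gradeInv, wedge_neg_left, wedge_neg_right]
    simp only [Pi.add_apply, Pi.neg_apply]
    abel

theorem wedge_assoc : wedge (wedge φ ψ) χ = wedge φ (wedge ψ χ) := by
  funext k
  induction k generalizing φ ψ χ with
  | zero => ext v; simp [wedge_zero, mul_assoc]
  | succ k ih =>
    refine form_ext_succ fun X => ?_
    simp only [iota_wedge, gradeInv_wedge, wedge_add_left, wedge_add_right, Pi.add_apply, ih]
    abel

theorem iota_iota : iota X (iota Y φ) = -iota Y (iota X φ) := by
  funext k
  ext v
  show φ (k + 1 + 1) (Matrix.vecCons Y (Matrix.vecCons X v)) = -φ (k + 1 + 1) (Matrix.vecCons X (Matrix.vecCons Y v))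
  have := (φ (k + 1 + 1)).toAlternatingMap.map_swap (Matrix.vecCons Y (Matrix.vecCons X v))
    (i := 0) (j := 1) (by simp)
  simp only [ContinuousAlternatingMap.coe_toAlternatingMap] at this
  rw [eq_neg_iff_add_eq_zero, add_comm, ← eq_neg_iff_add_eq_zero, ← this]
  congr 1
  funext i
  refine Fin.cases ?_ (fun i => Fin.cases ?_ (fun i => ?_) i) i
  · simp
  · simp
  · have : Equiv.swap (0 : Fin (k + 1 + 1)) 1 i.succ.succ = i.succ.succ :=
      Equiv.swap_apply_of_ne_of_ne (Fin.succ_ne_zero _) (by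
        rw [← Fin.succ_zero_eq_one]; exact fun h => Fin.succ_ne_zero _ (Fin.succ_injective _ h))
    simp [this]

@[simp] theorem iota_iota_self : iota X (iota X φ) = 0 := by
  exact pform_eq_zero_of_eq_neg (iota_iota X X φ)

end Linearity

/-- The constant function `c` as a polyform of degree zero. -/
def const (c : ℂ) : PForm V := Pi.single 0 (ContinuousAlternatingMap.constOfIsEmpty ℝ V (Fin 0) c)

theorem const_zero_apply (c : ℂ) (v : Fin 0 → V) : const (V := V) c 0 v = c := by simp [const]

@[simp] theorem const_succ (c : ℂ) (k : ℕ) : const (V := V) c (k + 1) = 0 := by simp [const]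

@[simp] theorem iota_const (X : V) (c : ℂ) : iota X (const c) = 0 := by
  funext k; ext v; simp [iota_apply]

@[simp] theorem gradeInv_const (c : ℂ) : gradeInv (const (V := V) c) = const c := by
  funext k
  cases k <;> simp [gradeInv_apply]

theorem const_wedge (c : ℂ) (φ : PForm V) : wedge (const c) φ = c • φ := by
  funext k
  induction k generalizing φ with
  | zero => ext v; simp [wedge_zero, const_zero_apply]
  | succ k ih =>
    refine form_ext_succ fun X => ?_
    simp [iota_wedge, ih]

theorem wedge_const (c : ℂ) (φ : PForm V) : wedge φ (const c) = c • φ := by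
  funext k
  induction k generalizing φ with
  | zero => ext v; simp [wedge_zero, const_zero_apply, mul_comm]
  | succ k ih =>
    refine form_ext_succ fun X => ?_
    simp [iota_wedge, ih]

@[simp] theorem ofCovector_zero_deg (ξ : V →L[ℝ] ℝ) : ofCovector ξ 0 = 0 := by
  simp [ofCovector, ofReal]

theorem iota_ofCovector (X : V) (ξ : V →L[ℝ] ℝ) : iota X (ofCovector ξ) = const (ξ X : ℂ) := by
  funext k
  ext v
  rcases k with _ | k
  · simp [iota_apply, ofCovector, ofReal, const_zero_apply]
  · simp [iota_apply, ofCovector, ofReal]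

@[simp] theorem gradeInv_ofCovector (ξ : V →L[ℝ] ℝ) : gradeInv (ofCovector ξ) = -ofCovector ξ := by
  funext k
  rcases k with _ | _ | k
  · simp [gradeInv_apply]
  · ext v; simp [gradeInv_apply]
  · simp [gradeInv_apply, ofCovector, ofReal]

theorem iota_covector_wedge (X : V) (ξ : V →L[ℝ] ℝ) (φ : PForm V) :
    iota X (wedge (ofCovector ξ) φ) = ξ X • φ - wedge (ofCovector ξ) (iota X φ) := by
  rw [iota_wedge, iota_ofCovector, const_wedge, gradeInv_ofCovector, wedge_neg_left,
    rsmul_eq_smul, sub_eq_add_neg]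

theorem covector_wedge (ξ : V →L[ℝ] ℝ) (φ : PForm V) :
    wedge (ofCovector ξ) φ = wedge (gradeInv φ) (ofCovector ξ) := by
  funext k
  induction k generalizing φ with
  | zero => ext v; simp [wedge_zero]
  | succ k ih =>
    refine form_ext_succ fun X => ?_
    rw [iota_covector_wedge, iota_wedge, iota_gradeInv, iota_ofCovector, gradeInv_gradeInv,
      wedge_const, wedge_neg_left, rsmul_eq_smul]
    simp only [Pi.sub_apply, Pi.add_apply, Pi.neg_apply, ih]
    abel

theorem covector_wedge_covector (ξ η : V →L[ℝ] ℝ) :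
    wedge (ofCovector ξ) (ofCovector η) = -wedge (ofCovector η) (ofCovector ξ) := by
  rw [covector_wedge, gradeInv_ofCovector, wedge_neg_left]

theorem covector_wedge_wedge (ξ : V →L[ℝ] ℝ) (φ ψ : PForm V) :
    wedge (ofCovector ξ) (wedge φ ψ) = wedge (gradeInv φ) (wedge (ofCovector ξ) ψ) := by
  rw [← wedge_assoc, covector_wedge, wedge_assoc]

theorem covector_wedge_anticomm (ξ η : V →L[ℝ] ℝ) (φ : PForm V) :
    wedge (ofCovector ξ) (wedge (ofCovector η) φ) =
      -wedge (ofCovector η) (wedge (ofCovector ξ) φ) := by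
  rw [covector_wedge_wedge, gradeInv_ofCovector, wedge_neg_left]

@[simp] theorem covector_wedge_self (ξ : V →L[ℝ] ℝ) (φ : PForm V) :
    wedge (ofCovector ξ) (wedge (ofCovector ξ) φ) = 0 := by
  exact pform_eq_zero_of_eq_neg (covector_wedge_anticomm ξ ξ φ)

theorem ofCovector_add (ξ η : V →L[ℝ] ℝ) : ofCovector (ξ + η) = ofCovector ξ + ofCovector η := by
  funext k; ext v
  rcases k with _ | _ | k <;> simp [ofCovector, ofReal]

theorem ofCovector_smul (r : ℝ) (ξ : V →L[ℝ] ℝ) : ofCovector (r • ξ) = r • ofCovector ξ := by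
  funext k; ext v
  rcases k with _ | _ | k <;> simp [ofCovector, ofReal]

@[simp] theorem ofCovector_zero : ofCovector (0 : V →L[ℝ] ℝ) = 0 := by
  have := ofCovector_smul 0 (0 : V →L[ℝ] ℝ)
  rwa [zero_smul, pform_zero_rsmul] at this

end Wedge

section Pull

variable {V W U : Type*} [NormedAddCommGroup V] [NormedSpace ℝ V]
  [NormedAddCommGroup W] [NormedSpace ℝ W] [NormedAddCommGroup U] [NormedSpace ℝ U]

theorem pull_apply (f : V →L[ℝ] W) (φ : PForm W) (k : ℕ) (v : Fin k → V) :
    pull f φ k v = φ k (f ∘ v) := rfl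

@[simp] theorem pull_add (f : V →L[ℝ] W) (φ ψ : PForm W) : pull f (φ + ψ) = pull f φ + pull f ψ := rfl
@[simp] theorem pull_sub (f : V →L[ℝ] W) (φ ψ : PForm W) : pull f (φ - ψ) = pull f φ - pull f ψ := rfl
@[simp] theorem pull_neg (f : V →L[ℝ] W) (φ : PForm W) : pull f (-φ) = -pull f φ := rfl
@[simp] theorem pull_zero (f : V →L[ℝ] W) : pull f (0 : PForm W) = 0 := rfl
@[simp] theorem pull_smul (f : V →L[ℝ] W) (c : ℂ) (φ : PForm W) : pull f (c • φ) = c • pull f φ := rfl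
@[simp] theorem pull_rsmul (f : V →L[ℝ] W) (c : ℝ) (φ : PForm W) : pull f (c • φ) = c • pull f φ :=
  rfl
theorem pull_pull (f : V →L[ℝ] W) (g : U →L[ℝ] V) (φ : PForm W) :
    pull g (pull f φ) = pull (f.comp g) φ := rfl
@[simp] theorem pull_id (φ : PForm W) : pull (ContinuousLinearMap.id ℝ W) φ = φ := rfl
@[simp] theorem pull_sum {ι : Type*} (f : V →L[ℝ] W) (s : Finset ι) (g : ι → PForm W) :
    pull f (∑ i ∈ s, g i) = ∑ i ∈ s, pull f (g i) := by
  classical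
  induction s using Finset.induction_on with
  | empty => simp
  | insert i s hi ih => rw [Finset.sum_insert hi, Finset.sum_insert hi, pull_add, ih]

theorem pull_equiv_symm_pull (f : V ≃L[ℝ] W) (φ : PForm V) :
    pull (f : V →L[ℝ] W) (pull (f.symm : W →L[ℝ] V) φ) = φ := by
  rw [pull_pull, ContinuousLinearEquiv.coe_symm_comp_coe, pull_id]

theorem pull_equiv_pull_symm (f : V ≃L[ℝ] W) (φ : PForm W) :
    pull (f.symm : W →L[ℝ] V) (pull (f : V →L[ℝ] W) φ) = φ := by
  rw [pull_pull, ContinuousLinearEquiv.coe_comp_coe_symm, pull_id]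

theorem pull_injective_of_surjective {f : V →L[ℝ] W} (hf : Function.Surjective f) :
    Function.Injective (pull f) := by
  intro φ ψ h
  funext k
  ext w
  choose g hg using hf
  have := congrArg (fun a : PForm V => a k (fun i => g (w i))) h
  simpa [pull_apply, Function.comp_def, hg] using this

theorem iota_pull (f : V →L[ℝ] W) (X : V) (φ : PForm W) :
    iota X (pull f φ) = pull f (iota (f X) φ) := by
  funext k
  ext v
  rw [iota_apply, pull_apply, pull_apply, iota_apply]
  congr 1
  funext i
  refine Fin.cases ?_ (fun i => ?_) i <;> simp

theorem pull_gradeInv (f : V →L[ℝ] W) (φ : PForm W) : pull f (gradeInv φ) = gradeInv (pull f φ) := rfl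

theorem pull_wedge (f : V →L[ℝ] W) (φ ψ : PForm W) :
    pull f (wedge φ ψ) = wedge (pull f φ) (pull f ψ) := by
  funext k
  induction k generalizing φ ψ with
  | zero => ext v; simp [wedge_zero, pull_apply]
  | succ k ih =>
    refine form_ext_succ fun X => ?_
    simp only [iota_pull, iota_wedge, pull_add, Pi.add_apply, ih, ← pull_gradeInv]

theorem pull_ofCovector (f : V →L[ℝ] W) (ξ : W →L[ℝ] ℝ) :
    pull f (ofCovector ξ) = ofCovector (ξ.comp f) := by
  funext k
  ext v
  rcases k with _ | _ | k <;> simp [pull_apply, ofCovector, ofReal]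

theorem ofReal_of_ne {k l : ℕ} (h : l ≠ k) (η : V [⋀^Fin k]→L[ℝ] ℝ) : ofReal k η l = 0 := by
  simp [ofReal, h]

theorem ofReal_same_apply {k : ℕ} (η : V [⋀^Fin k]→L[ℝ] ℝ) (v : Fin k → V) :
    ofReal k η k v = (η v : ℂ) := by
  simp [ofReal]

theorem gradeInv_ofReal (k : ℕ) (η : V [⋀^Fin k]→L[ℝ] ℝ) :
    gradeInv (ofReal k η) = ((-1 : ℝ) ^ k) • ofReal k η := by
  funext l
  by_cases h : l = k
  · subst h; rfl
  · simp [gradeInv_apply, ofReal_of_ne h]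

end Pull

section Finite

theorem form_eq_zero_of_finrank_lt [FiniteDimensional ℝ V] {k : ℕ} (h : Module.finrank ℝ V < k)
    (a : V [⋀^Fin k]→L[ℝ] ℂ) : a = 0 := by
  ext v
  refine a.toAlternatingMap.map_linearDependent v fun hv => ?_
  have := hv.fintype_card_le_finrank
  simp at this
  omega

theorem sum_covector_wedge_iota {ι : Type*} [Fintype ι] (e : ι → V) (f : ι → V →L[ℝ] ℝ)
    (hef : ∀ X, ∑ i, f i X • e i = X) (φ : PForm V) (k : ℕ) :
    (∑ i, wedge (ofCovector (f i)) (iota (e i) φ)) k = (k : ℝ) • φ k := by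
  induction k generalizing φ with
  | zero =>
    ext v
    simp [Finset.sum_apply, ContinuousAlternatingMap.sum_apply, wedge_zero]
  | succ k ih =>
    refine form_ext_succ (ψ := fun l => (l : ℝ) • φ l) fun X => ?_
    have h1 : ∑ i, f i X • iota (e i) φ = iota X φ := by
      conv_rhs => rw [← hef X]
      induction (Finset.univ : Finset ι) using Finset.cons_induction with
      | empty => simp
      | cons i s hi ih => rw [Finset.sum_cons, Finset.sum_cons, iota_vadd, iota_vsmul, ih]
    have h2 : ∀ i, wedge (ofCovector (f i)) (iota X (iota (e i) φ)) =
        -wedge (ofCovector (f i)) (iota (e i) (iota X φ)) := fun i => by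
      rw [iota_iota, wedge_neg_right]
    simp only [iota_sum, iota_covector_wedge, h2, sub_neg_eq_add]
    rw [Finset.sum_add_distrib, h1, Pi.add_apply, ih]
    ext v
    simp [iota_apply, add_mul, add_comm]

theorem single_apply_of_ne {k l : ℕ} (h : l ≠ k) (a : V [⋀^Fin k]→L[ℝ] ℂ) :
    (Pi.single k a : PForm V) l = 0 := by
  simp [h]

theorem iota_single_succ (k : ℕ) (a : V [⋀^Fin (k + 1)]→L[ℝ] ℂ) (X : V) :
    iota X (Pi.single (k + 1) a : PForm V) = Pi.single k (a.curryLeft X) := by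
  funext l
  ext v
  by_cases h : l = k
  · subst h; simp [iota_apply]
  · rw [iota_apply, single_apply_of_ne (by omega), single_apply_of_ne h]; rfl

theorem pform_eq_sum_single [FiniteDimensional ℝ V] (φ : PForm V) :
    φ = ∑ k ∈ Finset.range (Module.finrank ℝ V + 1), (Pi.single k (φ k) : PForm V) := by
  funext l
  rw [Finset.sum_apply]
  by_cases h : l < Module.finrank ℝ V + 1
  · rw [Finset.sum_eq_single l]
    · simp
    · intro b _ hb; exact single_apply_of_ne hb.symm _
    · intro h'; exact absurd (Finset.mem_range.2 h) h'
  · rw [form_eq_zero_of_finrank_lt (by omega) (φ l), Finset.sum_eq_zero]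
    intro b hb
    exact single_apply_of_ne (by rw [Finset.mem_range] at hb; omega) _

variable [FiniteDimensional ℝ V]

theorem exists_dual_frame (V : Type*) [NormedAddCommGroup V] [NormedSpace ℝ V]
    [FiniteDimensional ℝ V] : ∃ (e : Fin (Module.finrank ℝ V) → V)
      (f : Fin (Module.finrank ℝ V) → V →L[ℝ] ℝ), ∀ X, ∑ i, f i X • e i = X := by
  let b := Module.finBasis ℝ V
  exact ⟨b, fun i => LinearMap.toContinuousLinearMap (b.coord i), fun X => b.sum_repr X⟩

/-- A set of polyforms closed under sums, scalar multiples, contractions and products with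
covectors that contains a nonzero polyform contains every polyform. -/
theorem mem_of_stable (K : Set (PForm V)) (hadd : ∀ φ ∈ K, ∀ ψ ∈ K, φ + ψ ∈ K)
    (hsmul : ∀ (c : ℂ), ∀ φ ∈ K, c • φ ∈ K) (hiota : ∀ X, ∀ φ ∈ K, iota X φ ∈ K)
    (hcov : ∀ ξ, ∀ φ ∈ K, wedge (ofCovector ξ) φ ∈ K) {φ : PForm V} (hφ : φ ∈ K) (h0 : φ ≠ 0)
    (ψ : PForm V) : ψ ∈ K := by
  have hzero : (0 : PForm V) ∈ K := by simpa using hsmul 0 φ hφ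
  have hsum : ∀ {ι : Type} (s : Finset ι) (g : ι → PForm V), (∀ i ∈ s, g i ∈ K) →
      ∑ i ∈ s, g i ∈ K := by
    intro ι s g
    induction s using Finset.cons_induction with
    | empty => intro _; simpa using hzero
    | cons i s hi ih =>
      intro h
      rw [Finset.sum_cons]
      exact hadd _ (h i (by simp)) _ (ih fun j hj => h j (by simp [hj]))
  have step1 : ∀ r, ∀ φ ∈ K, φ r ≠ 0 → (∀ j, r < j → φ j = 0) → const 1 ∈ K := by
    intro r
    induction r with
    | zero =>
      intro φ hφ h hj
      have h1 : φ 0 0 ≠ 0 := fun h' => h (form_ext_zero h')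
      have h2 : φ = const (φ 0 0) := by
        funext k
        rcases k with _ | k
        · exact form_ext_zero (by rw [const_zero_apply])
        · rw [hj _ (Nat.succ_pos k), const_succ]
      have h3 : const 1 = (φ 0 0)⁻¹ • φ := by
        conv_rhs => rw [h2, const_zero_apply]
        funext k
        rcases k with _ | k
        · refine form_ext_zero ?_
          rw [const_zero_apply, Pi.smul_apply, ContinuousAlternatingMap.smul_apply,
            const_zero_apply, smul_eq_mul, inv_mul_cancel₀ h1]
        · simp
      rw [h3]
      exact hsmul _ _ hφ
    | succ r ih =>
      intro φ hφ h hj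
      obtain ⟨X, hX⟩ : ∃ X, iota X φ r ≠ 0 := by
        by_contra! hc
        exact h (form_ext_succ (ψ := 0) fun X => by simpa using hc X)
      refine ih _ (hiota X φ hφ) hX fun j hrj => ?_
      ext v
      rw [iota_apply, hj (j + 1) (by omega)]
      rfl
  have hone : const 1 ∈ K := by
    have hex : ∃ r, φ r ≠ 0 := by
      by_contra! hc
      exact h0 (funext hc)
    classical
    let r := Nat.findGreatest (fun r => φ r ≠ 0) (Module.finrank ℝ V)
    obtain ⟨r0, hr0⟩ := hex
    have hr0' : r0 ≤ Module.finrank ℝ V := by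
      by_contra hc
      exact hr0 (form_eq_zero_of_finrank_lt (by omega) _)
    refine step1 r φ hφ (Nat.findGreatest_spec (P := fun r => φ r ≠ 0) hr0' hr0) fun j hj => ?_
    by_cases hjd : j ≤ Module.finrank ℝ V
    · by_contra hne
      exact absurd (Nat.le_findGreatest hjd hne) (not_le.2 hj)
    · exact form_eq_zero_of_finrank_lt (by omega) _
  obtain ⟨e, f, hef⟩ := exists_dual_frame V
  have hsingle : ∀ k, ∀ a : V [⋀^Fin k]→L[ℝ] ℂ, (Pi.single k a : PForm V) ∈ K := by
    intro k
    induction k with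
    | zero =>
      intro a
      have : (Pi.single 0 a : PForm V) = a 0 • const 1 := by
        funext k
        rcases k with _ | k
        · exact form_ext_zero (by simp [const_zero_apply])
        · simp
      rw [this]
      exact hsmul _ _ hone
    | succ k ih =>
      intro a
      have : (Pi.single (k + 1) a : PForm V) = ((k + 1 : ℂ)⁻¹) •
          ∑ i, wedge (ofCovector (f i)) (iota (e i) (Pi.single (k + 1) a : PForm V)) := by
        funext l
        rw [Pi.smul_apply, sum_covector_wedge_iota e f hef]
        by_cases h : l = k + 1
        · subst h
          ext v
          have : (k + 1 : ℂ) ≠ 0 := by exact_mod_cast Nat.succ_ne_zero k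
          simp
          field_simp
        · rw [single_apply_of_ne h]; simp
      rw [this]
      refine hsmul _ _ (hsum _ _ fun i _ => ?_)
      rw [iota_single_succ]
      exact hcov _ _ (ih _)
  rw [pform_eq_sum_single ψ]
  exact hsum _ _ fun k _ => hsingle k _

end Finite

section Clifford

variable (v w : GT V) (φ ψ : PForm V) (c : ℂ) (r : ℝ)

@[simp] theorem cliff_add : cliff v (φ + ψ) = cliff v φ + cliff v ψ := by
  simp only [cliff, iota_add, wedge_add_right]; abel
@[simp] theorem cliff_smul : cliff v (c • φ) = c • cliff v φ := by
  simp only [cliff, iota_smul, wedge_smul_right, smul_add]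
@[simp] theorem cliff_neg : cliff v (-φ) = -cliff v φ := by
  rw [← pform_neg_one_smul φ, cliff_smul, pform_neg_one_smul]
@[simp] theorem cliff_zero : cliff v 0 = 0 := by simp [cliff]
theorem cliff_vadd : cliff (v + w) φ = cliff v φ + cliff w φ := by
  simp only [cliff, Prod.fst_add, Prod.snd_add, iota_vadd, ofCovector_add, wedge_add_left]; abel
theorem cliff_vsmul : cliff (r • v) φ = r • cliff v φ := by
  simp only [cliff, Prod.smul_fst, Prod.smul_snd, iota_vsmul, ofCovector_smul, wedge_rsmul_left,
    smul_add]
theorem cliff_vneg : cliff (-v) φ = -cliff v φ := by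
  have h : -v = (-1 : ℝ) • v := by ext <;> simp
  rw [h, cliff_vsmul, pform_neg_one_rsmul]
theorem cliff_vsub : cliff (v - w) φ = cliff v φ - cliff w φ := by
  rw [sub_eq_add_neg, cliff_vadd, cliff_vneg, sub_eq_add_neg]
@[simp] theorem cliff_vzero : cliff 0 φ = 0 := by simp [cliff]
theorem cliff_vector (X : V) : cliff (X, 0) φ = iota X φ := by simp [cliff]
theorem cliff_covector (ξ : V →L[ℝ] ℝ) : cliff (0, ξ) φ = wedge (ofCovector ξ) φ := by simp [cliff]

theorem cliff_cliff_add : cliff v (cliff w φ) + cliff w (cliff v φ) = (2 * inGT v w) • φ := by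
  simp only [cliff, iota_add, wedge_add_right, iota_covector_wedge, iota_iota w.1 v.1,
    covector_wedge_anticomm w.2 v.2]
  have : 2 * inGT v w = v.2 w.1 + w.2 v.1 := by simp [inGT]; ring
  rw [this]
  module

theorem cliff_cliff_self : cliff v (cliff v φ) = inGT v v • φ := by
  have h := cliff_cliff_add v v φ
  have h2 : cliff v (cliff v φ) = (1 / 2 : ℝ) • (cliff v (cliff v φ) + cliff v (cliff v φ)) := by
    module
  rw [h2, h, smul_smul]
  congr 1
  ring

theorem inGT_comm : inGT v w = inGT w v := by simp [inGT]; ring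
theorem inGT_add_left (u : GT V) : inGT (v + u) w = inGT v w + inGT u w := by simp [inGT]; ring
theorem inGT_smul_left : inGT (r • v) w = r * inGT v w := by simp [inGT]; ring
theorem inGT_smul_right : inGT v (r • w) = r * inGT v w := by simp [inGT]; ring
theorem inGT_sub_left (u : GT V) : inGT (v - u) w = inGT v w - inGT u w := by simp [inGT]; ring

theorem cliffC_add (a b : GT V) : cliffC a b (φ + ψ) = cliffC a b φ + cliffC a b ψ := by
  simp only [cliffC, cliff_add, smul_add]; abel
theorem cliffC_smul (a b : GT V) : cliffC a b (c • φ) = c • cliffC a b φ := by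
  simp only [cliffC, cliff_smul, smul_add, smul_comm c]
theorem cliffC_vadd (a b a' b' : GT V) :
    cliffC (a + a') (b + b') φ = cliffC a b φ + cliffC a' b' φ := by
  simp only [cliffC, cliff_vadd, smul_add]; abel

theorem cliffC_cliffC_add (a b a' b' : GT V) :
    cliffC a b (cliffC a' b' φ) + cliffC a' b' (cliffC a b φ) =
      (2 * ((inGT a a' - inGT b b' : ℝ) + Complex.I * (inGT a b' + inGT b a' : ℝ))) • φ := by
  have h1 := cliff_cliff_add a a' φ
  have h2 := cliff_cliff_add b b' φ
  have h3 := cliff_cliff_add a b' φ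
  have h4 := cliff_cliff_add b a' φ
  simp only [cliffC, cliff_add, cliff_smul, smul_add, smul_smul, Complex.I_mul_I]
  have : ∀ x1 x2 x3 x4 y1 y2 y3 y4 : PForm V,
      (x1 + Complex.I • x2 + (Complex.I • x3 + (-1 : ℂ) • x4)) +
      (y1 + Complex.I • y2 + (Complex.I • y3 + (-1 : ℂ) • y4)) =
      (x1 + y1) + (-1 : ℂ) • (x4 + y4) + Complex.I • (x3 + y2) + Complex.I • (x2 + y3) := by
    intros; module
  rw [this, h1, h2, h3, add_comm (cliff b (cliff a' φ)), add_comm (cliff a' (cliff b φ)), h4]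
  simp only [rsmul_eq_smul]
  push_cast
  module

/-- The isomorphism of generalised tangent spaces induced by a linear isomorphism. -/
def gtMap (f : V ≃L[ℝ] W) (v : GT V) : GT W := (f v.1, v.2.comp (f.symm : W →L[ℝ] V))

theorem gtMap_add (f : V ≃L[ℝ] W) : gtMap f (v + w) = gtMap f v + gtMap f w := by
  simp [gtMap]
theorem gtMap_smul (f : V ≃L[ℝ] W) : gtMap f (r • v) = r • gtMap f v := by
  simp [gtMap]
theorem gtMap_neg (f : V ≃L[ℝ] W) : gtMap f (-v) = -gtMap f v := by
  simp [gtMap]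
@[simp] theorem gtMap_symm_gtMap (f : V ≃L[ℝ] W) : gtMap f.symm (gtMap f v) = v := by
  refine Prod.ext (by simp [gtMap]) ?_
  ext X; simp [gtMap]

@[simp] theorem inGT_gtMap (f : V ≃L[ℝ] W) : inGT (gtMap f v) (gtMap f w) = inGT v w := by
  simp [gtMap, inGT]

theorem cliff_pull (f : V ≃L[ℝ] W) (φ : PForm W) :
    cliff v (pull (f : V →L[ℝ] W) φ) = pull (f : V →L[ℝ] W) (cliff (gtMap f v) φ) := by
  have : ((gtMap f v).2.comp (f : V →L[ℝ] W)) = v.2 := by ext; simp [gtMap]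
  simp only [cliff, iota_pull, pull_add, pull_wedge, pull_ofCovector, this]
  rfl

/-! Conjugation -/

theorem conj_apply (k : ℕ) (u : Fin k → V) : conj φ k u = (starRingEnd ℂ) (φ k u) := rfl

@[simp] theorem conj_add : conj (φ + ψ) = conj φ + conj ψ := by
  funext k; ext u; simp [conj_apply]
@[simp] theorem conj_neg : conj (-φ) = -conj φ := by
  funext k; ext u; simp [conj_apply]
@[simp] theorem conj_smul : conj (c • φ) = (starRingEnd ℂ) c • conj φ := by
  funext k; ext u; simp [conj_apply]
@[simp] theorem conj_zero : conj (0 : PForm V) = 0 := by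
  funext k; ext u; simp [conj_apply]
theorem conj_iota (X : V) : conj (iota X φ) = iota X (conj φ) := rfl
theorem conj_gradeInv : conj (gradeInv φ) = gradeInv (conj φ) := by
  funext k; ext u; simp [conj_apply, gradeInv_apply]
theorem conj_wedge : conj (wedge φ ψ) = wedge (conj φ) (conj ψ) := by
  funext k
  induction k generalizing φ ψ with
  | zero => ext v; simp [wedge_zero, conj_apply]
  | succ k ih =>
    refine form_ext_succ fun X => ?_
    rw [← conj_iota, iota_wedge, iota_wedge, conj_add, Pi.add_apply, Pi.add_apply, ih, ih,
      conj_gradeInv]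
    rfl
@[simp] theorem conj_ofReal (k : ℕ) (η : V [⋀^Fin k]→L[ℝ] ℝ) : conj (ofReal k η) = ofReal k η := by
  funext l; ext u
  by_cases h : l = k
  · subst h; rw [conj_apply, ofReal_same_apply, Complex.conj_ofReal]
  · rw [conj_apply, ofReal_of_ne h]; simp
@[simp] theorem conj_ofCovector (ξ : V →L[ℝ] ℝ) : conj (ofCovector ξ) = ofCovector ξ := conj_ofReal _ _
theorem conj_cliff : conj (cliff v φ) = cliff v (conj φ) := by
  simp only [cliff, conj_add, conj_wedge, conj_iota, conj_ofCovector]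
theorem conj_pull (f : W →L[ℝ] V) : conj (pull f φ) = pull f (conj φ) := rfl

/-! The pairing -/

theorem iota_signedReverse (X : V) :
    iota X (signedReverse φ) = -gradeInv (signedReverse (iota X φ)) := by
  funext k
  ext u
  have h : (k + 1) * (k + 1 - 1) / 2 = k * (k - 1) / 2 + k := by
    have := Nat.triangle_succ k
    exact this
  simp only [iota_apply, signedReverse, gradeInv_apply, Pi.neg_apply, h,
    ContinuousAlternatingMap.smul_apply, ContinuousAlternatingMap.neg_apply]
  rcases Nat.even_or_odd k with hk | hk <;> simp [pow_add, hk.neg_one_pow]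

@[simp] theorem signedReverse_add :
    signedReverse (φ + ψ) = signedReverse φ + signedReverse ψ := by
  funext k; exact smul_add _ _ _
@[simp] theorem signedReverse_smul : signedReverse (c • φ) = c • signedReverse φ := by
  funext k; exact smul_comm ((-1 : ℝ) ^ k * (-1 : ℝ) ^ (k * (k - 1) / 2)) c (φ k)
@[simp] theorem signedReverse_neg : signedReverse (-φ) = -signedReverse φ := by
  rw [← pform_neg_one_smul φ, signedReverse_smul, pform_neg_one_smul]
theorem pull_signedReverse (f : W →L[ℝ] V) :
    pull f (signedReverse φ) = signedReverse (pull f φ) := rfl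

theorem signedReverse_covector_wedge (ξ : V →L[ℝ] ℝ) :
    signedReverse (wedge (ofCovector ξ) φ) = -wedge (signedReverse φ) (ofCovector ξ) := by
  funext k
  induction k generalizing φ with
  | zero => ext v; simp [wedge_zero, signedReverse]
  | succ k ih =>
    refine form_ext_succ fun X => ?_
    have h : gradeInv (signedReverse (wedge (ofCovector ξ) (iota X φ))) k =
        gradeInv (-wedge (signedReverse (iota X φ)) (ofCovector ξ)) k := by
      rw [gradeInv_apply, ih, gradeInv_apply]
    rw [iota_signedReverse, iota_covector_wedge, sub_eq_add_neg, signedReverse_add,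
      signedReverse_neg, gradeInv_add, gradeInv_neg, Pi.neg_apply, Pi.add_apply, Pi.neg_apply, h]
    simp only [iota_neg, iota_wedge, iota_signedReverse, iota_ofCovector, wedge_const, gradeInv_neg,
      gradeInv_wedge, gradeInv_ofCovector, wedge_neg_left, wedge_neg_right,
      gradeInv_smul, signedReverse_smul, rsmul_eq_smul, Pi.add_apply, Pi.neg_apply,
      Pi.smul_apply]
    abel

/-- The pairing `(a, b) ↦ (-1)^{|a|} α(a) ∧ b`. -/
def mukai (a b : PForm V) : PForm V := wedge (signedReverse a) b

theorem mukai_add_left (a a' b : PForm V) : mukai (a + a') b = mukai a b + mukai a' b := by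
  simp [mukai, wedge_add_left]
theorem mukai_add_right (a b b' : PForm V) : mukai a (b + b') = mukai a b + mukai a b' := by
  simp [mukai, wedge_add_right]
theorem mukai_smul_left (a b : PForm V) : mukai (c • a) b = c • mukai a b := by
  simp [mukai, wedge_smul_left]
theorem mukai_smul_right (a b : PForm V) : mukai a (c • b) = c • mukai a b := by
  simp [mukai, wedge_smul_right]
theorem mukai_neg_right (a b : PForm V) : mukai a (-b) = -mukai a b := by
  simp [mukai, wedge_neg_right]
theorem pull_mukai (f : W →L[ℝ] V) (a b : PForm V) :
    pull f (mukai a b) = mukai (pull f a) (pull f b) := by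
  simp only [mukai, pull_wedge, pull_signedReverse]

theorem mukai_cliff_left {n : ℕ} (hn : ∀ a : V [⋀^Fin (n + 1)]→L[ℝ] ℂ, a = 0) (a b : PForm V) :
    mukai (cliff v a) b n = -mukai a (cliff v b) n := by
  have h1 : mukai (iota v.1 a) b n = -mukai a (iota v.1 b) n := by
    have h : iota v.1 (wedge (gradeInv (signedReverse a)) b) =
        mukai (iota v.1 a) b + mukai a (iota v.1 b) := by
      rw [iota_wedge, iota_gradeInv, iota_signedReverse, gradeInv_neg, gradeInv_gradeInv, neg_neg,
        gradeInv_gradeInv]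
      rfl
    have h0 : iota v.1 (wedge (gradeInv (signedReverse a)) b) n = 0 := by
      ext u
      rw [iota_apply, hn (wedge (gradeInv (signedReverse a)) b (n + 1))]
      rfl
    rw [h, Pi.add_apply] at h0
    exact eq_neg_of_add_eq_zero_left h0
  have h2 : mukai (wedge (ofCovector v.2) a) b = -mukai a (wedge (ofCovector v.2) b) := by
    rw [mukai, signedReverse_covector_wedge, wedge_neg_left, wedge_assoc]
    rfl
  rw [cliff, cliff, mukai_add_left, mukai_add_right, h2, Pi.add_apply, Pi.add_apply, h1,
    Pi.neg_apply]
  abel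

theorem pairing_eq (p q : PForm V × PForm V) :
    pairing p q = (mukai p.1 q.2 + mukai p.2 q.1) (Module.finrank ℝ V) := rfl

end Clifford

section Pure

theorem pform_sub_smul (c d : ℂ) (φ : PForm V) : (c - d) • φ = c • φ - d • φ := sub_smul c d φ

theorem cliffC_vsmul (s t : ℝ) (e : GT V) (φ : PForm V) :
    cliffC (s • e) (t • e) φ = ((s : ℂ) + Complex.I * t) • cliff e φ := by
  simp only [cliffC, cliff_vsmul, rsmul_eq_smul]
  module

theorem cliffC_real (a : GT V) (φ : PForm V) : cliffC a 0 φ = cliff a φ := by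
  simp [cliffC]

theorem cliffC_conj (a b : GT V) (φ : PForm V) : cliffC a b (conj φ) = conj (cliffC a (-b) φ) := by
  simp only [cliffC, conj_add, conj_smul, conj_cliff, cliff_vneg, conj_neg, Complex.conj_I]
  module

theorem cliffC_zero_right (a b : GT V) : cliffC a b (0 : PForm V) = 0 := by simp [cliffC]

theorem mukai_cliffC_left {n : ℕ} (hn : ∀ a : V [⋀^Fin (n + 1)]→L[ℝ] ℂ, a = 0) (v w : GT V)
    (a b : PForm V) : mukai (cliffC v w a) b n = -mukai a (cliffC v w b) n := by
  simp only [cliffC, mukai_add_left, mukai_add_right, mukai_smul_left, mukai_smul_right,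
    Pi.add_apply, Pi.smul_apply, mukai_cliff_left _ hn]
  module

theorem mukai_zero_left (b : PForm V) : mukai 0 b = 0 := by
  have := mukai_smul_left 0 (0 : PForm V) b
  rwa [pform_zero_smul, pform_zero_smul] at this

theorem mukai_zero_right (a : PForm V) : mukai a 0 = 0 := by simp [mukai]

/-- Two polyforms annihilated by a set `N` of complex generalised vectors are proportional, if `N`
has a complement that annihilates a polyform which pairs nontrivially with one of them. -/
theorem exists_smul_of_annihilated [FiniteDimensional ℝ V] (N N' : GT V → GT V → Prop)
    (hsum : ∀ a b, ∃ a₁ b₁ a₂ b₂, N a₁ b₁ ∧ N' a₂ b₂ ∧ a = a₁ + a₂ ∧ b = b₁ + b₂)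
    {φ φ₀ χ₀ : PForm V} (h : ∀ a b, N a b → cliffC a b φ = 0) (h₀ : ∀ a b, N a b → cliffC a b φ₀ = 0)
    (hχ : ∀ a b, N' a b → cliffC a b χ₀ = 0)
    (hB : mukai φ₀ χ₀ (Module.finrank ℝ V) ≠ 0) : ∃ c : ℂ, φ = c • φ₀ := by
  set n := Module.finrank ℝ V with hn_def
  have hn : ∀ a : V [⋀^Fin (n + 1)]→L[ℝ] ℂ, a = 0 := form_eq_zero_of_finrank_lt (by omega)
  -- every polyform pairs to zero with `ρ` as soon as `χ₀` does
  have key : ∀ ρ : PForm V, (∀ a b, N a b → cliffC a b ρ = 0) →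
      ∀ u, (mukai ρ χ₀ n) u = 0 →
      ∀ χ, (mukai ρ χ n) u = 0 := by
    intro ρ hρ u hu χ
    let S : Set (PForm V) := {x | ∃ l : List (GT V × GT V), (∀ z ∈ l, N z.1 z.2) ∧
      x = l.foldr (fun z y => cliffC z.1 z.2 y) χ₀}
    let K := Submodule.span ℂ S
    have hS : ∀ a b, ∀ x ∈ S, cliffC a b x ∈ K := by
      rintro a b x ⟨l, hl, rfl⟩
      obtain ⟨a₁, b₁, a₂, b₂, h1, h2, rfl, rfl⟩ := hsum a b
      rw [cliffC_vadd]
      refine K.add_mem (Submodule.subset_span ⟨(a₁, b₁) :: l, ?_, rfl⟩) ?_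
      · rintro z hz
        rcases List.mem_cons.1 hz with rfl | hz
        · exact h1
        · exact hl z hz
      · clear h1
        induction l with
        | nil => simp [hχ _ _ h2]
        | cons z l ih =>
          have hl' : ∀ z ∈ l, N z.1 z.2 := fun y hy => hl y (List.mem_cons_of_mem _ hy)
          have h3 := cliffC_cliffC_add (l.foldr (fun z y => cliffC z.1 z.2 y) χ₀) a₂ b₂ z.1 z.2
          rw [List.foldr_cons, eq_sub_of_add_eq h3]
          refine K.sub_mem (K.smul_mem _ (Submodule.subset_span ⟨l, hl', rfl⟩)) ?_
          have h4 := ih hl'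
          have h5 : ∀ x ∈ K, cliffC z.1 z.2 x ∈ K := by
            intro x hx
            refine Submodule.span_induction ?_ ?_ ?_ ?_ hx
            · rintro _ ⟨l', hl'', rfl⟩
              refine Submodule.subset_span ⟨z :: l', ?_, rfl⟩
              intro y hy
              rcases List.mem_cons.1 hy with rfl | hy
              · exact hl y List.mem_cons_self
              · exact hl'' y hy
            · rw [cliffC_zero_right]; exact K.zero_mem
            · intro x y _ _ hx hy
              rw [cliffC_add]; exact K.add_mem hx hy
            · intro c x _ hx
              rw [cliffC_smul]; exact K.smul_mem _ hx
          exact h5 _ h4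
    have hK : ∀ a b, ∀ x ∈ K, cliffC a b x ∈ K := by
      intro a b x hx
      refine Submodule.span_induction (hS a b) ?_ ?_ ?_ hx
      · rw [cliffC_zero_right]; exact K.zero_mem
      · intro x y _ _ hx hy
        rw [cliffC_add]; exact K.add_mem hx hy
      · intro c x _ hx
        rw [cliffC_smul]; exact K.smul_mem _ hx
    have hχ0 : χ₀ ≠ 0 := by
      rintro rfl
      exact hB (by simp [mukai_zero_right])
    have hall : χ ∈ (K : Set (PForm V)) :=
      mem_of_stable (K : Set (PForm V)) (fun φ hφ ψ hψ => K.add_mem hφ hψ)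
        (fun c φ hφ => K.smul_mem c hφ)
        (fun X φ hφ => by
          have := hK (X, 0) 0 φ hφ
          rwa [cliffC_real, cliff_vector] at this)
        (fun ξ φ hφ => by
          have := hK (0, ξ) 0 φ hφ
          rwa [cliffC_real, cliff_covector] at this)
        (Submodule.subset_span ⟨[], by simp, rfl⟩) hχ0 χ
    refine Submodule.span_induction ?_ ?_ ?_ ?_ hall
    · rintro _ ⟨l, hl, rfl⟩
      cases l with
      | nil => exact hu
      | cons z l =>
        have := mukai_cliffC_left hn z.1 z.2 ρ (l.foldr (fun z y => cliffC z.1 z.2 y) χ₀)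
        rw [hρ _ _ (hl z List.mem_cons_self)] at this
        rw [List.foldr_cons, ← neg_eq_zero, ← ContinuousAlternatingMap.neg_apply, ← this]
        simp [mukai_zero_left]
    · simp [mukai_zero_right]
    · intro x y _ _ hx hy
      rw [mukai_add_right, Pi.add_apply, ContinuousAlternatingMap.add_apply, hx, hy, add_zero]
    · intro c x _ hx
      rw [mukai_smul_right, Pi.smul_apply, ContinuousAlternatingMap.smul_apply, hx, smul_zero]
  obtain ⟨u, hu⟩ : ∃ u, (mukai φ₀ χ₀ n) u ≠ 0 := by
    by_contra! hc
    exact hB (ContinuousAlternatingMap.ext hc)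
  set c := (mukai φ χ₀ n) u / (mukai φ₀ χ₀ n) u with hc
  refine ⟨c, ?_⟩
  by_contra hne
  set ρ := φ - c • φ₀ with hρ
  have hρ0 : ρ ≠ 0 := fun h => hne (sub_eq_zero.1 h)
  have hρN : ∀ a b, N a b → cliffC a b ρ = 0 := by
    intro a b hab
    have h1 : ρ = φ + (-c) • φ₀ := by rw [hρ, pform_neg_smul, sub_eq_add_neg]
    rw [h1, cliffC_add, cliffC_smul, h _ _ hab, h₀ _ _ hab]
    simp
  have hρu : (mukai ρ χ₀ n) u = 0 := by
    have h1 : ρ = φ + (-c) • φ₀ := by rw [hρ, pform_neg_smul, sub_eq_add_neg]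
    rw [h1, mukai_add_left, mukai_smul_left, Pi.add_apply, Pi.smul_apply,
      ContinuousAlternatingMap.add_apply, ContinuousAlternatingMap.smul_apply, smul_eq_mul, hc]
    field_simp
    ring
  have hall := key ρ hρN u hρu
  -- the radical is stable
  have hmem : φ₀ ∈ {x : PForm V | ∀ χ, (mukai x χ n) u = 0} := by
    refine mem_of_stable {x : PForm V | ∀ χ, (mukai x χ n) u = 0} ?_ ?_ ?_ ?_ (φ := ρ) hall hρ0 φ₀
    · intro x hx y hy χ
      rw [mukai_add_left, Pi.add_apply, ContinuousAlternatingMap.add_apply, hx, hy, add_zero]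
    · intro c x hx χ
      rw [mukai_smul_left, Pi.smul_apply, ContinuousAlternatingMap.smul_apply, hx, smul_zero]
    · intro X x hx χ
      rw [← cliff_vector, mukai_cliff_left _ hn, ContinuousAlternatingMap.neg_apply, hx, neg_zero]
    · intro ξ x hx χ
      rw [← cliff_covector, mukai_cliff_left _ hn, ContinuousAlternatingMap.neg_apply, hx, neg_zero]
  exact hu (hmem χ₀)

end Pure

/-! ### Sekiya quadruples at a point -/

/-- A quadruple `(Φ, e₁, e₂, λ)` on a vector space. -/
structure PointQuadruple (V : Type*) [NormedAddCommGroup V] [NormedSpace ℝ V] where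
  Φ : GT V →ₗ[ℝ] GT V
  e₁ : GT V
  e₂ : GT V
  lam : ℝ

namespace PointQuadruple

/-- `μ = √(1 + λ²)`. -/
def mu (Q : PointQuadruple V) : ℝ := Real.sqrt (1 + Q.lam ^ 2)

/-- The algebraic conditions on a Sekiya quadruple. -/
structure IsSekiya (Q : PointQuadruple V) : Prop where
  e₁_e₁ : inGT Q.e₁ Q.e₁ = 0
  e₂_e₂ : inGT Q.e₂ Q.e₂ = 0
  e₁_e₂ : inGT Q.e₁ Q.e₂ = 1 / 2
  skew : ∀ v w, inGT (Q.Φ v) w = -inGT v (Q.Φ w)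
  Φ_e₁ : Q.Φ Q.e₁ = Q.lam • Q.e₁
  Φ_e₂ : Q.Φ Q.e₂ = -Q.lam • Q.e₂
  Φ_sq : ∀ v, Q.Φ (Q.Φ v) =
    -v + (2 * (1 + Q.lam ^ 2)) • (inGT v Q.e₂ • Q.e₁ + inGT v Q.e₁ • Q.e₂)

/-- The algebraic conditions on a mixed pair. -/
structure IsMixedPair (Q : PointQuadruple V) (p : PForm V × PForm V) : Prop where
  nondegenerate : pairing p (conjPair p) ≠ 0
  e₁_snd : cliff Q.e₁ p.2 = 0
  e₁_fst : Q.mu • cliff Q.e₁ p.1 = (1 + Complex.I * Q.lam) • p.2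
  e₂_fst : cliff Q.e₂ p.1 = 0
  e₂_snd : Q.mu • cliff Q.e₂ p.2 = (1 - Complex.I * Q.lam) • p.1
  eigenspace : ∀ a b : GT V, (Q.Φ a = -b ∧ Q.Φ b = a) ↔
    (cliffC a b p.1 = 0 ∧ cliffC a b p.2 = 0)

theorem mu_sq (Q : PointQuadruple V) : Q.mu * Q.mu = 1 + Q.lam ^ 2 :=
  Real.mul_self_sqrt (by positivity)

theorem mu_pos (Q : PointQuadruple V) : 0 < Q.mu := Real.sqrt_pos.2 (by positivity)

theorem one_add_I_mul_ne (r : ℝ) : (1 + Complex.I * r : ℂ) ≠ 0 := by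
  intro h
  have := congrArg Complex.re h
  simp at this

theorem one_sub_I_mul_ne (r : ℝ) : (1 - Complex.I * r : ℂ) ≠ 0 := by
  intro h
  have := congrArg Complex.re h
  simp at this

variable {Q : PointQuadruple V}

/-- The component of a generalised vector orthogonal to `e₁` and `e₂`. -/
def perp (Q : PointQuadruple V) (v : GT V) : GT V :=
  v - (2 * inGT v Q.e₂) • Q.e₁ - (2 * inGT v Q.e₁) • Q.e₂

theorem IsSekiya.inGT_perp_e₁ (h : Q.IsSekiya) (v : GT V) : inGT (Q.perp v) Q.e₁ = 0 := by
  have := h.e₁_e₂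
  rw [inGT_comm] at this
  simp only [perp, inGT_sub_left, inGT_smul_left, h.e₁_e₁, this]; ring

theorem IsSekiya.inGT_perp_e₂ (h : Q.IsSekiya) (v : GT V) : inGT (Q.perp v) Q.e₂ = 0 := by
  simp only [perp, inGT_sub_left, inGT_smul_left, h.e₂_e₂, h.e₁_e₂]; ring

theorem IsSekiya.Φ_Φ_perp (h : Q.IsSekiya) (v : GT V) : Q.Φ (Q.Φ (Q.perp v)) = -Q.perp v := by
  rw [h.Φ_sq, h.inGT_perp_e₁, h.inGT_perp_e₂]
  simp

theorem IsMixedPair.snd_eq {p : PForm V × PForm V} (hp : Q.IsMixedPair p) :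
    p.2 = ((Q.mu : ℂ) / (1 + Complex.I * Q.lam)) • cliff Q.e₁ p.1 := by
  have h := hp.e₁_fst
  rw [rsmul_eq_smul] at h
  rw [div_eq_inv_mul, ← smul_smul, h, smul_smul, inv_mul_cancel₀ (one_add_I_mul_ne _), one_smul]

theorem IsMixedPair.cliff_e₁_fst {p : PForm V × PForm V} (hp : Q.IsMixedPair p) :
    cliff Q.e₁ p.1 = ((1 + Complex.I * Q.lam) / (Q.mu : ℂ)) • p.2 := by
  have h := hp.e₁_fst
  rw [rsmul_eq_smul] at h
  have hmu : (Q.mu : ℂ) ≠ 0 := by exact_mod_cast Q.mu_pos.ne'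
  rw [div_eq_inv_mul, ← smul_smul, ← h, smul_smul, inv_mul_cancel₀ hmu, one_smul]

theorem IsMixedPair.cliff_e₂_snd {p : PForm V × PForm V} (hp : Q.IsMixedPair p) :
    cliff Q.e₂ p.2 = ((1 - Complex.I * Q.lam) / (Q.mu : ℂ)) • p.1 := by
  have h := hp.e₂_snd
  rw [rsmul_eq_smul] at h
  have hmu : (Q.mu : ℂ) ≠ 0 := by exact_mod_cast Q.mu_pos.ne'
  rw [div_eq_inv_mul, ← smul_smul, ← h, smul_smul, inv_mul_cancel₀ hmu, one_smul]

theorem IsMixedPair.fst_ne_zero {p : PForm V × PForm V} (hp : Q.IsMixedPair p) : p.1 ≠ 0 := by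
  intro h
  have h2 : p.2 = 0 := by rw [hp.snd_eq, h]; simp
  exact hp.nondegenerate (by
    rw [pairing_eq, h, h2]; simp [mukai_zero_left])

theorem IsMixedPair.snd_ne_zero {p : PForm V × PForm V} (hp : Q.IsMixedPair p) : p.2 ≠ 0 := by
  intro h
  have h1 := hp.cliff_e₂_snd
  rw [h, cliff_zero] at h1
  rcases pform_smul_eq_zero.1 h1.symm with h2 | h2
  · have hmu : (Q.mu : ℂ) ≠ 0 := by exact_mod_cast Q.mu_pos.ne'
    exact (div_ne_zero (one_sub_I_mul_ne _) hmu) h2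
  · exact hp.fst_ne_zero h2

variable [FiniteDimensional ℝ V]

theorem IsMixedPair.mukai_ne_zero {p : PForm V × PForm V} (hp : Q.IsMixedPair p) :
    mukai p.1 (conj p.2) (Module.finrank ℝ V) ≠ 0 := by
  intro h
  refine hp.nondegenerate ?_
  have hn : ∀ a : V [⋀^Fin (Module.finrank ℝ V + 1)]→L[ℝ] ℂ, a = 0 :=
    form_eq_zero_of_finrank_lt (by omega)
  have h1 : mukai p.2 (conj p.1) (Module.finrank ℝ V) = 0 := by
    conv_lhs => rw [hp.snd_eq]
    rw [mukai_smul_left, Pi.smul_apply, mukai_cliff_left _ hn, ← conj_cliff, hp.cliff_e₁_fst,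
      conj_smul, mukai_smul_right, Pi.smul_apply, h]
    ext; simp
  rw [pairing_eq, conjPair, mukai_neg_right, Pi.add_apply, Pi.neg_apply, h, h1]
  simp

/-- A mixed pair of a quadruple at a point is unique up to a factor. -/
theorem IsSekiya.exists_eq_smul (h : Q.IsSekiya) {p q : PForm V × PForm V} (hp : Q.IsMixedPair p)
    (hq : Q.IsMixedPair q) : ∃ c : ℂ, c ≠ 0 ∧ q.1 = c • p.1 ∧ q.2 = c • p.2 := by
  have hann : ∀ r : PForm V × PForm V, Q.IsMixedPair r → ∀ a b,
      (∃ a' b', ∃ s t : ℝ, Q.Φ a' = -b' ∧ Q.Φ b' = a' ∧ a = a' + s • Q.e₂ ∧ b = b' + t • Q.e₂) →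
      cliffC a b r.1 = 0 := by
    rintro r hr _ _ ⟨a, b, s, t, h1, h2, rfl, rfl⟩
    rw [cliffC_vadd, cliffC_vsmul, hr.e₂_fst, ((hr.eigenspace a b).1 ⟨h1, h2⟩).1]
    simp
  obtain ⟨c, hc⟩ := exists_smul_of_annihilated
    (fun a b => ∃ a' b', ∃ s t : ℝ, Q.Φ a' = -b' ∧ Q.Φ b' = a' ∧ a = a' + s • Q.e₂ ∧ b = b' + t • Q.e₂)
    (fun a b => ∃ a' b', ∃ s t : ℝ, Q.Φ a' = b' ∧ Q.Φ b' = -a' ∧ a = a' + s • Q.e₁ ∧ b = b' + t • Q.e₁)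
    (fun a b => ⟨(1 / 2 : ℝ) • (Q.perp a + Q.Φ (Q.perp b)) + (2 * inGT a Q.e₁) • Q.e₂,
      (1 / 2 : ℝ) • (Q.perp b - Q.Φ (Q.perp a)) + (2 * inGT b Q.e₁) • Q.e₂,
      (1 / 2 : ℝ) • (Q.perp a - Q.Φ (Q.perp b)) + (2 * inGT a Q.e₂) • Q.e₁,
      (1 / 2 : ℝ) • (Q.perp b + Q.Φ (Q.perp a)) + (2 * inGT b Q.e₂) • Q.e₁,
      ⟨_, _, _, _, by simp only [map_smul, map_add, h.Φ_Φ_perp]; module,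
        by simp only [map_smul, map_sub, h.Φ_Φ_perp]; module, rfl, rfl⟩,
      ⟨_, _, _, _, by simp only [map_smul, map_sub, h.Φ_Φ_perp]; module,
        by simp only [map_smul, map_add, h.Φ_Φ_perp]; module, rfl, rfl⟩,
      by simp only [perp]; module, by simp only [perp]; module⟩)
    (hann q hq) (hann p hp) (χ₀ := conj p.2) (by
      rintro _ _ ⟨a, b, s, t, h1, h2, rfl, rfl⟩
      rw [cliffC_vadd, cliffC_vsmul, ← conj_cliff, hp.e₁_snd, cliffC_conj,
        ((hp.eigenspace a (-b)).1 ⟨by rw [h1, neg_neg], by rw [map_neg, h2, neg_neg]⟩).2]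
      simp) hp.mukai_ne_zero
  refine ⟨c, ?_, hc, ?_⟩
  · rintro rfl
    exact hq.fst_ne_zero (by rw [hc]; simp)
  · rw [hq.snd_eq, hc, cliff_smul, smul_comm, ← hp.snd_eq]

section Canonical

variable (Q)

/-- Clifford action of `a + i b ∈ (V ⊕ ℝ ⊕ ℝ ⊕ V*) ⊗ ℂ` on pairs. -/
def cliffPairC (a b : CE V) (p : PForm V × PForm V) : PForm V × PForm V :=
  cliffPair a p + Complex.I • cliffPair b p

omit [FiniteDimensional ℝ V] in
theorem cliffPairC_fst (a b : CE V) (p : PForm V × PForm V) : (cliffPairC a b p).1 =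
    cliffC a.1 b.1 p.1 + ((a.2.1 : ℂ) + Complex.I * b.2.1) • p.2 := by
  simp only [cliffPairC, cliffPair, cliffC, Prod.fst_add, Prod.smul_fst, rsmul_eq_smul]
  module

omit [FiniteDimensional ℝ V] in
theorem cliffPairC_snd (a b : CE V) (p : PForm V × PForm V) : (cliffPairC a b p).2 =
    ((a.2.2 : ℂ) + Complex.I * b.2.2) • p.1 - cliffC a.1 b.1 p.2 := by
  simp only [cliffPairC, cliffPair, cliffC, Prod.snd_add, Prod.smul_snd, rsmul_eq_smul]
  module

/-- The real part of the representative of the complex section `a + i b`, modulo annihilators of a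
mixed pair, that is orthogonal to `e₁`, `e₂` and has eigenvalue `-i` for `Φ`. -/
def canonRe (a b : CE V) : CE V :=
  ((1 / 2 : ℝ) • (Q.perp a.1 - Q.Φ (Q.perp b.1)),
    a.2.1 + 2 * (inGT a.1 Q.e₂ - Q.lam * inGT b.1 Q.e₂) / Q.mu,
    a.2.2 - 2 * (inGT a.1 Q.e₁ + Q.lam * inGT b.1 Q.e₁) / Q.mu)

/-- The imaginary part of the representative described in `canonRe`. -/
def canonIm (a b : CE V) : CE V :=
  ((1 / 2 : ℝ) • (Q.perp b.1 + Q.Φ (Q.perp a.1)),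
    b.2.1 + 2 * (inGT b.1 Q.e₂ + Q.lam * inGT a.1 Q.e₂) / Q.mu,
    b.2.2 - 2 * (inGT b.1 Q.e₁ - Q.lam * inGT a.1 Q.e₁) / Q.mu)

variable {Q}

omit [FiniteDimensional ℝ V] in
theorem IsSekiya.cliffC_perp (_h : Q.IsSekiya) (a b : GT V) (φ : PForm V) :
    cliffC (Q.perp a) (Q.perp b) φ = cliffC a b φ
      - (2 * ((inGT a Q.e₂ : ℂ) + Complex.I * inGT b Q.e₂)) • cliff Q.e₁ φ
      - (2 * ((inGT a Q.e₁ : ℂ) + Complex.I * inGT b Q.e₁)) • cliff Q.e₂ φ := by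
  simp only [cliffC, perp, cliff_vsub, cliff_vsmul, rsmul_eq_smul]
  push_cast
  module

omit [FiniteDimensional ℝ V] in
theorem IsSekiya.cliffPairC_canon (h : Q.IsSekiya) {p : PForm V × PForm V} (hp : Q.IsMixedPair p)
    (a b : CE V) : cliffPairC (Q.canonRe a b) (Q.canonIm a b) p = cliffPairC a b p := by
  have hmu : (Q.mu : ℂ) ≠ 0 := by exact_mod_cast Q.mu_pos.ne'
  have hev := (hp.eigenspace ((1 / 2 : ℝ) • (Q.perp a.1 + Q.Φ (Q.perp b.1)))
    ((1 / 2 : ℝ) • (Q.perp b.1 - Q.Φ (Q.perp a.1)))).1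
    ⟨by simp only [map_smul, map_add, h.Φ_Φ_perp]; module,
      by simp only [map_smul, map_sub, h.Φ_Φ_perp]; module⟩
  have key : ∀ φ : PForm V, cliffC ((1 / 2 : ℝ) • (Q.perp a.1 + Q.Φ (Q.perp b.1)))
      ((1 / 2 : ℝ) • (Q.perp b.1 - Q.Φ (Q.perp a.1))) φ = 0 →
      cliffC (Q.canonRe a b).1 (Q.canonIm a b).1 φ = cliffC (Q.perp a.1) (Q.perp b.1) φ := by
    intro φ hφ
    rw [← add_zero (cliffC (Q.canonRe a b).1 (Q.canonIm a b).1 φ), ← hφ, ← cliffC_vadd]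
    congr 1
    · simp only [canonRe]; module
    · simp only [canonIm]; module
  refine Prod.ext ?_ ?_
  · rw [cliffPairC_fst, cliffPairC_fst, key _ hev.1, h.cliffC_perp, hp.e₂_fst, hp.cliff_e₁_fst]
    simp only [canonRe, canonIm, smul_smul, pform_smul_zero, sub_zero]
    rw [sub_add, ← pform_sub_smul]
    have : (2 * ((inGT a.1 Q.e₂ : ℂ) + Complex.I * inGT b.1 Q.e₂) *
        ((1 + Complex.I * Q.lam) / Q.mu) -
        (((a.2.1 + 2 * (inGT a.1 Q.e₂ - Q.lam * inGT b.1 Q.e₂) / Q.mu : ℝ) : ℂ) +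
        Complex.I * (b.2.1 + 2 * (inGT b.1 Q.e₂ + Q.lam * inGT a.1 Q.e₂) / Q.mu : ℝ))) =
        -((a.2.1 : ℂ) + Complex.I * b.2.1) := by
      push_cast
      field_simp
      ring_nf
      rw [Complex.I_sq]
      ring
    rw [this, pform_neg_smul, sub_neg_eq_add]
  · rw [cliffPairC_snd, cliffPairC_snd, key _ hev.2, h.cliffC_perp, hp.e₁_snd, hp.cliff_e₂_snd]
    simp only [canonRe, canonIm, smul_smul, pform_smul_zero, sub_zero]
    rw [← sub_add, add_comm, ← add_sub_assoc, ← pform_add_smul]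
    congr 2
    push_cast
    field_simp
    ring_nf
    rw [Complex.I_sq]
    ring

omit [FiniteDimensional ℝ V] in
theorem IsSekiya.canon_eq_zero (h : Q.IsSekiya) {p : PForm V × PForm V} (hp : Q.IsMixedPair p)
    {a b : CE V} (hab : cliffPairC a b p = 0) : Q.canonRe a b = 0 ∧ Q.canonIm a b = 0 := by
  have hmu : (Q.mu : ℂ) ≠ 0 := by exact_mod_cast Q.mu_pos.ne'
  have hmu2 : (Q.mu : ℂ) * Q.mu = 1 + (Q.lam : ℂ) ^ 2 := by exact_mod_cast Q.mu_sq
  have h1 : cliffC a.1 b.1 p.1 = -(((a.2.1 : ℂ) + Complex.I * b.2.1) • p.2) := by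
    have := congrArg Prod.fst hab
    rw [cliffPairC_fst] at this
    exact eq_neg_of_add_eq_zero_left this
  have h2 : cliffC a.1 b.1 p.2 = ((a.2.2 : ℂ) + Complex.I * b.2.2) • p.1 := by
    have := congrArg Prod.snd hab
    rw [cliffPairC_snd] at this
    exact (sub_eq_zero.1 this).symm
  set s : ℂ := 2 * ((inGT a.1 Q.e₂ : ℂ) + Complex.I * inGT b.1 Q.e₂) with hs
  set r : ℂ := 2 * ((inGT a.1 Q.e₁ : ℂ) + Complex.I * inGT b.1 Q.e₁) with hr
  -- the scalar components
  have hf : ((a.2.1 : ℂ) + Complex.I * b.2.1) + s * ((1 + Complex.I * Q.lam) / Q.mu) = 0 := by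
    have h3 := cliffC_cliffC_add p.1 a.1 b.1 Q.e₂ 0
    rw [cliffC_real, hp.e₂_fst, cliffC_zero_right, h1, cliffC_real, cliff_neg, cliff_smul,
      hp.cliff_e₂_snd, zero_add, ← pform_neg_smul, smul_smul, ← sub_eq_zero, ← pform_sub_smul] at h3
    have h4 := (pform_smul_eq_zero.1 h3).resolve_right hp.fst_ne_zero
    have h5 : (2 * ((inGT a.1 Q.e₂ - inGT b.1 0 : ℝ) + Complex.I * (inGT a.1 0 + inGT b.1 Q.e₂ : ℝ))
        : ℂ) = s := by simp [inGT, hs]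
    rw [h5] at h4
    have h6 : (1 - Complex.I * Q.lam : ℂ) * (1 + Complex.I * Q.lam) = Q.mu * Q.mu := by
      rw [hmu2]; ring_nf; rw [Complex.I_sq]; ring
    have h7 : s = -(((a.2.1 : ℂ) + Complex.I * b.2.1) * ((1 - Complex.I * Q.lam) / Q.mu)) := by
      linear_combination -h4
    rw [h7]
    field_simp
    linear_combination -((a.2.1 : ℂ) + Complex.I * b.2.1) * h6
  have hg : ((a.2.2 : ℂ) + Complex.I * b.2.2) - r * ((1 - Complex.I * Q.lam) / Q.mu) = 0 := by
    have h3 := cliffC_cliffC_add p.2 a.1 b.1 Q.e₁ 0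
    rw [cliffC_real, hp.e₁_snd, cliffC_zero_right, h2, cliffC_real, cliff_smul,
      hp.cliff_e₁_fst, zero_add, smul_smul, ← sub_eq_zero, ← pform_sub_smul] at h3
    have h4 := (pform_smul_eq_zero.1 h3).resolve_right hp.snd_ne_zero
    have h5 : (2 * ((inGT a.1 Q.e₁ - inGT b.1 0 : ℝ) + Complex.I * (inGT a.1 0 + inGT b.1 Q.e₁ : ℝ))
        : ℂ) = r := by simp [inGT, hr]
    rw [h5] at h4
    have h6 : (1 - Complex.I * Q.lam : ℂ) * (1 + Complex.I * Q.lam) = Q.mu * Q.mu := by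
      rw [hmu2]; ring_nf; rw [Complex.I_sq]; ring
    have h7 : r = ((a.2.2 : ℂ) + Complex.I * b.2.2) * ((1 + Complex.I * Q.lam) / Q.mu) := by
      linear_combination -h4
    rw [h7]
    field_simp
    linear_combination -((a.2.2 : ℂ) + Complex.I * b.2.2) * h6
  have hperp := (hp.eigenspace (Q.perp a.1) (Q.perp b.1)).2 ⟨by
    rw [h.cliffC_perp, hp.e₂_fst, hp.cliff_e₁_fst, h1, smul_smul, pform_smul_zero, sub_zero,
      ← pform_neg_smul, ← pform_sub_smul]
    rw [pform_smul_eq_zero]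
    left
    linear_combination -hf, by
    rw [h.cliffC_perp, hp.e₁_snd, hp.cliff_e₂_snd, h2, smul_smul, pform_smul_zero, sub_zero,
      ← pform_sub_smul, pform_smul_eq_zero]
    left
    exact hg⟩
  have hf1 := congrArg Complex.re hf
  have hf2 := congrArg Complex.im hf
  have hg1 := congrArg Complex.re hg
  have hg2 := congrArg Complex.im hg
  simp [hs, hr, Complex.div_re, Complex.div_im] at hf1 hf2 hg1 hg2
  have hmr : Q.mu ≠ 0 := Q.mu_pos.ne'
  field_simp at hf1 hf2 hg1 hg2
  constructor
  · refine Prod.ext ?_ (Prod.ext ?_ ?_)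
    · show (1 / 2 : ℝ) • (Q.perp a.1 - Q.Φ (Q.perp b.1)) = 0
      rw [hperp.2, sub_self, smul_zero]
    · simp only [canonRe, Prod.snd_zero, Prod.fst_zero]
      field_simp
      linear_combination hf1
    · simp only [canonRe, Prod.snd_zero]
      field_simp
      linear_combination hg1
  · refine Prod.ext ?_ (Prod.ext ?_ ?_)
    · show (1 / 2 : ℝ) • (Q.perp b.1 + Q.Φ (Q.perp a.1)) = 0
      rw [hperp.1, add_neg_cancel, smul_zero]
    · simp only [canonIm, Prod.snd_zero, Prod.fst_zero]
      field_simp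
      linear_combination hf2
    · simp only [canonIm, Prod.snd_zero]
      field_simp
      linear_combination hg2

end Canonical

end PointQuadruple

/-! ### Products of reflections -/

section Reflections

/-- The Clifford product `v_{k-1} ⋯ v_0`, acting on polyforms. -/
def cliffProd : ∀ {k : ℕ}, (Fin k → GT V) → PForm V → PForm V
  | 0, _, φ => φ
  | _ + 1, v, φ => cliffProd (Fin.tail v) (cliff (v 0) φ)

section
variable {k : ℕ} (v : Fin k → GT V) (φ ψ : PForm V) (c : ℂ) (r : ℝ)

@[simp] theorem cliffProd_add : cliffProd v (φ + ψ) = cliffProd v φ + cliffProd v ψ := by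
  induction k generalizing φ ψ with
  | zero => rfl
  | succ k ih => simp only [cliffProd, cliff_add, ih]

@[simp] theorem cliffProd_smul : cliffProd v (c • φ) = c • cliffProd v φ := by
  induction k generalizing φ with
  | zero => rfl
  | succ k ih => simp only [cliffProd, cliff_smul, ih]

@[simp] theorem cliffProd_rsmul : cliffProd v (r • φ) = r • cliffProd v φ := by
  rw [rsmul_eq_smul, cliffProd_smul, ← rsmul_eq_smul]

@[simp] theorem cliffProd_neg : cliffProd v (-φ) = -cliffProd v φ := by
  rw [← pform_neg_one_smul φ, cliffProd_smul, pform_neg_one_smul]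

@[simp] theorem cliffProd_sub : cliffProd v (φ - ψ) = cliffProd v φ - cliffProd v ψ := by
  rw [sub_eq_add_neg, cliffProd_add, cliffProd_neg, sub_eq_add_neg]

@[simp] theorem cliffProd_zero : cliffProd v (0 : PForm V) = 0 := by
  have := cliffProd_smul v (0 : PForm V) 0
  rwa [pform_zero_smul, pform_zero_smul] at this

@[simp] theorem cliffProd_sum {ι : Type*} (s : Finset ι) (f : ι → PForm V) :
    cliffProd v (∑ i ∈ s, f i) = ∑ i ∈ s, cliffProd v (f i) := by
  classical
  induction s using Finset.induction_on with
  | empty => simp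
  | insert a s ha ih => rw [Finset.sum_insert ha, Finset.sum_insert ha, cliffProd_add, ih]

theorem conj_cliffProd : conj (cliffProd v φ) = cliffProd v (conj φ) := by
  induction k generalizing φ with
  | zero => rfl
  | succ k ih => simp only [cliffProd, ih, conj_cliff]

theorem gradeInv_cliff (w : GT V) : gradeInv (cliff w φ) = -cliff w (gradeInv φ) := by
  have h : gradeInv (iota w.1 φ) = -iota w.1 (gradeInv φ) := by rw [iota_gradeInv, neg_neg]
  simp only [cliff, gradeInv_add, gradeInv_wedge, gradeInv_ofCovector, h, wedge_neg_left, neg_add]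

theorem gradeInv_cliffProd :
    gradeInv (cliffProd v φ) = ((-1 : ℝ) ^ k) • cliffProd v (gradeInv φ) := by
  induction k generalizing φ with
  | zero => simp [cliffProd]
  | succ k ih =>
    simp only [cliffProd, ih, gradeInv_cliff, cliffProd_neg, pow_succ]
    module

theorem cliffProd_pull (f : V ≃L[ℝ] W) (φ : PForm W) :
    cliffProd v (pull (f : V →L[ℝ] W) φ) =
      pull (f : V →L[ℝ] W) (cliffProd (fun i => gtMap f (v i)) φ) := by
  induction k generalizing φ with
  | zero => rfl
  | succ k ih => simp only [cliffProd, cliff_pull, ih]; rfl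

end

/-- The family `v` is orthogonal and consists of vectors of square `-1`. -/
def NegOrthonormal {k : ℕ} (v : Fin k → GT V) : Prop :=
  ∀ i j, inGT (v i) (v j) = if i = j then -1 else 0

theorem NegOrthonormal.tail {k : ℕ} {v : Fin (k + 1) → GT V} (h : NegOrthonormal v) :
    NegOrthonormal (Fin.tail v) := fun i j => by
  simp only [Fin.tail, h i.succ j.succ, Fin.succ_inj]

/-- The product of the commuting reflections in the vectors of a `NegOrthonormal` family. -/
def reflect {k : ℕ} (v : Fin k → GT V) : GT V →ₗ[ℝ] GT V where
  toFun w := w + ∑ i, (2 * inGT w (v i)) • v i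
  map_add' a b := by
    simp only [inGT_add_left, mul_add, add_smul, Finset.sum_add_distrib]; abel
  map_smul' r a := by
    simp only [inGT_smul_left, smul_add, Finset.smul_sum, smul_smul, RingHom.id_apply]
    congr 1
    exact Finset.sum_congr rfl fun i _ => by congr 1; ring

theorem reflect_apply {k : ℕ} (v : Fin k → GT V) (w : GT V) :
    reflect v w = w + ∑ i, (2 * inGT w (v i)) • v i := rfl

theorem inGT_sum_left {ι : Type*} (s : Finset ι) (f : ι → GT V) (w : GT V) :
    inGT (∑ i ∈ s, f i) w = ∑ i ∈ s, inGT (f i) w := by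
  classical
  induction s using Finset.induction_on with
  | empty => simp [inGT]
  | insert a s ha ih => rw [Finset.sum_insert ha, Finset.sum_insert ha, inGT_add_left, ih]

section
variable {k : ℕ} {v : Fin k → GT V} (h : NegOrthonormal v)
include h

theorem NegOrthonormal.inGT_reflect (w : GT V) (j : Fin k) :
    inGT (reflect v w) (v j) = -inGT w (v j) := by
  rw [reflect_apply, inGT_add_left, inGT_sum_left]
  simp only [inGT_smul_left, h _ j, mul_ite, mul_zero]
  simp
  ring

theorem NegOrthonormal.reflect_reflect (w : GT V) : reflect v (reflect v w) = w := by
  rw [reflect_apply v (reflect v w)]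
  simp only [h.inGT_reflect]
  rw [reflect_apply, add_assoc, ← Finset.sum_add_distrib]
  conv_rhs => rw [← add_zero w]
  congr 1
  refine Finset.sum_eq_zero fun i _ => ?_
  module

theorem NegOrthonormal.inGT_reflect_reflect (w u : GT V) :
    inGT (reflect v w) (reflect v u) = inGT w u := by
  rw [reflect_apply v u, inGT_comm, inGT_add_left, inGT_sum_left, inGT_comm u, reflect_apply v w,
    inGT_add_left, inGT_sum_left, add_assoc, ← Finset.sum_add_distrib]
  conv_rhs => rw [← add_zero (inGT w u)]
  congr 1
  refine Finset.sum_eq_zero fun i _ => ?_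
  rw [← reflect_apply, inGT_smul_left, inGT_smul_left, inGT_comm (v i) (reflect v w),
    h.inGT_reflect, inGT_comm (v i) u]
  ring

theorem NegOrthonormal.inGT_reflect_left (w u : GT V) :
    inGT (reflect v w) u = inGT w (reflect v u) := by
  rw [← h.inGT_reflect_reflect w (reflect v u), h.reflect_reflect]

theorem NegOrthonormal.cliffProd_cliff (w : GT V) (φ : PForm V) :
    cliffProd v (cliff w φ) = ((-1 : ℝ) ^ k) • cliff (reflect v w) (cliffProd v φ) := by
  induction k generalizing φ w with
  | zero =>
    have : reflect v w = w := by simp [reflect_apply]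
    simp [cliffProd, this]
  | succ k ih =>
    have h00 : inGT (v 0) (v 0) = -1 := by simpa using h 0 0
    have h1 : cliff (v 0) (cliff w φ) = -cliff (w + (2 * inGT w (v 0)) • v 0) (cliff (v 0) φ) := by
      have h2 := cliff_cliff_add (v 0) w φ
      rw [cliff_vadd, cliff_vsmul, cliff_cliff_self, h00, eq_sub_of_add_eq h2, inGT_comm (v 0) w]
      module
    have h3 : reflect (Fin.tail v) (w + (2 * inGT w (v 0)) • v 0) = reflect v w := by
      rw [reflect_apply, reflect_apply, Fin.sum_univ_succ, add_assoc]
      congr 2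
      refine Finset.sum_congr rfl fun i _ => ?_
      have : inGT (v 0) (v i.succ) = 0 := by rw [h, if_neg (Fin.succ_ne_zero i).symm]
      simp only [Fin.tail, inGT_add_left, inGT_smul_left, this, mul_zero, add_zero]
    rw [cliffProd, h1, cliffProd_neg, ih h.tail, h3, cliffProd, pow_succ]
    module

theorem NegOrthonormal.cliffProd_injective : Function.Injective (cliffProd v) := by
  induction k with
  | zero => exact fun _ _ h => h
  | succ k ih =>
    intro φ ψ hφ
    have h00 : inGT (v 0) (v 0) = -1 := by simpa using h 0 0
    have := congrArg (cliff (v 0)) (ih h.tail hφ)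
    rwa [cliff_cliff_self, cliff_cliff_self, h00, pform_neg_one_rsmul, pform_neg_one_rsmul,
      neg_inj] at this

theorem NegOrthonormal.mukai_cliffProd {n : ℕ} (hn : ∀ a : V [⋀^Fin (n + 1)]→L[ℝ] ℂ, a = 0)
    (a b : PForm V) : mukai (cliffProd v a) (cliffProd v b) n = mukai a b n := by
  induction k generalizing a b with
  | zero => rfl
  | succ k ih =>
    have h00 : inGT (v 0) (v 0) = -1 := by simpa using h 0 0
    rw [cliffProd, cliffProd, ih h.tail, mukai_cliff_left _ hn, cliff_cliff_self, h00,
      pform_neg_one_rsmul, mukai_neg_right, Pi.neg_apply, neg_neg]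

end

theorem inGT_gtMap_gtMap (f : V ≃L[ℝ] W) (a b : GT V) : inGT (gtMap f a) (gtMap f b) = inGT a b := by
  simp [inGT, gtMap]

theorem gtMap_reflect {k : ℕ} (v : Fin k → GT V) (f : V ≃L[ℝ] W) (w : GT V) :
    gtMap f (reflect v w) = reflect (fun i => gtMap f (v i)) (gtMap f w) := by
  have hs : ∀ (s : Finset (Fin k)) (g : Fin k → GT V),
      gtMap f (∑ i ∈ s, g i) = ∑ i ∈ s, gtMap f (g i) := by
    classical
    intro s g
    induction s using Finset.induction_on with
    | empty => simp [gtMap]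
    | insert a s ha ih => rw [Finset.sum_insert ha, Finset.sum_insert ha, gtMap_add, ih]
  simp only [reflect_apply, gtMap_add, hs, gtMap_smul, inGT_gtMap_gtMap]

/-- `gtMap` as a linear equivalence. -/
def gtEquiv (f : V ≃L[ℝ] W) : GT V ≃ₗ[ℝ] GT W where
  toFun := gtMap f
  invFun := gtMap f.symm
  map_add' a b := gtMap_add a b f
  map_smul' r a := gtMap_smul a r f
  left_inv a := gtMap_symm_gtMap a f
  right_inv a := gtMap_symm_gtMap a f.symm

end Reflections

/-! ### Duality of pairs and quadruples at a point -/

section PointDual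

variable {k : ℕ}

/-- The pullback of a pair of polyforms. -/
def pullPair (f : V →L[ℝ] W) (p : PForm W × PForm W) : PForm V × PForm V := (pull f p.1, pull f p.2)

/-- The transform `(φ, ψ) ↦ (i 𝕋 ψ, ε (-1)^k i 𝕋 φ)` of pairs, where `𝕋` is the Clifford product
of the `k` vectors `v`. -/
def dualPair (ε : ℝ) (v : Fin k → GT V) (p : PForm V × PForm V) : PForm V × PForm V :=
  (Complex.I • cliffProd v p.2, (ε * (-1) ^ k * Complex.I) • cliffProd v p.1)

/-- The quadruple `(RΦR, ε R e₂, ε R e₁, -λ)`, where `R` is the product of the reflections in `v`. -/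
def PointQuadruple.dual (ε : ℝ) (v : Fin k → GT V) (Q : PointQuadruple V) : PointQuadruple V :=
  ⟨reflect v ∘ₗ Q.Φ ∘ₗ reflect v, ε • reflect v Q.e₂, ε • reflect v Q.e₁, -Q.lam⟩

/-- Transport of a quadruple along a linear isomorphism. -/
def PointQuadruple.map (f : V ≃L[ℝ] W) (Q : PointQuadruple V) : PointQuadruple W :=
  ⟨(gtEquiv f : GT V →ₗ[ℝ] GT W) ∘ₗ Q.Φ ∘ₗ (gtEquiv f.symm : GT W →ₗ[ℝ] GT V),
    gtMap f Q.e₁, gtMap f Q.e₂, Q.lam⟩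

/-- The endomorphism of `V ⊕ ℝ ⊕ ℝ ⊕ V*` associated with a quadruple. -/
def PointQuadruple.J (Q : PointQuadruple V) (a : CE V) : CE V :=
  (Q.Φ a.1 + (Q.mu * a.2.1) • Q.e₁ + (Q.mu * a.2.2) • Q.e₂,
    -2 * Q.mu * inGT Q.e₂ a.1 - Q.lam * a.2.1,
    -2 * Q.mu * inGT Q.e₁ a.1 + Q.lam * a.2.2)

/-- The isometry `(w, f, g) ↦ (R w, ε g, ε f)` of `V ⊕ ℝ ⊕ ℝ ⊕ V*`. -/
def reflectCE (ε : ℝ) (v : Fin k → GT V) (a : CE V) : CE V :=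
  (reflect v a.1, ε * a.2.2, ε * a.2.1)

/-- Transport of `V ⊕ ℝ ⊕ ℝ ⊕ V*` along a linear isomorphism. -/
def ceMap (f : V ≃L[ℝ] W) (a : CE V) : CE W := (gtMap f a.1, a.2)

theorem cliffC_pull (f : V ≃L[ℝ] W) (a b : GT V) (φ : PForm W) :
    cliffC a b (pull (f : V →L[ℝ] W) φ) =
      pull (f : V →L[ℝ] W) (cliffC (gtMap f a) (gtMap f b) φ) := by
  simp only [cliffC, cliff_pull, pull_add, pull_smul]

theorem cliffPair_pullPair (f : V ≃L[ℝ] W) (a : CE V) (p : PForm W × PForm W) :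
    cliffPair a (pullPair (f : V →L[ℝ] W) p) =
      pullPair (f : V →L[ℝ] W) (cliffPair (ceMap f a) p) := by
  simp only [cliffPair, pullPair, cliff_pull, ceMap, pull_add, pull_sub, pull_rsmul]

theorem conjPair_pullPair (f : V →L[ℝ] W) (p : PForm W × PForm W) :
    conjPair (pullPair f p) = pullPair f (conjPair p) := by
  simp only [conjPair, pullPair, conj_pull, pull_neg]

theorem pull_eq_zero_iff (f : V ≃L[ℝ] W) (φ : PForm W) : pull (f : V →L[ℝ] W) φ = 0 ↔ φ = 0 :=
  ⟨fun h => pull_injective_of_surjective f.surjective (by rw [h]; rfl), fun h => by rw [h]; rfl⟩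

theorem pairing_pullPair (f : V ≃L[ℝ] W) (p q : PForm W × PForm W) :
    pairing (pullPair (f : V →L[ℝ] W) p) (pullPair (f : V →L[ℝ] W) q) =
      (pull (f : V →L[ℝ] W) (mukai p.1 q.2 + mukai p.2 q.1)) (Module.finrank ℝ V) := by
  simp only [pairing_eq, pullPair, ← pull_mukai, ← pull_add]

theorem pull_apply_eq_zero_iff (f : V ≃L[ℝ] W) (φ : PForm W) (n : ℕ) :
    pull (f : V →L[ℝ] W) φ n = 0 ↔ φ n = 0 := by
  refine ⟨fun h => ?_, fun h => ?_⟩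
  · ext u
    have := congrArg (fun a : V [⋀^Fin n]→L[ℝ] ℂ => a (f.symm ∘ u)) h
    simpa [pull_apply, Function.comp_def] using this
  · ext u; simp [pull_apply, h]

theorem PointQuadruple.dual_mu (ε : ℝ) (v : Fin k → GT V) (Q : PointQuadruple V) :
    (Q.dual ε v).mu = Q.mu := by
  simp [PointQuadruple.mu, PointQuadruple.dual]

theorem PointQuadruple.map_Φ_gtMap (f : V ≃L[ℝ] W) (Q : PointQuadruple V) (w : GT V) :
    (Q.map f).Φ (gtMap f w) = gtMap f (Q.Φ w) := by
  show gtMap f (Q.Φ (gtMap f.symm (gtMap f w))) = _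
  rw [gtMap_symm_gtMap]

theorem exists_gtMap_eq (f : V ≃L[ℝ] W) (w : GT W) : ∃ u, gtMap f u = w :=
  (gtEquiv f).surjective w

theorem gtMap_injective (f : V ≃L[ℝ] W) : Function.Injective (gtMap f) := (gtEquiv f).injective

theorem PointQuadruple.IsSekiya.map {Q : PointQuadruple V} (h : Q.IsSekiya) (f : V ≃L[ℝ] W) :
    (Q.map f).IsSekiya where
  e₁_e₁ := (inGT_gtMap_gtMap f _ _).trans h.e₁_e₁
  e₂_e₂ := (inGT_gtMap_gtMap f _ _).trans h.e₂_e₂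
  e₁_e₂ := (inGT_gtMap_gtMap f _ _).trans h.e₁_e₂
  skew v w := by
    obtain ⟨v, rfl⟩ := exists_gtMap_eq f v
    obtain ⟨w, rfl⟩ := exists_gtMap_eq f w
    rw [map_Φ_gtMap, map_Φ_gtMap, inGT_gtMap_gtMap, inGT_gtMap_gtMap, h.skew]
  Φ_e₁ := by
    show (Q.map f).Φ (gtMap f Q.e₁) = Q.lam • gtMap f Q.e₁
    rw [map_Φ_gtMap, h.Φ_e₁, gtMap_smul]
  Φ_e₂ := by
    show (Q.map f).Φ (gtMap f Q.e₂) = -Q.lam • gtMap f Q.e₂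
    rw [map_Φ_gtMap, h.Φ_e₂, gtMap_smul]
  Φ_sq v := by
    obtain ⟨v, rfl⟩ := exists_gtMap_eq f v
    rw [map_Φ_gtMap, map_Φ_gtMap, h.Φ_sq]
    show _ = -gtMap f v + (2 * (1 + Q.lam ^ 2)) • (inGT (gtMap f v) (gtMap f Q.e₂) • gtMap f Q.e₁ +
      inGT (gtMap f v) (gtMap f Q.e₁) • gtMap f Q.e₂)
    simp only [inGT_gtMap_gtMap, gtMap_add, gtMap_neg, gtMap_smul]

theorem PointQuadruple.IsMixedPair.of_map {Q : PointQuadruple V} (f : V ≃L[ℝ] W)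
    {p : PForm W × PForm W} (h : (Q.map f).IsMixedPair p) :
    Q.IsMixedPair (pullPair (f : V →L[ℝ] W) p) where
  nondegenerate := by
    rw [conjPair_pullPair, pairing_pullPair, Ne, pull_apply_eq_zero_iff,
      f.toLinearEquiv.finrank_eq]
    exact h.nondegenerate
  e₁_snd := by
    show cliff Q.e₁ (pull (f : V →L[ℝ] W) p.2) = 0
    rw [cliff_pull, pull_eq_zero_iff]; exact h.e₁_snd
  e₁_fst := by
    show Q.mu • cliff Q.e₁ (pull (f : V →L[ℝ] W) p.1) = _ • pull (f : V →L[ℝ] W) p.2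
    rw [cliff_pull, ← pull_smul, ← pull_rsmul]
    exact congrArg _ h.e₁_fst
  e₂_fst := by
    show cliff Q.e₂ (pull (f : V →L[ℝ] W) p.1) = 0
    rw [cliff_pull, pull_eq_zero_iff]; exact h.e₂_fst
  e₂_snd := by
    show Q.mu • cliff Q.e₂ (pull (f : V →L[ℝ] W) p.2) = _ • pull (f : V →L[ℝ] W) p.1
    rw [cliff_pull, ← pull_smul, ← pull_rsmul]
    exact congrArg _ h.e₂_snd
  eigenspace a b := by
    show _ ↔ cliffC a b (pull (f : V →L[ℝ] W) p.1) = 0 ∧ cliffC a b (pull (f : V →L[ℝ] W) p.2) = 0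
    rw [cliffC_pull, cliffC_pull, pull_eq_zero_iff, pull_eq_zero_iff, ← h.eigenspace, map_Φ_gtMap,
      map_Φ_gtMap, ← gtMap_neg, (gtMap_injective f).eq_iff, (gtMap_injective f).eq_iff]

theorem PointQuadruple.map_map_symm (f : V ≃L[ℝ] W) (Q : PointQuadruple V) :
    (Q.map f).map f.symm = Q := by
  have h : ∀ w, gtMap f.symm (gtMap f w) = w := fun w => gtMap_symm_gtMap w f
  obtain ⟨Φ, e₁, e₂, lam⟩ := Q
  simp only [PointQuadruple.map, PointQuadruple.mk.injEq, h, and_self, and_true]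
  refine LinearMap.ext fun w => ?_
  show gtMap f.symm (gtMap f (Φ (gtMap f.symm (gtMap f w)))) = Φ w
  rw [h, h]

theorem PointQuadruple.IsMixedPair.map {Q : PointQuadruple V} (f : V ≃L[ℝ] W)
    {p : PForm V × PForm V} (h : Q.IsMixedPair p) :
    (Q.map f).IsMixedPair (pullPair (f.symm : W →L[ℝ] V) p) :=
  IsMixedPair.of_map f.symm (by rwa [map_map_symm])

theorem PointQuadruple.J_map (f : V ≃L[ℝ] W) (Q : PointQuadruple V) (a : CE V) :
    (Q.map f).J (ceMap f a) = ceMap f (Q.J a) := by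
  refine Prod.ext ?_ (Prod.ext ?_ ?_)
  · show (Q.map f).Φ (gtMap f a.1) + (Q.mu * a.2.1) • gtMap f Q.e₁ + (Q.mu * a.2.2) • gtMap f Q.e₂ =
      gtMap f (Q.Φ a.1 + (Q.mu * a.2.1) • Q.e₁ + (Q.mu * a.2.2) • Q.e₂)
    rw [map_Φ_gtMap, gtMap_add, gtMap_add, gtMap_smul, gtMap_smul]
  · show -2 * Q.mu * inGT (gtMap f Q.e₂) (gtMap f a.1) - Q.lam * a.2.1 =
      -2 * Q.mu * inGT Q.e₂ a.1 - Q.lam * a.2.1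
    rw [inGT_gtMap_gtMap]
  · show -2 * Q.mu * inGT (gtMap f Q.e₁) (gtMap f a.1) + Q.lam * a.2.2 =
      -2 * Q.mu * inGT Q.e₁ a.1 + Q.lam * a.2.2
    rw [inGT_gtMap_gtMap]

theorem inCE_ceMap (f : V ≃L[ℝ] W) (a b : CE V) : inCE (ceMap f a) (ceMap f b) = inCE a b := by
  simp only [inCE, ceMap, inGT_gtMap_gtMap]

section
variable {v : Fin k → GT V} (hv : NegOrthonormal v) {ε : ℝ} (hε : ε * ε = 1)
include hv

theorem NegOrthonormal.cliff_reflect_cliffProd (w : GT V) (φ : PForm V) :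
    cliff (reflect v w) (cliffProd v φ) = ((-1 : ℝ) ^ k) • cliffProd v (cliff w φ) := by
  rw [hv.cliffProd_cliff, smul_smul, ← mul_pow]
  simp

theorem NegOrthonormal.cliffC_reflect_cliffProd (a b : GT V) (φ : PForm V) :
    cliffC (reflect v a) (reflect v b) (cliffProd v φ) =
      ((-1 : ℝ) ^ k) • cliffProd v (cliffC a b φ) := by
  simp only [cliffC, hv.cliff_reflect_cliffProd, cliffProd_add, cliffProd_smul, smul_add]
  rw [smul_comm]

include hε

theorem PointQuadruple.J_dual (Q : PointQuadruple V) (a : CE V) :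
    (Q.dual ε v).J (reflectCE ε v a) = reflectCE ε v (Q.J a) := by
  refine Prod.ext ?_ (Prod.ext ?_ ?_)
  · simp only [J, dual_mu, reflectCE]
    simp only [dual, LinearMap.comp_apply, hv.reflect_reflect, map_add, map_smul, smul_smul]
    rw [show Q.mu * (ε * a.2.2) * ε = Q.mu * a.2.2 by linear_combination Q.mu * a.2.2 * hε,
      show Q.mu * (ε * a.2.1) * ε = Q.mu * a.2.1 by linear_combination Q.mu * a.2.1 * hε]
    abel
  · simp only [J, dual_mu, reflectCE]
    simp only [dual, inGT_smul_left, hv.inGT_reflect_reflect]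
    ring
  · simp only [J, dual_mu, reflectCE]
    simp only [dual, inGT_smul_left, hv.inGT_reflect_reflect]
    ring

theorem inCE_reflectCE (a b : CE V) : inCE (reflectCE ε v a) (reflectCE ε v b) = inCE a b := by
  simp only [inCE, reflectCE, hv.inGT_reflect_reflect]
  linear_combination (a.2.1 * b.2.2 + a.2.2 * b.2.1) / 2 * hε

theorem reflectCE_reflectCE (a : CE V) : reflectCE ε v (reflectCE ε v a) = a := by
  refine Prod.ext (hv.reflect_reflect _) (Prod.ext ?_ ?_)
  · show ε * (ε * a.2.1) = a.2.1
    linear_combination a.2.1 * hε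
  · show ε * (ε * a.2.2) = a.2.2
    linear_combination a.2.2 * hε

theorem PointQuadruple.IsSekiya.dual {Q : PointQuadruple V} (h : Q.IsSekiya) :
    (Q.dual ε v).IsSekiya where
  e₁_e₁ := by
    simp only [PointQuadruple.dual, inGT_smul_left, inGT_smul_right, hv.inGT_reflect_reflect,
      h.e₂_e₂, mul_zero]
  e₂_e₂ := by
    simp only [PointQuadruple.dual, inGT_smul_left, inGT_smul_right, hv.inGT_reflect_reflect,
      h.e₁_e₁, mul_zero]
  e₁_e₂ := by
    simp only [PointQuadruple.dual, inGT_smul_left, inGT_smul_right, hv.inGT_reflect_reflect]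
    rw [inGT_comm, h.e₁_e₂]; linear_combination hε / 2
  skew a b := by
    simp only [PointQuadruple.dual, LinearMap.comp_apply]
    rw [hv.inGT_reflect_left, h.skew, hv.inGT_reflect_left]
  Φ_e₁ := by
    simp only [PointQuadruple.dual, LinearMap.comp_apply, map_smul, hv.reflect_reflect, h.Φ_e₂]
    rw [smul_comm]
  Φ_e₂ := by
    simp only [PointQuadruple.dual, LinearMap.comp_apply, map_smul, hv.reflect_reflect, h.Φ_e₁,
      neg_neg]
    rw [smul_comm]
  Φ_sq a := by
    simp only [PointQuadruple.dual, LinearMap.comp_apply, hv.reflect_reflect, h.Φ_sq, map_add,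
      map_neg, map_smul, inGT_smul_right, hv.inGT_reflect_left, smul_smul]
    rw [show ε * inGT a ((reflect v) Q.e₁) * ε = inGT a ((reflect v) Q.e₁) by
        linear_combination inGT a ((reflect v) Q.e₁) * hε,
      show ε * inGT a ((reflect v) Q.e₂) * ε = inGT a ((reflect v) Q.e₂) by
        linear_combination inGT a ((reflect v) Q.e₂) * hε]
    rw [neg_sq, add_comm (inGT a ((reflect v) Q.e₁) • _)]

omit hv hε in
theorem dualPair_conjPair (v : Fin k → GT V) (ε : ℝ) (p : PForm V × PForm V) :
    dualPair ε v (conjPair p) = conjPair (dualPair ε v p) := by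
  refine Prod.ext ?_ ?_
  · simp only [dualPair, conjPair, cliffProd_neg, conj_smul, conj_cliffProd, Complex.conj_I]
    module
  · simp only [dualPair, conjPair, conj_smul, conj_cliffProd, map_mul, map_pow, map_neg, map_one,
      Complex.conj_ofReal, Complex.conj_I]
    module

omit hε in
theorem pairing_dualPair [FiniteDimensional ℝ V] (p q : PForm V × PForm V) :
    pairing (dualPair ε v p) (dualPair ε v q) = (-ε * (-1) ^ k) • pairing p q := by
  have hn : ∀ a : V [⋀^Fin (Module.finrank ℝ V + 1)]→L[ℝ] ℂ, a = 0 :=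
    form_eq_zero_of_finrank_lt (by omega)
  simp only [pairing_eq, dualPair, mukai_smul_left, mukai_smul_right, Pi.add_apply, Pi.smul_apply,
    hv.mukai_cliffProd hn]
  ext u
  simp only [ContinuousAlternatingMap.add_apply, ContinuousAlternatingMap.smul_apply, smul_eq_mul,
    Complex.real_smul]
  push_cast
  ring_nf
  rw [Complex.I_sq]
  ring

theorem PointQuadruple.IsMixedPair.dual [FiniteDimensional ℝ V] {Q : PointQuadruple V}
    {p : PForm V × PForm V} (h : Q.IsMixedPair p) : (Q.dual ε v).IsMixedPair (dualPair ε v p) := by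
  have hεc : (ε : ℂ) * ε = 1 := by exact_mod_cast hε
  have hε0 : (ε : ℂ) ≠ 0 := left_ne_zero_of_mul_eq_one hεc
  have h1 : ((-1 : ℂ) ^ k) * (-1) ^ k = 1 := by rw [← mul_pow]; simp
  refine ⟨?_, ?_, ?_, ?_, ?_, fun a b => ?_⟩
  · rw [← dualPair_conjPair, pairing_dualPair hv]
    have : (-ε * (-1) ^ k) ≠ 0 :=
      mul_ne_zero (neg_ne_zero.2 (left_ne_zero_of_mul_eq_one hε)) (by simp)
    intro h0
    refine h.nondegenerate ?_
    exact (smul_eq_zero.1 h0).resolve_left this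
  · simp only [PointQuadruple.dual, dualPair, cliff_vsmul, cliff_smul, hv.cliff_reflect_cliffProd,
      h.e₂_fst, cliffProd_zero, pform_smul_zero, pform_rsmul_zero]
  · rw [dual_mu]
    simp only [PointQuadruple.dual, dualPair, cliff_vsmul, cliff_smul, hv.cliff_reflect_cliffProd]
    have := congrArg (cliffProd v) h.e₂_snd
    rw [cliffProd_rsmul, cliffProd_smul] at this
    simp only [rsmul_eq_smul, smul_smul] at this ⊢
    rw [show (Q.mu * (Complex.I * (ε * ((-1 : ℝ) ^ k : ℝ))) : ℂ) = (ε * (Complex.I * ((-1) ^ k))) * Q.mu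
      by push_cast; ring, ← smul_smul, this, smul_smul]
    congr 1
    push_cast; ring
  · simp only [PointQuadruple.dual, dualPair, cliff_vsmul, cliff_smul, hv.cliff_reflect_cliffProd,
      h.e₁_snd, cliffProd_zero, pform_smul_zero, pform_rsmul_zero]
  · rw [dual_mu]
    simp only [PointQuadruple.dual, dualPair, cliff_vsmul, cliff_smul, hv.cliff_reflect_cliffProd]
    have := congrArg (cliffProd v) h.e₁_fst
    rw [cliffProd_rsmul, cliffProd_smul] at this
    simp only [rsmul_eq_smul, smul_smul] at this ⊢
    rw [show (Q.mu * (ε * (-1) ^ k * Complex.I * (ε * ((-1 : ℝ) ^ k : ℝ))) : ℂ) =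
      ((ε * ε) * ((-1) ^ k * (-1) ^ k) * Complex.I) * Q.mu
      by push_cast; ring, ← smul_smul, this, smul_smul, hεc, h1]
    congr 1
    push_cast; ring
  · obtain ⟨a, rfl⟩ : ∃ a', reflect v a' = a := ⟨_, hv.reflect_reflect a⟩
    obtain ⟨b, rfl⟩ : ∃ b', reflect v b' = b := ⟨_, hv.reflect_reflect b⟩
    have hinj : Function.Injective (reflect v) := fun x y h => by
      rw [← hv.reflect_reflect x, h, hv.reflect_reflect]
    have hz : ∀ (c : ℂ) (φ : PForm V), c ≠ 0 →
        (cliffC (reflect v a) (reflect v b) (c • cliffProd v φ) = 0 ↔ cliffC a b φ = 0) := by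
      intro c φ hc
      rw [cliffC_smul, hv.cliffC_reflect_cliffProd, rsmul_eq_smul, smul_smul, pform_smul_eq_zero,
        or_iff_right (mul_ne_zero hc (by simp))]
      exact ⟨fun h => hv.cliffProd_injective (h.trans (cliffProd_zero v).symm),
        fun h => by rw [h, cliffProd_zero]⟩
    simp only [PointQuadruple.dual, dualPair, LinearMap.comp_apply, hv.reflect_reflect]
    rw [hz _ _ Complex.I_ne_zero, hz _ _ (mul_ne_zero (mul_ne_zero hε0 (by simp)) Complex.I_ne_zero),
      ← map_neg, hinj.eq_iff, hinj.eq_iff, h.eigenspace, and_comm]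

theorem dualPair_cliffPair (a : CE V) (p : PForm V × PForm V) :
    dualPair ε v (cliffPair a p) = (-(-1 : ℝ) ^ k) •
      cliffPair (reflect v a.1, -ε * a.2.2, -ε * a.2.1) (dualPair ε v p) := by
  have hεc : (ε : ℂ) * ε = 1 := by exact_mod_cast hε
  have h1 : ((-1 : ℂ) ^ k) * (-1) ^ k = 1 := by rw [← mul_pow]; simp
  refine Prod.ext ?_ ?_
  · simp only [dualPair, cliffPair, cliffProd_sub, cliffProd_rsmul, cliff_smul,
      hv.cliff_reflect_cliffProd, Prod.smul_fst]
    simp only [rsmul_eq_smul, smul_smul, smul_sub, smul_add]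
    rw [sub_eq_add_neg, add_comm, ← pform_neg_smul]
    push_cast
    congr 2
    · linear_combination Complex.I * h1
    · linear_combination -(a.2.2 : ℂ) * (-1) ^ k * (-1) ^ k * Complex.I * hεc
        - (a.2.2 : ℂ) * Complex.I * h1
  · simp only [dualPair, cliffPair, cliffProd_add, cliffProd_rsmul, cliff_smul,
      hv.cliff_reflect_cliffProd, Prod.smul_snd]
    simp only [rsmul_eq_smul, smul_smul, smul_sub, smul_add]
    rw [sub_eq_add_neg, add_comm, ← pform_neg_smul]
    push_cast
    congr 2
    · ring
    · linear_combination -(ε : ℂ) * (-1) ^ k * Complex.I * h1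

end

end PointDual

/-! ### The exponential of a two-form -/

section ExpWedge

theorem wedge_apply_eq_zero {F φ : PForm V} {l k : ℕ} (hF0 : F 0 = 0) (hF1 : F 1 = 0)
    (h : ∀ i < l, φ i = 0) (hk : k < l + 2) : wedge F φ k = 0 := by
  rw [wedge_eq_sum]
  refine Finset.sum_eq_zero fun pq hpq => ?_
  have h1 := Finset.HasAntidiagonal.mem_antidiagonal.1 hpq
  have hz1 : ∀ b : V [⋀^Fin pq.2]→L[ℝ] ℂ, wedgeAt pq.1 pq.2 k 0 b = 0 := by
    intro b
    rw [wedgeAt, dif_pos h1]; ext v; simp [wedgeHom_apply]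
  have hz2 : ∀ b : V [⋀^Fin pq.1]→L[ℝ] ℂ, wedgeAt pq.1 pq.2 k b 0 = 0 := by
    intro b
    rw [wedgeAt, dif_pos h1]; ext v; simp [wedgeHom_apply]
  obtain ⟨p, q⟩ := pq
  rcases p with _ | _ | p
  · simp only [hF0]; exact hz1 _
  · simp only [hF1]; exact hz1 _
  · simp only at h1
    simp only [h q (by omega)]; exact hz2 _

variable {F : PForm V}

theorem wedge_iterate_apply_eq_zero (hF0 : F 0 = 0) (hF1 : F 1 = 0) (φ : PForm V) (j k : ℕ)
    (hk : k < 2 * j) : ((wedge F)^[j] φ) k = 0 := by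
  induction j generalizing k with
  | zero => omega
  | succ j ih =>
    rw [Function.iterate_succ_apply']
    exact wedge_apply_eq_zero (l := 2 * j) hF0 hF1 (fun i hi => ih i hi) (by omega)

theorem wedge_iterate_add (φ ψ : PForm V) (j : ℕ) :
    (wedge F)^[j] (φ + ψ) = (wedge F)^[j] φ + (wedge F)^[j] ψ := by
  induction j with
  | zero => rfl
  | succ j ih => simp only [Function.iterate_succ_apply', ih, wedge_add_right]

theorem iota_wedge_iterate (hF : gradeInv F = F) (X : V) (η : V →L[ℝ] ℝ)
    (hη : iota X F = ofCovector η) (φ : PForm V) (j : ℕ) :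
    iota X ((wedge F)^[j + 1] φ) = (wedge F)^[j + 1] (iota X φ) +
      ((j + 1 : ℕ) : ℝ) • (wedge F)^[j] (wedge (ofCovector η) φ) := by
  have hc : ∀ (i : ℕ), wedge (ofCovector η) ((wedge F)^[i] φ) =
      (wedge F)^[i] (wedge (ofCovector η) φ) := by
    intro i
    induction i with
    | zero => rfl
    | succ i ih => rw [Function.iterate_succ_apply', Function.iterate_succ_apply', ← ih,
        covector_wedge_wedge, hF]
  induction j with
  | zero => 
    simp only [Function.iterate_succ_apply', Function.iterate_zero, id, iota_wedge, hF, hη]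
    simp [add_comm]
  | succ j ih =>
    rw [Function.iterate_succ_apply', iota_wedge, hF, hη, ih, hc, wedge_add_right,
      wedge_rsmul_right, ← Function.iterate_succ_apply' (wedge F), ← Function.iterate_succ_apply' (wedge F)]
    push_cast
    module

theorem expWedge_apply_of_le (hF0 : F 0 = 0) (hF1 : F 1 = 0) (φ : PForm V) (k N : ℕ) (h : k ≤ N) :
    expWedge F φ k = ∑ j ∈ Finset.range (N + 1), ((j.factorial : ℝ)⁻¹) • ((wedge F)^[j] φ) k := by
  rw [expWedge]
  refine Finset.sum_subset (Finset.range_mono (by omega)) fun j _ hj => ?_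
  rw [wedge_iterate_apply_eq_zero hF0 hF1 _ _ _ (by simp at hj; omega)]
  simp

theorem iota_expWedge (hF0 : F 0 = 0) (hF1 : F 1 = 0) (hF : gradeInv F = F) (X : V)
    (η : V →L[ℝ] ℝ) (hη : iota X F = ofCovector η) (φ : PForm V) :
    iota X (expWedge F φ) = expWedge F (iota X φ + wedge (ofCovector η) φ) := by
  funext k
  have h1 : iota X (expWedge F φ) k = ∑ j ∈ Finset.range (k + 1 + 1),
      ((j.factorial : ℝ)⁻¹) • iota X ((wedge F)^[j] φ) k := by
    ext v
    rw [iota_apply]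
    simp only [expWedge, ContinuousAlternatingMap.sum_apply, ContinuousAlternatingMap.smul_apply]
    rfl
  have h2 : expWedge F (iota X φ + wedge (ofCovector η) φ) k =
      expWedge F (iota X φ) k + expWedge F (wedge (ofCovector η) φ) k := by
    simp only [expWedge, wedge_iterate_add, Pi.add_apply, smul_add, Finset.sum_add_distrib]
  rw [h1, h2, expWedge_apply_of_le hF0 hF1 _ k (k + 1) (by omega), expWedge,
    Finset.sum_range_succ', Finset.sum_range_succ' _ (k + 1)]
  simp only [iota_wedge_iterate hF X η hη, Pi.add_apply, Pi.smul_apply, smul_add,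
    Finset.sum_add_distrib]
  simp only [Function.iterate_zero, id]
  have hA : ∑ x ∈ Finset.range (k + 1), (((x + 1).factorial : ℝ)⁻¹) • ((x + 1 : ℕ) : ℝ) •
      (wedge F)^[x] (wedge (ofCovector η) φ) k =
      ∑ x ∈ Finset.range (k + 1), ((x.factorial : ℝ)⁻¹) •
        (wedge F)^[x] (wedge (ofCovector η) φ) k := by
    refine Finset.sum_congr rfl fun j _ => ?_
    rw [smul_smul]
    congr 1
    rw [Nat.factorial_succ]
    push_cast
    field_simp
  rw [hA]
  abel

theorem pull_expWedge (f : W →L[ℝ] V) (φ : PForm V) :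
    pull f (expWedge F φ) = expWedge (pull f F) (pull f φ) := by
  have h : ∀ j, pull f ((wedge F)^[j] φ) = (wedge (pull f F))^[j] (pull f φ) := by
    intro j
    induction j with
    | zero => rfl
    | succ j ih => simp only [Function.iterate_succ_apply', pull_wedge, ih]
  funext k
  ext v
  simp [pull_apply, expWedge, ← h]

theorem expWedge_zero (φ : PForm V) : expWedge 0 φ = φ := by
  funext k
  rw [expWedge, Finset.sum_range_succ', Finset.sum_eq_zero]
  · simp
  · intro j _
    rw [Function.iterate_succ_apply', wedge_zero_left]
    simp

theorem cliffProd_expWedge {n : ℕ} (hF0 : F 0 = 0) (hF1 : F 1 = 0) (hF : gradeInv F = F)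
    (X : Fin n → V) (η : Fin n → V →L[ℝ] ℝ) (hη : ∀ i, iota (X i) F = ofCovector (η i))
    (φ : PForm V) : cliffProd (fun i => (X i, 0)) (expWedge F φ) =
      expWedge F (cliffProd (fun i => (X i, η i)) φ) := by
  induction n generalizing φ with
  | zero => rfl
  | succ n ih =>
    simp only [cliffProd, cliff_vector]
    rw [iota_expWedge hF0 hF1 hF _ _ (hη 0)]
    exact ih (Fin.tail X) (Fin.tail η) (fun i => hη i.succ) _

theorem ofCovector_neg (ξ : V →L[ℝ] ℝ) : ofCovector (-ξ) = -ofCovector ξ := by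
  have h : -ξ = (-1 : ℝ) • ξ := by ext; simp
  rw [h, ofCovector_smul, pform_neg_one_rsmul]

theorem cliffProd_vector_apply {n : ℕ} (X : Fin n → V) (φ : PForm V) (j : ℕ) (w : Fin j → V) :
    cliffProd (fun i => (X i, 0)) φ j w = φ (n + j) (Fin.append X w) := by
  have hcast : ∀ {a b : ℕ} (h : a = b) (u : Fin b → V), φ b u = φ a (u ∘ Fin.cast h) := by
    rintro a _ rfl u; rfl
  induction n generalizing φ with
  | zero =>
    rw [hcast (by omega : j = 0 + j)]
    show φ j w = _
    congr 1
    funext i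
    simp [Fin.append, Fin.addCases]
  | succ n ih =>
    simp only [cliffProd, cliff_vector]
    have h1 := ih (Fin.tail X) (iota (X 0) φ) (by rintro a _ rfl u; rfl)
    refine h1.trans ?_
    rw [iota_apply, hcast (by omega : n + j + 1 = n + 1 + j)]
    congr 1
    funext i
    refine Fin.cases ?_ (fun i => ?_) i
    · simp [Fin.append, Fin.addCases]; rfl
    · simp only [Matrix.cons_val_succ, Function.comp_apply, Fin.append, Fin.addCases]
      by_cases hi : (i : ℕ) < n
      · simp [hi, Fin.tail]; rfl
      · simp [hi]
        congr 1
        ext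
        simp

theorem iota_cliffProd_vector {n : ℕ} (X : Fin n → V) (φ : PForm V) (i : Fin n) :
    iota (X i) (cliffProd (fun i => (X i, 0)) φ) = 0 := by
  have h0 : ∀ {m : ℕ} (Y : Fin m → V) (Z : V) (φ : PForm V), iota Z φ = 0 →
      iota Z (cliffProd (fun i => (Y i, 0)) φ) = 0 := by
    intro m
    induction m with
    | zero => exact fun _ _ _ h => h
    | succ m ih =>
      intro Y Z φ h
      simp only [cliffProd, cliff_vector]
      refine ih (Fin.tail Y) Z _ ?_
      rw [iota_iota, h, iota_zero, neg_zero]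
  induction n generalizing φ with
  | zero => exact i.elim0
  | succ n ih =>
    simp only [cliffProd, cliff_vector]
    refine Fin.cases ?_ (fun i => ?_) i
    · exact h0 (Fin.tail X) _ _ (iota_iota_self _ _)
    · exact ih (Fin.tail X) (iota (X 0) φ) i

/-- A polyform annihilated by the kernel of a surjection `b` with section `δ` is a pullback. -/
theorem eq_pull_pull_of_iota_eq_zero (b : V →L[ℝ] W) (δ : W →L[ℝ] V) {φ : PForm V}
    (h : ∀ X, iota (X - δ (b X)) φ = 0) : φ = pull b (pull δ φ) := by
  funext k
  induction k generalizing φ with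
  | zero => exact form_ext_zero (by rw [pull_apply, pull_apply]; congr 1; exact Subsingleton.elim _ _)
  | succ k ih =>
    refine form_ext_succ fun X => ?_
    have h1 : iota X φ = iota (δ (b X)) φ := by
      have := h X
      rw [sub_eq_add_neg, iota_vadd] at this
      have h2 : iota (-δ (b X)) φ = -iota (δ (b X)) φ := by
        have := iota_vsmul (δ (b X)) φ (-1)
        simpa [pform_neg_one_rsmul] using this
      rw [h2, ← sub_eq_add_neg] at this
      exact sub_eq_zero.1 this
    rw [iota_pull, iota_pull, h1]
    refine ih fun Y => ?_
    rw [iota_iota, h, iota_zero, neg_zero]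

end ExpWedge

/-! ### The linear Fourier transform -/

section Fourier

variable (W : Type*) [NormedAddCommGroup W] [NormedSpace ℝ W] {W₁ : Type*} [NormedAddCommGroup W₁]
  [NormedSpace ℝ W₁] {n : ℕ}

/-- The vertical coordinate covectors `dsᵢ` of `W × ℝⁿ`. -/
def ds (i : Fin n) : W × (Fin n → ℝ) →L[ℝ] ℝ :=
  (ContinuousLinearMap.proj i).comp (ContinuousLinearMap.snd ℝ W (Fin n → ℝ))

/-- The vertical coordinate vectors `∂ᵢ` of `W × ℝⁿ`. -/
def del (i : Fin n) : W × (Fin n → ℝ) := (0, Pi.single i 1)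

/-- The generalised vectors `(∂ᵢ, -dsᵢ)`. -/
def torusVec (i : Fin n) : GT (W × (Fin n → ℝ)) := (del W i, -ds W i)

theorem ds_apply (i : Fin n) (v : W × (Fin n → ℝ)) : ds W i v = v.2 i := rfl

theorem ds_del (i j : Fin n) : ds W i (del W j) = if i = j then 1 else 0 := by
  simp [ds_apply, del, Pi.single_apply]

theorem torusVec_negOrthonormal : NegOrthonormal (torusVec W (n := n)) := by
  intro i j
  simp only [inGT, torusVec, neg_apply, ds_del]
  by_cases h : i = j
  · simp [h]
  · simp [h, Ne.symm h]

/-- The two-form `-∑ dsᵢ ∧ ds'ᵢ` on `W × ℝⁿ × ℝⁿ`. -/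
def linFourier (n : ℕ) : PForm (W × (Fin n → ℝ) × (Fin n → ℝ)) :=
  -∑ i, wedge (ofCovector ((ContinuousLinearMap.proj (φ := fun _ : Fin n => ℝ) i).comp
      ((ContinuousLinearMap.fst ℝ _ _).comp (ContinuousLinearMap.snd ℝ _ _))))
    (ofCovector ((ContinuousLinearMap.proj (φ := fun _ : Fin n => ℝ) i).comp
      ((ContinuousLinearMap.snd ℝ _ _).comp (ContinuousLinearMap.snd ℝ _ _))))

/-- The projection `(w, c, c') ↦ (w, c)`. -/
def corrFst (n : ℕ) : W × (Fin n → ℝ) × (Fin n → ℝ) →L[ℝ] W × (Fin n → ℝ) :=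
  (ContinuousLinearMap.fst ℝ _ _).prod
    ((ContinuousLinearMap.fst ℝ _ _).comp (ContinuousLinearMap.snd ℝ _ _))

/-- The projection `(w, c, c') ↦ (w, c')`. -/
def corrSnd (n : ℕ) : W × (Fin n → ℝ) × (Fin n → ℝ) →L[ℝ] W × (Fin n → ℝ) :=
  (ContinuousLinearMap.fst ℝ _ _).prod
    ((ContinuousLinearMap.snd ℝ _ _).comp (ContinuousLinearMap.snd ℝ _ _))

/-- The diagonal `(w, c) ↦ (w, c, c)`. -/
def corrDiag (n : ℕ) : W × (Fin n → ℝ) →L[ℝ] W × (Fin n → ℝ) × (Fin n → ℝ) :=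
  (ContinuousLinearMap.fst ℝ _ _).prod
    ((ContinuousLinearMap.snd ℝ _ _).prod (ContinuousLinearMap.snd ℝ _ _))

theorem ofCovector_apply_of_ne {V : Type*} [NormedAddCommGroup V] [NormedSpace ℝ V]
    (ξ : V →L[ℝ] ℝ) {k : ℕ} (h : k ≠ 1) : ofCovector ξ k = 0 := ofReal_of_ne h _

theorem covector_wedge_covector_apply_of_lt {V : Type*} [NormedAddCommGroup V] [NormedSpace ℝ V]
    (ξ η : V →L[ℝ] ℝ) {k : ℕ} (h : k < 2) : wedge (ofCovector ξ) (ofCovector η) k = 0 := by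
  interval_cases k
  · refine form_ext_zero ?_
    rw [wedge_zero, ofCovector_zero_deg]; simp
  · refine form_ext_succ (ψ := 0) fun X => ?_
    refine form_ext_zero ?_
    rw [iota_covector_wedge, iota_ofCovector, wedge_const]
    simp only [Pi.sub_apply, Pi.smul_apply, ofCovector_zero_deg]
    simp

/-- The Fourier transform along the fibres of `(w, c, c') ↦ (w, c')` is the Clifford product of the
vectors `(∂ᵢ, -dsᵢ)`. -/
theorem cliffProd_expWedge_linFourier (ρ : PForm (W × (Fin n → ℝ))) :
    cliffProd (fun i : Fin n => (((0, Pi.single i 1, 0) : W × (Fin n → ℝ) × (Fin n → ℝ)), 0))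
      (expWedge (linFourier W n) (pull (corrFst W n) ρ)) =
      pull (corrSnd W n) (cliffProd (torusVec W) ρ) := by
  set X : Fin n → W × (Fin n → ℝ) × (Fin n → ℝ) := fun i => (0, Pi.single i 1, 0) with hX
  set F := linFourier W n with hF
  set η : Fin n → W × (Fin n → ℝ) × (Fin n → ℝ) →L[ℝ] ℝ := fun i =>
    -(ContinuousLinearMap.proj (φ := fun _ : Fin n => ℝ) i).comp
      ((ContinuousLinearMap.snd ℝ _ _).comp (ContinuousLinearMap.snd ℝ _ _)) with hη_def
  have hF01 : ∀ k < 2, F k = 0 := by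
    intro k hk
    rw [hF, linFourier, Pi.neg_apply, Finset.sum_apply, Finset.sum_eq_zero, neg_zero]
    exact fun i _ => covector_wedge_covector_apply_of_lt _ _ hk
  have hFg : gradeInv F = F := by
    have hs : ∀ (s : Finset (Fin n)) (f : Fin n → PForm (W × (Fin n → ℝ) × (Fin n → ℝ))),
        gradeInv (∑ i ∈ s, f i) = ∑ i ∈ s, gradeInv (f i) := by
      intro s f
      funext k
      simp [gradeInv_apply, Finset.smul_sum]
    rw [hF, linFourier, gradeInv_neg, hs]
    simp only [gradeInv_wedge, gradeInv_ofCovector, wedge_neg_left, wedge_neg_right, neg_neg]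
  have hη : ∀ i, iota (X i) F = ofCovector (η i) := by
    intro i
    have h1 : ∀ j : Fin n, iota (X i) (wedge (ofCovector
        ((ContinuousLinearMap.proj (φ := fun _ : Fin n => ℝ) j).comp
          ((ContinuousLinearMap.fst ℝ (Fin n → ℝ) (Fin n → ℝ)).comp
            (ContinuousLinearMap.snd ℝ W ((Fin n → ℝ) × (Fin n → ℝ))))))
        (ofCovector ((ContinuousLinearMap.proj (φ := fun _ : Fin n => ℝ) j).comp
          ((ContinuousLinearMap.snd ℝ _ _).comp (ContinuousLinearMap.snd ℝ _ _))))) =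
        if j = i then -ofCovector (η j) else 0 := by
      intro j
      rw [iota_covector_wedge, iota_ofCovector, wedge_const]
      rw [hη_def, ofCovector_neg]
      by_cases hij : j = i
      · subst hij; simp [X]
      · simp [X, hij]
    rw [hF, linFourier, iota_neg, iota_sum]
    simp only [h1, Finset.sum_ite_eq', Finset.mem_univ, if_true, neg_neg]
  have hker : ∀ Y : PForm (W × (Fin n → ℝ) × (Fin n → ℝ)), (∀ i, iota (X i) Y = 0) →
      ∀ c : Fin n → ℝ, iota (0, c, 0) Y = 0 := by
    intro Y hY c
    have hc : ((0, c, 0) : W × (Fin n → ℝ) × (Fin n → ℝ)) = ∑ i, c i • X i := by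
      refine Prod.ext ?_ (Prod.ext ?_ ?_)
      · simp [X, Prod.fst_sum]
      · simp only [X, Prod.snd_sum, Prod.fst_sum, Prod.smul_snd, Prod.smul_fst]
        funext j
        simp [Pi.single_apply]
      · simp [X, Prod.snd_sum]
    have hs : ∀ s : Finset (Fin n), iota (∑ i ∈ s, c i • X i) Y = 0 := by
      intro s
      induction s using Finset.induction_on with
      | empty => simp
      | insert a s ha ih => rw [Finset.sum_insert ha, iota_vadd, ih, iota_vsmul, hY]; simp
    rw [hc, hs]
  -- restriction to the diagonal
  have hdiag : ∀ {m : ℕ} (g : Fin m → Fin n) (_ : Function.Injective g)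
      (Y : PForm (W × (Fin n → ℝ) × (Fin n → ℝ))),
      (∀ i, iota ((0, 0, Pi.single (g i) 1) : W × (Fin n → ℝ) × (Fin n → ℝ)) Y = 0) →
      pull (corrDiag W n) (cliffProd (fun i => (X (g i), η (g i))) Y) =
        cliffProd (fun i => torusVec W (g i)) (pull (corrDiag W n) Y) := by
    intro m
    induction m with
    | zero => exact fun _ _ _ _ => rfl
    | succ m ih =>
      intro g hg Y hY
      simp only [cliffProd]
      have h1 : pull (corrDiag W n) (cliff (X (g 0), η (g 0)) Y) =
          cliff (torusVec W (g 0)) (pull (corrDiag W n) Y) := by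
        simp only [cliff, torusVec, pull_add, pull_wedge, pull_ofCovector, iota_pull]
        congr 2
        have : corrDiag W n (del W (g 0)) = X (g 0) + (0, 0, Pi.single (g 0) 1) := by
          simp [corrDiag, del, X]
        rw [this, iota_vadd, hY, add_zero]
      rw [← h1]
      refine ih (Fin.tail g) (fun a b hab => Fin.succ_injective _ (hg hab)) _ fun i => ?_
      have h2 : η (g 0) (0, 0, Pi.single (g i.succ) 1) = 0 := by
        have : g 0 ≠ g i.succ := fun h => (Fin.succ_ne_zero i).symm (hg h)
        simp [hη_def, this]
      simp only [cliff, Fin.tail, iota_add, iota_covector_wedge, h2, hY]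
      rw [iota_iota, hY]
      simp
  have hX0 := eq_pull_pull_of_iota_eq_zero (corrSnd W n) (corrDiag W n)
    (φ := cliffProd (fun i => (X i, 0)) (expWedge F (pull (corrFst W n) ρ))) (by
      rintro ⟨w, c, c'⟩
      have : ((w, c, c') : W × (Fin n → ℝ) × (Fin n → ℝ)) -
          corrDiag W n (corrSnd W n (w, c, c')) = (0, c - c', 0) := by
        simp [corrDiag, corrSnd]
      rw [this]
      exact hker _ (fun i => iota_cliffProd_vector X _ i) _)
  rw [hX0]
  congr 1
  rw [cliffProd_expWedge (hF01 0 (by norm_num)) (hF01 1 (by norm_num)) hFg X η hη, pull_expWedge]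
  have hF0 : pull (corrDiag W n) F = 0 := by
    have hs : pull (corrDiag W n) F = -∑ i : Fin n, wedge (ofCovector (ds W i)) (ofCovector (ds W i)) := by
      rw [hF, linFourier, pull_neg, pull_sum]
      simp only [pull_wedge, pull_ofCovector]
      rfl
    rw [hs, Finset.sum_eq_zero, neg_zero]
    intro i _
    have := covector_wedge_covector (ds W i) (ds W i)
    exact pform_eq_zero_of_eq_neg this
  rw [hF0, expWedge_zero]
  have h3 := hdiag id Function.injective_id (pull (corrFst W n) ρ) (fun i => by
    rw [iota_pull]
    have : corrFst W n ((0, 0, Pi.single (id i) 1) : W × (Fin n → ℝ) × (Fin n → ℝ)) = 0 := by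
      simp [corrFst]
    rw [this]; simp)
  exact h3

/-- The projection of `W × ℝ^{k+1}` to `W × ℝ^k` that forgets the coordinate `0`. -/
def dropZero (k : ℕ) : W × (Fin (k + 1) → ℝ) →L[ℝ] W × (Fin k → ℝ) :=
  (ContinuousLinearMap.fst ℝ _ _).prod
    ((ContinuousLinearMap.pi fun i => ContinuousLinearMap.proj i.succ).comp
      (ContinuousLinearMap.snd ℝ _ _))

theorem dropZero_apply (k : ℕ) (v : W × (Fin (k + 1) → ℝ)) : dropZero W k v = (v.1, Fin.tail v.2) :=
  rfl

theorem cliffProd_torusVec_lift {k : ℕ} {ε : ℝ} (hε : ε * ε = 1)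
    (p : PForm (W × (Fin k → ℝ)) × PForm (W × (Fin k → ℝ))) :
    cliffProd (torusVec W) (pull (dropZero W k) p.1 +
      Complex.I • wedge (ofCovector (ds W 0)) (pull (dropZero W k) p.2)) =
      pull (dropZero W k) (dualPair ε (torusVec W) p).1 + (ε * Complex.I) •
        wedge (ofCovector (ds W 0)) (pull (dropZero W k) (dualPair ε (torusVec W) p).2) := by
  have h0 : dropZero W k (del W 0) = 0 := by
    rw [dropZero_apply]
    refine Prod.ext rfl ?_
    funext i
    simp [del, Fin.tail]
  have hd0 : ds W (n := k + 1) 0 (del W 0) = 1 := by simp [ds_del]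
  have hpull : ∀ χ : PForm (W × (Fin k → ℝ)), cliffProd (Fin.tail (torusVec W))
      (pull (dropZero W k) χ) = pull (dropZero W k) (cliffProd (torusVec W) χ) := by
    have : ∀ {m : ℕ} (g : Fin m → Fin k) (χ : PForm (W × (Fin k → ℝ))),
        cliffProd (fun i => torusVec W (g i).succ) (pull (dropZero W k) χ) =
          pull (dropZero W k) (cliffProd (fun i => torusVec W (g i)) χ) := by
      intro m
      induction m with
      | zero => exact fun _ _ => rfl
      | succ m ih =>
        intro g χ
        simp only [cliffProd]
        have h1 : cliff (torusVec W (g 0).succ) (pull (dropZero W k) χ) =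
            pull (dropZero W k) (cliff (torusVec W (g 0)) χ) := by
          simp only [cliff, torusVec, iota_pull, pull_add, pull_wedge, pull_ofCovector]
          have : dropZero W k (del W (g 0).succ) = del W (g 0) := by
            rw [dropZero_apply]
            refine Prod.ext rfl ?_
            funext i
            simp [del, Fin.tail, Pi.single_apply]
          rw [this]
          rfl
        rw [h1]
        exact ih (Fin.tail g) _
    exact this id
  have hds : ∀ χ, cliffProd (Fin.tail (torusVec W (n := k + 1))) (wedge (ofCovector (ds W 0)) χ) =
      ((-1 : ℝ) ^ k) • wedge (ofCovector (ds W 0)) (cliffProd (Fin.tail (torusVec W)) χ) := by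
    intro χ
    rw [← cliff_covector, (torusVec_negOrthonormal W).tail.cliffProd_cliff, ← cliff_covector]
    congr 2
    rw [reflect_apply, Finset.sum_eq_zero, add_zero]
    intro i _
    have : inGT ((0, ds W 0) : GT (W × (Fin (k + 1) → ℝ))) (Fin.tail (torusVec W) i) = 0 := by
      simp only [inGT, torusVec, Fin.tail, ds_del]
      simp [(Fin.succ_ne_zero i).symm]
    rw [this]; simp
  rw [cliffProd]
  have h2 : cliff (torusVec W 0) (pull (dropZero W k) p.1 +
      Complex.I • wedge (ofCovector (ds W 0)) (pull (dropZero W k) p.2)) =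
      Complex.I • pull (dropZero W k) p.2 - wedge (ofCovector (ds W 0)) (pull (dropZero W k) p.1) := by
    rw [cliff_add, cliff_smul]
    simp only [cliff, torusVec, iota_covector_wedge, iota_pull, h0, iota_vzero, hd0, ofCovector_neg,
      wedge_neg_left, covector_wedge_self, pull_zero, wedge_zero_right, one_smul, sub_zero, neg_zero,
      add_zero, zero_add]
    abel
  rw [h2, cliffProd_sub, cliffProd_smul, hpull, hds, hpull]
  simp only [dualPair, pull_smul, wedge_smul_right, smul_smul]
  have hεc : (ε : ℂ) * ε = 1 := by exact_mod_cast hε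
  rw [show (ε * Complex.I * (ε * (-1) ^ k * Complex.I) : ℂ) = -((-1 : ℝ) ^ k : ℝ) by
    push_cast; linear_combination (-1 : ℂ) ^ k * Complex.I ^ 2 * hεc + (-1 : ℂ) ^ k * Complex.I_sq,
    pform_neg_smul, ← rsmul_eq_smul, sub_eq_add_neg]

/-- Clifford products of the vectors `(∂ᵢ, -dsᵢ)` and forms pulled back from `W`. -/
theorem cliffProd_torusVec_wedge_basic {k : ℕ} (s : ℝ) (β : PForm W) (hβ : gradeInv β = s • β)
    (φ : PForm (W × (Fin k → ℝ))) :
    cliffProd (torusVec W) (wedge (pull (ContinuousLinearMap.fst ℝ _ _) β) φ) =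
      s ^ k • wedge (pull (ContinuousLinearMap.fst ℝ _ _) β) (cliffProd (torusVec W) φ) := by
  have : ∀ {m : ℕ} (g : Fin m → Fin k) (φ : PForm (W × (Fin k → ℝ))),
      cliffProd (fun i => torusVec W (g i)) (wedge (pull (ContinuousLinearMap.fst ℝ _ _) β) φ) =
      s ^ m • wedge (pull (ContinuousLinearMap.fst ℝ _ _) β)
        (cliffProd (fun i => torusVec W (g i)) φ) := by
    intro m
    induction m with
    | zero => intro g φ; simp [cliffProd]
    | succ m ih =>
      intro g φ
      simp only [cliffProd]
      have h1 : ∀ i, cliff (torusVec W i) (wedge (pull (ContinuousLinearMap.fst ℝ _ _) β) φ) =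
          s • wedge (pull (ContinuousLinearMap.fst ℝ _ _) β) (cliff (torusVec W i) φ) := by
        intro i
        have h0 : iota (del W i) (pull (ContinuousLinearMap.fst ℝ W (Fin k → ℝ)) β) = 0 := by
          rw [iota_pull]; simp [del]
        simp only [cliff, torusVec, iota_wedge, h0, covector_wedge_wedge, ← pull_gradeInv, hβ,
          wedge_zero_left, zero_add, pull_rsmul, wedge_rsmul_left, wedge_add_right, smul_add]
      rw [h1, cliffProd_rsmul]
      refine (congrArg _ (ih (Fin.tail g) _)).trans ?_
      rw [smul_smul, pow_succ']
      rfl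
  exact this id φ

theorem gtMap_torusVec {k : ℕ} (D : W ≃L[ℝ] W₁) (i : Fin k) :
    gtMap (D.prodCongr (ContinuousLinearEquiv.refl ℝ (Fin k → ℝ))) (torusVec W i) = torusVec W₁ i := by
  refine Prod.ext ?_ ?_
  · simp [gtMap, torusVec, del]
  · ext v <;> simp [gtMap, torusVec, ds]

end Fourier

/-! ### Smooth families of polyforms -/

section Families

variable {X V W : Type*} [NormedAddCommGroup X] [NormedSpace ℝ X]
  [NormedAddCommGroup V] [NormedSpace ℝ V] [NormedAddCommGroup W] [NormedSpace ℝ W]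


/-- `curryLeft` as a continuous linear map. -/
def curryLeftCLM (k : ℕ) : (V [⋀^Fin (k + 1)]→L[ℝ] ℂ) →L[ℝ] (V →L[ℝ] V [⋀^Fin k]→L[ℝ] ℂ) :=
  (ContinuousAlternatingMap.curryLeftLI (𝕜 := ℝ) (E := V) (F := ℂ)
    (n := k)).toContinuousLinearMap

theorem contDiff_curryLeft (k : ℕ) :
    ContDiff ℝ ∞ (fun a : V [⋀^Fin (k + 1)]→L[ℝ] ℂ => a.curryLeft) :=
  by
  have h := ContinuousLinearMap.contDiff (𝕜 := ℝ) (n := ∞) (F := V →L[ℝ] V [⋀^Fin k]→L[ℝ] ℂ)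
    (curryLeftCLM (V := V) k)
  exact h

theorem hasFDerivAt_curryLeft (k : ℕ) (a : V [⋀^Fin (k + 1)]→L[ℝ] ℂ) :
    HasFDerivAt (fun a : V [⋀^Fin (k + 1)]→L[ℝ] ℂ => a.curryLeft) (curryLeftCLM k) a :=
  ContinuousLinearMap.hasFDerivAt (E := V [⋀^Fin (k + 1)]→L[ℝ] ℂ)
    (F := V →L[ℝ] V [⋀^Fin k]→L[ℝ] ℂ) (curryLeftCLM k)

/-- A family of polyforms is smooth at a point of the parameter space. -/
def SmoothFamAt (α : X → PForm V) (x : X) : Prop := ∀ k, ContDiffAt ℝ ∞ (fun u => α u k) x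

theorem contDiffAt_form_of_apply [FiniteDimensional ℝ V] {k : ℕ} {a : X → V [⋀^Fin k]→L[ℝ] ℂ} {x : X}
    (h : ∀ v : Fin k → V, ContDiffAt ℝ ∞ (fun u => a u v) x) : ContDiffAt ℝ ∞ a x := by
  let b := Module.finBasis ℝ V
  let L : (V [⋀^Fin k]→L[ℝ] ℂ) →ₗ[ℝ] ((Fin k → Fin (Module.finrank ℝ V)) → ℂ) :=
    { toFun := fun a i => a (fun j => b (i j))
      map_add' := fun _ _ => rfl
      map_smul' := fun _ _ => rfl }
  have hL : Function.Injective L := by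
    intro a c hac
    ext v
    have : a.toMultilinearMap = c.toMultilinearMap :=
      Module.Basis.ext_multilinear (fun _ => b) fun i => congrFun hac i
    exact congrArg (fun m : MultilinearMap ℝ (fun _ : Fin k => V) ℂ => m v) this
  obtain ⟨g, hg⟩ := L.exists_leftInverse_of_injective (LinearMap.ker_eq_bot.2 hL)
  have h1 : ContDiffAt ℝ ∞ (fun u => L (a u)) x := contDiffAt_pi.2 fun i => h _
  have h2 := (LinearMap.toContinuousLinearMap g).contDiff.contDiffAt.comp x h1
  refine h2.congr_of_eventuallyEq (Filter.Eventually.of_forall fun u => ?_)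
  exact (congrArg (fun m => m (a u)) hg).symm

theorem contDiffAt_form_apply {k : ℕ} {a : X → V [⋀^Fin k]→L[ℝ] ℂ} {x : X}
    (h : ContDiffAt ℝ ∞ a x) (v : Fin k → V) : ContDiffAt ℝ ∞ (fun u => a u v) x :=
  (ContinuousAlternatingMap.apply ℝ V ℂ v).contDiff.contDiffAt.comp x h

theorem smoothFamAt_iff_apply [FiniteDimensional ℝ V] {α : X → PForm V} {x : X} :
    SmoothFamAt α x ↔ ∀ k (v : Fin k → V), ContDiffAt ℝ ∞ (fun u => α u k v) x :=
  ⟨fun h k v => contDiffAt_form_apply (h k) v, fun h k => contDiffAt_form_of_apply (h k)⟩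

namespace SmoothFamAt

variable {α χ : X → PForm V} {x : X}

theorem differentiableAt (h : SmoothFamAt α x) (k : ℕ) : DifferentiableAt ℝ (fun u => α u k) x :=
  (h k).differentiableAt (by simp)

theorem congr (h : SmoothFamAt α x) (e : χ =ᶠ[nhds x] α) : SmoothFamAt χ x := fun k =>
  (h k).congr_of_eventuallyEq (e.mono fun _ hu => congrFun hu k)

theorem const (φ : PForm V) : SmoothFamAt (fun _ : X => φ) x := fun _ => contDiffAt_const

theorem comp {Y : Type*} [NormedAddCommGroup Y] [NormedSpace ℝ Y] {f : Y → X} {y : Y}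
    (h : SmoothFamAt α (f y)) (hf : ContDiffAt ℝ ∞ f y) : SmoothFamAt (fun u => α (f u)) y :=
  fun k => (h k).comp y hf

theorem add (h : SmoothFamAt α x) (h' : SmoothFamAt χ x) : SmoothFamAt (fun u => α u + χ u) x :=
  fun k => (h k).add (h' k)

theorem neg (h : SmoothFamAt α x) : SmoothFamAt (fun u => -α u) x := fun k => (h k).neg

theorem smul {f : X → ℂ} (hf : ContDiffAt ℝ ∞ f x) (h : SmoothFamAt α x) :
    SmoothFamAt (fun u => f u • α u) x := fun k => hf.smul (h k)

theorem const_smul (c : ℂ) (h : SmoothFamAt α x) : SmoothFamAt (fun u => c • α u) x :=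
  smul contDiffAt_const h

theorem sum {ι : Type*} (s : Finset ι) {f : ι → X → PForm V} (h : ∀ i ∈ s, SmoothFamAt (f i) x) :
    SmoothFamAt (fun u => ∑ i ∈ s, f i u) x := fun k => by
  simp only [Finset.sum_apply]
  exact ContDiffAt.sum fun i hi => h i hi k

theorem iota {Y : X → V} (hY : ContDiffAt ℝ ∞ Y x) (h : SmoothFamAt α x) :
    SmoothFamAt (fun u => iota (Y u) (α u)) x := fun k => by
  have h1 : ContDiffAt ℝ ∞ (fun u => (α u (k + 1)).curryLeft) x :=
    (contDiff_curryLeft k).contDiffAt.comp x (h (k + 1))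
  exact h1.clm_apply hY

variable [FiniteDimensional ℝ V]

theorem wedge (h : SmoothFamAt α x) (h' : SmoothFamAt χ x) :
    SmoothFamAt (fun u => wedge (α u) (χ u)) x := by
  refine smoothFamAt_iff_apply.2 fun k v => ?_
  simp only [GenGeom.wedge, ContinuousAlternatingMap.sum_apply, wedgeHom_apply]
  refine ContDiffAt.sum fun pq _ => ?_
  refine ContDiffAt.const_smul (((pq.1.1.factorial * pq.1.2.factorial : ℕ) : ℝ)⁻¹)
    (ContDiffAt.sum fun σ _ => ?_)
  refine ContDiffAt.const_smul _ ?_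
  exact (contDiffAt_form_apply (h _) _).mul (contDiffAt_form_apply (h' _) _)

theorem ofCovector {ξ : X → V →L[ℝ] ℝ} (h : ContDiffAt ℝ ∞ ξ x) :
    SmoothFamAt (fun u => GenGeom.ofCovector (ξ u)) x := by
  refine smoothFamAt_iff_apply.2 fun k v => ?_
  by_cases hk : k = 1
  · subst hk
    simp only [GenGeom.ofCovector, ofReal_same_apply]
    exact Complex.ofRealCLM.contDiff.contDiffAt.comp x (h.clm_apply contDiffAt_const)
  · simp only [ofCovector_apply_of_ne _ hk]
    exact contDiffAt_const

theorem cliff {a : X → GT V} (ha : ContDiffAt ℝ ∞ a x) (h : SmoothFamAt α x) :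
    SmoothFamAt (fun u => cliff (a u) (α u)) x :=
  (iota (contDiffAt_fst.comp x ha) h).add
    ((ofCovector (contDiffAt_snd.comp x ha)).wedge h)

theorem cliffProd {k : ℕ} (v : Fin k → GT V) (h : SmoothFamAt α x) :
    SmoothFamAt (fun u => cliffProd v (α u)) x := by
  induction k generalizing α with
  | zero => exact h
  | succ k ih => exact ih (Fin.tail v) (cliff contDiffAt_const h)

omit [FiniteDimensional ℝ V] in
theorem pull [FiniteDimensional ℝ W] {f : X → W →L[ℝ] V} (hf : ContDiffAt ℝ ∞ f x)
    (h : SmoothFamAt α x) : SmoothFamAt (fun u => pull (f u) (α u)) x := by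
  refine smoothFamAt_iff_apply.2 fun k v => ?_
  induction k generalizing α with
  | zero =>
    have : ∀ u, GenGeom.pull (f u) (α u) 0 v = α u 0 0 := fun u => by
      rw [pull_apply]; congr 1; exact Subsingleton.elim _ _
    simp only [this]
    exact contDiffAt_form_apply (h 0) _
  | succ k ih =>
    have : ∀ u, GenGeom.pull (f u) (α u) (k + 1) v =
        GenGeom.pull (f u) (GenGeom.iota (f u (Matrix.vecHead v)) (α u)) k (Matrix.vecTail v) := by
      intro u
      rw [← iota_pull, iota_apply, Matrix.cons_head_tail]
    simp only [this]
    exact ih (iota (hf.clm_apply contDiffAt_const) h) _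

theorem pullPairLike {ε : ℝ} {k : ℕ} (v : Fin k → GT V) {p : X → PForm V × PForm V}
    (h1 : SmoothFamAt (fun u => (p u).1) x) (h2 : SmoothFamAt (fun u => (p u).2) x) :
    SmoothFamAt (fun u => (dualPair ε v (p u)).1) x ∧
      SmoothFamAt (fun u => (dualPair ε v (p u)).2) x :=
  ⟨const_smul _ (cliffProd v h2), const_smul _ (cliffProd v h1)⟩

end SmoothFamAt

/-! ### Partial derivatives and the exterior derivative -/

/-- The derivative of a family of polyforms in the direction `w`. -/
def pd (w : X) (α : X → PForm V) (x : X) : PForm V := fun k => fderiv ℝ (fun u => α u k) x w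

theorem pd_apply {α : X → PForm V} {x : X} (h : SmoothFamAt α x) (w : X) (k : ℕ) (v : Fin k → V) :
    pd w α x k v = fderiv ℝ (fun u => α u k v) x w := by
  have h1 : HasFDerivAt (fun u => α u k v)
      ((ContinuousAlternatingMap.apply ℝ V ℂ v).comp (fderiv ℝ (fun u => α u k) x)) x :=
    (ContinuousAlternatingMap.apply ℝ V ℂ v).hasFDerivAt.comp x (h.differentiableAt k).hasFDerivAt
  rw [h1.fderiv]; rfl

section PdRules

variable {α χ : X → PForm V} {x : X} (hα : SmoothFamAt α x) (hχ : SmoothFamAt χ x) (w : X)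

theorem pd_const (φ : PForm V) : pd w (fun _ => φ) x = 0 := by
  funext k; simp [pd]

include hα

theorem pd_smul {f : X → ℂ} (hf : ContDiffAt ℝ ∞ f x) :
    pd w (fun u => f u • α u) x = (fderiv ℝ f x w) • α x + f x • pd w α x := by
  funext k
  have := fderiv_fun_smul (hf.differentiableAt (by simp)) (hα.differentiableAt k)
  simp only [pd, Pi.smul_apply, this, Pi.add_apply]
  simp [add_comm]

theorem pd_const_smul (c : ℂ) : pd w (fun u => c • α u) x = c • pd w α x := by
  rw [pd_smul hα w contDiffAt_const]; simp

theorem pd_iota {Y : X → V} (hY : ContDiffAt ℝ ∞ Y x) : pd w (fun u => iota (Y u) (α u)) x =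
    iota (Y x) (pd w α x) + iota (fderiv ℝ Y x w) (α x) := by
  funext k
  have h1 : HasFDerivAt (fun u => (α u (k + 1)).curryLeft)
      ((curryLeftCLM (V := V) k).comp (fderiv ℝ (fun u => α u (k + 1)) x)) x :=
    by
    have h := HasFDerivAt.comp (F := V [⋀^Fin (k + 1)]→L[ℝ] ℂ) (G := V →L[ℝ] V [⋀^Fin k]→L[ℝ] ℂ) x
      (hasFDerivAt_curryLeft k (α x (k + 1))) (hα.differentiableAt (k + 1)).hasFDerivAt
    exact h
  have h2 := h1.clm_apply (hY.differentiableAt (by simp)).hasFDerivAt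
  show fderiv ℝ (fun u => (α u (k + 1)).curryLeft (Y u)) x w = _
  rw [h2.fderiv]
  simp only [add_apply, Pi.add_apply]
  rw [add_comm]
  rfl

theorem pd_iota_const (Y : V) : pd w (fun u => iota Y (α u)) x = iota Y (pd w α x) := by
  rw [pd_iota hα w contDiffAt_const]; simp

theorem pd_neg : pd w (fun u => -α u) x = -pd w α x := by
  have := pd_const_smul hα w (-1)
  simpa only [pform_neg_one_smul] using this

include hχ

theorem pd_add : pd w (fun u => α u + χ u) x = pd w α x + pd w χ x := by
  funext k
  have := fderiv_fun_add (hα.differentiableAt k) (hχ.differentiableAt k)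
  simp only [pd, Pi.add_apply, this]
  rfl

theorem pd_wedge [FiniteDimensional ℝ V] : pd w (fun u => wedge (α u) (χ u)) x =
    wedge (pd w α x) (χ x) + wedge (α x) (pd w χ x) := by
  funext k
  induction k generalizing α χ with
  | zero =>
    refine form_ext_zero ?_
    rw [pd_apply (hα.wedge hχ), Pi.add_apply, ContinuousAlternatingMap.add_apply, wedge_zero,
      wedge_zero, pd_apply hα, pd_apply hχ]
    simp only [wedge_zero]
    have := fderiv_fun_mul ((contDiffAt_form_apply (hα 0) 0).differentiableAt (by simp))
      ((contDiffAt_form_apply (hχ 0) 0).differentiableAt (by simp))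
    rw [this]
    simp only [add_apply, smul_apply, smul_eq_mul]
    ring
  | succ k ih =>
    refine form_ext_succ fun Y => ?_
    have hg : SmoothFamAt (fun u => gradeInv (α u)) x := fun k =>
      ContDiffAt.const_smul ((-1 : ℝ) ^ k) (hα k)
    have hgd : pd w (fun u => gradeInv (α u)) x = gradeInv (pd w α x) := by
      funext l
      have := fderiv_fun_const_smul (hα.differentiableAt l) ((-1 : ℝ) ^ l)
      simp only [pd, gradeInv_apply, this]
      rfl
    have hi1 : SmoothFamAt (fun u => iota Y (α u)) x := hα.iota contDiffAt_const
    have hi2 : SmoothFamAt (fun u => iota Y (χ u)) x := hχ.iota contDiffAt_const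
    have h1 := pd_add (hi1.wedge hχ) (hg.wedge hi2) w
    rw [← pd_iota_const (hα.wedge hχ)]
    simp only [iota_wedge]
    rw [h1, Pi.add_apply, ih hi1 hχ, ih hg hi2, hgd, iota_add, iota_wedge, iota_wedge,
      pd_iota_const hα, pd_iota_const hχ]
    simp only [Pi.add_apply]
    abel

end PdRules

theorem pd_cliff_const [FiniteDimensional ℝ V] {α : X → PForm V} {x : X} (hα : SmoothFamAt α x)
    (w : X) (a : GT V) : pd w (fun u => cliff a (α u)) x = cliff a (pd w α x) := by
  have h1 : SmoothFamAt (fun u => iota a.1 (α u)) x := hα.iota contDiffAt_const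
  have h2 : SmoothFamAt (fun _ : X => ofCovector a.2) x := SmoothFamAt.const _
  simp only [cliff]
  rw [pd_add h1 (h2.wedge hα), pd_iota_const hα, pd_wedge h2 hα, pd_const, wedge_zero_left, zero_add]

theorem pd_cliffProd [FiniteDimensional ℝ V] {α : X → PForm V} {x : X} (hα : SmoothFamAt α x)
    (w : X) {k : ℕ} (v : Fin k → GT V) :
    pd w (fun u => cliffProd v (α u)) x = cliffProd v (pd w α x) := by
  induction k generalizing α with
  | zero => rfl
  | succ k ih =>
    simp only [cliffProd]
    rw [ih (hα.cliff contDiffAt_const), pd_cliff_const hα]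

theorem pd_ofCovector [FiniteDimensional ℝ V] {ξ : X → V →L[ℝ] ℝ} {x : X} (h : ContDiffAt ℝ ∞ ξ x)
    (w : X) : pd w (fun u => ofCovector (ξ u)) x = ofCovector (fderiv ℝ ξ x w) := by
  funext k
  ext v
  rw [pd_apply (SmoothFamAt.ofCovector h)]
  by_cases hk : k = 1
  · subst hk
    simp only [ofCovector, ofReal_same_apply]
    have h1 : HasFDerivAt (fun u => ξ u (v 0)) ((fderiv ℝ ξ x).flip (v 0)) x :=
      ((h.differentiableAt (by simp)).hasFDerivAt.clm_apply (hasFDerivAt_const (v 0) x)).congr_fderiv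
        (by ext; simp)
    have h2 := Complex.ofRealCLM.hasFDerivAt.comp x h1
    exact congrArg (fun a => a w) h2.fderiv
  · simp [ofCovector_apply_of_ne _ hk]

/-- The exterior derivative of a family of polyforms on a vector space. -/
def flatD (α : V → PForm V) (x : V) : PForm V
  | 0 => 0
  | k + 1 => extDeriv (fun y => α y k) x

theorem flatD_congr {α χ : V → PForm V} {x : V} (e : χ =ᶠ[nhds x] α) : flatD χ x = flatD α x := by
  funext k
  cases k with
  | zero => rfl
  | succ k => exact Filter.EventuallyEq.extDeriv_eq (e.mono fun _ hu => congrFun hu k)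

theorem covector_wedge_apply (ξ : V →L[ℝ] ℝ) (φ : PForm V) (k : ℕ) (v : Fin (k + 1) → V) :
    wedge (ofCovector ξ) φ (k + 1) v = ∑ i : Fin (k + 1), (-1 : ℝ) ^ (i : ℕ) •
      (ξ (v i) • φ k (i.removeNth v)) := by
  induction k generalizing φ with
  | zero =>
    obtain ⟨X, rfl⟩ : ∃ X : V, v = Matrix.vecCons X 0 :=
      ⟨v 0, by ext i; fin_cases i; rfl⟩
    rw [← iota_apply, iota_covector_wedge]
    simp [wedge_zero, ofCovector_zero_deg]
  | succ k ih =>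
    obtain ⟨X, u, rfl⟩ : ∃ (X : V) (u : Fin (k + 1) → V), v = Matrix.vecCons X u :=
      ⟨v 0, Fin.tail v, (Fin.cons_self_tail v).symm⟩
    rw [← iota_apply, iota_covector_wedge, Fin.sum_univ_succ, Pi.sub_apply,
      ContinuousAlternatingMap.sub_apply, ih]
    simp only [Fin.val_zero, pow_zero, one_smul, Matrix.cons_val_zero, Fin.val_succ,
      Matrix.cons_val_succ]
    have h1 : (Fin.removeNth 0 (Matrix.vecCons X u) : Fin (k + 1) → V) = u := by
      ext i; rfl
    have h2 : ∀ i : Fin (k + 1), (Fin.removeNth i.succ (Matrix.vecCons X u) : Fin (k + 1) → V) =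
        Matrix.vecCons X (i.removeNth u) := by
      intro i
      ext j
      refine Fin.cases ?_ (fun j => ?_) j
      · rfl
      · simp [Fin.removeNth]
    rw [h1]
    simp only [h2, ← iota_apply]
    rw [sub_eq_add_neg, ← Finset.sum_neg_distrib]
    congr 1
    refine Finset.sum_congr rfl fun i _ => ?_
    rw [pow_succ]
    module

/-- `d = ∑ eʲ ∧ ∂ⱼ`. -/
theorem flatD_eq_sum {ι : Type*} [Fintype ι] (e : ι → V) (f : ι → V →L[ℝ] ℝ)
    (hef : ∀ X, ∑ i, f i X • e i = X) {α : V → PForm V} {x : V} (hα : SmoothFamAt α x) :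
    flatD α x = ∑ j, wedge (ofCovector (f j)) (pd (e j) α x) := by
  funext k
  cases k with
  | zero =>
    rw [Finset.sum_apply, Finset.sum_eq_zero]
    · rfl
    · intro j _
      refine form_ext_zero ?_
      rw [wedge_zero, ofCovector_zero_deg]; simp
  | succ k =>
    ext v
    rw [Finset.sum_apply, ContinuousAlternatingMap.sum_apply]
    simp only [covector_wedge_apply]
    rw [Finset.sum_comm]
    show extDeriv (fun y => α y k) x v = _
    rw [extDeriv_apply (hα.differentiableAt k)]
    refine Finset.sum_congr rfl fun i _ => ?_
    rw [← Finset.smul_sum]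
    have h1 : fderiv ℝ (fun y => α y k) x (v i) (i.removeNth v) =
        ∑ j, f j (v i) • pd (e j) α x k (i.removeNth v) := by
      conv_lhs => rw [← hef (v i), map_sum]
      rw [ContinuousAlternatingMap.sum_apply]
      refine Finset.sum_congr rfl fun j _ => ?_
      rw [map_smul]
      rfl
    have h2 : fderiv ℝ (fun y => α y k (i.removeNth v)) x (v i) =
        fderiv ℝ (fun y => α y k) x (v i) (i.removeNth v) :=
      (pd_apply hα (v i) k (i.removeNth v)).symm
    rw [h2, h1, ← Int.cast_smul_eq_zsmul ℝ]
    push_cast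
    rfl

end Families

/-! ### Torus-invariant forms in a frame -/

section Shear

variable {W : Type*} [NormedAddCommGroup W] [NormedSpace ℝ W] {k : ℕ}

/-- The endomorphism `(w, c) ↦ (w, c + τ w)` of `W × ℝᵏ`. -/
def shearMap (τ : Fin k → W →L[ℝ] ℝ) : W × (Fin k → ℝ) →L[ℝ] W × (Fin k → ℝ) :=
  (ContinuousLinearMap.fst ℝ _ _).prod
    (ContinuousLinearMap.snd ℝ _ _ + (ContinuousLinearMap.pi τ).comp (ContinuousLinearMap.fst ℝ _ _))

theorem shearMap_apply (τ : Fin k → W →L[ℝ] ℝ) (v : W × (Fin k → ℝ)) :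
    shearMap τ v = (v.1, v.2 + fun i => τ i v.1) := rfl

/-- `shearMap` as an isomorphism. -/
def shear (τ : Fin k → W →L[ℝ] ℝ) : (W × (Fin k → ℝ)) ≃L[ℝ] W × (Fin k → ℝ) :=
  ContinuousLinearEquiv.equivOfInverse (shearMap τ) (shearMap (-τ))
    (fun v => Prod.ext rfl (by funext i; simp [shearMap_apply]))
    (fun v => Prod.ext rfl (by funext i; simp [shearMap_apply]))

/-- Pullback of polyforms from `W` to `W × ℝᵏ`. -/
def basic (β : PForm W) : PForm (W × (Fin k → ℝ)) := pull (ContinuousLinearMap.fst ℝ _ _) β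

theorem pull_shearMap_basic (τ : Fin k → W →L[ℝ] ℝ) (β : PForm W) :
    pull (shearMap τ) (basic β) = basic β := rfl

theorem iota_del_basic (i : Fin k) (β : PForm W) : iota (del W i) (basic β) = 0 := by
  rw [basic, iota_pull]; simp [del]

variable {X : Type*} [NormedAddCommGroup X] [NormedSpace ℝ X] [FiniteDimensional ℝ W]

theorem contDiffAt_clm_of_apply {V U : Type*} [NormedAddCommGroup V] [NormedSpace ℝ V]
    [FiniteDimensional ℝ V] [NormedAddCommGroup U] [NormedSpace ℝ U] {f : X → V →L[ℝ] U} {x : X}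
    (h : ∀ v, ContDiffAt ℝ ∞ (fun u => f u v) x) : ContDiffAt ℝ ∞ f x := by
  obtain ⟨e, c, hec⟩ := exists_dual_frame V
  have : f = fun u => ∑ i, (c i).smulRight (f u (e i)) := by
    funext u
    ext v
    conv_lhs => rw [← hec v, map_sum]
    simp
  rw [this]
  refine ContDiffAt.sum fun i _ => ?_
  exact (ContinuousLinearMap.smulRightL ℝ V U (c i)).contDiff.contDiffAt.comp x (h (e i))

theorem contDiffAt_shearMap {τ : X → Fin k → W →L[ℝ] ℝ} {x : X} (hτ : ContDiffAt ℝ ∞ τ x) :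
    ContDiffAt ℝ ∞ (fun u => shearMap (τ u)) x := by
  refine contDiffAt_clm_of_apply ?_
  intro v
  simp only [shearMap_apply]
  refine contDiffAt_const.prodMk (contDiffAt_const.add (contDiffAt_pi.2 fun i => ?_))
  exact (contDiffAt_pi.1 hτ i).clm_apply contDiffAt_const

/-- Derivative of the pullback by a family of shears. -/
theorem pd_pull_shearMap {τ : X → Fin k → W →L[ℝ] ℝ} {x : X} (hτ : ContDiffAt ℝ ∞ τ x)
    {α : X → PForm (W × (Fin k → ℝ))} (hα : SmoothFamAt α x) (w : X) :
    pd w (fun u => pull (shearMap (τ u)) (α u)) x = pull (shearMap (τ x)) (pd w α x) +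
      ∑ i, wedge (ofCovector ((fderiv ℝ (fun u => τ u i) x w).comp (ContinuousLinearMap.fst ℝ _ _)))
        (pull (shearMap (τ x)) (iota (del W i) (α x))) := by
  have hS := contDiffAt_shearMap hτ
  funext n
  induction n generalizing α with
  | zero =>
    have h0 : ∀ u, pull (shearMap (τ u)) (α u) 0 = α u 0 := fun u =>
      form_ext_zero (by rw [pull_apply]; congr 1; exact Subsingleton.elim _ _)
    refine form_ext_zero ?_
    rw [Pi.add_apply, ContinuousAlternatingMap.add_apply, Finset.sum_apply,
      ContinuousAlternatingMap.sum_apply, Finset.sum_eq_zero]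
    · rw [add_zero, pull_apply, pd, pd]
      simp only [h0]
      congr 1; exact Subsingleton.elim _ _
    · intro i _
      rw [wedge_zero, ofCovector_zero_deg]; simp
  | succ n ih =>
    refine form_ext_succ fun v => ?_
    rw [← pd_iota_const (SmoothFamAt.pull hS hα)]
    simp only [iota_pull]
    have hSv : ContDiffAt ℝ ∞ (fun u => shearMap (τ u) v) x := hS.clm_apply contDiffAt_const
    have hder : fderiv ℝ (fun u => shearMap (τ u) v) x w =
        ∑ i, (fderiv ℝ (fun u => τ u i) x w v.1) • del W i := by
      have hd : HasFDerivAt (fun u => shearMap (τ u) v)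
          ((0 : X →L[ℝ] W).prod (ContinuousLinearMap.pi fun i =>
            (fderiv ℝ (fun u => τ u i) x).flip v.1)) x := by
        simp only [shearMap_apply]
        refine (hasFDerivAt_const v.1 x).prodMk ?_
        refine HasFDerivAt.const_add v.2 (hasFDerivAt_pi.2 fun i => ?_)
        exact ((((contDiffAt_pi.1 hτ i).differentiableAt (by simp)).hasFDerivAt).clm_apply
          (hasFDerivAt_const v.1 x)).congr_fderiv (by ext; simp)
      rw [hd.fderiv]
      refine Prod.ext ?_ ?_
      · simp [Prod.fst_sum, del]
      · funext j
        simp [Prod.snd_sum, del, Pi.single_apply]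
    rw [ih (hα.iota hSv), pd_iota hα w hSv, hder]
    have hsum : ∀ s : Finset (Fin k), iota (∑ i ∈ s, (fderiv ℝ (fun u => τ u i) x w v.1) • del W i)
        (α x) = ∑ i ∈ s, (fderiv ℝ (fun u => τ u i) x w v.1) • iota (del W i) (α x) := by
      intro s
      induction s using Finset.induction_on with
      | empty => simp
      | insert a s ha ih =>
        rw [Finset.sum_insert ha, iota_vadd, ih, iota_vsmul, Finset.sum_insert ha]
    rw [hsum, iota_add, iota_sum]
    simp only [iota_covector_wedge, iota_pull, pull_add, pull_sum, pull_rsmul,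
      Finset.sum_sub_distrib, ContinuousLinearMap.comp_apply, ContinuousLinearMap.coe_fst',
      Pi.add_apply, Pi.sub_apply, add_assoc]
    congr 1
    rw [sub_eq_add_neg]
    congr 1
    simp only [Finset.sum_apply]
    rw [← Finset.sum_neg_distrib]
    refine Finset.sum_congr rfl fun i _ => ?_
    rw [iota_iota, pull_neg, wedge_neg_right]
    rfl

variable (W) in
/-- A chosen frame of a finite dimensional vector space. -/
def frameVec : Fin (Module.finrank ℝ W) → W := (exists_dual_frame W).choose

variable (W) in
/-- The coframe dual to `frameVec`. -/
def frameCov : Fin (Module.finrank ℝ W) → W →L[ℝ] ℝ := (exists_dual_frame W).choose_spec.choose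

theorem sum_frameCov (w : W) : ∑ i, frameCov W i w • frameVec W i = w :=
  (exists_dual_frame W).choose_spec.choose_spec w

/-- The base part `∑ eʲ ∧ ∂ⱼ` of the exterior derivative of an invariant form. -/
def baseD (α : W → PForm (W × (Fin k → ℝ))) (u : W) : PForm (W × (Fin k → ℝ)) :=
  ∑ j, wedge (basic (ofCovector (frameCov W j))) (pd (frameVec W j) α u)

/-- The exterior derivative of an invariant form in a frame with curvatures `F`. -/
def frameD (F : Fin k → PForm W) (α : W → PForm (W × (Fin k → ℝ))) (u : W) :
    PForm (W × (Fin k → ℝ)) :=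
  baseD α u + ∑ i, wedge (basic (F i)) (iota (del W i) (α u))

theorem flatD_pull_shearMap {θ : W → Fin k → W →L[ℝ] ℝ} {u : W} (hθ : ContDiffAt ℝ ∞ θ u)
    {α : W → PForm (W × (Fin k → ℝ))} (hα : SmoothFamAt α u) (s : Fin k → ℝ) :
    flatD (fun z : W × (Fin k → ℝ) => pull (shearMap (θ z.1)) (α z.1)) (u, s) =
      pull (shearMap (θ u)) (frameD (fun i => flatD (fun y => ofCovector (θ y i)) u) α u) := by
  set e : Fin (Module.finrank ℝ W) ⊕ Fin k → W × (Fin k → ℝ) :=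
    Sum.elim (fun j => (frameVec W j, 0)) (fun i => del W i) with he
  set f : Fin (Module.finrank ℝ W) ⊕ Fin k → W × (Fin k → ℝ) →L[ℝ] ℝ :=
    Sum.elim (fun j => (frameCov W j).comp (ContinuousLinearMap.fst ℝ _ _)) (fun i => ds W i) with hf
  have hef : ∀ v, ∑ i, f i v • e i = v := by
    intro v
    rw [Fintype.sum_sum_type]
    refine Prod.ext ?_ ?_
    · simp [e, f, Prod.fst_sum, del, sum_frameCov]
    · funext l
      simp [e, f, Prod.snd_sum, del, ds_apply, Pi.single_apply]
  have hS := contDiffAt_shearMap hθ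
  have hsm : SmoothFamAt (fun z : W × (Fin k → ℝ) => pull (shearMap (θ z.1)) (α z.1)) (u, s) :=
    SmoothFamAt.comp (α := fun y => pull (shearMap (θ y)) (α y)) (f := Prod.fst) (y := (u, s))
      (SmoothFamAt.pull hS hα) contDiffAt_fst
  have hpd : ∀ v : W × (Fin k → ℝ),
      pd v (fun z : W × (Fin k → ℝ) => pull (shearMap (θ z.1)) (α z.1)) (u, s) =
        pd v.1 (fun y => pull (shearMap (θ y)) (α y)) u := by
    intro v
    funext n
    have h1 := ((SmoothFamAt.pull hS hα).differentiableAt n).hasFDerivAt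
    have h2 := HasFDerivAt.comp (f := Prod.fst) (u, s) h1
      (hasFDerivAt_fst (p := ((u, s) : W × (Fin k → ℝ))))
    exact congrArg (fun a => a v) h2.fderiv
  rw [flatD_eq_sum e f hef hsm, Fintype.sum_sum_type]
  simp only [hpd]
  have hz : ∀ i : Fin k, pd (e (Sum.inr i)).1 (fun y => pull (shearMap (θ y)) (α y)) u = 0 := by
    intro i
    funext n
    simp [pd, e, del]
  simp only [hz, wedge_zero_right, Finset.sum_const_zero, add_zero]
  have h3 : ∀ j, (e (Sum.inl j)).1 = frameVec W j := fun j => rfl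
  have h4 : ∀ j, ofCovector (f (Sum.inl j)) = basic (ofCovector (frameCov W j)) := fun j => by
    rw [basic, pull_ofCovector]; rfl
  simp only [h3, h4, pd_pull_shearMap hθ hα, wedge_add_right, Finset.sum_add_distrib, frameD, baseD,
    pull_add, pull_sum, pull_wedge, pull_shearMap_basic]
  congr 1
  simp only [wedge_sum_right]
  rw [Finset.sum_comm]
  refine Finset.sum_congr rfl fun i _ => ?_
  have h5 : flatD (fun y => ofCovector (θ y i)) u = ∑ j, wedge (ofCovector (frameCov W j))
      (ofCovector (fderiv ℝ (fun y => θ y i) u (frameVec W j))) := by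
    rw [flatD_eq_sum _ _ sum_frameCov (SmoothFamAt.ofCovector (contDiffAt_pi.1 hθ i))]
    simp only [pd_ofCovector (contDiffAt_pi.1 hθ i)]
  rw [h5, basic, pull_sum, wedge_sum_left]
  refine Finset.sum_congr rfl fun j _ => ?_
  rw [pull_wedge, wedge_assoc, pull_ofCovector (ContinuousLinearMap.fst ℝ W (Fin k → ℝ))
    (fderiv ℝ (fun y => θ y i) u (frameVec W j))]
  rfl

/-! ### The twisted differential in a frame -/

/-- The untwisted part of `frameTwistD`. -/
def frameNabla (F F' : Fin (k + 1) → PForm W) (h : PForm W) (α : W → PForm (W × (Fin k → ℝ)))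
    (u : W) : PForm (W × (Fin k → ℝ)) :=
  baseD α u + ∑ i : Fin k, wedge (basic (F i.succ)) (iota (del W i) (α u)) +
    (wedge (basic h) (α u) +
      ∑ i : Fin k, wedge (basic (F' i.succ)) (wedge (ofCovector (ds W i)) (α u)))

/-- The twisted differential of a torus-invariant pair in a frame with curvatures `F`, where the
dual bundle has curvatures `F'` and the basic component of the three-form is `h`. -/
def frameTwistD (s : ℝ) (F F' : Fin (k + 1) → PForm W) (h : PForm W)
    (p : W → PForm (W × (Fin k → ℝ)) × PForm (W × (Fin k → ℝ))) (u : W) :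
    PForm (W × (Fin k → ℝ)) × PForm (W × (Fin k → ℝ)) :=
  (frameNabla F F' h (fun y => (p y).1) u + s • wedge (basic (F 0)) (p u).2,
    s • wedge (basic (F' 0)) (p u).1 - frameNabla F F' h (fun y => (p y).2) u)

/-- The three-form of the twist in a frame. -/
def frameH3 (k : ℕ) (F' : Fin (k + 1) → PForm W) (h : PForm W) : PForm (W × (Fin k → ℝ)) :=
  basic h + ∑ i : Fin k, wedge (basic (F' i.succ)) (ofCovector (ds W i))

theorem frameNabla_eq (F F' : Fin (k + 1) → PForm W) (h : PForm W)
    (α : W → PForm (W × (Fin k → ℝ))) (u : W) : frameNabla F F' h α u =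
      frameD (fun i => F i.succ) α u + wedge (frameH3 k F' h) (α u) := by
  simp only [frameNabla, frameD, frameH3, wedge_add_left, wedge_sum_left, wedge_assoc]

omit [FiniteDimensional ℝ W] in
theorem torusVec_reflect_basic (ξ : W →L[ℝ] ℝ) :
    reflect (torusVec W (n := k)) (0, ξ.comp (ContinuousLinearMap.fst ℝ _ _)) =
      (0, ξ.comp (ContinuousLinearMap.fst ℝ _ _)) := by
  rw [reflect_apply, Finset.sum_eq_zero, add_zero]
  intro i _
  simp [inGT, torusVec, del]

omit [FiniteDimensional ℝ W] in
theorem torusVec_reflect_del (i : Fin k) :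
    reflect (torusVec W (n := k)) (del W i, 0) = (0, ds W i) := by
  rw [reflect_apply, Finset.sum_eq_single i]
  · simp only [inGT, torusVec, ds_del, neg_apply, if_true]
    refine Prod.ext ?_ ?_
    · simp only [Prod.fst_add, Prod.smul_fst, zero_apply]
      module
    · simp only [Prod.snd_add, Prod.smul_snd, zero_apply]
      module
  · intro j _ hj
    simp [inGT, torusVec, ds_del, hj]
  · simp

omit [FiniteDimensional ℝ W] in
theorem torusVec_reflect_ds (i : Fin k) :
    reflect (torusVec W (n := k)) (0, ds W i) = (del W i, 0) := by
  rw [← torusVec_reflect_del, (torusVec_negOrthonormal W).reflect_reflect]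

theorem cliffProd_frameNabla {F F' : Fin (k + 1) → PForm W} {h : PForm W}
    (hF : ∀ i, gradeInv (F i) = F i) (hF' : ∀ i, gradeInv (F' i) = F' i) (hh : gradeInv h = -h)
    {α : W → PForm (W × (Fin k → ℝ))} {u : W} (hα : SmoothFamAt α u) :
    frameNabla F' F h (fun y => cliffProd (torusVec W) (α y)) u =
      ((-1 : ℝ) ^ k) • cliffProd (torusVec W) (frameNabla F F' h α u) := by
  have hk : ((-1 : ℝ) ^ k) * (-1 : ℝ) ^ k = 1 := by rw [← mul_pow]; simp
  have hT := torusVec_negOrthonormal W (n := k)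
  have h1 : ∀ (β : PForm W) (_ : gradeInv β = β) (φ : PForm (W × (Fin k → ℝ))),
      cliffProd (torusVec W) (wedge (basic β) φ) = wedge (basic β) (cliffProd (torusVec W) φ) := by
    intro β hβ φ
    have := cliffProd_torusVec_wedge_basic W 1 β (by rw [hβ, one_smul]) φ
    rwa [one_pow, one_smul] at this
  have h2 : cliffProd (torusVec W) (wedge (basic h) (α u)) =
      ((-1 : ℝ) ^ k) • wedge (basic h) (cliffProd (torusVec W) (α u)) :=
    cliffProd_torusVec_wedge_basic W (-1) h (by rw [hh, pform_neg_one_rsmul]) _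
  have h3 : ∀ (i : Fin k) (φ : PForm (W × (Fin k → ℝ))), cliffProd (torusVec W) (iota (del W i) φ) =
      ((-1 : ℝ) ^ k) • wedge (ofCovector (ds W i)) (cliffProd (torusVec W) φ) := by
    intro i φ
    rw [← cliff_vector, hT.cliffProd_cliff, torusVec_reflect_del, cliff_covector]
  have h4 : ∀ (i : Fin k) (φ : PForm (W × (Fin k → ℝ))),
      cliffProd (torusVec W) (wedge (ofCovector (ds W i)) φ) =
      ((-1 : ℝ) ^ k) • iota (del W i) (cliffProd (torusVec W) φ) := by
    intro i φ
    rw [← cliff_covector, hT.cliffProd_cliff, torusVec_reflect_ds, cliff_vector]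
  have h5 : ∀ (ξ : W →L[ℝ] ℝ) (φ : PForm (W × (Fin k → ℝ))),
      cliffProd (torusVec W) (wedge (basic (ofCovector ξ)) φ) =
      ((-1 : ℝ) ^ k) • wedge (basic (ofCovector ξ)) (cliffProd (torusVec W) φ) := by
    intro ξ φ
    rw [basic, pull_ofCovector, ← cliff_covector, hT.cliffProd_cliff, torusVec_reflect_basic,
      cliff_covector]
  simp only [frameNabla, baseD, pd_cliffProd hα, cliffProd_add, cliffProd_sum, h1 _ (hF _),
    h1 _ (hF' _), h2, h3, h4, h5, smul_add, Finset.smul_sum, wedge_rsmul_right, smul_smul, hk,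
    one_smul]
  abel

/-- The dual pair of a torus-invariant pair has the dual twisted differential. -/
theorem frameTwistD_dualPair {ε : ℝ} (hε : ε * ε = 1) {F F' : Fin (k + 1) → PForm W} {h : PForm W}
    (hF : ∀ i, gradeInv (F i) = F i) (hF' : ∀ i, gradeInv (F' i) = F' i) (hh : gradeInv h = -h)
    {p : W → PForm (W × (Fin k → ℝ)) × PForm (W × (Fin k → ℝ))} {u : W}
    (h₁ : SmoothFamAt (fun y => (p y).1) u) (h₂ : SmoothFamAt (fun y => (p y).2) u) :
    frameTwistD (-ε) F' F h (fun y => dualPair ε (torusVec W) (p y)) u =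
      (-(-1 : ℝ) ^ k) • dualPair ε (torusVec W) (frameTwistD 1 F F' h p u) := by
  have hεc : (ε : ℂ) * ε = 1 := by exact_mod_cast hε
  have hk : ((-1 : ℂ) ^ k) * (-1 : ℂ) ^ k = 1 := by rw [← mul_pow]; simp
  have h1 : ∀ (β : PForm W) (_ : gradeInv β = β) (φ : PForm (W × (Fin k → ℝ))),
      cliffProd (torusVec W) (wedge (basic β) φ) = wedge (basic β) (cliffProd (torusVec W) φ) := by
    intro β hβ φ
    have := cliffProd_torusVec_wedge_basic W 1 β (by rw [hβ, one_smul]) φ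
    rwa [one_pow, one_smul] at this
  have hsm : ∀ (c : ℂ) {α : W → PForm (W × (Fin k → ℝ))} (_ : SmoothFamAt α u),
      frameNabla F' F h (fun y => c • α y) u = c • frameNabla F' F h α u := by
    intro c α hα
    simp only [frameNabla, baseD, pd_const_smul hα, iota_smul, wedge_smul_right, smul_add,
      Finset.smul_sum]
  refine Prod.ext ?_ ?_
  · simp only [frameTwistD, dualPair, hsm _ (h₂.cliffProd (torusVec W)),
      cliffProd_frameNabla hF hF' hh h₂, cliffProd_sub, h1 _ (hF' 0), wedge_smul_right, one_smul,
      Prod.smul_fst]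
    simp only [rsmul_eq_smul, smul_smul, smul_sub]
    rw [sub_eq_add_neg, add_comm, ← pform_neg_smul]
    push_cast
    congr 2
    · linear_combination -(-1 : ℂ) ^ k * Complex.I * hεc
    · ring
  · simp only [frameTwistD, dualPair, hsm _ (h₁.cliffProd (torusVec W)),
      cliffProd_frameNabla hF hF' hh h₁, cliffProd_add, h1 _ (hF 0), wedge_smul_right, one_smul,
      Prod.smul_snd]
    simp only [rsmul_eq_smul, smul_smul, smul_add]
    rw [sub_eq_add_neg, add_comm, ← pform_neg_smul]
    push_cast
    congr 2
    · ring
    · linear_combination (ε : ℂ) * Complex.I * hk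

/-- The differential twisted by three forms on a vector space. -/
def flatTwistD {V : Type*} [NormedAddCommGroup V] [NormedSpace ℝ V] (H3 H2 F : V → PForm V)
    (p : V → PForm V × PForm V) (z : V) : PForm V × PForm V :=
  (flatD (fun y => (p y).1) z + wedge (H3 z) (p z).1 + wedge (F z) (p z).2,
    wedge (H2 z) (p z).1 - flatD (fun y => (p y).2) z - wedge (H3 z) (p z).2)

theorem flatTwistD_pullPair_shearMap (s : ℝ) {θ : W → Fin k → W →L[ℝ] ℝ} {u : W}
    (hθ : ContDiffAt ℝ ∞ θ u) {F F' : Fin (k + 1) → PForm W} {h : PForm W}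
    (hF : ∀ i : Fin k, F i.succ = flatD (fun y => ofCovector (θ y i)) u)
    {H3 H2 F2 : W × (Fin k → ℝ) → PForm (W × (Fin k → ℝ))} {c : Fin k → ℝ}
    (hH3 : H3 (u, c) = pull (shearMap (θ u)) (frameH3 k F' h)) (hH2 : H2 (u, c) = s • basic (F' 0))
    (hF2 : F2 (u, c) = s • basic (F 0))
    {p : W → PForm (W × (Fin k → ℝ)) × PForm (W × (Fin k → ℝ))}
    (h₁ : SmoothFamAt (fun y => (p y).1) u) (h₂ : SmoothFamAt (fun y => (p y).2) u) :
    flatTwistD H3 H2 F2 (fun z => pullPair (shearMap (θ z.1)) (p z.1)) (u, c) =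
      pullPair (shearMap (θ u)) (frameTwistD s F F' h p u) := by
  refine Prod.ext ?_ ?_
  · simp only [flatTwistD, pullPair, hH3, hF2, frameTwistD, frameNabla_eq]
    rw [flatD_pull_shearMap hθ h₁]
    simp only [hF, pull_add, pull_wedge, pull_rsmul, wedge_rsmul_left, pull_shearMap_basic]
  · simp only [flatTwistD, pullPair, hH3, hH2, frameTwistD, frameNabla_eq]
    rw [flatD_pull_shearMap hθ h₂]
    simp only [hF, pull_add, pull_sub, pull_wedge, pull_rsmul, wedge_rsmul_left,
      pull_shearMap_basic]
    abel

end Shear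

/-! ### Fields of forms and smooth maps from a vector space -/

theorem two_le_infty : (2 : WithTop ℕ∞) ≤ ∞ := by
  exact WithTop.coe_le_coe.2 (le_top : (2 : ℕ∞) ≤ ⊤)

section Charts

variable {V E N : Type*} [NormedAddCommGroup V] [NormedSpace ℝ V]
  [NormedAddCommGroup E] [NormedSpace ℝ E] [TopologicalSpace N] [ChartedSpace E N]
  [IsManifold 𝓘(ℝ, E) ∞ N] {Ψ : V → N} {z : V} {x₀ : N}

theorem contMDiffAt_eventually (hΨ : ContMDiffAt 𝓘(ℝ, V) 𝓘(ℝ, E) ∞ Ψ z) :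
    ∀ᶠ y in nhds z, ContMDiffAt 𝓘(ℝ, V) 𝓘(ℝ, E) 2 Ψ y :=
  (contMDiffAt_iff_contMDiffAt_nhds (n := 2) (by simp)).1 (hΨ.of_le two_le_infty)

theorem contDiffAt_extChartAt_comp (hΨ : ContMDiffAt 𝓘(ℝ, V) 𝓘(ℝ, E) ∞ Ψ z)
    (hx : Ψ z ∈ (chartAt E x₀).source) :
    ContDiffAt ℝ ∞ (fun y => extChartAt 𝓘(ℝ, E) x₀ (Ψ y)) z :=
  contMDiffAt_iff_contDiffAt.1 ((contMDiffAt_extChartAt' hx).comp z hΨ)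

theorem mdifferentiableAt_extChartAt_symm {u : E} (hu : u ∈ (extChartAt 𝓘(ℝ, E) x₀).target) :
    MDifferentiableAt 𝓘(ℝ, E) 𝓘(ℝ, E) (extChartAt 𝓘(ℝ, E) x₀).symm u :=
  ((contMDiffOn_extChartAt_symm (n := ∞) x₀).contMDiffAt
    ((isOpen_extChartAt_target x₀).mem_nhds hu)).mdifferentiableAt (by simp)

theorem mfderiv_extChartAt_symm_comp (hΨ : MDifferentiableAt 𝓘(ℝ, V) 𝓘(ℝ, E) Ψ z)
    (hx : Ψ z ∈ (chartAt E x₀).source) :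
    ((mfderiv 𝓘(ℝ, E) 𝓘(ℝ, E) (extChartAt 𝓘(ℝ, E) x₀).symm (extChartAt 𝓘(ℝ, E) x₀ (Ψ z)) :
      E →L[ℝ] E)).comp (fderiv ℝ (fun y => extChartAt 𝓘(ℝ, E) x₀ (Ψ y)) z) =
      (mfderiv 𝓘(ℝ, V) 𝓘(ℝ, E) Ψ z : V →L[ℝ] E) := by
  have hs : Ψ z ∈ (extChartAt 𝓘(ℝ, E) x₀).source := by rwa [extChartAt_source]
  have h1 := mdifferentiableAt_extChartAt_symm ((extChartAt 𝓘(ℝ, E) x₀).map_source hs)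
  have h2 : MDifferentiableAt 𝓘(ℝ, V) 𝓘(ℝ, E) (fun y => extChartAt 𝓘(ℝ, E) x₀ (Ψ y)) z :=
    ((contMDiffAt_extChartAt' (n := ∞) hx).mdifferentiableAt (by simp)).comp z hΨ
  have h3 := mfderiv_comp z h1 h2
  rw [mfderiv_eq_fderiv] at h3
  refine h3.symm.trans ?_
  refine Filter.EventuallyEq.mfderiv_eq ?_
  filter_upwards [hΨ.continuousAt ((chartAt E x₀).open_source.mem_nhds hx)] with y hy
  exact (extChartAt 𝓘(ℝ, E) x₀).left_inv (by rw [extChartAt_source]; exact hy)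

theorem pullback_eq_chartRep (φ : N → PForm E) (hΨ : MDifferentiableAt 𝓘(ℝ, V) 𝓘(ℝ, E) Ψ z)
    (hx : Ψ z ∈ (chartAt E x₀).source) :
    pullback Ψ φ z = pull (fderiv ℝ (fun y => extChartAt 𝓘(ℝ, E) x₀ (Ψ y)) z)
      (fun k => chartRep 𝓘(ℝ, E) (fun x => φ x k) x₀ (extChartAt 𝓘(ℝ, E) x₀ (Ψ z))) := by
  have hs : Ψ z ∈ (extChartAt 𝓘(ℝ, E) x₀).source := by rwa [extChartAt_source]
  funext k
  ext v
  simp only [pullback, pull_apply, chartRep, (extChartAt 𝓘(ℝ, E) x₀).left_inv hs,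
    ← mfderiv_extChartAt_symm_comp hΨ hx]
  rfl

theorem eventually_pullback_eq_chartRep (φ : N → PForm E)
    (hΨ : ContMDiffAt 𝓘(ℝ, V) 𝓘(ℝ, E) ∞ Ψ z) (hx : Ψ z ∈ (chartAt E x₀).source) :
    ∀ᶠ y in nhds z, pullback (E' := V) Ψ φ y = pull (fderiv ℝ (fun y => extChartAt 𝓘(ℝ, E) x₀ (Ψ y)) y)
      (fun k => chartRep 𝓘(ℝ, E) (fun x => φ x k) x₀ (extChartAt 𝓘(ℝ, E) x₀ (Ψ y))) := by
  filter_upwards [contMDiffAt_eventually hΨ,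
    hΨ.continuousAt ((chartAt E x₀).open_source.mem_nhds hx)] with y hy hy'
  exact pullback_eq_chartRep φ (hy.mdifferentiableAt (by simp)) hy'

omit [IsManifold 𝓘(ℝ, E) ∞ N] in
theorem SmoothFormOn.contDiffAt_chartRep {φ : N → PForm E} {U : Set N}
    (h : SmoothFormOn 𝓘(ℝ, E) φ U) (hU : IsOpen U) {x : N} (hx : x ∈ (chartAt E x₀).source)
    (hxU : x ∈ U) : SmoothFamAt (fun u k => chartRep 𝓘(ℝ, E) (fun x => φ x k) x₀ u)
      (extChartAt 𝓘(ℝ, E) x₀ x) := by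
  have hs : x ∈ (extChartAt 𝓘(ℝ, E) x₀).source := by rwa [extChartAt_source]
  intro k
  refine (h k x₀).contDiffAt (IsOpen.mem_nhds ?_ ?_)
  · exact (continuousOn_extChartAt_symm x₀).isOpen_inter_preimage (isOpen_extChartAt_target x₀) hU
  · refine ⟨(extChartAt 𝓘(ℝ, E) x₀).map_source hs, ?_⟩
    rwa [Set.mem_preimage, (extChartAt 𝓘(ℝ, E) x₀).left_inv hs]

theorem SmoothFormOn.smoothFamAt_pullback [FiniteDimensional ℝ V] {φ : N → PForm E} {U : Set N}
    (h : SmoothFormOn 𝓘(ℝ, E) φ U)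
    (hU : IsOpen U) (hΨ : ContMDiffAt 𝓘(ℝ, V) 𝓘(ℝ, E) ∞ Ψ z) (hz : Ψ z ∈ U) :
    SmoothFamAt (pullback (E' := V) Ψ φ) z := by
  have hx : Ψ z ∈ (chartAt E (Ψ z)).source := mem_chart_source E _
  have hg := contDiffAt_extChartAt_comp hΨ hx
  refine SmoothFamAt.congr ?_ (eventually_pullback_eq_chartRep φ hΨ hx)
  exact SmoothFamAt.pull (hg.fderiv_right (by simp))
    (SmoothFamAt.comp (f := fun y => extChartAt 𝓘(ℝ, E) (Ψ z) (Ψ y)) (h.contDiffAt_chartRep hU hx hz) hg)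

theorem fderiv_extChartAt_self_comp (hΨ : MDifferentiableAt 𝓘(ℝ, V) 𝓘(ℝ, E) Ψ z) :
    fderiv ℝ (fun y => extChartAt 𝓘(ℝ, E) (Ψ z) (Ψ y)) z =
      (mfderiv 𝓘(ℝ, V) 𝓘(ℝ, E) Ψ z : V →L[ℝ] E) := by
  have h := mfderiv_comp z ((contMDiffAt_extChartAt (n := ∞)).mdifferentiableAt (by simp)) hΨ
  rw [mfderiv_extChartAt_self] at h
  rw [← mfderiv_eq_fderiv]
  exact h

theorem flatD_pullback {φ : N → PForm E} {U : Set N} (h : SmoothFormOn 𝓘(ℝ, E) φ U)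
    (hU : IsOpen U) (hΨ : ContMDiffAt 𝓘(ℝ, V) 𝓘(ℝ, E) ∞ Ψ z) (hz : Ψ z ∈ U) :
    flatD (pullback (E' := V) Ψ φ) z = pullback (E' := V) Ψ (extD 𝓘(ℝ, E) φ) z := by
  have hx : Ψ z ∈ (chartAt E (Ψ z)).source := mem_chart_source E _
  have hg := contDiffAt_extChartAt_comp hΨ hx
  rw [flatD_congr (eventually_pullback_eq_chartRep φ hΨ hx)]
  funext k
  cases k with
  | zero => rfl
  | succ k =>
    have := extDeriv_pullback (r := ∞) (f := fun y => extChartAt 𝓘(ℝ, E) (Ψ z) (Ψ y)) (x := z)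
      (((h.contDiffAt_chartRep hU hx hz) k).differentiableAt (by simp)) hg
      (by simpa using two_le_infty)
    rw [fderiv_extChartAt_self_comp (hΨ.mdifferentiableAt (by simp))] at this
    exact this

end Charts

/-! ### Local parametrizations of manifolds -/

section Params

variable {V E N : Type*} [NormedAddCommGroup V] [NormedSpace ℝ V]
  [NormedAddCommGroup E] [NormedSpace ℝ E] [TopologicalSpace N] [ChartedSpace E N]
  {Ψ : V → N} {d : V → V ≃L[ℝ] E} {z : V}

/-- `Ψ` is smooth at `z` and near `z` its differential is the isomorphism `d`. -/
structure IsParam (Ψ : V → N) (d : V → V ≃L[ℝ] E) (z : V) : Prop where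
  smooth : ContMDiffAt 𝓘(ℝ, V) 𝓘(ℝ, E) ∞ Ψ z
  mfderiv_eq : ∀ᶠ y in nhds z, (d y : V →L[ℝ] E) = (mfderiv 𝓘(ℝ, V) 𝓘(ℝ, E) Ψ y : V →L[ℝ] E)

variable [IsManifold 𝓘(ℝ, E) ∞ N]

theorem IsParam.exists_localInverse [CompleteSpace V] (h : IsParam Ψ d z) {x₀ : N}
    (hx : Ψ z ∈ (chartAt E x₀).source) :
    ∃ g : E → V, ContDiffAt ℝ ∞ g (extChartAt 𝓘(ℝ, E) x₀ (Ψ z)) ∧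
      g (extChartAt 𝓘(ℝ, E) x₀ (Ψ z)) = z ∧
      (∀ᶠ u in nhds (extChartAt 𝓘(ℝ, E) x₀ (Ψ z)), extChartAt 𝓘(ℝ, E) x₀ (Ψ (g u)) = u) ∧
      ∀ᶠ y in nhds z, g (extChartAt 𝓘(ℝ, E) x₀ (Ψ y)) = y := by
  have hf := contDiffAt_extChartAt_comp h.smooth hx
  set f : V → E := fun y => extChartAt 𝓘(ℝ, E) x₀ (Ψ y) with hfdef
  have hs : Ψ z ∈ (extChartAt 𝓘(ℝ, E) x₀).source := by rwa [extChartAt_source]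
  have h1 : (fderiv ℝ f z) =
      ((mfderiv 𝓘(ℝ, E) 𝓘(ℝ, E) (extChartAt 𝓘(ℝ, E) x₀) (Ψ z) : E →L[ℝ] E)).comp
        (d z : V →L[ℝ] E) := by
    have h2 := mfderiv_comp z ((contMDiffAt_extChartAt' (n := ∞) hx).mdifferentiableAt (by simp))
      (h.smooth.mdifferentiableAt (by simp))
    rw [h.mfderiv_eq.self_of_nhds, ← mfderiv_eq_fderiv]
    exact h2
  have hinv : ((mfderiv 𝓘(ℝ, E) 𝓘(ℝ, E) (extChartAt 𝓘(ℝ, E) x₀) (Ψ z) : E →L[ℝ] E)).IsInvertible :=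
    isInvertible_mfderiv_extChartAt hs
  obtain ⟨e, he⟩ := hinv
  have hf' : HasFDerivAt f (((d z).trans e : V ≃L[ℝ] E) : V →L[ℝ] E) z := by
    have := (hf.differentiableAt (by simp)).hasFDerivAt
    rw [h1, ← he] at this
    exact this
  have hn : (∞ : WithTop ℕ∞) ≠ 0 := by simp
  refine ⟨hf.localInverse hf' hn, hf.to_localInverse hf' hn, hf.localInverse_apply_image hf' hn,
    ?_, ?_⟩
  · exact (hf.hasStrictFDerivAt' hf' hn).eventually_right_inverse
  · exact (hf.hasStrictFDerivAt' hf' hn).eventually_left_inverse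

omit [IsManifold 𝓘(ℝ, E) ∞ N] in
theorem IsParam.pull_eventuallyEq (h : IsParam Ψ d z) (φ : N → PForm E) :
    (fun y => pull (d y : V →L[ℝ] E) (φ (Ψ y))) =ᶠ[nhds z] pullback (E' := V) Ψ φ := by
  filter_upwards [h.mfderiv_eq] with y hy
  rw [hy]
  rfl

theorem IsParam.smoothFamAt [FiniteDimensional ℝ V] (h : IsParam Ψ d z) {φ : N → PForm E}
    {U : Set N} (hφ : SmoothFormOn 𝓘(ℝ, E) φ U) (hU : IsOpen U) (hz : Ψ z ∈ U) :
    SmoothFamAt (fun y => pull (d y : V →L[ℝ] E) (φ (Ψ y))) z :=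
  (hφ.smoothFamAt_pullback hU h.smooth hz).congr (h.pull_eventuallyEq φ)

theorem IsParam.flatD_pull (h : IsParam Ψ d z) {φ : N → PForm E}
    {U : Set N} (hφ : SmoothFormOn 𝓘(ℝ, E) φ U) (hU : IsOpen U) (hz : Ψ z ∈ U) :
    flatD (fun y => pull (d y : V →L[ℝ] E) (φ (Ψ y))) z =
      pull (d z : V →L[ℝ] E) (extD 𝓘(ℝ, E) φ (Ψ z)) := by
  rw [flatD_congr (h.pull_eventuallyEq φ), flatD_pullback hφ hU h.smooth hz,
    h.mfderiv_eq.self_of_nhds]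
  rfl

theorem smoothFormOn_of_isParam [FiniteDimensional ℝ V] [FiniteDimensional ℝ E] {φ : N → PForm E}
    {U : Set N} (H : ∀ x ∈ U, ∃ (Ψ : V → N) (d : V → V ≃L[ℝ] E) (z : V), Ψ z = x ∧
      IsParam Ψ d z ∧ SmoothFamAt (fun y => pull (d y : V →L[ℝ] E) (φ (Ψ y))) z) :
    SmoothFormOn 𝓘(ℝ, E) φ U := by
  have : CompleteSpace V := FiniteDimensional.complete ℝ V
  intro k x₀ u₀ hu₀
  obtain ⟨Ψ, d, z, hz, hp, hs⟩ := H _ hu₀.2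
  have hx : Ψ z ∈ (chartAt E x₀).source := by
    rw [hz, ← extChartAt_source 𝓘(ℝ, E)]
    exact (extChartAt 𝓘(ℝ, E) x₀).map_target hu₀.1
  have hu : extChartAt 𝓘(ℝ, E) x₀ (Ψ z) = u₀ := by
    rw [hz]; exact (extChartAt 𝓘(ℝ, E) x₀).right_inv hu₀.1
  obtain ⟨g, hg, hgz, hright, -⟩ := hp.exists_localInverse hx
  rw [hu] at hg hgz hright
  refine ContDiffAt.contDiffWithinAt ?_
  have hs' : SmoothFamAt (pullback (E' := V) Ψ φ) z := hs.congr (hp.pull_eventuallyEq φ).symm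
  have hmain : SmoothFamAt (fun u => pull (fderiv ℝ g u) (pullback (E' := V) Ψ φ (g u))) u₀ := by
    refine SmoothFamAt.pull (hg.fderiv_right (by simp)) (SmoothFamAt.comp (f := g) ?_ hg)
    rwa [hgz]
  refine (hmain k).congr_of_eventuallyEq ?_
  have hcont : Filter.Tendsto g (nhds u₀) (nhds z) := by
    have := hg.continuousAt.tendsto
    rwa [hgz] at this
  have hgd : ∀ᶠ u in nhds u₀, DifferentiableAt ℝ g u := by
    filter_upwards [(hg.of_le (two_le_infty)).eventually (by simp)] with u hu
    exact hu.differentiableAt (by simp)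
  have hfd : ∀ᶠ y in nhds z, DifferentiableAt ℝ (fun y => extChartAt 𝓘(ℝ, E) x₀ (Ψ y)) y := by
    filter_upwards [((contDiffAt_extChartAt_comp hp.smooth hx).of_le two_le_infty).eventually
      (by simp)] with u hu
    exact hu.differentiableAt (by simp)
  filter_upwards [hright, hright.eventually_nhds, hgd, hcont.eventually hfd,
    hcont.eventually (eventually_pullback_eq_chartRep φ hp.smooth hx)] with u h1 h2 h3 h4 h5
  rw [h5]
  have h6 : (fderiv ℝ (fun y => extChartAt 𝓘(ℝ, E) x₀ (Ψ y)) (g u)).comp (fderiv ℝ g u) =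
      ContinuousLinearMap.id ℝ E := by
    have h7 := h4.hasFDerivAt.comp u h3.hasFDerivAt
    have h8 : HasFDerivAt ((fun y => extChartAt 𝓘(ℝ, E) x₀ (Ψ y)) ∘ g)
      (ContinuousLinearMap.id ℝ E) u := (hasFDerivAt_id u).congr_of_eventuallyEq h2
    exact h7.unique h8
  ext v
  simp only [pull_apply, h1]
  congr 1
  funext i
  exact (congrArg (fun L => L (v i)) h6).symm

theorem contMDiffAt_vectorField_iff (X : N → E) (x₀ : N) :
    ContMDiffAt 𝓘(ℝ, E) 𝓘(ℝ, E).tangent ∞ (fun x => (⟨x, X x⟩ : TangentBundle 𝓘(ℝ, E) N)) x₀ ↔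
      ContMDiffAt 𝓘(ℝ, E) 𝓘(ℝ, E) ∞
        (fun x => (mfderiv 𝓘(ℝ, E) 𝓘(ℝ, E) (extChartAt 𝓘(ℝ, E) x₀) x : E →L[ℝ] E) (X x)) x₀ := by
  have h := Bundle.contMDiffAt_section (IB := 𝓘(ℝ, E)) (n := ∞) (F := E)
    (E := (TangentSpace 𝓘(ℝ, E) : N → Type _)) (s := X) x₀
  refine h.trans ?_
  refine Filter.EventuallyEq.contMDiffAt_iff ?_
  filter_upwards [(chartAt E x₀).open_source.mem_nhds (mem_chart_source E x₀)] with x hx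
  have h1 := TangentBundle.continuousLinearMapAt_trivializationAt (I := 𝓘(ℝ, E)) (x₀ := x₀) hx
  have h2 := Bundle.Trivialization.coe_linearMapAt_of_mem (R := ℝ)
    (trivializationAt E (TangentSpace 𝓘(ℝ, E)) x₀) (b := x) hx
  have h3 := congrFun h2 (X x)
  exact h3.symm.trans (congrArg (fun L : E →L[ℝ] E => L (X x)) h1)

omit [IsManifold 𝓘(ℝ, E) ∞ N] in
theorem IsParam.contDiffAt_comp (h : IsParam Ψ d z) {f : N → ℝ} {U : Set N}
    (hf : SmoothFunOn (E := E) f U) (hU : IsOpen U) (hz : Ψ z ∈ U) :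
    ContDiffAt ℝ ∞ (fun y => f (Ψ y)) z :=
  contMDiffAt_iff_contDiffAt.1 ((hf.contMDiffAt (hU.mem_nhds hz)).comp z h.smooth)

theorem IsParam.exists_localInverse' [CompleteSpace V] (h : IsParam Ψ d z) :
    ∃ g : N → V, ContMDiffAt 𝓘(ℝ, E) 𝓘(ℝ, V) ∞ g (Ψ z) ∧ g (Ψ z) = z ∧
      (∀ᶠ x in nhds (Ψ z), Ψ (g x) = x) ∧ ∀ᶠ y in nhds z, g (Ψ y) = y := by
  have hx : Ψ z ∈ (chartAt E (Ψ z)).source := mem_chart_source E _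
  obtain ⟨g, hg, hgz, hright, hleft⟩ := h.exists_localInverse hx
  have hc : ContinuousAt (extChartAt 𝓘(ℝ, E) (Ψ z)) (Ψ z) := continuousAt_extChartAt _
  refine ⟨fun x => g (extChartAt 𝓘(ℝ, E) (Ψ z) x), ?_, hgz, ?_, hleft⟩
  · exact ContMDiffAt.comp (I' := 𝓘(ℝ, E)) (Ψ z) hg.contMDiffAt (contMDiffAt_extChartAt (n := ∞))
  · have h1 : ContinuousAt (fun x => Ψ (g (extChartAt 𝓘(ℝ, E) (Ψ z) x))) (Ψ z) := by
      refine ContinuousAt.comp (f := fun x => g (extChartAt 𝓘(ℝ, E) (Ψ z) x)) (g := Ψ) ?_ ?_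
      · rw [hgz]; exact h.smooth.continuousAt
      · exact ContinuousAt.comp (f := extChartAt 𝓘(ℝ, E) (Ψ z)) hg.continuousAt hc
    have h2 : ∀ᶠ x in nhds (Ψ z), Ψ (g (extChartAt 𝓘(ℝ, E) (Ψ z) x)) ∈ (chartAt E (Ψ z)).source := by
      refine h1.eventually_mem ((chartAt E (Ψ z)).open_source.mem_nhds ?_)
      simpa only [hgz] using hx
    filter_upwards [hc.eventually hright, h2,
      (chartAt E (Ψ z)).open_source.mem_nhds hx] with x h3 h4 h5
    refine (extChartAt 𝓘(ℝ, E) (Ψ z)).injOn ?_ ?_ h3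
    · rwa [extChartAt_source]
    · rwa [extChartAt_source]

theorem smoothFunOn_of_isParam [FiniteDimensional ℝ V] {f : N → ℝ} {U : Set N}
    (H : ∀ x ∈ U, ∃ (Ψ : V → N) (d : V → V ≃L[ℝ] E) (z : V), Ψ z = x ∧
      IsParam Ψ d z ∧ ContDiffAt ℝ ∞ (fun y => f (Ψ y)) z) : SmoothFunOn (E := E) f U := by
  have : CompleteSpace V := FiniteDimensional.complete ℝ V
  intro x hx
  obtain ⟨Ψ, d, z, rfl, hp, hs⟩ := H x hx
  obtain ⟨g, hg, hgz, hright, -⟩ := hp.exists_localInverse'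
  refine ContMDiffAt.contMDiffWithinAt ?_
  have h1 : ContMDiffAt 𝓘(ℝ, E) 𝓘(ℝ, ℝ) ∞ (fun x => f (Ψ (g x))) (Ψ z) :=
    ContMDiffAt.comp (I' := 𝓘(ℝ, V)) (g := fun y => f (Ψ y)) (Ψ z)
      (by rw [hgz]; exact hs.contMDiffAt) hg
  exact h1.congr_of_eventuallyEq (hright.mono fun x hx => (congrArg f hx).symm)

theorem contDiffAt_of_smoothFamAt_ofCovector {X : Type*} [NormedAddCommGroup X] [NormedSpace ℝ X]
    [FiniteDimensional ℝ V] {ξ : X → V →L[ℝ] ℝ} {x : X}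
    (h : SmoothFamAt (fun u => ofCovector (ξ u)) x) : ContDiffAt ℝ ∞ ξ x := by
  refine contDiffAt_clm_of_apply fun v => ?_
  have h1 := Complex.reCLM.contDiff.contDiffAt.comp x (contDiffAt_form_apply (h 1) fun _ => v)
  refine h1.congr_of_eventuallyEq (Filter.Eventually.of_forall fun u => ?_)
  simp [ofCovector, ofReal_same_apply]

theorem IsParam.contDiffAt_gtMap [FiniteDimensional ℝ V] (h : IsParam Ψ d z) {v : N → GT E}
    {U : Set N} (hv : SmoothGTOn v U) (hU : IsOpen U) (hz : Ψ z ∈ U) :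
    ContDiffAt ℝ ∞ (fun y => gtMap (d y).symm (v (Ψ y))) z := by
  have : CompleteSpace V := FiniteDimensional.complete ℝ V
  refine ContDiffAt.prodMk ?_ ?_
  · have hx : Ψ z ∈ (chartAt E (Ψ z)).source := mem_chart_source E _
    obtain ⟨g, hg, hgz, hright, hleft⟩ := h.exists_localInverse hx
    have hf := contDiffAt_extChartAt_comp h.smooth hx
    have hX := (contMDiffAt_vectorField_iff (fun x => (v x).1) (Ψ z)).1
      (hv.1.contMDiffAt (hU.mem_nhds hz))
    have hX' := contMDiffAt_iff_contDiffAt.1 (hX.comp z h.smooth)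
    have hmain : ContDiffAt ℝ ∞ (fun y => fderiv ℝ g (extChartAt 𝓘(ℝ, E) (Ψ z) (Ψ y))
        ((mfderiv 𝓘(ℝ, E) 𝓘(ℝ, E) (extChartAt 𝓘(ℝ, E) (Ψ z)) (Ψ y) : E →L[ℝ] E)
          (v (Ψ y)).1)) z :=
      ContDiffAt.clm_apply (ContDiffAt.comp (f := fun y => extChartAt 𝓘(ℝ, E) (Ψ z) (Ψ y)) z
        (hg.fderiv_right (by simp)) hf) hX'
    refine hmain.congr_of_eventuallyEq ?_
    have hgd : ∀ᶠ y in nhds z, DifferentiableAt ℝ g (extChartAt 𝓘(ℝ, E) (Ψ z) (Ψ y)) := by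
      refine hf.continuousAt.eventually ?_
      filter_upwards [(hg.of_le (two_le_infty)).eventually (by simp)] with u hu
      exact hu.differentiableAt (by simp)
    filter_upwards [h.mfderiv_eq, hleft.eventually_nhds, hgd, contMDiffAt_eventually h.smooth,
      h.smooth.continuousAt ((chartAt E (Ψ z)).open_source.mem_nhds hx)] with y h1 h2 h3 h4 h5
    have h6 := mfderiv_comp y ((contMDiffAt_extChartAt' (n := ∞) h5).mdifferentiableAt (by simp))
      (h4.mdifferentiableAt (by simp))
    have h4' : DifferentiableAt ℝ (fun y => extChartAt 𝓘(ℝ, E) (Ψ z) (Ψ y)) y :=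
      (contMDiffAt_iff_contDiffAt.1 (((contMDiffAt_extChartAt' (n := ∞) h5).of_le
        two_le_infty).comp y h4)).differentiableAt (by simp)
    rw [mfderiv_eq_fderiv] at h6
    have h7 := h3.hasFDerivAt.comp y h4'.hasFDerivAt
    have h8 : HasFDerivAt (g ∘ fun y => extChartAt 𝓘(ℝ, E) (Ψ z) (Ψ y))
      (ContinuousLinearMap.id ℝ V) y := (hasFDerivAt_id y).congr_of_eventuallyEq h2
    have h9 := h7.unique h8
    show (d y).symm (v (Ψ y)).1 = _
    set w := (d y).symm (v (Ψ y)).1 with hw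
    have hvw : (v (Ψ y)).1 = (mfderiv 𝓘(ℝ, V) 𝓘(ℝ, E) Ψ y : V →L[ℝ] E) w := by
      refine Eq.trans ?_ (congrArg (fun L : V →L[ℝ] E => L w) h1)
      exact ((d y).apply_symm_apply _).symm
    rw [hvw]
    have h10 := congrArg (fun L : V →L[ℝ] V => L w) h9
    have h11 := congrArg (fun L : V →L[ℝ] E => L w) h6
    exact h10.symm.trans (congrArg (fderiv ℝ g _) h11)
  · have h1 := h.smoothFamAt hv.2 hU hz
    simp only [pull_ofCovector] at h1
    exact contDiffAt_of_smoothFamAt_ofCovector h1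

theorem smoothGTOn_of_isParam [FiniteDimensional ℝ V] [FiniteDimensional ℝ E] {v : N → GT E}
    {U : Set N} (H : ∀ x ∈ U, ∃ (Ψ : V → N) (d : V → V ≃L[ℝ] E) (z : V), Ψ z = x ∧
      IsParam Ψ d z ∧ ContDiffAt ℝ ∞ (fun y => gtMap (d y).symm (v (Ψ y))) z) :
    SmoothGTOn v U := by
  have : CompleteSpace V := FiniteDimensional.complete ℝ V
  refine ⟨fun x hx => ?_, ?_⟩
  · obtain ⟨Ψ, d, z, rfl, hp, hs⟩ := H x hx
    refine ContMDiffAt.contMDiffWithinAt ?_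
    refine (contMDiffAt_vectorField_iff (fun x => (v x).1) (Ψ z)).2 ?_
    obtain ⟨g, hg, hgz, hright, hleft⟩ := hp.exists_localInverse'
    have hf := contDiffAt_extChartAt_comp hp.smooth (mem_chart_source E (Ψ z))
    have h1 : ContDiffAt ℝ ∞ (fun y => fderiv ℝ (fun y => extChartAt 𝓘(ℝ, E) (Ψ z) (Ψ y)) y
        ((d y).symm (v (Ψ y)).1)) z :=
      ContDiffAt.clm_apply (hf.fderiv_right (by simp)) (contDiffAt_fst.comp z hs)
    have h2 := ContMDiffAt.comp (I' := 𝓘(ℝ, V)) (f := g) (Ψ z)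
      (by rw [hgz]; exact h1.contMDiffAt) hg
    refine h2.congr_of_eventuallyEq ?_
    have hev : ∀ᶠ y in nhds z, ∀ w : E,
        (mfderiv 𝓘(ℝ, E) 𝓘(ℝ, E) (extChartAt 𝓘(ℝ, E) (Ψ z)) (Ψ y) : E →L[ℝ] E) w =
        fderiv ℝ (fun y => extChartAt 𝓘(ℝ, E) (Ψ z) (Ψ y)) y ((d y).symm w) := by
      filter_upwards [hp.mfderiv_eq, contMDiffAt_eventually hp.smooth, hp.smooth.continuousAt
        ((chartAt E (Ψ z)).open_source.mem_nhds (mem_chart_source E (Ψ z)))] with y h1 h4 h5 w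
      have h6 := mfderiv_comp y ((contMDiffAt_extChartAt' (n := ∞) h5).mdifferentiableAt (by simp))
        (h4.mdifferentiableAt (by simp))
      rw [mfderiv_eq_fderiv] at h6
      have hvw : w = (mfderiv 𝓘(ℝ, V) 𝓘(ℝ, E) Ψ y : V →L[ℝ] E) ((d y).symm w) := by
        refine Eq.trans ?_ (congrArg (fun L : V →L[ℝ] E => L ((d y).symm w)) h1)
        exact ((d y).apply_symm_apply _).symm
      have h11 := congrArg (fun L : V →L[ℝ] E => L ((d y).symm w)) h6
      refine Eq.trans ?_ h11.symm
      conv_lhs => rw [hvw]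
      rfl
    have hgc : Filter.Tendsto g (nhds (Ψ z)) (nhds z) := by
      have := hg.continuousAt.tendsto
      rwa [hgz] at this
    filter_upwards [hgc.eventually hev, hright] with x h3 h4
    have h5 := h3 (v x).1
    rw [h4] at h5
    rw [h5]
    simp only [Function.comp_apply, h4]
  · refine smoothFormOn_of_isParam (V := V) fun x hx => ?_
    obtain ⟨Ψ, d, z, hz, hp, hs⟩ := H x hx
    refine ⟨Ψ, d, z, hz, hp, ?_⟩
    simp only [pull_ofCovector]
    exact SmoothFamAt.ofCovector (contDiffAt_snd.comp z hs)

end Params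

variable {EB B EM M EP P EM' M' EP' P' : Type*}
  [NormedAddCommGroup EB] [NormedSpace ℝ EB] [TopologicalSpace B] [ChartedSpace EB B]
  [NormedAddCommGroup EM] [NormedSpace ℝ EM] [TopologicalSpace M] [ChartedSpace EM M]
  [NormedAddCommGroup EP] [NormedSpace ℝ EP] [TopologicalSpace P] [ChartedSpace EP P]
  [NormedAddCommGroup EM'] [NormedSpace ℝ EM'] [TopologicalSpace M'] [ChartedSpace EM' M']
  [NormedAddCommGroup EP'] [NormedSpace ℝ EP'] [TopologicalSpace P'] [ChartedSpace EP' P']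

/-! ### Differentials as maps of model spaces -/

section Differential

variable {E₁ N₁ E₂ N₂ E₃ N₃ : Type*}
  [NormedAddCommGroup E₁] [NormedSpace ℝ E₁] [TopologicalSpace N₁] [ChartedSpace E₁ N₁]
  [NormedAddCommGroup E₂] [NormedSpace ℝ E₂] [TopologicalSpace N₂] [ChartedSpace E₂ N₂]
  [NormedAddCommGroup E₃] [NormedSpace ℝ E₃] [TopologicalSpace N₃] [ChartedSpace E₃ N₃]

/-- The differential of `f` at `x`, as a map of the model spaces. -/
def diff (f : N₁ → N₂) (x : N₁) : E₁ →L[ℝ] E₂ := mfderiv 𝓘(ℝ, E₁) 𝓘(ℝ, E₂) f x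

theorem diff_comp {g : N₂ → N₃} {f : N₁ → N₂} (x : N₁)
    (hg : MDifferentiableAt 𝓘(ℝ, E₂) 𝓘(ℝ, E₃) g (f x))
    (hf : MDifferentiableAt 𝓘(ℝ, E₁) 𝓘(ℝ, E₂) f x) :
    (diff (fun y => g (f y)) x : E₁ →L[ℝ] E₃) =
      (diff g (f x) : E₂ →L[ℝ] E₃).comp (diff f x : E₁ →L[ℝ] E₂) := mfderiv_comp x hg hf

theorem diff_congr {f g : N₁ → N₂} {x : N₁} (h : f =ᶠ[nhds x] g) :
    (diff f x : E₁ →L[ℝ] E₂) = diff g x := h.mfderiv_eq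

theorem diff_const (y : N₂) (x : N₁) : (diff (fun _ : N₁ => y) x : E₁ →L[ℝ] E₂) = 0 :=
  mfderiv_const

theorem diff_id (x : N₁) : (diff (fun y => y) x : E₁ →L[ℝ] E₁) = ContinuousLinearMap.id ℝ E₁ :=
  mfderiv_id

theorem diff_eq_fderiv (f : E₁ → E₂) (x : E₁) : diff f x = fderiv ℝ f x := mfderiv_eq_fderiv

end Differential

/-! ### Frames of torus bundles -/

namespace TorusBundle

variable {n : ℕ} (T : TorusBundle n EP P EB B)

theorem mdifferentiableAt_proj (x : P) : MDifferentiableAt 𝓘(ℝ, EP) 𝓘(ℝ, EB) T.proj x :=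
  T.smooth_proj.mdifferentiable (by simp) x

theorem dact_eq (s : Fin n → ℝ) (x : P) : T.dact s x = diff (T.act s) x := rfl

theorem proj_act (s : Fin n → ℝ) (x : P) : T.proj (T.act s x) = T.proj x :=
  ((T.proj_eq_iff _ _).2 ⟨s, rfl⟩).symm

theorem contMDiff_act (s : Fin n → ℝ) : ContMDiff 𝓘(ℝ, EP) 𝓘(ℝ, EP) ∞ (T.act s) :=
  T.smooth_act.comp (contMDiff_const.prodMk contMDiff_id)

theorem mdifferentiableAt_act (s : Fin n → ℝ) (x : P) :
    MDifferentiableAt 𝓘(ℝ, EP) 𝓘(ℝ, EP) (T.act s) x :=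
  (T.contMDiff_act s).mdifferentiable (by simp) x

theorem contMDiff_orbit (x : P) :
    ContMDiff 𝓘(ℝ, Fin n → ℝ) 𝓘(ℝ, EP) ∞ (fun s => T.act s x) :=
  T.smooth_act.comp (contMDiff_id.prodMk contMDiff_const)

theorem mdifferentiableAt_orbit (x : P) (s : Fin n → ℝ) :
    MDifferentiableAt 𝓘(ℝ, Fin n → ℝ) 𝓘(ℝ, EP) (fun s => T.act s x) s :=
  (T.contMDiff_orbit x).mdifferentiable (by simp) s

/-- The differential at `0` of `s ↦ s · x`. -/
def orb (x : P) : (Fin n → ℝ) →L[ℝ] EP := diff (fun s => T.act s x) 0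

theorem orb_single (x : P) (i : Fin n) : T.orb x (Pi.single i 1) = T.gen i x := rfl

theorem orb_eq_sum (x : P) (c : Fin n → ℝ) : T.orb x c = ∑ i, c i • T.gen i x := by
  conv_lhs => rw [← Finset.univ_sum_single c]
  rw [map_sum]
  refine Finset.sum_congr rfl fun i _ => ?_
  rw [← orb_single, ← map_smul, ← Pi.single_smul, smul_eq_mul, mul_one]

theorem dproj_dact (s : Fin n → ℝ) (x : P) (v : EP) :
    T.dproj (T.act s x) (T.dact s x v) = T.dproj x v := by
  have h := diff_comp x (T.mdifferentiableAt_proj (T.act s x)) (T.mdifferentiableAt_act s x)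
  simp only [T.proj_act] at h
  exact (congrArg (fun L : EP →L[ℝ] EB => L v) h).symm

theorem dproj_orb (x : P) (c : Fin n → ℝ) : T.dproj x (T.orb x c) = 0 := by
  have h := diff_comp (0 : Fin n → ℝ) (T.mdifferentiableAt_proj (T.act 0 x))
    (T.mdifferentiableAt_orbit x 0)
  simp only [T.proj_act, T.act_zero, diff_const] at h
  exact (congrArg (fun L : (Fin n → ℝ) →L[ℝ] EB => L c) h).symm

theorem dproj_surjective (x : P) : Function.Surjective (T.dproj x) := by
  obtain ⟨U, σ, hU, hx, hσ, hsec⟩ := T.exists_section (T.proj x)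
  obtain ⟨s, hs⟩ := (T.proj_eq_iff (σ (T.proj x)) x).1 (hsec _ hx)
  have h1 : MDifferentiableAt 𝓘(ℝ, EB) 𝓘(ℝ, EP) σ (T.proj x) :=
    (hσ.contMDiffAt (hU.mem_nhds hx)).mdifferentiableAt (by simp)
  have h2 : MDifferentiableAt 𝓘(ℝ, EB) 𝓘(ℝ, EP) (fun y => T.act s (σ y)) (T.proj x) :=
    (T.mdifferentiableAt_act s _).comp _ h1
  have h3 := diff_comp (T.proj x) (T.mdifferentiableAt_proj _) h2
  have h4 : (fun y => T.proj (T.act s (σ y))) =ᶠ[nhds (T.proj x)] fun y => y := by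
    filter_upwards [hU.mem_nhds hx] with y hy
    exact (T.proj_act s (σ y)).trans (hsec y hy)
  rw [diff_congr h4, diff_id] at h3
  simp only [hs] at h3
  exact fun w => ⟨_, (congrArg (fun L : EB →L[ℝ] EB => L w) h3).symm⟩

theorem dact_orb (s : Fin n → ℝ) (x : P) (c : Fin n → ℝ) :
    T.dact s x (T.orb x c) = (diff (fun s => T.act s x) s : (Fin n → ℝ) →L[ℝ] EP) c := by
  have h2 := diff_comp (0 : Fin n → ℝ) (T.mdifferentiableAt_act s (T.act 0 x))
    (T.mdifferentiableAt_orbit x 0)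
  have h4 := diff_comp (g := fun s => T.act s x) (f := fun s' : Fin n → ℝ => s + s')
    (0 : Fin n → ℝ) (T.mdifferentiableAt_orbit x (s + 0))
    (mdifferentiableAt_iff_differentiableAt.2 (by fun_prop))
  have h5 : fderiv ℝ (fun s' : Fin n → ℝ => s + s') 0 = ContinuousLinearMap.id ℝ _ := by
    rw [fderiv_const_add]; exact fderiv_fun_id
  rw [diff_eq_fderiv, h5] at h4
  simp only [← T.act_add, T.act_zero] at h2
  rw [h2] at h4
  simp only [add_zero] at h4
  exact congrArg (fun L : (Fin n → ℝ) →L[ℝ] EP => L c) h4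

theorem dact_of_int {s : Fin n → ℝ} (hs : ∀ i, ∃ z : ℤ, s i = z) (x : P) :
    T.dact s x = ContinuousLinearMap.id ℝ EP := by
  have h : T.act s = fun y => y := funext fun y => (T.act_eq_self_iff s y).2 hs
  rw [dact_eq, h, diff_id]

/-- The fundamental vector fields are linearly independent, because the stabilisers are
discrete. -/
theorem orb_injective [IsManifold 𝓘(ℝ, EP) ∞ P] (x : P) : Function.Injective (T.orb x) := by
  refine (injective_iff_map_eq_zero _).2 fun c hc => ?_
  have hzero : ∀ t : ℝ, (diff (fun r : ℝ => T.act (r • c) x) t : ℝ →L[ℝ] EP) = 0 := by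
    intro t
    have h1 := diff_comp (g := fun s => T.act s x) (f := fun r : ℝ => r • c) t
      (T.mdifferentiableAt_orbit x _) (mdifferentiableAt_iff_differentiableAt.2 (by fun_prop))
    rw [h1, diff_eq_fderiv]
    ext
    have h2 : fderiv ℝ (fun r : ℝ => r • c) t 1 = c := by
      rw [fderiv_smul_const (by fun_prop)]
      simp
    rw [ContinuousLinearMap.comp_apply, h2, ← T.dact_orb, hc]
    simp
  have hcm : ∀ t : ℝ, ContMDiffAt 𝓘(ℝ, ℝ) 𝓘(ℝ, EP) ∞ (fun r : ℝ => T.act (r • c) x) t := fun t =>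
    ContMDiffAt.comp (I' := 𝓘(ℝ, Fin n → ℝ)) (g := fun s => T.act s x) t
      ((T.contMDiff_orbit x).contMDiffAt)
      (contMDiffAt_iff_contDiffAt.2 (by fun_prop))
  obtain ⟨δ, hδ, hball⟩ : ∃ δ > 0, ∀ t ∈ Metric.ball (0 : ℝ) δ,
      T.act (t • c) x ∈ (chartAt EP (T.act ((0 : ℝ) • c) x)).source :=
    Metric.eventually_nhds_iff_ball.1 ((hcm 0).continuousAt.eventually_mem
      ((chartAt EP _).open_source.mem_nhds (mem_chart_source EP _)))
  have hconst : ∀ t ∈ Metric.ball (0 : ℝ) δ, T.act (t • c) x = x := by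
    intro t ht
    set f : ℝ → EP := fun r => extChartAt 𝓘(ℝ, EP) (T.act ((0 : ℝ) • c) x) (T.act (r • c) x) with hf
    have hd : ∀ r ∈ Metric.ball (0 : ℝ) δ, HasFDerivAt f (0 : ℝ →L[ℝ] EP) r := by
      intro r hr
      have h1 := (contDiffAt_extChartAt_comp (hcm r) (hball r hr)).differentiableAt (by simp)
      have h2 := diff_comp r
        ((contMDiffAt_extChartAt' (n := ∞) (hball r hr)).mdifferentiableAt (by simp))
        ((hcm r).mdifferentiableAt (by simp))
      rw [hzero r, ContinuousLinearMap.comp_zero, diff_eq_fderiv] at h2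
      rw [← h2]
      exact h1.hasFDerivAt
    have h3 : f t = f 0 := by
      refine (convex_ball (0 : ℝ) δ).is_const_of_fderivWithin_eq_zero (𝕜 := ℝ)
        (fun r hr => (hd r hr).differentiableAt.differentiableWithinAt) (fun r hr => ?_) ht
        (Metric.mem_ball_self hδ)
      rw [fderivWithin_of_isOpen Metric.isOpen_ball hr]
      exact (hd r hr).fderiv
    have h4 := (extChartAt 𝓘(ℝ, EP) (T.act ((0 : ℝ) • c) x)).injOn
      (by rw [extChartAt_source]; exact hball t ht)
      (by rw [extChartAt_source]; exact hball 0 (Metric.mem_ball_self hδ)) h3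
    rw [h4, zero_smul, T.act_zero]
  funext i
  by_contra hci
  have hci' : c i ≠ 0 := hci
  have hpos : 0 < |c i| := abs_pos.2 hci'
  set t := min (δ / 2) (1 / (2 * |c i|)) with ht
  have ht0 : 0 < t := lt_min (by positivity) (by positivity)
  have htball : t ∈ Metric.ball (0 : ℝ) δ := by
    rw [mem_ball_zero_iff, Real.norm_eq_abs, abs_of_pos ht0]
    exact (min_le_left _ _).trans_lt (by linarith)
  obtain ⟨m, hm⟩ := (T.act_eq_self_iff _ x).1 (hconst t htball) i
  rw [Pi.smul_apply, smul_eq_mul] at hm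
  have h5 : |t * c i| < 1 := by
    rw [abs_mul, abs_of_pos ht0]
    have : t * |c i| ≤ 1 / (2 * |c i|) * |c i| :=
      mul_le_mul_of_nonneg_right (min_le_right _ _) hpos.le
    refine this.trans_lt ?_
    rw [div_mul_eq_mul_div, div_lt_one (by positivity)]
    linarith
  rw [hm, ← Int.cast_abs, ← Int.cast_one, Int.cast_lt, Int.abs_lt_one_iff] at h5
  rw [h5, Int.cast_zero] at hm
  exact (mul_ne_zero ht0.ne' hci') hm

/-- An invariant frame of the total space: isomorphisms `TP ≅ TB × ℝⁿ` compatible with the projection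
and the fundamental vector fields. -/
structure Frame where
  fr : P → EP ≃L[ℝ] EB × (Fin n → ℝ)
  fst_fr : ∀ x v, (fr x v).1 = T.dproj x v
  fr_orb : ∀ x c, fr x (T.orb x c) = (0, c)
  fr_dact : ∀ s x v, fr (T.act s x) (T.dact s x v) = fr x v

variable {T}

theorem IsConnection.apply_orb {A : Fin n → P → EP →L[ℝ] ℝ} (h : T.IsConnection A) (i : Fin n)
    (x : P) (c : Fin n → ℝ) : A i x (T.orb x c) = c i := by
  rw [orb_eq_sum, map_sum]
  simp only [map_smul, h.apply_gen, smul_eq_mul, mul_ite, mul_one, mul_zero]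
  simp

variable [FiniteDimensional ℝ EP] [FiniteDimensional ℝ EB]

theorem IsConnection.bijective {A : Fin n → P → EP →L[ℝ] ℝ} (h : T.IsConnection A) (x : P) :
    Function.Bijective ((T.dproj x).prod (ContinuousLinearMap.pi fun i => A i x)) := by
  have hs : Function.Surjective
      ((T.dproj x).prod (ContinuousLinearMap.pi fun i => A i x) : EP →ₗ[ℝ] EB × (Fin n → ℝ)) := by
    rintro ⟨w, c⟩
    obtain ⟨v, hv⟩ := T.dproj_surjective x w
    refine ⟨v + T.orb x (fun i => c i - A i x v), ?_⟩
    refine Prod.ext ?_ ?_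
    · show T.dproj x _ = w
      rw [map_add, hv, T.dproj_orb, add_zero]
    · funext i
      show A i x _ = c i
      rw [map_add, h.apply_orb]; ring
  have hrk : Module.finrank ℝ EP = Module.finrank ℝ (EB × (Fin n → ℝ)) := by
    rw [T.finrank_eq, Module.finrank_prod, Module.finrank_fin_fun]
  exact ⟨(LinearMap.injective_iff_surjective_of_finrank_eq_finrank hrk).2 hs, hs⟩

/-- The frame of a principal connection. -/
def IsConnection.frame {A : Fin n → P → EP →L[ℝ] ℝ} (h : T.IsConnection A) : T.Frame where
  fr x := (LinearEquiv.ofBijective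
    ((T.dproj x).prod (ContinuousLinearMap.pi fun i => A i x) : EP →ₗ[ℝ] EB × (Fin n → ℝ))
    (h.bijective x)).toContinuousLinearEquiv
  fst_fr _ _ := rfl
  fr_orb x c := Prod.ext (T.dproj_orb x c) (funext fun i => h.apply_orb i x c)
  fr_dact s x v := Prod.ext (T.dproj_dact s x v)
    (funext fun i => congrArg (fun L : EP →L[ℝ] ℝ => L v) (h.invariant i s x))

end TorusBundle

/-! ### The frame of the reduced bundle -/

namespace Reduction

variable {k : ℕ} (R : Reduction k EB B EM M EP P)

theorem mdifferentiableAt_q (x : P) : MDifferentiableAt 𝓘(ℝ, EP) 𝓘(ℝ, EM) R.q x :=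
  R.smooth_q.mdifferentiable (by simp) x

/-- The differential of `q`. -/
def dq (x : P) : EP →L[ℝ] EM := diff R.q x

theorem dproj_dq (x : P) (v : EP) : R.TM.dproj (R.q x) (R.dq x v) = R.TP.dproj x v := by
  have h := diff_comp x (R.TM.mdifferentiableAt_proj (R.q x)) (R.mdifferentiableAt_q x)
  simp only [R.proj_q] at h
  exact (congrArg (fun L : EP →L[ℝ] EB => L v) h).symm

theorem dq_dact (s : Fin (k + 1) → ℝ) (x : P) (v : EP) :
    R.dq (R.TP.act s x) (R.TP.dact s x v) = R.TM.dact (Fin.tail s) (R.q x) (R.dq x v) := by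
  have h := diff_comp x (R.mdifferentiableAt_q (R.TP.act s x)) (R.TP.mdifferentiableAt_act s x)
  have h' := diff_comp x (R.TM.mdifferentiableAt_act (Fin.tail s) (R.q x)) (R.mdifferentiableAt_q x)
  simp only [R.q_act] at h
  exact congrArg (fun L : EP →L[ℝ] EM => L v) (h.symm.trans h')

theorem dq_orb (x : P) (c : Fin (k + 1) → ℝ) :
    R.dq x (R.TP.orb x c) = R.TM.orb (R.q x) (Fin.tail c) := by
  let L : (Fin (k + 1) → ℝ) →L[ℝ] Fin k → ℝ :=
    ContinuousLinearMap.pi fun i => ContinuousLinearMap.proj i.succ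
  have h := diff_comp (0 : Fin (k + 1) → ℝ) (R.mdifferentiableAt_q (R.TP.act 0 x))
    (R.TP.mdifferentiableAt_orbit x 0)
  have h' := diff_comp (g := fun s => R.TM.act s (R.q x)) (f := fun s => L s)
    (0 : Fin (k + 1) → ℝ) (R.TM.mdifferentiableAt_orbit (R.q x) _)
    (mdifferentiableAt_iff_differentiableAt.2 L.differentiableAt)
  rw [diff_eq_fderiv, L.fderiv, map_zero] at h'
  simp only [R.q_act, R.TP.act_zero] at h
  exact congrArg (fun L : (Fin (k + 1) → ℝ) →L[ℝ] EM => L c) (h.symm.trans h')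

theorem q_surjective : Function.Surjective R.q := by
  intro m
  obtain ⟨U, σ, -, hb, -, hσ⟩ := R.TP.exists_section (R.TM.proj m)
  have h : R.TM.proj (R.q (σ (R.TM.proj m))) = R.TM.proj m := by
    rw [R.proj_q]; exact hσ _ hb
  obtain ⟨s, hs⟩ := (R.TM.proj_eq_iff _ _).1 h
  refine ⟨R.TP.act (Fin.cons 0 s) (σ (R.TM.proj m)), ?_⟩
  rw [R.q_act, Fin.tail_cons, hs]

variable [FiniteDimensional ℝ EP] [FiniteDimensional ℝ EB]

/-- The frame of `P`. -/
def frP : R.TP.Frame := R.connection.frame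

/-- `(w, c) ↦ (w, (0, c))`. -/
def consZero (W : Type*) [NormedAddCommGroup W] [NormedSpace ℝ W] (k : ℕ) :
    W × (Fin k → ℝ) →L[ℝ] W × (Fin (k + 1) → ℝ) :=
  (ContinuousLinearMap.fst ℝ _ _).prod (ContinuousLinearMap.pi
    (Fin.cons 0 fun i => (ContinuousLinearMap.proj (φ := fun _ : Fin k => ℝ) i).comp
      (ContinuousLinearMap.snd ℝ _ _)))

theorem consZero_apply {W : Type*} [NormedAddCommGroup W] [NormedSpace ℝ W] (k : ℕ)
    (v : W × (Fin k → ℝ)) : consZero W k v = (v.1, Fin.cons 0 v.2) := by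
  refine Prod.ext rfl (funext fun i => ?_)
  refine Fin.cases ?_ (fun i => ?_) i <;> simp [consZero]

theorem dropZero_consZero {W : Type*} [NormedAddCommGroup W] [NormedSpace ℝ W] (k : ℕ)
    (v : W × (Fin k → ℝ)) : dropZero W k (consZero W k v) = v := by
  rw [consZero_apply, dropZero_apply, Fin.tail_cons]

omit [FiniteDimensional ℝ EB] in
theorem fr_symm_orb {n : ℕ} {EX X : Type*} [NormedAddCommGroup EX] [NormedSpace ℝ EX]
    [TopologicalSpace X] [ChartedSpace EX X] {T : TorusBundle n EX X EB B} (f : T.Frame)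
    (x : X) (c : Fin n → ℝ) : (f.fr x).symm (0, c) = T.orb x c := by
  rw [ContinuousLinearEquiv.symm_apply_eq, f.fr_orb]

theorem dq_fr_symm (x : P) (w : EB) (c : Fin (k + 1) → ℝ) :
    R.dq x ((R.frP.fr x).symm (w, c)) =
      R.dq x ((R.frP.fr x).symm (consZero EB k (dropZero EB k (w, c)))) := by
  have h : ((w, c) : EB × (Fin (k + 1) → ℝ)) =
      consZero EB k (dropZero EB k (w, c)) + (0, Pi.single 0 (c 0)) := by
    rw [consZero_apply, dropZero_apply]
    refine Prod.ext (by simp) (funext fun i => ?_)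
    refine Fin.cases ?_ (fun i => ?_) i <;> simp [Fin.tail]
  conv_lhs => rw [h, map_add, map_add, fr_symm_orb, R.dq_orb]
  have h2 : Fin.tail (Pi.single 0 (c 0) : Fin (k + 1) → ℝ) = 0 := by
    funext i; simp [Fin.tail]
  rw [h2, map_zero, add_zero]

variable [IsManifold 𝓘(ℝ, EM) ∞ M] [FiniteDimensional ℝ EM]

omit [FiniteDimensional ℝ EM] in
theorem injective_dq_fr_symm (x : P) : Function.Injective
    ((R.dq x).comp (((R.frP.fr x).symm : _ →L[ℝ] EP).comp (consZero EB k))) := by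
  refine (injective_iff_map_eq_zero _).2 fun v hv => ?_
  obtain ⟨w, c⟩ := v
  simp only [ContinuousLinearMap.comp_apply, ContinuousLinearEquiv.coe_coe] at hv
  have h1 := congrArg (R.TM.dproj (R.q x)) hv
  rw [R.dproj_dq, ← R.frP.fst_fr, ContinuousLinearEquiv.apply_symm_apply, map_zero] at h1
  have hw : w = 0 := h1
  subst hw
  rw [consZero_apply, fr_symm_orb, R.dq_orb, Fin.tail_cons] at hv
  have hc : c = 0 := R.TM.orb_injective _ (hv.trans (map_zero _).symm)
  rw [hc]; rfl

theorem bijective_dq_fr_symm (x : P) : Function.Bijective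
    ((R.dq x).comp (((R.frP.fr x).symm : _ →L[ℝ] EP).comp (consZero EB k))) := by
  have hrk : Module.finrank ℝ (EB × (Fin k → ℝ)) = Module.finrank ℝ EM := by
    rw [R.TM.finrank_eq, Module.finrank_prod, Module.finrank_fin_fun]
  have hi : Function.Injective (((R.dq x).comp (((R.frP.fr x).symm : _ →L[ℝ] EP).comp
    (consZero EB k))) : EB × (Fin k → ℝ) →ₗ[ℝ] EM) := R.injective_dq_fr_symm x
  exact ⟨hi, (LinearMap.injective_iff_surjective_of_finrank_eq_finrank hrk).1 hi⟩

/-- The frame of `M` at `q x` induced by the frame of `P` at `x`. -/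
def frMAt (x : P) : EM ≃L[ℝ] EB × (Fin k → ℝ) :=
  (LinearEquiv.ofBijective ((R.dq x).comp (((R.frP.fr x).symm : _ →L[ℝ] EP).comp (consZero EB k)) :
    EB × (Fin k → ℝ) →ₗ[ℝ] EM) (R.bijective_dq_fr_symm x)).toContinuousLinearEquiv.symm

theorem frMAt_dq (x : P) (v : EP) : R.frMAt x (R.dq x v) = dropZero EB k (R.frP.fr x v) := by
  have h : R.dq x v = (R.frMAt x).symm (dropZero EB k (R.frP.fr x v)) := by
    show _ = R.dq x ((R.frP.fr x).symm (consZero EB k (dropZero EB k (R.frP.fr x v))))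
    have := R.dq_fr_symm x (R.frP.fr x v).1 (R.frP.fr x v).2
    rwa [Prod.mk.eta, ContinuousLinearEquiv.symm_apply_apply] at this
  rw [h, ContinuousLinearEquiv.apply_symm_apply]

theorem dq_surjective (x : P) : Function.Surjective (R.dq x) := fun v => by
  obtain ⟨u, hu⟩ := (R.bijective_dq_fr_symm x).2 v
  exact ⟨_, hu⟩

theorem frMAt_congr {x x' : P} (h : R.q x = R.q x') : R.frMAt x = R.frMAt x' := by
  have h1 : R.TP.proj x = R.TP.proj x' := by rw [← R.proj_q, h, R.proj_q]
  obtain ⟨s, rfl⟩ := (R.TP.proj_eq_iff _ _).1 h1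
  rw [R.q_act] at h
  have hint := (R.TM.act_eq_self_iff _ _).1 h.symm
  ext1
  funext v
  obtain ⟨u, rfl⟩ := R.dq_surjective x v
  rw [frMAt_dq]
  have h2 := R.dq_dact s x u
  rw [R.TM.dact_of_int hint] at h2
  have h3 : R.dq x u = R.dq (R.TP.act s x) (R.TP.dact s x u) := h2.symm
  rw [h3, frMAt_dq, R.frP.fr_dact]

/-- The frame of `M`. -/
def frM : R.TM.Frame where
  fr m := R.frMAt (R.q_surjective m).choose
  fst_fr m v := by
    obtain ⟨x, rfl⟩ := R.q_surjective m
    obtain ⟨u, rfl⟩ := R.dq_surjective x v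
    rw [R.frMAt_congr (R.q_surjective (R.q x)).choose_spec, frMAt_dq, dproj_dq]
    exact R.frP.fst_fr x u
  fr_orb m c := by
    obtain ⟨x, rfl⟩ := R.q_surjective m
    have := R.dq_orb x (Fin.cons 0 c)
    rw [Fin.tail_cons] at this
    rw [R.frMAt_congr (R.q_surjective (R.q x)).choose_spec, ← this, frMAt_dq, R.frP.fr_orb,
      dropZero_apply, Fin.tail_cons]
  fr_dact s m v := by
    obtain ⟨x, rfl⟩ := R.q_surjective m
    obtain ⟨u, rfl⟩ := R.dq_surjective x v
    have h1 := R.q_act (Fin.cons 0 s) x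
    have h2 := R.dq_dact (Fin.cons 0 s) x u
    rw [Fin.tail_cons] at h1 h2
    rw [R.frMAt_congr (R.q_surjective (R.q x)).choose_spec,
      R.frMAt_congr (x' := R.TP.act (Fin.cons 0 s) x)
        ((R.q_surjective (R.TM.act s (R.q x))).choose_spec.trans h1.symm),
      ← h2, frMAt_dq, frMAt_dq, R.frP.fr_dact]

theorem frM_dq (x : P) (v : EP) : R.frM.fr (R.q x) (R.dq x v) = dropZero EB k (R.frP.fr x v) := by
  show R.frMAt _ _ = _
  rw [R.frMAt_congr (R.q_surjective (R.q x)).choose_spec, frMAt_dq]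

end Reduction

/-! ### Local charts adapted to a torus bundle -/

/-- A chart of the base, with the differential of its inverse. -/
structure BaseChart (EB B : Type*) [NormedAddCommGroup EB] [NormedSpace ℝ EB] [TopologicalSpace B]
    [ChartedSpace EB B] where
  e : OpenPartialHomeomorph B EB
  D : EB → EB ≃L[ℝ] EB
  isParam : ∀ u ∈ e.target, IsParam e.symm D u

section Base

theorem BaseChart.diff_eq (c : BaseChart EB B) {u : EB} (hu : u ∈ c.e.target) :
    diff c.e.symm u = (c.D u : EB →L[ℝ] EB) :=
  (c.isParam u hu).mfderiv_eq.self_of_nhds.symm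

theorem exists_baseChart [IsManifold 𝓘(ℝ, EB) ∞ B] {b : B} {U : Set B} (hU : IsOpen U)
    (hb : b ∈ U) : ∃ c : BaseChart EB B, b ∈ c.e.source ∧ c.e.source ⊆ U := by
  classical
  set e := (chartAt EB b).restrOpen U hU with he
  have hsrc : e.source = (chartAt EB b).source ∩ U := rfl
  have hsymm : ∀ u, e.symm u = (extChartAt 𝓘(ℝ, EB) b).symm u := fun u => rfl
  have htar : ∀ u ∈ e.target, u ∈ (extChartAt 𝓘(ℝ, EB) b).target := by
    intro u hu
    have h1 := (e.map_target hu).1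
    have h2 : e (e.symm u) = u := e.right_inv hu
    rw [← h2, ← extChartAt_source 𝓘(ℝ, EB)] at *
    exact (extChartAt 𝓘(ℝ, EB) b).map_source h1
  have hinv : ∀ u ∈ e.target, (diff e.symm u : EB →L[ℝ] EB).IsInvertible := by
    intro u hu
    have := isInvertible_mfderivWithin_extChartAt_symm (I := 𝓘(ℝ, EB)) (htar u hu)
    rw [modelWithCornersSelf_coe, Set.range_id, mfderivWithin_univ] at this
    exact this
  refine ⟨⟨e, fun u => if h : (diff e.symm u : EB →L[ℝ] EB).IsInvertible then h.choose else
    ContinuousLinearEquiv.refl ℝ EB, fun u hu => ⟨?_, ?_⟩⟩, ?_, ?_⟩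
  · exact (contMDiffOn_extChartAt_symm (n := ∞) b).contMDiffAt
      ((isOpen_extChartAt_target b).mem_nhds (htar u hu))
  · filter_upwards [e.open_target.mem_nhds hu] with y hy
    rw [dif_pos (hinv y hy)]
    exact (hinv y hy).choose_spec
  · exact ⟨mem_chart_source EB b, hb⟩
  · exact fun x hx => hx.2

end Base

section Total

variable {n : ℕ}

/-- A parametrization `Ψ (u, s) = s · σ(u)` of a torus bundle over a chart of the base, in which the
frame is the standard one up to the shears by the local connection forms `θ`. -/
structure FrameChart {T : TorusBundle n EP P EB B} (f : T.Frame) (c : BaseChart EB B) where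
  Ψ : EB × (Fin n → ℝ) → P
  θ : EB → Fin n → EB →L[ℝ] ℝ
  smooth : ∀ u ∈ c.e.target, ∀ s, ContMDiffAt 𝓘(ℝ, EB × (Fin n → ℝ)) 𝓘(ℝ, EP) ∞ Ψ (u, s)
  proj_Ψ : ∀ u ∈ c.e.target, ∀ s, T.proj (Ψ (u, s)) = c.e.symm u
  act_Ψ : ∀ u s s', T.act s (Ψ (u, s')) = Ψ (u, s + s')
  smooth_θ : ∀ u ∈ c.e.target, ContDiffAt ℝ ∞ θ u
  fr_diff : ∀ u ∈ c.e.target, ∀ (s : Fin n → ℝ) (v : EB × (Fin n → ℝ)),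
    f.fr (Ψ (u, s)) ((diff Ψ (u, s) : EB × (Fin n → ℝ) →L[ℝ] EP) v) = (c.D u v.1, v.2 + fun i => θ u i v.1)

namespace FrameChart

variable {T : TorusBundle n EP P EB B} {f : T.Frame} {c : BaseChart EB B} (K : FrameChart f c)

theorem exists_eq {x : P} (hx : T.proj x ∈ c.e.source) :
    ∃ s, K.Ψ (c.e (T.proj x), s) = x := by
  have hu := c.e.map_source hx
  have h : T.proj (K.Ψ (c.e (T.proj x), 0)) = T.proj x := by
    rw [K.proj_Ψ _ hu, c.e.left_inv hx]
  obtain ⟨s, hs⟩ := (T.proj_eq_iff _ _).1 h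
  rw [K.act_Ψ, add_zero] at hs
  exact ⟨s, hs⟩

/-- The frame normalised so that it is the standard one in the chart. -/
def nf (z : EB × (Fin n → ℝ)) : EP ≃L[ℝ] EB × (Fin n → ℝ) :=
  (f.fr (K.Ψ z)).trans ((c.D z.1).symm.prodCongr (ContinuousLinearEquiv.refl ℝ (Fin n → ℝ)))

/-- The differential of `Ψ`. -/
def d (z : EB × (Fin n → ℝ)) : (EB × (Fin n → ℝ)) ≃L[ℝ] EP := (shear (K.θ z.1)).trans (K.nf z).symm

theorem nf_d (z : EB × (Fin n → ℝ)) (v : EB × (Fin n → ℝ)) :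
    K.nf z (K.d z v) = shearMap (K.θ z.1) v := (K.nf z).apply_symm_apply _

theorem d_eq_diff {u : EB} (hu : u ∈ c.e.target) (s : Fin n → ℝ) :
    (K.d (u, s) : EB × (Fin n → ℝ) →L[ℝ] EP) = diff K.Ψ (u, s) := by
  refine ContinuousLinearMap.ext fun v => ?_
  refine (K.nf (u, s)).injective ?_
  refine (K.nf_d _ _).trans ?_
  have h := K.fr_diff u hu s v
  show _ = ((c.D u).symm.prodCongr (ContinuousLinearEquiv.refl ℝ (Fin n → ℝ)))
    (f.fr (K.Ψ (u, s)) _)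
  rw [h, shearMap_apply]
  refine Prod.ext ?_ rfl
  exact ((c.D u).symm_apply_apply v.1).symm

theorem isParam {u : EB} (hu : u ∈ c.e.target) (s : Fin n → ℝ) : IsParam K.Ψ K.d (u, s) where
  smooth := K.smooth u hu s
  mfderiv_eq := by
    have : ∀ᶠ y : EB × (Fin n → ℝ) in nhds (u, s), y.1 ∈ c.e.target :=
      continuous_fst.continuousAt.eventually_mem (c.e.open_target.mem_nhds hu)
    filter_upwards [this] with y hy
    exact K.d_eq_diff hy y.2

end FrameChart

variable {T : TorusBundle n EP P EB B}

theorem nonempty_frameChart [FiniteDimensional ℝ EP] [FiniteDimensional ℝ EB]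
    [IsManifold 𝓘(ℝ, EP) ∞ P]
    {A : Fin n → P → EP →L[ℝ] ℝ} (hA : T.IsConnection A) (c : BaseChart EB B) {σ : B → P}
    (hσ : ContMDiffOn 𝓘(ℝ, EB) 𝓘(ℝ, EP) ∞ σ c.e.source) (hs : ∀ y ∈ c.e.source, T.proj (σ y) = y) :
    Nonempty (FrameChart hA.frame c) := by
  set g : EB → P := fun u => σ (c.e.symm u) with hg
  have hgs : ∀ u ∈ c.e.target, ContMDiffAt 𝓘(ℝ, EB) 𝓘(ℝ, EP) ∞ g u := fun u hu =>
    ContMDiffAt.comp (I' := 𝓘(ℝ, EB)) (g := σ) (f := c.e.symm) u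
      (hσ.contMDiffAt (c.e.open_source.mem_nhds (c.e.map_target hu))) (c.isParam u hu).smooth
  set Ψ : EB × (Fin n → ℝ) → P := fun z => T.act z.2 (g z.1) with hΨ
  have hΨs : ∀ u ∈ c.e.target, ∀ s,
      ContMDiffAt 𝓘(ℝ, EB × (Fin n → ℝ)) 𝓘(ℝ, EP) ∞ Ψ (u, s) := by
    intro u hu s
    have h1 : ContMDiffAt 𝓘(ℝ, EB × (Fin n → ℝ)) 𝓘(ℝ, EP) ∞
        (fun z : EB × (Fin n → ℝ) => g z.1) (u, s) :=
      ContMDiffAt.comp (I' := 𝓘(ℝ, EB)) (g := g) (f := Prod.fst) (u, s) (hgs u hu)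
        contDiffAt_fst.contMDiffAt
    have h2 : ContMDiffAt 𝓘(ℝ, EB × (Fin n → ℝ)) 𝓘(ℝ, Fin n → ℝ) ∞
        (fun z : EB × (Fin n → ℝ) => z.2) (u, s) := contDiffAt_snd.contMDiffAt
    exact (T.smooth_act.contMDiffAt).comp (u, s) (h2.prodMk h1)
  have hproj : ∀ u ∈ c.e.target, T.proj (g u) = c.e.symm u := fun u hu => hs _ (c.e.map_target hu)
  have hA0 : ∀ i, SmoothFormOn 𝓘(ℝ, EP) (fun x => ofCovector (A i x)) Set.univ := hA.smooth
  refine ⟨⟨Ψ, fun u i => (A i (g u)).comp (diff g u : EB →L[ℝ] EP), hΨs, ?_, ?_, ?_, ?_⟩⟩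
  · intro u hu s
    exact (T.proj_act _ _).trans (hproj u hu)
  · intro u s s'
    exact (T.act_add _ _ _).symm
  · intro u hu
    refine contDiffAt_pi.2 fun i => contDiffAt_of_smoothFamAt_ofCovector ?_
    have h1 := (hA0 i).smoothFamAt_pullback isOpen_univ (hgs u hu) (Set.mem_univ _)
    refine h1.congr (Filter.Eventually.of_forall fun y => ?_)
    show ofCovector ((A i (g y)).comp (diff g y : EB →L[ℝ] EP)) = pull (diff g y : EB →L[ℝ] EP) _
    rw [pull_ofCovector]
  · intro u hu s v
    have hd := (hΨs u hu s).mdifferentiableAt (by simp)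
    have hgd := (hgs u hu).mdifferentiableAt (by simp)
    have e1 : (diff Ψ (u, s) : EB × (Fin n → ℝ) →L[ℝ] EP) (v.1, 0) =
        T.dact s (g u) ((diff g u : EB →L[ℝ] EP) v.1) := by
      have h1 := diff_comp (g := Ψ) (f := fun y : EB => (y, s)) u hd
        (mdifferentiableAt_iff_differentiableAt.2 (by fun_prop))
      have h2 := diff_comp (g := T.act s) (f := g) u (T.mdifferentiableAt_act s _) hgd
      rw [diff_eq_fderiv, (hasFDerivAt_prodMk_left u s).fderiv] at h1
      exact congrArg (fun L : EB →L[ℝ] EP => L v.1) (h1.symm.trans h2)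
    have e2 : (diff Ψ (u, s) : EB × (Fin n → ℝ) →L[ℝ] EP) (0, v.2) = T.dact s (g u) (T.orb (g u) v.2) := by
      have h1 := diff_comp (g := Ψ) (f := fun y : Fin n → ℝ => (u, y)) s hd
        (mdifferentiableAt_iff_differentiableAt.2 (by fun_prop))
      rw [diff_eq_fderiv, (hasFDerivAt_prodMk_right u s).fderiv] at h1
      rw [T.dact_orb]
      exact congrArg (fun L : (Fin n → ℝ) →L[ℝ] EP => L v.2) h1.symm
    have e3 : v = (v.1, 0) + (0, v.2) := by simp
    conv_lhs => rw [e3, map_add, e1, e2, ← map_add]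
    show hA.frame.fr (T.act s (g u)) _ = _
    rw [hA.frame.fr_dact, map_add, hA.frame.fr_orb]
    refine Prod.ext ?_ ?_
    · rw [Prod.fst_add, hA.frame.fst_fr, add_zero]
      have h1 := diff_comp (g := T.proj) (f := g) u (T.mdifferentiableAt_proj _) hgd
      have h2 : (fun y => T.proj (g y)) =ᶠ[nhds u] c.e.symm := by
        filter_upwards [c.e.open_target.mem_nhds hu] with y hy
        exact hproj y hy
      rw [diff_congr h2, c.diff_eq hu] at h1
      exact (congrArg (fun L : EB →L[ℝ] EB => L v.1) h1).symm
    · rw [Prod.snd_add, add_comm]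
      rfl

end Total

namespace Reduction

variable {k : ℕ} (R : Reduction k EB B EM M EP P) [FiniteDimensional ℝ EP] [FiniteDimensional ℝ EB]
  [IsManifold 𝓘(ℝ, EM) ∞ M] [FiniteDimensional ℝ EM]

/-- The chart of `M` induced by a chart of `P`. -/
def quotChart {c : BaseChart EB B} (K : FrameChart R.frP c) : FrameChart R.frM c where
  Ψ z := R.q (K.Ψ (consZero EB k z))
  θ u i := K.θ u i.succ
  smooth u hu s := by
    refine ContMDiffAt.comp (I' := 𝓘(ℝ, EP)) (g := R.q) (u, s) R.smooth_q.contMDiffAt ?_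
    refine ContMDiffAt.comp (I' := 𝓘(ℝ, EB × (Fin (k + 1) → ℝ))) (g := K.Ψ) (u, s) ?_
      (consZero EB k).contDiff.contDiffAt.contMDiffAt
    rw [consZero_apply]
    exact K.smooth u hu _
  proj_Ψ u hu s := by rw [consZero_apply, R.proj_q, K.proj_Ψ u hu]
  act_Ψ u s s' := by
    rw [consZero_apply, consZero_apply]
    have h := R.q_act (Fin.cons 0 s) (K.Ψ (u, Fin.cons 0 s'))
    rw [Fin.tail_cons, K.act_Ψ] at h
    rw [← h]
    congr 3
    funext i
    refine Fin.cases ?_ (fun i => ?_) i <;> simp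
  smooth_θ u hu := contDiffAt_pi.2 fun i => contDiffAt_pi.1 (K.smooth_θ u hu) i.succ
  fr_diff u hu s v := by
    have hc : consZero EB k (u, s) = (u, Fin.cons 0 s) := consZero_apply k _
    have h1 := diff_comp (g := R.q) (f := fun z => K.Ψ (consZero EB k z)) (u, s)
      (R.mdifferentiableAt_q _)
      (MDifferentiableAt.comp (I' := 𝓘(ℝ, EB × (Fin (k + 1) → ℝ))) (g := K.Ψ) (u, s)
        (by rw [hc]; exact (K.smooth u hu _).mdifferentiableAt (by simp))
        (mdifferentiableAt_iff_differentiableAt.2 (consZero EB k).differentiableAt))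
    have h2 := diff_comp (g := K.Ψ) (f := fun z => consZero EB k z) (u, s)
        (by rw [hc]; exact (K.smooth u hu _).mdifferentiableAt (by simp))
        (mdifferentiableAt_iff_differentiableAt.2 (consZero EB k).differentiableAt)
    rw [diff_eq_fderiv, (consZero EB k).fderiv, hc] at h2
    rw [h2, hc] at h1
    rw [h1, hc]
    have h3 := R.frM_dq (K.Ψ (u, Fin.cons 0 s))
      ((diff K.Ψ (u, Fin.cons 0 s) : EB × (Fin (k + 1) → ℝ) →L[ℝ] EP) (consZero EB k v))
    refine h3.trans ?_
    rw [K.fr_diff u hu, dropZero_apply, consZero_apply]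
    refine Prod.ext rfl (funext fun i => ?_)
    simp [Fin.tail]

theorem quotChart_Ψ {c : BaseChart EB B} (K : FrameChart R.frP c) {u : EB}
    (s : Fin (k + 1) → ℝ) : R.q (K.Ψ (u, s)) = (R.quotChart K).Ψ (u, Fin.tail s) := by
  show _ = R.q (K.Ψ (consZero EB k (u, Fin.tail s)))
  rw [consZero_apply]
  have h1 : s = Pi.single 0 (s 0) + Fin.cons 0 (Fin.tail s) := by
    funext i
    refine Fin.cases ?_ (fun i => ?_) i <;> simp [Fin.tail]
  conv_lhs => rw [h1, ← K.act_Ψ, R.q_act]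
  have h2 : Fin.tail (Pi.single 0 (s 0) : Fin (k + 1) → ℝ) = 0 := by
    funext i; simp [Fin.tail]
  rw [h2, R.TM.act_zero]

theorem nf_quotChart_dq {c : BaseChart EB B} (K : FrameChart R.frP c) {u : EB}
    (s : Fin (k + 1) → ℝ) (v : EP) :
    (R.quotChart K).nf (u, Fin.tail s) (R.dq (K.Ψ (u, s)) v) = dropZero EB k (K.nf (u, s) v) := by
  show ((c.D u).symm.prodCongr (ContinuousLinearEquiv.refl ℝ (Fin k → ℝ)))
    (R.frM.fr ((R.quotChart K).Ψ (u, Fin.tail s)) _) = _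
  rw [← R.quotChart_Ψ K s, R.frM_dq]
  rfl

end Reduction

/-! ### The exterior derivative of the Fourier form -/

section Leibniz

variable {V W : Type*} [NormedAddCommGroup V] [NormedSpace ℝ V] [FiniteDimensional ℝ V]
  [NormedAddCommGroup W] [NormedSpace ℝ W] {α χ : V → PForm V} {x : V}

theorem flatD_wedge (hα : SmoothFamAt α x) (hχ : SmoothFamAt χ x) :
    flatD (fun u => wedge (α u) (χ u)) x =
      wedge (flatD α x) (χ x) + wedge (gradeInv (α x)) (flatD χ x) := by
  rw [flatD_eq_sum _ _ sum_frameCov (hα.wedge hχ), flatD_eq_sum _ _ sum_frameCov hα,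
    flatD_eq_sum _ _ sum_frameCov hχ]
  simp only [pd_wedge hα hχ, wedge_add_right, Finset.sum_add_distrib, wedge_sum_left,
    wedge_sum_right, wedge_assoc]
  refine congrArg₂ (· + ·) rfl (Finset.sum_congr rfl fun j _ => ?_)
  rw [← wedge_assoc, covector_wedge, wedge_assoc]

theorem flatD_neg (hα : SmoothFamAt α x) : flatD (fun u => -α u) x = -flatD α x := by
  rw [flatD_eq_sum _ _ sum_frameCov hα.neg, flatD_eq_sum _ _ sum_frameCov hα]
  simp only [pd_neg hα, wedge_neg_right, Finset.sum_neg_distrib]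

theorem flatD_add (hα : SmoothFamAt α x) (hχ : SmoothFamAt χ x) :
    flatD (fun u => α u + χ u) x = flatD α x + flatD χ x := by
  rw [flatD_eq_sum _ _ sum_frameCov (hα.add hχ), flatD_eq_sum _ _ sum_frameCov hα,
    flatD_eq_sum _ _ sum_frameCov hχ]
  simp only [pd_add hα hχ, wedge_add_right, Finset.sum_add_distrib]

theorem flatD_const (φ : PForm V) : flatD (fun _ => φ) x = 0 := by
  rw [flatD_eq_sum _ _ sum_frameCov (SmoothFamAt.const φ)]
  simp [pd_const]

theorem flatD_sum {ι : Type*} (s : Finset ι) {f : ι → V → PForm V}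
    (h : ∀ i ∈ s, SmoothFamAt (f i) x) :
    flatD (fun u => ∑ i ∈ s, f i u) x = ∑ i ∈ s, flatD (f i) x := by
  classical
  induction s using Finset.induction_on with
  | empty => simp [flatD_const]
  | insert a s ha ih =>
    simp only [Finset.sum_insert ha]
    rw [flatD_add (h a (Finset.mem_insert_self _ _))
      (SmoothFamAt.sum s fun i hi => h i (Finset.mem_insert_of_mem hi)),
      ih fun i hi => h i (Finset.mem_insert_of_mem hi)]

omit [FiniteDimensional ℝ V] in
theorem flatD_pull_linear (L : W →L[ℝ] V) {z : W} (hα : SmoothFamAt α (L z)) :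
    flatD (fun u => pull L (α (L u))) z = pull L (flatD α (L z)) := by
  funext k
  cases k with
  | zero => rfl
  | succ k =>
    have := extDeriv_pullback (r := ∞) (f := fun y => L y) (x := z)
      ((hα k).differentiableAt (by simp)) L.contDiff.contDiffAt (by simpa using two_le_infty)
    simp only [L.fderiv] at this
    exact this

end Leibniz

theorem extD_eq_flatD {E H M : Type*} [NormedAddCommGroup E] [NormedSpace ℝ E] [TopologicalSpace H]
    (I : ModelWithCorners ℝ E H) [TopologicalSpace M] [ChartedSpace H M] (φ : M → PForm E) (x : M) :
    extD I φ x = flatD (fun u k => chartRep I (fun y => φ y k) x u) (extChartAt I x x) := by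
  funext k
  cases k <;> rfl

section Product

variable {E N E' N' : Type*} [NormedAddCommGroup E] [NormedSpace ℝ E] [TopologicalSpace N]
  [ChartedSpace E N] [IsManifold 𝓘(ℝ, E) ∞ N] [NormedAddCommGroup E'] [NormedSpace ℝ E']
  [TopologicalSpace N'] [ChartedSpace E' N'] [IsManifold 𝓘(ℝ, E') ∞ N']

theorem mfderiv_extChartAt_prod_symm (x : N) (y : N') {u : E × E'}
    (h1 : u.1 ∈ (extChartAt 𝓘(ℝ, E) x).target) (h2 : u.2 ∈ (extChartAt 𝓘(ℝ, E') y).target) :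
    (mfderiv 𝓘(ℝ, E × E') (𝓘(ℝ, E).prod 𝓘(ℝ, E'))
      (extChartAt (𝓘(ℝ, E).prod 𝓘(ℝ, E')) (x, y)).symm u : E × E' →L[ℝ] E × E') =
      ((diff (extChartAt 𝓘(ℝ, E) x).symm u.1 : E →L[ℝ] E).comp
        (ContinuousLinearMap.fst ℝ E E')).prod
      ((diff (extChartAt 𝓘(ℝ, E') y).symm u.2 : E' →L[ℝ] E').comp
        (ContinuousLinearMap.snd ℝ E E')) := by
  have hf : ((extChartAt (𝓘(ℝ, E).prod 𝓘(ℝ, E')) (x, y)).symm : E × E' → N × N') =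
      fun u => ((extChartAt 𝓘(ℝ, E) x).symm u.1, (extChartAt 𝓘(ℝ, E') y).symm u.2) := by
    rw [extChartAt_prod]; rfl
  have hd1 : MDifferentiableAt 𝓘(ℝ, E × E') 𝓘(ℝ, E) (Prod.fst : E × E' → E) u :=
    mdifferentiableAt_iff_differentiableAt.2 differentiableAt_fst
  have hd2 : MDifferentiableAt 𝓘(ℝ, E × E') 𝓘(ℝ, E') (Prod.snd : E × E' → E') u :=
    mdifferentiableAt_iff_differentiableAt.2 differentiableAt_snd
  have c1 := diff_comp (g := (extChartAt 𝓘(ℝ, E) x).symm) (f := Prod.fst) u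
    (mdifferentiableAt_extChartAt_symm h1) hd1
  have c2 := diff_comp (g := (extChartAt 𝓘(ℝ, E') y).symm) (f := Prod.snd) u
    (mdifferentiableAt_extChartAt_symm h2) hd2
  have hm := mfderiv_prodMk ((mdifferentiableAt_extChartAt_symm h1).comp u hd1)
    ((mdifferentiableAt_extChartAt_symm h2).comp u hd2)
  rw [diff_eq_fderiv, fderiv_fst] at c1
  rw [diff_eq_fderiv, fderiv_snd] at c2
  rw [hf, ← c1, ← c2]
  exact hm

end Product

theorem diff_extChartAt_symm_self {E N : Type*} [NormedAddCommGroup E] [NormedSpace ℝ E]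
    [TopologicalSpace N] [ChartedSpace E N] [IsManifold 𝓘(ℝ, E) ∞ N] (x : N) :
    (diff (extChartAt 𝓘(ℝ, E) x).symm (extChartAt 𝓘(ℝ, E) x x) : E →L[ℝ] E) =
      ContinuousLinearMap.id ℝ E := by
  have h := fderiv_extChartAt_self_comp (Ψ := (extChartAt 𝓘(ℝ, E) x).symm)
    (mdifferentiableAt_extChartAt_symm (mem_extChartAt_target x))
  simp only [extChartAt_to_inv] at h
  have h2 : (fun u => extChartAt 𝓘(ℝ, E) x ((extChartAt 𝓘(ℝ, E) x).symm u))
      =ᶠ[nhds (extChartAt 𝓘(ℝ, E) x x)] fun u => u := by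
    filter_upwards [(isOpen_extChartAt_target x).mem_nhds (mem_extChartAt_target x)] with u hu
    exact (extChartAt 𝓘(ℝ, E) x).right_inv hu
  rw [h2.fderiv_eq, fderiv_fun_id] at h
  exact h.symm

namespace Reduction

variable {k : ℕ} (R : Reduction k EB B EM M EP P) (R' : Reduction k EB B EM' M' EP' P')
  [FiniteDimensional ℝ EP] [FiniteDimensional ℝ EP'] [IsManifold 𝓘(ℝ, EP) ∞ P]
  [IsManifold 𝓘(ℝ, EP') ∞ P']

theorem extD_fourierForm (x : P) (y : P') :
    extD (𝓘(ℝ, EP).prod 𝓘(ℝ, EP')) (fourierForm R R') (x, y) =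
      ∑ i, (wedge (pull (ContinuousLinearMap.fst ℝ EP EP') (ofCovector (R.A i x)))
        (pull (ContinuousLinearMap.snd ℝ EP EP')
          (extD 𝓘(ℝ, EP') (fun y => ofCovector (R'.A i y)) y)) -
        wedge (pull (ContinuousLinearMap.fst ℝ EP EP')
          (extD 𝓘(ℝ, EP) (fun y => ofCovector (R.A i y)) x))
        (pull (ContinuousLinearMap.snd ℝ EP EP') (ofCovector (R'.A i y)))) := by
  set a : Fin (k + 1) → EP → PForm EP := fun i u j =>
    chartRep 𝓘(ℝ, EP) (fun z => ofCovector (R.A i z) j) x u with ha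
  set a' : Fin (k + 1) → EP' → PForm EP' := fun i u j =>
    chartRep 𝓘(ℝ, EP') (fun z => ofCovector (R'.A i z) j) y u with ha'
  set u₀ := extChartAt 𝓘(ℝ, EP) x x with hu₀
  set v₀ := extChartAt 𝓘(ℝ, EP') y y with hv₀
  have hsa : ∀ i, SmoothFamAt (a i) u₀ := fun i =>
    (R.connection.smooth i).contDiffAt_chartRep isOpen_univ (mem_chart_source EP x) (Set.mem_univ _)
  have hsa' : ∀ i, SmoothFamAt (a' i) v₀ := fun i =>
    (R'.connection.smooth i).contDiffAt_chartRep isOpen_univ (mem_chart_source EP' y)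
      (Set.mem_univ _)
  have hp : ∀ (i : Fin (k + 1)) (u : EP), a i u = pull (diff (extChartAt 𝓘(ℝ, EP) x).symm u : EP →L[ℝ] EP)
      (ofCovector (R.A i ((extChartAt 𝓘(ℝ, EP) x).symm u))) := fun i u => rfl
  have hp' : ∀ (i : Fin (k + 1)) (u : EP'), a' i u =
      pull (diff (extChartAt 𝓘(ℝ, EP') y).symm u : EP' →L[ℝ] EP')
      (ofCovector (R'.A i ((extChartAt 𝓘(ℝ, EP') y).symm u))) := fun i u => rfl
  have hid : ∀ i, a i u₀ = ofCovector (R.A i x) := by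
    intro i
    rw [hp, hu₀, diff_extChartAt_symm_self, extChartAt_to_inv, pull_id]
  have hid' : ∀ i, a' i v₀ = ofCovector (R'.A i y) := by
    intro i
    rw [hp', hv₀, diff_extChartAt_symm_self, extChartAt_to_inv, pull_id]
  have hext : extChartAt (𝓘(ℝ, EP).prod 𝓘(ℝ, EP')) (x, y) (x, y) = (u₀, v₀) := by
    rw [extChartAt_prod]; rfl
  have hev : (fun (u : EP × EP') j => chartRep (𝓘(ℝ, EP).prod 𝓘(ℝ, EP'))
      (fun z => fourierForm R R' z j) (x, y) u) =ᶠ[nhds (u₀, v₀)]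
      fun u => -∑ i, wedge (pull (ContinuousLinearMap.fst ℝ EP EP') (a i u.1))
        (pull (ContinuousLinearMap.snd ℝ EP EP') (a' i u.2)) := by
    have ht : ∀ᶠ u : EP × EP' in nhds (u₀, v₀), u.1 ∈ (extChartAt 𝓘(ℝ, EP) x).target ∧
        u.2 ∈ (extChartAt 𝓘(ℝ, EP') y).target :=
      (continuous_fst.continuousAt.eventually_mem
        ((isOpen_extChartAt_target x).mem_nhds (mem_extChartAt_target x))).and
      (continuous_snd.continuousAt.eventually_mem
        ((isOpen_extChartAt_target y).mem_nhds (mem_extChartAt_target y)))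
    filter_upwards [ht] with u hu
    have hf : (extChartAt (𝓘(ℝ, EP).prod 𝓘(ℝ, EP')) (x, y)).symm u =
        ((extChartAt 𝓘(ℝ, EP) x).symm u.1, (extChartAt 𝓘(ℝ, EP') y).symm u.2) := by
      rw [extChartAt_prod]; rfl
    have h1 : (fun j => chartRep (𝓘(ℝ, EP).prod 𝓘(ℝ, EP')) (fun z => fourierForm R R' z j)
        (x, y) u) = pull (mfderiv 𝓘(ℝ, EP × EP') (𝓘(ℝ, EP).prod 𝓘(ℝ, EP'))
          (extChartAt (𝓘(ℝ, EP).prod 𝓘(ℝ, EP')) (x, y)).symm u : EP × EP' →L[ℝ] EP × EP')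
          (fourierForm R R' ((extChartAt (𝓘(ℝ, EP).prod 𝓘(ℝ, EP')) (x, y)).symm u)) := rfl
    rw [h1, mfderiv_extChartAt_prod_symm x y hu.1 hu.2, hf, fourierForm, pull_neg, pull_sum]
    refine congrArg Neg.neg (Finset.sum_congr rfl fun i _ => ?_)
    rw [pull_wedge]
    rfl
  have hs1 : ∀ i, SmoothFamAt (fun u : EP × EP' => pull (ContinuousLinearMap.fst ℝ EP EP')
      (a i u.1)) (u₀, v₀) := fun i => SmoothFamAt.pull contDiffAt_const
    (SmoothFamAt.comp (f := Prod.fst) (y := (u₀, v₀)) (hsa i) contDiffAt_fst)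
  have hs2 : ∀ i, SmoothFamAt (fun u : EP × EP' => pull (ContinuousLinearMap.snd ℝ EP EP')
      (a' i u.2)) (u₀, v₀) := fun i => SmoothFamAt.pull contDiffAt_const
    (SmoothFamAt.comp (f := Prod.snd) (y := (u₀, v₀)) (hsa' i) contDiffAt_snd)
  have hd1 : ∀ i, flatD (fun u : EP × EP' => pull (ContinuousLinearMap.fst ℝ EP EP') (a i u.1))
      (u₀, v₀) = pull (ContinuousLinearMap.fst ℝ EP EP')
        (extD 𝓘(ℝ, EP) (fun y => ofCovector (R.A i y)) x) := fun i => by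
    rw [extD_eq_flatD]
    exact flatD_pull_linear (ContinuousLinearMap.fst ℝ EP EP') (z := (u₀, v₀)) (hsa i)
  have hd2 : ∀ i, flatD (fun u : EP × EP' => pull (ContinuousLinearMap.snd ℝ EP EP') (a' i u.2))
      (u₀, v₀) = pull (ContinuousLinearMap.snd ℝ EP EP')
        (extD 𝓘(ℝ, EP') (fun y => ofCovector (R'.A i y)) y) := fun i => by
    rw [extD_eq_flatD]
    exact flatD_pull_linear (ContinuousLinearMap.snd ℝ EP EP') (z := (u₀, v₀)) (hsa' i)
  rw [extD_eq_flatD, hext, flatD_congr hev, flatD_neg (SmoothFamAt.sum _ fun i _ =>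
    (hs1 i).wedge (hs2 i)), flatD_sum _ fun i _ => (hs1 i).wedge (hs2 i), ← Finset.sum_neg_distrib]
  refine Finset.sum_congr rfl fun i _ => ?_
  rw [flatD_wedge (hs1 i) (hs2 i), hd1, hd2, hid, hid', ← pull_gradeInv, gradeInv_ofCovector,
    pull_neg, wedge_neg_left]
  abel

end Reduction

/-! ### The twists of T-dual bundles in a frame -/

section Extract

variable {W : Type*} [NormedAddCommGroup W] [NormedSpace ℝ W] {k : ℕ}

theorem dropZero_surjective : Function.Surjective (dropZero W k) := fun v =>
  ⟨_, Reduction.dropZero_consZero k v⟩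

theorem pull_dropZero_injective {φ ψ : PForm (W × (Fin k → ℝ))}
    (h : pull (dropZero W k) φ = pull (dropZero W k) ψ) : φ = ψ :=
  pull_injective_of_surjective dropZero_surjective h

/-- The pair of forms `(φ, ψ)` lifted to `φ + z ds₀ ∧ ψ`. -/
def linLift (z : ℂ) (p : PForm (W × (Fin k → ℝ)) × PForm (W × (Fin k → ℝ))) :
    PForm (W × (Fin (k + 1) → ℝ)) :=
  pull (dropZero W k) p.1 + z • wedge (ofCovector (ds W 0)) (pull (dropZero W k) p.2)

/-- The map `(w, c, c') ↦ (w, c', c)`. -/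
def corrSwap (W : Type*) [NormedAddCommGroup W] [NormedSpace ℝ W] (n : ℕ) :
    W × (Fin n → ℝ) × (Fin n → ℝ) →L[ℝ] W × (Fin n → ℝ) × (Fin n → ℝ) :=
  (ContinuousLinearMap.fst ℝ _ _).prod
    (((ContinuousLinearMap.snd ℝ _ _).comp (ContinuousLinearMap.snd ℝ _ _)).prod
      ((ContinuousLinearMap.fst ℝ _ _).comp (ContinuousLinearMap.snd ℝ _ _)))

/-- The equation `p^*H - p'^*H' = ∑ (A_i ∧ dA'_i - dA_i ∧ A'_i)` in a frame. -/
def FluxEq (F F' : Fin (k + 1) → PForm W)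
    (q q' : PForm (W × (Fin k → ℝ)) × PForm (W × (Fin k → ℝ))) : Prop :=
  pull (corrFst W (k + 1)) (linLift 1 q) - pull (corrSnd W (k + 1)) (linLift 1 q') =
    ∑ i, (wedge (pull (corrFst W (k + 1)) (ofCovector (ds W i)))
        (pull (corrSnd W (k + 1)) (basic (F' i))) -
      wedge (pull (corrFst W (k + 1)) (basic (F i)))
        (pull (corrSnd W (k + 1)) (ofCovector (ds W i))))

variable {F F' : Fin (k + 1) → PForm W} {q q' : PForm (W × (Fin k → ℝ)) × PForm (W × (Fin k → ℝ))}

theorem FluxEq.symm (hF : ∀ i, gradeInv (F i) = F i) (hF' : ∀ i, gradeInv (F' i) = F' i)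
    (h : FluxEq F F' q q') : FluxEq F' F q' q := by
  have h1 := congrArg (fun φ => -pull (corrSwap W (k + 1)) φ) h
  have e1 : (corrFst W (k + 1)).comp (corrSwap W (k + 1)) = corrSnd W (k + 1) := rfl
  have e2 : (corrSnd W (k + 1)).comp (corrSwap W (k + 1)) = corrFst W (k + 1) := rfl
  simp only [pull_sub, pull_sum, pull_wedge, pull_pull, e1, e2, neg_sub] at h1
  rw [FluxEq, h1, ← Finset.sum_neg_distrib]
  refine Finset.sum_congr rfl fun i _ => ?_
  have c1 : wedge (pull (corrSnd W (k + 1)) (ofCovector (ds W i)))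
      (pull (corrFst W (k + 1)) (basic (F' i))) =
      wedge (pull (corrFst W (k + 1)) (basic (F' i)))
        (pull (corrSnd W (k + 1)) (ofCovector (ds W i))) := by
    rw [pull_ofCovector, covector_wedge, ← pull_gradeInv, basic, ← pull_gradeInv, hF']
  have c2 : wedge (pull (corrSnd W (k + 1)) (basic (F i)))
        (pull (corrFst W (k + 1)) (ofCovector (ds W i))) =
      wedge (pull (corrFst W (k + 1)) (ofCovector (ds W i)))
        (pull (corrSnd W (k + 1)) (basic (F i))) := by
    rw [pull_ofCovector, covector_wedge, ← pull_gradeInv, basic, ← pull_gradeInv, hF]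
  rw [c1, c2, neg_sub]

/-- The map `(w, c) ↦ (w, (0, c), 0)`. -/
def corrIncl (W : Type*) [NormedAddCommGroup W] [NormedSpace ℝ W] (k : ℕ) :
    W × (Fin k → ℝ) →L[ℝ] W × (Fin (k + 1) → ℝ) × (Fin (k + 1) → ℝ) :=
  (ContinuousLinearMap.fst ℝ _ _).prod
    (((ContinuousLinearMap.snd ℝ _ _).comp (Reduction.consZero W k)).prod 0)

theorem corrFst_comp_corrIncl :
    (corrFst W (k + 1)).comp (corrIncl W k) = Reduction.consZero W k :=
  ContinuousLinearMap.ext fun _ => rfl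

theorem dropZero_comp_consZero :
    (dropZero W k).comp (Reduction.consZero W k) = ContinuousLinearMap.id ℝ _ :=
  ContinuousLinearMap.ext fun v => Reduction.dropZero_consZero k v

theorem corrSnd_comp_corrIncl : (corrSnd W (k + 1)).comp (corrIncl W k) =
    (ContinuousLinearMap.inl ℝ W (Fin (k + 1) → ℝ)).comp (ContinuousLinearMap.fst ℝ W _) :=
  ContinuousLinearMap.ext fun _ => rfl

theorem dropZero_comp_corrSnd_comp_corrIncl :
    (dropZero W k).comp ((corrSnd W (k + 1)).comp (corrIncl W k)) =
      (ContinuousLinearMap.inl ℝ W (Fin k → ℝ)).comp (ContinuousLinearMap.fst ℝ W _) :=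
  ContinuousLinearMap.ext fun _ => rfl

theorem pull_corrSnd_comp_corrIncl_basic (β : PForm W) :
    pull ((corrSnd W (k + 1)).comp (corrIncl W k)) (basic β) = basic β := by
  rw [corrSnd_comp_corrIncl, basic, basic, pull_pull, ← ContinuousLinearMap.comp_assoc,
    ContinuousLinearMap.fst_comp_inl, ContinuousLinearMap.id_comp]

theorem ds_zero_comp_consZero : (ds W (0 : Fin (k + 1))).comp (Reduction.consZero W k) = 0 :=
  ContinuousLinearMap.ext fun _ => rfl

theorem ds_succ_comp_consZero (i : Fin k) :
    (ds W i.succ).comp (Reduction.consZero W k) = ds W i :=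
  ContinuousLinearMap.ext fun _ => rfl

theorem ds_comp_corrSnd_comp_corrIncl (i : Fin (k + 1)) :
    (ds W i).comp ((corrSnd W (k + 1)).comp (corrIncl W k)) = 0 :=
  ContinuousLinearMap.ext fun _ => rfl

theorem pull_corrIncl_corrFst_linLift (z : ℂ)
    (p : PForm (W × (Fin k → ℝ)) × PForm (W × (Fin k → ℝ))) :
    pull (corrIncl W k) (pull (corrFst W (k + 1)) (linLift z p)) = p.1 := by
  rw [pull_pull, corrFst_comp_corrIncl, linLift, pull_add, pull_smul, pull_wedge, pull_ofCovector,
    ds_zero_comp_consZero, ofCovector_zero, wedge_zero_left, pull_pull, dropZero_comp_consZero,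
    pull_id, pform_smul_zero, add_zero]

theorem pull_corrIncl_corrSnd_linLift (z : ℂ)
    (p : PForm (W × (Fin k → ℝ)) × PForm (W × (Fin k → ℝ))) :
    pull (corrIncl W k) (pull (corrSnd W (k + 1)) (linLift z p)) =
      basic (pull (ContinuousLinearMap.inl ℝ W (Fin k → ℝ)) p.1) := by
  rw [pull_pull, linLift, pull_add, pull_smul, pull_wedge, pull_ofCovector,
    ds_comp_corrSnd_comp_corrIncl, ofCovector_zero, wedge_zero_left, pform_smul_zero, add_zero,
    pull_pull, dropZero_comp_corrSnd_comp_corrIncl, basic, pull_pull]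

theorem FluxEq.fst_eq (hF' : ∀ i, gradeInv (F' i) = F' i) (h : FluxEq F F' q q') :
    q.1 = frameH3 k F' (pull (ContinuousLinearMap.inl ℝ W (Fin k → ℝ)) q'.1) := by
  have h1 := congrArg (pull (corrIncl W k)) h
  rw [pull_sub, pull_corrIncl_corrFst_linLift, pull_corrIncl_corrSnd_linLift, pull_sum,
    Fin.sum_univ_succ, sub_eq_iff_eq_add] at h1
  rw [h1, frameH3, add_comm]
  have e : ∀ i, pull (corrIncl W k) (wedge (pull (corrFst W (k + 1)) (ofCovector (ds W i)))
        (pull (corrSnd W (k + 1)) (basic (F' i))) -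
      wedge (pull (corrFst W (k + 1)) (basic (F i)))
        (pull (corrSnd W (k + 1)) (ofCovector (ds W i)))) =
      wedge (ofCovector ((ds W i).comp (Reduction.consZero W k))) (basic (F' i)) := fun i => by
    rw [pull_sub, pull_wedge, pull_wedge, pull_pull, pull_pull, pull_pull, pull_pull,
      pull_corrSnd_comp_corrIncl_basic, pull_ofCovector, pull_ofCovector,
      ds_comp_corrSnd_comp_corrIncl, ofCovector_zero, wedge_zero_right, sub_zero,
      corrFst_comp_corrIncl]
  rw [e, ds_zero_comp_consZero, ofCovector_zero, wedge_zero_left, zero_add]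
  congr 1
  refine Finset.sum_congr rfl fun i _ => ?_
  rw [e, ds_succ_comp_consZero, covector_wedge, basic, ← pull_gradeInv, hF']

theorem FluxEq.snd_eq (h : FluxEq F F' q q') : q.2 = basic (F' 0) := by
  let X : W × (Fin (k + 1) → ℝ) × (Fin (k + 1) → ℝ) := (0, Pi.single 0 1, 0)
  have x1 : corrFst W (k + 1) X = del W 0 := rfl
  have x2 : corrSnd W (k + 1) X = 0 := rfl
  have x3 : dropZero W k (del W 0) = 0 := by
    rw [dropZero_apply]
    refine Prod.ext rfl (funext fun i => ?_)
    simp [Fin.tail, del]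
  have a1 : iota X (pull (corrFst W (k + 1)) (linLift 1 q)) =
      pull (corrFst W (k + 1)) (pull (dropZero W k) q.2) := by
    rw [iota_pull, x1, linLift, one_smul, iota_add, iota_pull, x3, iota_vzero, pull_zero, zero_add,
      iota_covector_wedge, iota_pull, x3, iota_vzero, pull_zero, wedge_zero_right, sub_zero,
      ds_del, if_pos rfl, one_smul]
  have a2 : iota X (pull (corrSnd W (k + 1)) (linLift 1 q')) = 0 := by
    rw [iota_pull, x2, iota_vzero, pull_zero]
  have a3 : ∀ i, iota X (wedge (pull (corrFst W (k + 1)) (ofCovector (ds W i)))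
        (pull (corrSnd W (k + 1)) (basic (F' i))) -
      wedge (pull (corrFst W (k + 1)) (basic (F i)))
        (pull (corrSnd W (k + 1)) (ofCovector (ds W i)))) =
      (ds W i (del W 0) : ℝ) • pull (corrSnd W (k + 1)) (basic (F' i)) := fun i => by
    rw [iota_sub, pull_ofCovector, iota_covector_wedge, iota_wedge, iota_pull, iota_pull,
      iota_pull, x1, x2, iota_del_basic, iota_vzero, iota_vzero, pull_zero, pull_zero,
      wedge_zero_left, wedge_zero_right, wedge_zero_right, add_zero, sub_zero, sub_zero]
    rfl
  have h1 := congrArg (fun φ => pull (corrIncl W k) (iota X φ)) h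
  simp only [iota_sub, a1, a2, sub_zero, iota_sum] at h1
  simp only [← iota_sub, a3] at h1
  rw [pull_pull, pull_pull, ← ContinuousLinearMap.comp_assoc, ContinuousLinearMap.comp_assoc,
    corrFst_comp_corrIncl, dropZero_comp_consZero, pull_id, pull_sum,
    Finset.sum_eq_single 0 (fun i _ hi => by rw [ds_del, if_neg hi,
      pform_zero_rsmul, pull_zero]) (by simp)] at h1
  rw [h1, ds_del, if_pos rfl, one_smul, pull_pull,
    pull_corrSnd_comp_corrIncl_basic]

end Extract

namespace FrameChart

variable {n : ℕ}

/-- The curvature forms of the frame. -/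
def curv {T : TorusBundle n EP P EB B} {f : T.Frame} {c : BaseChart EB B} (K : FrameChart f c)
    (u : EB) (i : Fin n) : PForm EB :=
  flatD (fun y => ofCovector (K.θ y i)) u

theorem gradeInv_flatD_ofCovector (ξ : EB → EB →L[ℝ] ℝ) (u : EB) :
    gradeInv (flatD (fun y => ofCovector (ξ y)) u) = flatD (fun y => ofCovector (ξ y)) u := by
  funext l
  rcases l with _ | _ | _ | l
  · simp [gradeInv_apply]
  · have h : flatD (fun y => ofCovector (ξ y)) u 1 = 0 := by
      have h0 : (fun y => ofCovector (ξ y) 0) = fun _ => 0 :=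
        funext fun y => ofCovector_apply_of_ne _ (by norm_num)
      show extDeriv (fun y => ofCovector (ξ y) 0) u = 0
      rw [h0]
      ext
      simp [extDeriv, ContinuousAlternatingMap.alternatizeUncurryFin_apply]
    rw [gradeInv_apply, h]
    ext
    simp
  · simp [gradeInv_apply]
  · have h : flatD (fun y => ofCovector (ξ y)) u (l + 3) = 0 := by
      have h0 : (fun y => ofCovector (ξ y) (l + 2)) = fun _ => 0 :=
        funext fun y => ofCovector_apply_of_ne _ (by omega)
      show extDeriv (fun y => ofCovector (ξ y) (l + 2)) u = 0
      rw [h0]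
      ext
      simp [extDeriv, ContinuousAlternatingMap.alternatizeUncurryFin_apply]
    rw [gradeInv_apply, h]
    ext
    simp

variable {T : TorusBundle n EP P EB B} {f : T.Frame} {c : BaseChart EB B} (K : FrameChart f c)

theorem gradeInv_curv (u : EB) (i : Fin n) : gradeInv (K.curv u i) = K.curv u i :=
  gradeInv_flatD_ofCovector _ _

end FrameChart

section

variable {n : ℕ} {T : TorusBundle n EP P EB B}

theorem pull_nf_symm_of_pull_d {f : T.Frame} {c : BaseChart EB B} (K : FrameChart f c)
    {z : EB × (Fin n → ℝ)} {φ : PForm EP} {β : PForm (EB × (Fin n → ℝ))}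
    (h : pull (K.d z : EB × (Fin n → ℝ) →L[ℝ] EP) φ = pull (shearMap (K.θ z.1)) β) :
    pull ((K.nf z).symm : EB × (Fin n → ℝ) →L[ℝ] EP) φ = β :=
  pull_injective_of_surjective (shear (K.θ z.1)).surjective h

variable [FiniteDimensional ℝ EP] [FiniteDimensional ℝ EB]

theorem pull_nf_symm_connection {A : Fin n → P → EP →L[ℝ] ℝ} (hA : T.IsConnection A)
    {c : BaseChart EB B} (K : FrameChart hA.frame c) (z : EB × (Fin n → ℝ)) (i : Fin n) :
    pull ((K.nf z).symm : EB × (Fin n → ℝ) →L[ℝ] EP) (ofCovector (A i (K.Ψ z))) =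
      ofCovector (ds EB i) := by
  rw [pull_ofCovector]
  congr 1
  refine ContinuousLinearMap.ext fun v => ?_
  have h : ∀ w, A i (K.Ψ z) w = (K.nf z w).2 i := fun w => rfl
  show A i (K.Ψ z) ((K.nf z).symm v) = v.2 i
  rw [h, ContinuousLinearEquiv.apply_symm_apply]

variable [IsManifold 𝓘(ℝ, EP) ∞ P]

theorem pull_nf_symm_extD_connection {A : Fin n → P → EP →L[ℝ] ℝ} (hA : T.IsConnection A)
    {c : BaseChart EB B} (K : FrameChart hA.frame c) {u : EB} (hu : u ∈ c.e.target)
    (s : Fin n → ℝ) (i : Fin n) :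
    pull ((K.nf (u, s)).symm : EB × (Fin n → ℝ) →L[ℝ] EP)
      (extD 𝓘(ℝ, EP) (fun y => ofCovector (A i y)) (K.Ψ (u, s))) = basic (K.curv u i) := by
  refine pull_nf_symm_of_pull_d K ?_
  rw [← (K.isParam hu s).flatD_pull (hA.smooth i) isOpen_univ (Set.mem_univ _)]
  have h : (fun y => pull (K.d y : EB × (Fin n → ℝ) →L[ℝ] EP) (ofCovector (A i (K.Ψ y)))) =
      fun y : EB × (Fin n → ℝ) => pull (shearMap (K.θ y.1)) (ofCovector (ds EB i)) := by
    funext y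
    rw [← pull_nf_symm_connection hA K y i]
    rfl
  rw [h, flatD_pull_shearMap (K.smooth_θ u hu) (SmoothFamAt.const (ofCovector (ds EB i))) s]
  congr 1
  have h2 : baseD (fun _ : EB => (ofCovector (ds EB i) : PForm (EB × (Fin n → ℝ)))) u = 0 :=
    Finset.sum_eq_zero fun j _ => by rw [pd_const, wedge_zero_right]
  rw [frameD, h2, zero_add, Finset.sum_eq_single i]
  · rw [iota_ofCovector, wedge_const, ds_del, if_pos rfl, Complex.ofReal_one, one_smul]; rfl
  · intro j _ hj
    rw [iota_ofCovector, wedge_const, ds_del, if_neg (Ne.symm hj), Complex.ofReal_zero,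
      pform_zero_smul]
  · simp

end

section Twists

variable {k : ℕ} {R : Reduction k EB B EM M EP P} [FiniteDimensional ℝ EP] [FiniteDimensional ℝ EB]
  [IsManifold 𝓘(ℝ, EM) ∞ M] [FiniteDimensional ℝ EM] {c : BaseChart EB B}

theorem Reduction.pull_nf_symm_pullback_q (K : FrameChart R.frP c) (u : EB) (s : Fin (k + 1) → ℝ)
    (φ : M → PForm EM) :
    pull ((K.nf (u, s)).symm : EB × (Fin (k + 1) → ℝ) →L[ℝ] EP) (pullback R.q φ (K.Ψ (u, s))) =
      pull (dropZero EB k) (pull (((R.quotChart K).nf (u, Fin.tail s)).symm :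
        EB × (Fin k → ℝ) →L[ℝ] EM) (φ ((R.quotChart K).Ψ (u, Fin.tail s)))) := by
  rw [← R.quotChart_Ψ K s]
  show pull _ (pull (R.dq (K.Ψ (u, s))) (φ (R.q (K.Ψ (u, s))))) = _
  rw [pull_pull, pull_pull]
  congr 1
  refine ContinuousLinearMap.ext fun v => ?_
  refine ((R.quotChart K).nf (u, Fin.tail s)).injective ?_
  refine (R.nf_quotChart_dq K s _).trans ?_
  refine Eq.trans ?_ (((R.quotChart K).nf (u, Fin.tail s)).apply_symm_apply _).symm
  exact congrArg (dropZero EB k) ((K.nf (u, s)).apply_symm_apply v)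

omit [IsManifold 𝓘(ℝ, EM) ∞ M] [FiniteDimensional ℝ EM] in
theorem Reduction.pull_nf_symm_ofCovector_A (K : FrameChart R.frP c) (z : EB × (Fin (k + 1) → ℝ))
    (i : Fin (k + 1)) : pull ((K.nf z).symm : EB × (Fin (k + 1) → ℝ) →L[ℝ] EP)
      (ofCovector (R.A i (K.Ψ z))) = ofCovector (ds EB i) :=
  pull_nf_symm_connection R.connection K z i

omit [IsManifold 𝓘(ℝ, EM) ∞ M] [FiniteDimensional ℝ EM] in
theorem Reduction.pull_nf_symm_extD_A [IsManifold 𝓘(ℝ, EP) ∞ P] (K : FrameChart R.frP c) {u : EB}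
    (hu : u ∈ c.e.target) (s : Fin (k + 1) → ℝ) (i : Fin (k + 1)) :
    pull ((K.nf (u, s)).symm : EB × (Fin (k + 1) → ℝ) →L[ℝ] EP)
      (extD 𝓘(ℝ, EP) (fun y => ofCovector (R.A i y)) (K.Ψ (u, s))) = basic (K.curv u i) :=
  pull_nf_symm_extD_connection R.connection K hu s i

theorem Reduction.pull_nf_symm_lift (K : FrameChart R.frP c) (u : EB) (s : Fin (k + 1) → ℝ)
    (z : ℂ) (p : M → PForm EM × PForm EM) :
    pull ((K.nf (u, s)).symm : EB × (Fin (k + 1) → ℝ) →L[ℝ] EP) (R.lift z p (K.Ψ (u, s))) =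
      linLift z (pullPair (((R.quotChart K).nf (u, Fin.tail s)).symm :
        EB × (Fin k → ℝ) →L[ℝ] EM) (p ((R.quotChart K).Ψ (u, Fin.tail s)))) := by
  rw [Reduction.lift, pull_add, pull_smul, pull_wedge, R.pull_nf_symm_pullback_q,
    R.pull_nf_symm_pullback_q, R.pull_nf_symm_ofCovector_A K]
  rfl

theorem Reduction.IsCurvature.pull_nf_symm [IsManifold 𝓘(ℝ, EP) ∞ P] {t : Twist EM M}
    (h : R.IsCurvature t) (K : FrameChart R.frP c) {u : EB} (hu : u ∈ c.e.target)
    (s : Fin k → ℝ) :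
    pull (((R.quotChart K).nf (u, s)).symm : EB × (Fin k → ℝ) →L[ℝ] EM)
      (ofReal 2 (t.F ((R.quotChart K).Ψ (u, s)))) = basic (K.curv u 0) := by
  refine pull_dropZero_injective ?_
  have h1 := R.pull_nf_symm_pullback_q K u (Fin.cons 0 s) (fun y => ofReal 2 (t.F y))
  rw [← h, R.pull_nf_symm_extD_A K hu, Fin.tail_cons] at h1
  rw [← h1]
  rfl

variable [FiniteDimensional ℝ EP'] [IsManifold 𝓘(ℝ, EM') ∞ M'] [FiniteDimensional ℝ EM']
  [IsManifold 𝓘(ℝ, EP) ∞ P] [IsManifold 𝓘(ℝ, EP') ∞ P'] {R' : Reduction k EB B EM' M' EP' P'}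

/-- The twist in a normalised frame. -/
def FrameChart.twistPair {T : TorusBundle k EM M EB B} {f : T.Frame} (K : FrameChart f c)
    (t : Twist EM M) (z : EB × (Fin k → ℝ)) :
    PForm (EB × (Fin k → ℝ)) × PForm (EB × (Fin k → ℝ)) :=
  pullPair ((K.nf z).symm : EB × (Fin k → ℝ) →L[ℝ] EM)
    (ofReal 3 (t.H3 (K.Ψ z)), ofReal 2 (t.H2 (K.Ψ z)))

/-- The isomorphism of `W × ℝⁿ × ℝⁿ` with the tangent space of the correspondence space. -/
def corrTangent (K : FrameChart R.frP c) (K' : FrameChart R'.frP c)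
    (z z' : EB × (Fin (k + 1) → ℝ)) :
    EB × (Fin (k + 1) → ℝ) × (Fin (k + 1) → ℝ) →L[ℝ] EP × EP' :=
  (((K.nf z).symm : _ →L[ℝ] EP).comp (corrFst EB (k + 1))).prod
    (((K'.nf z').symm : _ →L[ℝ] EP').comp (corrSnd EB (k + 1)))

omit [IsManifold 𝓘(ℝ, EM) ∞ M] [FiniteDimensional ℝ EM] [IsManifold 𝓘(ℝ, EM') ∞ M']
  [FiniteDimensional ℝ EM'] [IsManifold 𝓘(ℝ, EP) ∞ P] [IsManifold 𝓘(ℝ, EP') ∞ P'] in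
theorem dproj_corrTangent (K : FrameChart R.frP c) (K' : FrameChart R'.frP c)
    (u : EB) (s s' : Fin (k + 1) → ℝ)
    (v : EB × (Fin (k + 1) → ℝ) × (Fin (k + 1) → ℝ)) :
    R.TP.dproj (K.Ψ (u, s)) (corrTangent K K' (u, s) (u, s') v).1 =
      R'.TP.dproj (K'.Ψ (u, s')) (corrTangent K K' (u, s) (u, s') v).2 := by
  have h1 : ∀ w, (K.nf (u, s) w).1 = (c.D u).symm (R.TP.dproj (K.Ψ (u, s)) w) := fun w =>
    congrArg (c.D u).symm (R.frP.fst_fr _ w)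
  have h2 : ∀ w, (K'.nf (u, s') w).1 = (c.D u).symm (R'.TP.dproj (K'.Ψ (u, s')) w) := fun w =>
    congrArg (c.D u).symm (R'.frP.fst_fr _ w)
  refine (c.D u).symm.injective ?_
  rw [← h1, ← h2]
  show (K.nf (u, s) ((K.nf (u, s)).symm _)).1 = (K'.nf (u, s') ((K'.nf (u, s')).symm _)).1
  rw [ContinuousLinearEquiv.apply_symm_apply, ContinuousLinearEquiv.apply_symm_apply]
  rfl

theorem IsTDual.fluxEq {t : Twist EM M} {t' : Twist EM' M'} (h : IsTDual R R' t t')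
    (K : FrameChart R.frP c) (K' : FrameChart R'.frP c) {u : EB} (hu : u ∈ c.e.target)
    (s s' : Fin k → ℝ) : FluxEq (K.curv u) (K'.curv u)
      ((R.quotChart K).twistPair t (u, s)) ((R'.quotChart K').twistPair t' (u, s')) := by
  set z : EB × (Fin (k + 1) → ℝ) := (u, Fin.cons 0 s) with hz
  set z' : EB × (Fin (k + 1) → ℝ) := (u, Fin.cons 0 s') with hz'
  have h1 : pull (corrTangent K K' z z') (pull (ContinuousLinearMap.fst ℝ EP EP')
        (R.flux t (K.Ψ z))) - pull (corrTangent K K' z z')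
          (pull (ContinuousLinearMap.snd ℝ EP EP') (R'.flux t' (K'.Ψ z'))) =
      pull (corrTangent K K' z z') (extD (𝓘(ℝ, EP).prod 𝓘(ℝ, EP')) (fourierForm R R')
        (K.Ψ z, K'.Ψ z')) := by
    funext j
    ext v
    have := h.flux (K.Ψ z) (K'.Ψ z') (by rw [hz, hz', K.proj_Ψ u hu, K'.proj_Ψ u hu]) j
      (fun i => corrTangent K K' z z' (v i)) (fun i => dproj_corrTangent K K' u _ _ (v i))
    exact this
  rw [R.extD_fourierForm, pull_sum] at h1
  have e1 : ∀ φ, pull (corrTangent K K' z z') (pull (ContinuousLinearMap.fst ℝ EP EP') φ) =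
      pull (corrFst EB (k + 1)) (pull ((K.nf z).symm : _ →L[ℝ] EP) φ) := fun φ => rfl
  have e2 : ∀ φ, pull (corrTangent K K' z z') (pull (ContinuousLinearMap.snd ℝ EP EP') φ) =
      pull (corrSnd EB (k + 1)) (pull ((K'.nf z').symm : _ →L[ℝ] EP') φ) := fun φ => rfl
  have f1 := R.pull_nf_symm_lift K u (Fin.cons 0 s) 1
    (fun y => (ofReal 3 (t.H3 y), ofReal 2 (t.H2 y)))
  have f2 := R'.pull_nf_symm_lift K' u (Fin.cons 0 s') 1
    (fun y => (ofReal 3 (t'.H3 y), ofReal 2 (t'.H2 y)))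
  rw [Fin.tail_cons] at f1 f2
  rw [e1, e2, Reduction.flux, Reduction.flux, f1, f2] at h1
  refine h1.trans (Finset.sum_congr rfl fun i _ => ?_)
  rw [pull_sub, pull_wedge, pull_wedge, e1, e2, e1, e2, R.pull_nf_symm_ofCovector_A K,
    R'.pull_nf_symm_ofCovector_A K', R.pull_nf_symm_extD_A K hu,
    R'.pull_nf_symm_extD_A K' hu]

end Twists

section Flat

variable {W : Type*} [NormedAddCommGroup W] [NormedSpace ℝ W] {k : ℕ}

theorem flatD_flatD {α : W → PForm W} {u : W} (hα : SmoothFamAt α u) :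
    flatD (flatD α) u = 0 := by
  funext l
  rcases l with _ | _ | l
  · rfl
  · have h : (fun y => flatD α y 0) = fun _ => 0 := rfl
    show extDeriv (fun y => flatD α y 0) u = 0
    rw [h]
    ext
    simp [extDeriv, ContinuousAlternatingMap.alternatizeUncurryFin_apply]
  · exact extDeriv_extDeriv_apply (hα l) (by simpa using two_le_infty)

theorem SmoothFamAt.flatD {α : W → PForm W} {u : W} (hα : SmoothFamAt α u) :
    SmoothFamAt (flatD α) u := by
  intro l
  rcases l with _ | l
  · exact contDiffAt_const
  · have h1 : ContDiffAt ℝ ∞ (fderiv ℝ fun y => α y l) u := (hα l).fderiv_right le_rfl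
    exact (ContinuousAlternatingMap.alternatizeUncurryFinCLM ℝ W ℂ).contDiff.contDiffAt.comp u h1

theorem flatD_const_rsmul (s : ℝ) (α : W → PForm W) (u : W) :
    flatD (fun y => s • α y) u = s • flatD α u := by
  funext l
  rcases l with _ | l
  · show (0 : W [⋀^Fin 0]→L[ℝ] ℂ) = s • 0
    ext
    simp
  · exact extDeriv_fun_smul s _

theorem basic_injective {β β' : PForm W} (h : (basic β : PForm (W × (Fin k → ℝ))) = basic β') :
    β = β' := pull_injective_of_surjective (f := ContinuousLinearMap.fst ℝ W (Fin k → ℝ))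
  (fun w => ⟨(w, 0), rfl⟩) h

theorem basic_wedge (β β' : PForm W) :
    (basic (wedge β β') : PForm (W × (Fin k → ℝ))) = wedge (basic β) (basic β') :=
  pull_wedge _ _ _

theorem basic_add (β β' : PForm W) :
    (basic (β + β') : PForm (W × (Fin k → ℝ))) = basic β + basic β' := rfl

theorem pull_inl_frameH3 (F : Fin (k + 1) → PForm W) (h : PForm W) :
    pull (ContinuousLinearMap.inl ℝ W (Fin k → ℝ)) (frameH3 k F h) = h := by
  have h0 : ∀ i : Fin k, (ds W i).comp (ContinuousLinearMap.inl ℝ W (Fin k → ℝ)) = 0 := fun i =>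
    ContinuousLinearMap.ext fun _ => rfl
  rw [frameH3, pull_add, pull_sum, Finset.sum_eq_zero, add_zero, basic, pull_pull,
    ContinuousLinearMap.fst_comp_inl, pull_id]
  intro i _
  rw [pull_wedge, pull_ofCovector, h0, ofCovector_zero, wedge_zero_right]

variable [FiniteDimensional ℝ W]

theorem flatD_ofCovector_wedge_comm {ξ : W → W →L[ℝ] ℝ} {u : W} (hξ : ContDiffAt ℝ ∞ ξ u)
    (φ : PForm W) : wedge (flatD (fun y => ofCovector (ξ y)) u) φ =
      wedge φ (flatD (fun y => ofCovector (ξ y)) u) := by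
  rw [flatD_eq_sum _ _ sum_frameCov (SmoothFamAt.ofCovector hξ), wedge_sum_left, wedge_sum_right]
  refine Finset.sum_congr rfl fun j _ => ?_
  rw [pd_ofCovector hξ, wedge_assoc, covector_wedge _ φ, ← wedge_assoc, covector_wedge,
    gradeInv_gradeInv, wedge_assoc]

omit [FiniteDimensional ℝ W] in
theorem flatD_basic {β : W → PForm W} {u : W} (hβ : SmoothFamAt β u) (s : Fin k → ℝ) :
    flatD (fun z : W × (Fin k → ℝ) => (basic (β z.1) : PForm (W × (Fin k → ℝ)))) (u, s) =
      basic (flatD β u) :=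
  flatD_pull_linear (ContinuousLinearMap.fst ℝ W (Fin k → ℝ)) hβ

theorem SmoothFamAt.basic {β : W → PForm W} {u : W} (hβ : SmoothFamAt β u) (s : Fin k → ℝ) :
    SmoothFamAt (fun z : W × (Fin k → ℝ) => (basic (β z.1) : PForm (W × (Fin k → ℝ)))) (u, s) :=
  SmoothFamAt.pull contDiffAt_const (SmoothFamAt.comp (f := Prod.fst) (y := (u, s)) hβ
    contDiffAt_fst)

theorem flatD_pull_shearMap_frameH3 {θ : W → Fin k → W →L[ℝ] ℝ} {F : W → Fin (k + 1) → PForm W}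
    {h : W → PForm W} {u : W} (hθ : ContDiffAt ℝ ∞ θ u) (hF : ∀ i, SmoothFamAt (fun y => F y i) u)
    (hF0 : ∀ i, flatD (fun y => F y i) u = 0) (hg : ∀ i, gradeInv (F u i) = F u i)
    (hh : SmoothFamAt h u) (s : Fin k → ℝ) :
    flatD (fun z : W × (Fin k → ℝ) => pull (shearMap (θ z.1)) (frameH3 k (F z.1) (h z.1))) (u, s) =
      basic (flatD h u + ∑ i : Fin k, wedge (F u i.succ) (flatD (fun y => ofCovector (θ y i)) u)) := by
  have e : ∀ z : W × (Fin k → ℝ), pull (shearMap (θ z.1)) (frameH3 k (F z.1) (h z.1)) =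
      basic (h z.1) + ∑ i : Fin k, wedge (basic (F z.1 i.succ))
        (ofCovector (ds W i) + basic (ofCovector (θ z.1 i))) := by
    intro z
    rw [frameH3, pull_add, pull_sum, pull_shearMap_basic]
    refine congrArg₂ (· + ·) rfl (Finset.sum_congr rfl fun i _ => ?_)
    rw [pull_wedge, pull_shearMap_basic, pull_ofCovector, basic, basic, pull_ofCovector,
      ← ofCovector_add]
    rfl
  have hθi : ∀ i, SmoothFamAt (fun y => ofCovector (θ y i)) u := fun i =>
    SmoothFamAt.ofCovector (contDiffAt_pi.1 hθ i)
  have hc : ∀ i, SmoothFamAt (fun z : W × (Fin k → ℝ) =>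
      ofCovector (ds W i) + (basic (ofCovector (θ z.1 i)) : PForm (W × (Fin k → ℝ)))) (u, s) :=
    fun i => (SmoothFamAt.const _).add ((hθi i).basic s)
  have hw : ∀ i : Fin k, SmoothFamAt (fun z : W × (Fin k → ℝ) => wedge (basic (F z.1 i.succ))
      (ofCovector (ds W i) + (basic (ofCovector (θ z.1 i)) : PForm (W × (Fin k → ℝ))))) (u, s) :=
    fun i => ((hF i.succ).basic s).wedge (hc i)
  simp only [e]
  rw [flatD_add (hh.basic s) (SmoothFamAt.sum _ fun i _ => hw i), flatD_sum _ fun i _ => hw i,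
    flatD_basic hh, basic_add]
  refine congrArg₂ (· + ·) rfl ?_
  rw [basic, pull_sum]
  refine Finset.sum_congr rfl fun i _ => ?_
  have h2 := flatD_wedge ((hF i.succ).basic s) (hc i)
  rw [flatD_basic (hF i.succ), hF0, flatD_add (SmoothFamAt.const _) ((hθi i).basic s), flatD_const,
    zero_add, flatD_basic (hθi i), basic, pull_zero, wedge_zero_left, zero_add, basic,
    ← pull_gradeInv, hg] at h2
  rw [pull_wedge]
  exact h2

end Flat

section Chart

variable {k : ℕ} [FiniteDimensional ℝ EB] {T : TorusBundle k EM M EB B} {f : T.Frame}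
  {c : BaseChart EB B}

omit [FiniteDimensional ℝ EB] in
theorem FrameChart.eventually_mem {u : EB} (hu : u ∈ c.e.target) (s : Fin k → ℝ) :
    ∀ᶠ z : EB × (Fin k → ℝ) in nhds (u, s), z.1 ∈ c.e.target :=
  continuous_fst.continuousAt.eventually_mem (c.e.open_target.mem_nhds hu)

variable [IsManifold 𝓘(ℝ, EM) ∞ M] (K : FrameChart f c)

omit [FiniteDimensional ℝ EB] in
/-- The exterior derivative of an invariant form, in terms of its base family. -/
theorem FrameChart.pull_d_extD {φ : M → PForm EM} {U : Set M} (hφ : SmoothFormOn 𝓘(ℝ, EM) φ U)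
    (hU : IsOpen U) {β : EB → PForm (EB × (Fin k → ℝ))} {u : EB} (hu : u ∈ c.e.target)
    (s : Fin k → ℝ) (hm : K.Ψ (u, s) ∈ U) (hβ : ∀ᶠ z in nhds (u, s),
      pull ((K.nf z).symm : EB × (Fin k → ℝ) →L[ℝ] EM) (φ (K.Ψ z)) = β z.1) :
    pull (K.d (u, s) : EB × (Fin k → ℝ) →L[ℝ] EM) (extD 𝓘(ℝ, EM) φ (K.Ψ (u, s))) =
      flatD (fun z => pull (shearMap (K.θ z.1)) (β z.1)) (u, s) := by
  rw [← (K.isParam hu s).flatD_pull hφ hU hm]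
  refine flatD_congr ?_
  filter_upwards [hβ] with z hz
  rw [← hz]
  rfl

/-- The smoothness of the base family of an invariant form. -/
theorem FrameChart.smoothFamAt_nf {φ : M → PForm EM} {U : Set M} (hφ : SmoothFormOn 𝓘(ℝ, EM) φ U)
    (hU : IsOpen U) {u : EB} (hu : u ∈ c.e.target) (s : Fin k → ℝ) (hm : K.Ψ (u, s) ∈ U) :
    SmoothFamAt (fun y => pull ((K.nf (y, s)).symm : EB × (Fin k → ℝ) →L[ℝ] EM)
      (φ (K.Ψ (y, s)))) u := by
  have h1 := (K.isParam hu s).smoothFamAt hφ hU hm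
  have h2 : SmoothFamAt (fun y => pull (K.d (y, s) : EB × (Fin k → ℝ) →L[ℝ] EM)
      (φ (K.Ψ (y, s)))) u :=
    SmoothFamAt.comp (f := fun y => (y, s)) (y := u) h1 (contDiffAt_id.prodMk contDiffAt_const)
  have h3 : ContDiffAt ℝ ∞ (fun y => shearMap (-K.θ y)) u :=
    contDiffAt_shearMap (K.smooth_θ u hu).neg
  refine (SmoothFamAt.pull h3 h2).congr (Filter.Eventually.of_forall fun y => ?_)
  have h5 : pull (K.d (y, s) : EB × (Fin k → ℝ) →L[ℝ] EM) (φ (K.Ψ (y, s))) =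
    pull (shearMap (K.θ y)) (pull ((K.nf (y, s)).symm : EB × (Fin k → ℝ) →L[ℝ] EM)
      (φ (K.Ψ (y, s)))) := rfl
  simp only [h5]
  have h4 : (shearMap (K.θ y)).comp (shearMap (-K.θ y)) = ContinuousLinearMap.id ℝ _ :=
    ContinuousLinearMap.ext fun v => (shear (K.θ y)).apply_symm_apply v
  rw [pull_pull, h4, pull_id]

/-- The twist of `K` is given by forms on the base. -/
structure FrameChart.HasTwist (t : Twist EM M) (σ : ℝ) (F F' : EB → Fin (k + 1) → PForm EB)
    (h : EB → PForm EB) : Prop where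
  twist : ∀ u ∈ c.e.target, ∀ s, K.twistPair t (u, s) = (frameH3 k (F' u) (h u), σ • basic (F' u 0))
  curv : ∀ u ∈ c.e.target, ∀ s, pull ((K.nf (u, s)).symm : EB × (Fin k → ℝ) →L[ℝ] EM)
    (ofReal 2 (t.F (K.Ψ (u, s)))) = σ • basic (F u 0)
  curv_succ : ∀ u ∈ c.e.target, ∀ i : Fin k, K.curv u i = F u i.succ
  smooth : ∀ u ∈ c.e.target, ∀ i, SmoothFamAt (fun y => F y i) u
  smooth' : ∀ u ∈ c.e.target, ∀ i, SmoothFamAt (fun y => F' y i) u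
  smooth_h : ∀ u ∈ c.e.target, SmoothFamAt h u
  closed : ∀ u ∈ c.e.target, ∀ i, flatD (fun y => F y i) u = 0
  closed' : ∀ u ∈ c.e.target, ∀ i, flatD (fun y => F' y i) u = 0
  even : ∀ u ∈ c.e.target, ∀ i, gradeInv (F u i) = F u i
  even' : ∀ u ∈ c.e.target, ∀ i, gradeInv (F' u i) = F' u i
  odd : ∀ u ∈ c.e.target, gradeInv (h u) = -h u

variable {K} {t : Twist EM M} {σ : ℝ} {F F' : EB → Fin (k + 1) → PForm EB} {h : EB → PForm EB}

omit [FiniteDimensional ℝ EB] in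
theorem FrameChart.extD_eq_zero {η : M → PForm EM}
    (hη : SmoothFormOn 𝓘(ℝ, EM) η Set.univ) {β : EB → PForm EB} {u : EB} (hu : u ∈ c.e.target)
    (s : Fin k → ℝ) (hβ : SmoothFamAt β u) (hc : flatD β u = 0)
    (he : ∀ y ∈ c.e.target, ∀ s, pull ((K.nf (y, s)).symm : EB × (Fin k → ℝ) →L[ℝ] EM)
      (η (K.Ψ (y, s))) = σ • basic (β y)) : extD 𝓘(ℝ, EM) η (K.Ψ (u, s)) = 0 := by
  have h1 := K.pull_d_extD hη isOpen_univ (β := fun y => σ • basic (β y)) hu s (Set.mem_univ _)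
    ((FrameChart.eventually_mem hu s).mono fun z hz => he _ hz _)
  simp only [pull_rsmul, pull_shearMap_basic] at h1
  rw [flatD_const_rsmul, flatD_basic hβ, hc, basic, pull_zero, pform_rsmul_zero] at h1
  exact (pull_eq_zero_iff _ _).1 h1

theorem FrameChart.HasTwist.maurerCartan_iff (H : K.HasTwist t σ F F' h) (hσ : σ * σ = 1)
    (ht : t.Smooth) {u : EB} (hu : u ∈ c.e.target) (s : Fin k → ℝ) :
    (extD 𝓘(ℝ, EM) (fun y => ofReal 3 (t.H3 y)) (K.Ψ (u, s)) +
      wedge (ofReal 2 (t.H2 (K.Ψ (u, s)))) (ofReal 2 (t.F (K.Ψ (u, s)))) = 0 ↔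
      flatD h u + ∑ i, wedge (F' u i) (F u i) = 0) ∧
    extD 𝓘(ℝ, EM) (fun y => ofReal 2 (t.H2 y)) (K.Ψ (u, s)) = 0 ∧
    extD 𝓘(ℝ, EM) (fun y => ofReal 2 (t.F y)) (K.Ψ (u, s)) = 0 := by
  refine ⟨?_, K.extD_eq_zero ht.2.1 hu s (H.smooth' u hu 0) (H.closed' u hu 0)
      fun y hy s => congrArg Prod.snd (H.twist y hy s),
    K.extD_eq_zero ht.2.2 hu s (H.smooth u hu 0) (H.closed u hu 0) H.curv⟩
  rw [← pull_eq_zero_iff (K.d (u, s)), pull_add, K.pull_d_extD ht.1 isOpen_univ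
    (β := fun y => frameH3 k (F' y) (h y)) hu s (Set.mem_univ _)
    ((FrameChart.eventually_mem hu s).mono fun z hz => congrArg Prod.fst (H.twist _ hz z.2)),
    flatD_pull_shearMap_frameH3 (K.smooth_θ u hu) (H.smooth' u hu) (H.closed' u hu)
      (H.even' u hu) (H.smooth_h u hu)]
  have e : pull (K.d (u, s) : EB × (Fin k → ℝ) →L[ℝ] EM)
      (wedge (ofReal 2 (t.H2 (K.Ψ (u, s)))) (ofReal 2 (t.F (K.Ψ (u, s))))) =
      basic (wedge (F' u 0) (F u 0)) := by
    show pull (shearMap (K.θ u)) (pull ((K.nf (u, s)).symm : EB × (Fin k → ℝ) →L[ℝ] EM) _) = _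
    have e2 : pull ((K.nf (u, s)).symm : EB × (Fin k → ℝ) →L[ℝ] EM)
      (ofReal 2 (t.H2 (K.Ψ (u, s)))) = σ • basic (F' u 0) := congrArg Prod.snd (H.twist u hu s)
    rw [pull_wedge, e2, H.curv u hu, wedge_rsmul_left, wedge_rsmul_right, smul_smul, hσ, one_smul,
      ← basic_wedge, pull_shearMap_basic]
  have e3 : ∀ i : Fin k, flatD (fun y => ofCovector (K.θ y i)) u = F u i.succ := fun i =>
    H.curv_succ u hu i
  simp only [e3]
  rw [e, ← basic_add, Fin.sum_univ_succ, add_comm (wedge (F' u 0) (F u 0)), add_assoc]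
  refine ⟨fun h0 => basic_injective (k := k) ?_, fun h0 => ?_⟩
  · rw [h0, basic, pull_zero]
  · rw [h0, basic, pull_zero]

end Chart

section Scale

variable {E M : Type*} [NormedAddCommGroup E] [NormedSpace ℝ E] [TopologicalSpace M]
  [ChartedSpace E M]

theorem ofReal_smul {V : Type*} [NormedAddCommGroup V] [NormedSpace ℝ V] {k : ℕ} (s : ℝ)
    (η : V [⋀^Fin k]→L[ℝ] ℝ) : ofReal k (s • η) = s • ofReal k η := by
  funext l
  ext v
  by_cases h : l = k
  · subst h; simp [ofReal_same_apply]
  · simp [ofReal_of_ne h]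

theorem SmoothFormOn.const_rsmul {φ : M → PForm E} {U : Set M} (h : SmoothFormOn 𝓘(ℝ, E) φ U)
    (s : ℝ) : SmoothFormOn 𝓘(ℝ, E) (fun x => s • φ x) U := fun k x₀ =>
  (h k x₀).const_smul s

theorem Twist.Smooth.scale {t : Twist E M} (h : t.Smooth) (s : ℝ) : (t.scale s).Smooth := by
  refine ⟨h.1, ?_, ?_⟩
  · have := h.2.1.const_rsmul s
    simp only [← ofReal_smul] at this
    exact this
  · have := h.2.2.const_rsmul s
    simp only [← ofReal_smul] at this
    exact this

end Scale

section Twists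

variable {k : ℕ} [FiniteDimensional ℝ EB] [FiniteDimensional ℝ EM] [IsManifold 𝓘(ℝ, EM) ∞ M]
  [FiniteDimensional ℝ EP] [IsManifold 𝓘(ℝ, EP) ∞ P] [FiniteDimensional ℝ EM']
  [IsManifold 𝓘(ℝ, EM') ∞ M'] [FiniteDimensional ℝ EP'] [IsManifold 𝓘(ℝ, EP') ∞ P']
  {R : Reduction k EB B EM M EP P} {R' : Reduction k EB B EM' M' EP' P'}

omit [IsManifold 𝓘(ℝ, EM) ∞ M] [FiniteDimensional ℝ EM] [IsManifold 𝓘(ℝ, EM') ∞ M']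
  [FiniteDimensional ℝ EM'] in
theorem Reduction.exists_charts [IsManifold 𝓘(ℝ, EB) ∞ B] (R : Reduction k EB B EM M EP P)
    (R' : Reduction k EB B EM' M' EP' P') {b : B} {U : Set B}
    (hU : IsOpen U) (hb : b ∈ U) : ∃ (c : BaseChart EB B) (_ : FrameChart R.frP c)
      (_ : FrameChart R'.frP c), b ∈ c.e.source ∧ c.e.source ⊆ U := by
  obtain ⟨V, σ, hV, hbV, hσ, hs⟩ := R.TP.exists_section b
  obtain ⟨V', σ', hV', hbV', hσ', hs'⟩ := R'.TP.exists_section b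
  obtain ⟨c, hbc, hc⟩ := exists_baseChart (EB := EB) ((hU.inter hV).inter hV')
    ⟨⟨hb, hbV⟩, hbV'⟩
  obtain ⟨K⟩ := nonempty_frameChart R.connection c (hσ.mono fun x hx => (hc hx).1.2)
    fun y hy => hs y (hc hy).1.2
  obtain ⟨K'⟩ := nonempty_frameChart R'.connection c (hσ'.mono fun x hx => (hc hx).2)
    fun y hy => hs' y (hc hy).2
  exact ⟨c, K, K', hbc, fun x hx => (hc hx).1.1⟩

variable {t : Twist EM M} {t' : Twist EM' M'} {c : BaseChart EB B}

theorem IsTDual.exists_hasTwist (h : IsTDual R R' t t') (K : FrameChart R.frP c)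
    (K' : FrameChart R'.frP c) : ∃ η : EB → PForm EB,
      (R.quotChart K).HasTwist t 1 K.curv K'.curv η ∧
      ∀ σ : ℝ, (R'.quotChart K').HasTwist (t'.scale σ) σ K'.curv K.curv η := by
  set η : EB → PForm EB := fun u => pull (ContinuousLinearMap.inl ℝ EB (Fin k → ℝ))
    ((R.quotChart K).twistPair t (u, 0)).1 with hη
  have hf : ∀ u ∈ c.e.target, ∀ s s', FluxEq (K.curv u) (K'.curv u)
      ((R.quotChart K).twistPair t (u, s)) ((R'.quotChart K').twistPair t' (u, s')) :=
    fun u hu s s' => h.fluxEq K K' hu s s'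
  have hs : ∀ u ∈ c.e.target, ∀ s s', FluxEq (K'.curv u) (K.curv u)
      ((R'.quotChart K').twistPair t' (u, s')) ((R.quotChart K).twistPair t (u, s)) :=
    fun u hu s s' => (hf u hu s s').symm (K.gradeInv_curv u) (K'.gradeInv_curv u)
  have h' : ∀ u ∈ c.e.target, ∀ s', (R'.quotChart K').twistPair t' (u, s') =
      (frameH3 k (K.curv u) (η u), basic (K.curv u 0)) := fun u hu s' =>
    Prod.ext ((hs u hu 0 s').fst_eq (K.gradeInv_curv u)) (hs u hu 0 s').snd_eq
  have h1 : ∀ u ∈ c.e.target, ∀ s, (R.quotChart K).twistPair t (u, s) =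
      (frameH3 k (K'.curv u) (η u), basic (K'.curv u 0)) := fun u hu s => by
    refine Prod.ext ?_ (hf u hu s 0).snd_eq
    rw [(hf u hu s 0).fst_eq (K'.gradeInv_curv u), h' u hu, pull_inl_frameH3]
  have hθ : ∀ (n : ℕ) (θ : EB → Fin n → EB →L[ℝ] ℝ) (u : EB), ContDiffAt ℝ ∞ θ u → ∀ i,
      SmoothFamAt (fun y => ofCovector (θ y i)) u := fun n θ u hθ i =>
    SmoothFamAt.ofCovector (contDiffAt_pi.1 hθ i)
  have hsη : ∀ u ∈ c.e.target, SmoothFamAt η u := fun u hu =>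
    SmoothFamAt.pull contDiffAt_const
      ((R.quotChart K).smoothFamAt_nf h.smooth.1 isOpen_univ hu 0 (Set.mem_univ _))
  have hoη : ∀ u ∈ c.e.target, gradeInv (η u) = -η u := fun u _ => by
    have e : gradeInv (ofReal 3 (t.H3 ((R.quotChart K).Ψ (u, 0)))) =
        -ofReal 3 (t.H3 ((R.quotChart K).Ψ (u, 0))) := by
      rw [gradeInv_ofReal, ← pform_neg_one_rsmul]; norm_num
    rw [hη]
    simp only [FrameChart.twistPair, pullPair]
    rw [← pull_gradeInv, ← pull_gradeInv, e, pull_neg, pull_neg]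
  refine ⟨η, ⟨fun u hu s => ?_, fun u hu s => ?_, fun _ _ _ => rfl,
      fun u hu i => (hθ _ _ u (K.smooth_θ u hu) i).flatD,
      fun u hu i => (hθ _ _ u (K'.smooth_θ u hu) i).flatD, hsη,
      fun u hu i => flatD_flatD (hθ _ _ u (K.smooth_θ u hu) i),
      fun u hu i => flatD_flatD (hθ _ _ u (K'.smooth_θ u hu) i),
      fun u _ => K.gradeInv_curv u, fun u _ => K'.gradeInv_curv u, hoη⟩,
    fun σ => ⟨fun u hu s => ?_, fun u hu s => ?_, fun _ _ _ => rfl,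
      fun u hu i => (hθ _ _ u (K'.smooth_θ u hu) i).flatD,
      fun u hu i => (hθ _ _ u (K.smooth_θ u hu) i).flatD, hsη,
      fun u hu i => flatD_flatD (hθ _ _ u (K'.smooth_θ u hu) i),
      fun u hu i => flatD_flatD (hθ _ _ u (K.smooth_θ u hu) i),
      fun u _ => K'.gradeInv_curv u, fun u _ => K.gradeInv_curv u, hoη⟩⟩
  · rw [h1 u hu, one_smul]
  · rw [h.curvature.pull_nf_symm K hu, one_smul]
  · have e := h' u hu s
    refine Prod.ext (Prod.mk.inj e).1 ?_
    show pull _ (ofReal 2 (σ • t'.H2 _)) = _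
    rw [ofReal_smul, pull_rsmul]
    exact congrArg (σ • ·) (Prod.mk.inj e).2
  · show pull _ (ofReal 2 (σ • t'.F _)) = _
    rw [ofReal_smul, pull_rsmul, h.curvature'.pull_nf_symm K' hu]

theorem IsTDual.maurerCartan_at (h : IsTDual R R' t t') (ht : t.MaurerCartan) {σ : ℝ}
    (hσ : σ * σ = 1) (K : FrameChart R.frP c) (K' : FrameChart R'.frP c) {u : EB}
    (hu : u ∈ c.e.target) (s : Fin k → ℝ) :
    extD 𝓘(ℝ, EM') (fun y => ofReal 3 ((t'.scale σ).H3 y)) ((R'.quotChart K').Ψ (u, s)) +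
      wedge (ofReal 2 ((t'.scale σ).H2 ((R'.quotChart K').Ψ (u, s))))
        (ofReal 2 ((t'.scale σ).F ((R'.quotChart K').Ψ (u, s)))) = 0 ∧
    extD 𝓘(ℝ, EM') (fun y => ofReal 2 ((t'.scale σ).H2 y)) ((R'.quotChart K').Ψ (u, s)) = 0 ∧
    extD 𝓘(ℝ, EM') (fun y => ofReal 2 ((t'.scale σ).F y)) ((R'.quotChart K').Ψ (u, s)) = 0 := by
  obtain ⟨η, H, H'⟩ := h.exists_hasTwist K K'
  have h1 := (H.maurerCartan_iff (one_mul 1) h.smooth hu 0).1.1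
    (ht ((R.quotChart K).Ψ (u, 0))).1
  have h2 := (H' σ).maurerCartan_iff hσ (h.smooth'.scale σ) hu s
  have e : ∑ i, wedge (K.curv u i) (K'.curv u i) = ∑ i, wedge (K'.curv u i) (K.curv u i) :=
    Finset.sum_congr rfl fun i _ =>
      flatD_ofCovector_wedge_comm (contDiffAt_pi.1 (K.smooth_θ u hu) i) (K'.curv u i)
  rw [e] at h2
  exact ⟨h2.1.2 h1, h2.2⟩

theorem IsTDual.maurerCartan [IsManifold 𝓘(ℝ, EB) ∞ B] (h : IsTDual R R' t t')
    (ht : t.MaurerCartan) {σ : ℝ} (hσ : σ * σ = 1) : (t'.scale σ).MaurerCartan := by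
  intro m
  obtain ⟨c, K, K', hb, -⟩ := R.exists_charts R' isOpen_univ (Set.mem_univ (R'.TM.proj m))
  obtain ⟨s, hs⟩ := (R'.quotChart K').exists_eq hb
  have h1 := h.maurerCartan_at ht hσ K K' (c.e.map_source hb) s
  rwa [hs] at h1

end Twists

section Point

variable {V W U : Type*} [NormedAddCommGroup V] [NormedSpace ℝ V]
  [NormedAddCommGroup W] [NormedSpace ℝ W] [NormedAddCommGroup U] [NormedSpace ℝ U] {k : ℕ}

theorem PointQuadruple.ext_apply {Q Q' : PointQuadruple V} (h : ∀ v, Q.Φ v = Q'.Φ v)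
    (h₁ : Q.e₁ = Q'.e₁) (h₂ : Q.e₂ = Q'.e₂) (hl : Q.lam = Q'.lam) : Q = Q' := by
  obtain ⟨Φ, e₁, e₂, l⟩ := Q
  obtain ⟨Φ', e₁', e₂', l'⟩ := Q'
  obtain rfl : Φ = Φ' := LinearMap.ext h
  obtain rfl : e₁ = e₁' := h₁
  obtain rfl : e₂ = e₂' := h₂
  obtain rfl : l = l' := hl
  rfl

theorem PointQuadruple.map_map (Q : PointQuadruple V) (f : V ≃L[ℝ] W) (g : W ≃L[ℝ] U) :
    (Q.map f).map g = Q.map (f.trans g) := rfl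

theorem PointQuadruple.map_symm_map (f : W ≃L[ℝ] V) (Q : PointQuadruple V) :
    (Q.map f.symm).map f = Q := PointQuadruple.map_map_symm f.symm Q

theorem PointQuadruple.map_dual (ε : ℝ) (v : Fin k → GT V) (Q : PointQuadruple V) (f : V ≃L[ℝ] W) :
    (Q.dual ε v).map f = (Q.map f).dual ε (fun i => gtMap f (v i)) := by
  have h : ∀ w, gtMap f.symm (reflect (fun i => gtMap f (v i)) w) =
      reflect v (gtMap f.symm w) := fun w => by
    obtain ⟨w, rfl⟩ := exists_gtMap_eq f w
    rw [← gtMap_reflect, gtMap_symm_gtMap, gtMap_symm_gtMap]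
  refine PointQuadruple.ext_apply (fun w => ?_) ?_ ?_ rfl
  · show gtMap f (reflect v (Q.Φ (reflect v (gtMap f.symm w)))) =
      reflect _ (gtMap f (Q.Φ (gtMap f.symm (reflect _ w))))
    rw [h, gtMap_reflect]
  · show gtMap f (ε • reflect v Q.e₂) = ε • reflect _ (gtMap f Q.e₂)
    rw [gtMap_smul, gtMap_reflect]
  · show gtMap f (ε • reflect v Q.e₁) = ε • reflect _ (gtMap f Q.e₁)
    rw [gtMap_smul, gtMap_reflect]

theorem pullPair_dualPair (ε : ℝ) (v : Fin k → GT W) (f : V ≃L[ℝ] W) (p : PForm W × PForm W) :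
    pullPair (f : V →L[ℝ] W) (dualPair ε v p) =
      dualPair ε (fun i => gtMap f.symm (v i)) (pullPair (f : V →L[ℝ] W) p) := by
  have h : ∀ φ, pull (f : V →L[ℝ] W) (cliffProd v φ) =
      cliffProd (fun i => gtMap f.symm (v i)) (pull (f : V →L[ℝ] W) φ) := fun φ => by
    rw [cliffProd_pull]
    congr 2
    funext i
    exact (gtMap_symm_gtMap (v i) f.symm).symm
  simp only [dualPair, pullPair, pull_smul, h]

theorem pullPair_pullPair (f : V →L[ℝ] W) (g : U →L[ℝ] V) (p : PForm W × PForm W) :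
    pullPair g (pullPair f p) = pullPair (f.comp g) p := rfl

theorem pullPair_symm_pullPair (f : V ≃L[ℝ] W) (p : PForm W × PForm W) :
    pullPair (f.symm : W →L[ℝ] V) (pullPair (f : V →L[ℝ] W) p) = p :=
  Prod.ext (pull_equiv_pull_symm f _) (pull_equiv_pull_symm f _)

theorem pullPair_pullPair_symm (f : V ≃L[ℝ] W) (p : PForm V × PForm V) :
    pullPair (f : V →L[ℝ] W) (pullPair (f.symm : W →L[ℝ] V) p) = p :=
  Prod.ext (pull_equiv_symm_pull f _) (pull_equiv_symm_pull f _)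

end Point

/-- The value of a quadruple at a point. -/
def Quadruple.at {E M : Type*} [NormedAddCommGroup E] [NormedSpace ℝ E] (S : Quadruple E M) (m : M) :
    PointQuadruple E := ⟨S.Φ m, S.e₁ m, S.e₂ m, S.lam m⟩

namespace TorusBundle

variable {n : ℕ} (T : TorusBundle n EP P EB B)

theorem exists_proj_eq (b : B) : ∃ x, T.proj x = b := by
  obtain ⟨U, σ, -, hb, -, hσ⟩ := T.exists_section b
  exact ⟨σ b, hσ b hb⟩

/-- A chosen point of a fibre. -/
def pt (b : B) : P := (T.exists_proj_eq b).choose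

theorem proj_pt (b : B) : T.proj (T.pt b) = b := (T.exists_proj_eq b).choose_spec

variable {T} (f : T.Frame)

namespace Frame

theorem fr_comp_dact (s : Fin n → ℝ) (x : P) :
    (f.fr (T.act s x) : EP →L[ℝ] EB × (Fin n → ℝ)).comp (T.dact s x) = f.fr x :=
  ContinuousLinearMap.ext fun v => f.fr_dact s x v

theorem dact_eq_symm (s : Fin n → ℝ) (x : P) : T.dact s x =
    ((f.fr (T.act s x)).symm : EB × (Fin n → ℝ) →L[ℝ] EP).comp (f.fr x : EP →L[ℝ] _) :=
  ContinuousLinearMap.ext fun v => by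
    rw [← f.fr_comp_dact s x]
    exact ((f.fr (T.act s x)).symm_apply_apply _).symm

theorem dact_neg_eq_symm (s : Fin n → ℝ) (x : P) : T.dact (-s) (T.act s x) =
    ((f.fr x).symm : EB × (Fin n → ℝ) →L[ℝ] EP).comp (f.fr (T.act s x) : EP →L[ℝ] _) := by
  have h := f.dact_eq_symm (-s) (T.act s x)
  rwa [← T.act_add, neg_add_cancel, T.act_zero] at h

theorem gtMap_pushGT (s : Fin n → ℝ) (x : P) (v : GT EP) :
    gtMap (f.fr (T.act s x)) (T.pushGT s x v) = gtMap (f.fr x) v := by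
  refine Prod.ext (f.fr_dact s x v.1) ?_
  show (v.2.comp (T.dact (-s) (T.act s x))).comp _ = _
  rw [f.dact_neg_eq_symm, ContinuousLinearMap.comp_assoc, ContinuousLinearMap.comp_assoc,
    ContinuousLinearEquiv.coe_comp_coe_symm, ContinuousLinearMap.comp_id]
  rfl

theorem pushGT_eq (s : Fin n → ℝ) (x : P) (v : GT EP) :
    T.pushGT s x v = gtMap (f.fr (T.act s x)).symm (gtMap (f.fr x) v) := by
  rw [← f.gtMap_pushGT s x, gtMap_symm_gtMap]

/-- The family of quadruples on the base that describes an invariant quadruple. -/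
def quad (S : Quadruple EP P) (b : B) : PointQuadruple (EB × (Fin n → ℝ)) :=
  (S.at (T.pt b)).map (f.fr (T.pt b))

theorem map_at_eq_quad {S : Quadruple EP P} (hS : T.InvariantQuadruple S) (x : P) :
    (S.at x).map (f.fr x) = f.quad S (T.proj x) := by
  obtain ⟨s, hs⟩ := (T.proj_eq_iff x (T.pt (T.proj x))).1 (T.proj_pt _).symm
  rw [quad, ← hs]
  refine PointQuadruple.ext_apply (fun v => ?_) ?_ ?_ (hS.lam s x).symm
  · obtain ⟨w, rfl⟩ := exists_gtMap_eq (f.fr x) v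
    rw [PointQuadruple.map_Φ_gtMap, ← f.gtMap_pushGT s x w, PointQuadruple.map_Φ_gtMap]
    show _ = gtMap _ (S.Φ (T.act s x) (T.pushGT s x w))
    rw [hS.Φ, f.gtMap_pushGT]
    rfl
  · show gtMap _ (S.e₁ x) = gtMap _ (S.e₁ (T.act s x))
    rw [hS.e₁, f.gtMap_pushGT]
  · show gtMap _ (S.e₂ x) = gtMap _ (S.e₂ (T.act s x))
    rw [hS.e₂, f.gtMap_pushGT]

/-- The invariant quadruple described by a family of quadruples on the base. -/
def liftQuad (Q : B → PointQuadruple (EB × (Fin n → ℝ))) : Quadruple EP P where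
  Φ x := ((Q (T.proj x)).map (f.fr x).symm).Φ
  e₁ x := ((Q (T.proj x)).map (f.fr x).symm).e₁
  e₂ x := ((Q (T.proj x)).map (f.fr x).symm).e₂
  lam x := ((Q (T.proj x)).map (f.fr x).symm).lam

theorem at_liftQuad (Q : B → PointQuadruple (EB × (Fin n → ℝ))) (x : P) :
    (f.liftQuad Q).at x = (Q (T.proj x)).map (f.fr x).symm := rfl

theorem invariantQuadruple_liftQuad (Q : B → PointQuadruple (EB × (Fin n → ℝ))) :
    T.InvariantQuadruple (f.liftQuad Q) where
  Φ s x v := by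
    show gtMap (f.fr (T.act s x)).symm ((Q (T.proj (T.act s x))).Φ
      (gtMap (f.fr (T.act s x)) (T.pushGT s x v))) =
      T.pushGT s x (gtMap (f.fr x).symm ((Q (T.proj x)).Φ (gtMap (f.fr x) v)))
    rw [f.gtMap_pushGT, f.pushGT_eq, T.proj_act]
    congr 1
    exact (gtMap_symm_gtMap _ (f.fr x).symm).symm
  e₁ s x := by
    show gtMap (f.fr (T.act s x)).symm (Q (T.proj (T.act s x))).e₁ =
      T.pushGT s x (gtMap (f.fr x).symm (Q (T.proj x)).e₁)
    rw [f.pushGT_eq, T.proj_act]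
    congr 1
    exact (gtMap_symm_gtMap _ (f.fr x).symm).symm
  e₂ s x := by
    show gtMap (f.fr (T.act s x)).symm (Q (T.proj (T.act s x))).e₂ =
      T.pushGT s x (gtMap (f.fr x).symm (Q (T.proj x)).e₂)
    rw [f.pushGT_eq, T.proj_act]
    congr 1
    exact (gtMap_symm_gtMap _ (f.fr x).symm).symm
  lam s x := by
    show (Q (T.proj (T.act s x))).lam = (Q (T.proj x)).lam
    rw [T.proj_act]

/-- The family of pairs on the base that describes an invariant pair. -/
def basePair (p : P → PForm EP × PForm EP) (b : B) :
    PForm (EB × (Fin n → ℝ)) × PForm (EB × (Fin n → ℝ)) :=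
  pullPair ((f.fr (T.pt b)).symm : EB × (Fin n → ℝ) →L[ℝ] EP) (p (T.pt b))

theorem pullPair_eq_basePair {p : P → PForm EP × PForm EP} {U : Set B}
    (hp : T.InvariantPairOn (T.proj ⁻¹' U) p) {x : P} (hx : T.proj x ∈ U) :
    pullPair ((f.fr x).symm : EB × (Fin n → ℝ) →L[ℝ] EP) (p x) = f.basePair p (T.proj x) := by
  obtain ⟨s, hs⟩ := (T.proj_eq_iff x (T.pt (T.proj x))).1 (T.proj_pt _).symm
  have h : p x = pullPair (T.dact s x) (p (T.act s x)) :=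
    Prod.ext (hp s x hx).1.symm (hp s x hx).2.symm
  rw [basePair, ← hs, h, pullPair_pullPair, f.dact_eq_symm, ContinuousLinearMap.comp_assoc,
    ContinuousLinearEquiv.coe_comp_coe_symm, ContinuousLinearMap.comp_id]

/-- The invariant pair described by a family of pairs on the base. -/
def liftPair (p : B → PForm (EB × (Fin n → ℝ)) × PForm (EB × (Fin n → ℝ))) (x : P) :
    PForm EP × PForm EP :=
  pullPair (f.fr x : EP →L[ℝ] EB × (Fin n → ℝ)) (p (T.proj x))

theorem invariantPairOn_liftPair
    (p : B → PForm (EB × (Fin n → ℝ)) × PForm (EB × (Fin n → ℝ))) (U : Set P) :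
    T.InvariantPairOn U (f.liftPair p) := by
  intro s x _
  have h : pullPair (T.dact s x) (f.liftPair p (T.act s x)) = f.liftPair p x := by
    rw [liftPair, pullPair_pullPair, f.fr_comp_dact, T.proj_act, liftPair]
  exact ⟨congrArg Prod.fst h, congrArg Prod.snd h⟩

theorem liftPair_basePair {p : P → PForm EP × PForm EP} {U : Set B}
    (hp : T.InvariantPairOn (T.proj ⁻¹' U) p) {x : P} (hx : T.proj x ∈ U) :
    f.liftPair (f.basePair p) x = p x := by
  rw [liftPair, ← f.pullPair_eq_basePair hp hx, pullPair_pullPair_symm]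

end Frame

end TorusBundle

/-! ### Smooth families of quadruples -/

section Families

variable {X V W : Type*} [NormedAddCommGroup X] [NormedSpace ℝ X] [NormedAddCommGroup V]
  [NormedSpace ℝ V] [NormedAddCommGroup W] [NormedSpace ℝ W] {x : X}

theorem contDiffAt_inGT {v w : X → GT V} (hv : ContDiffAt ℝ ∞ v x) (hw : ContDiffAt ℝ ∞ w x) :
    ContDiffAt ℝ ∞ (fun y => inGT (v y) (w y)) x :=
  (((hv.snd.clm_apply hw.fst).add (hw.snd.clm_apply hv.fst)).div_const 2)

theorem contDiffAt_gtMap {f : X → V ≃L[ℝ] W} (hf : ContDiffAt ℝ ∞ (fun y => (f y : V →L[ℝ] W)) x)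
    (hf' : ContDiffAt ℝ ∞ (fun y => ((f y).symm : W →L[ℝ] V)) x) {w : X → GT V}
    (hw : ContDiffAt ℝ ∞ w x) : ContDiffAt ℝ ∞ (fun y => gtMap (f y) (w y)) x :=
  (hf.clm_apply hw.fst).prodMk (hw.snd.clm_comp hf')

/-- The family of quadruples is smooth at `x`. -/
structure SmoothQuadAt (Q : X → PointQuadruple V) (x : X) : Prop where
  Φ : ∀ w, ContDiffAt ℝ ∞ (fun y => (Q y).Φ w) x
  e₁ : ContDiffAt ℝ ∞ (fun y => (Q y).e₁) x
  e₂ : ContDiffAt ℝ ∞ (fun y => (Q y).e₂) x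
  lam : ContDiffAt ℝ ∞ (fun y => (Q y).lam) x

namespace SmoothQuadAt

variable {Q : X → PointQuadruple V}

theorem congr (h : SmoothQuadAt Q x) {Q' : X → PointQuadruple V} (e : Q' =ᶠ[nhds x] Q) :
    SmoothQuadAt Q' x where
  Φ w := (h.Φ w).congr_of_eventuallyEq (e.mono fun _ hy => congrArg (fun q => q.Φ w) hy)
  e₁ := h.e₁.congr_of_eventuallyEq (e.mono fun _ hy => congrArg (fun q => q.e₁) hy)
  e₂ := h.e₂.congr_of_eventuallyEq (e.mono fun _ hy => congrArg (fun q => q.e₂) hy)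
  lam := h.lam.congr_of_eventuallyEq (e.mono fun _ hy => congrArg (fun q => q.lam) hy)

theorem comp {Y : Type*} [NormedAddCommGroup Y] [NormedSpace ℝ Y] {g : Y → X} {y : Y}
    (h : SmoothQuadAt Q (g y)) (hg : ContDiffAt ℝ ∞ g y) : SmoothQuadAt (fun u => Q (g u)) y where
  Φ w := (h.Φ w).comp y hg
  e₁ := h.e₁.comp y hg
  e₂ := h.e₂.comp y hg
  lam := h.lam.comp y hg

theorem mu (h : SmoothQuadAt Q x) : ContDiffAt ℝ ∞ (fun y => (Q y).mu) x :=
  (contDiffAt_const.add (h.lam.pow 2)).sqrt (by positivity)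

variable [FiniteDimensional ℝ V]

theorem apply (h : SmoothQuadAt Q x) {w : X → GT V} (hw : ContDiffAt ℝ ∞ w x) :
    ContDiffAt ℝ ∞ (fun y => (Q y).Φ (w y)) x := by
  obtain ⟨e, c, hec⟩ := exists_dual_frame (GT V)
  have : (fun y => (Q y).Φ (w y)) = fun y => ∑ i, c i (w y) • (Q y).Φ (e i) := by
    funext y
    conv_lhs => rw [← hec (w y)]
    simp only [map_sum, map_smul]
  rw [this]
  exact ContDiffAt.sum fun i _ => ((c i).contDiff.contDiffAt.comp x hw).smul (h.Φ (e i))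

theorem map (h : SmoothQuadAt Q x) {f : X → V ≃L[ℝ] W}
    (hf : ContDiffAt ℝ ∞ (fun y => (f y : V →L[ℝ] W)) x)
    (hf' : ContDiffAt ℝ ∞ (fun y => ((f y).symm : W →L[ℝ] V)) x) :
    SmoothQuadAt (fun y => (Q y).map (f y)) x where
  Φ _ := contDiffAt_gtMap hf hf' (h.apply (contDiffAt_gtMap (f := fun y => (f y).symm) hf' hf
    contDiffAt_const))
  e₁ := contDiffAt_gtMap hf hf' h.e₁
  e₂ := contDiffAt_gtMap hf hf' h.e₂
  lam := h.lam

theorem contDiffAt_reflect {k : ℕ} (v : Fin k → GT V) {w : X → GT V} (hw : ContDiffAt ℝ ∞ w x) :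
    ContDiffAt ℝ ∞ (fun y => reflect v (w y)) x :=
  (LinearMap.toContinuousLinearMap (reflect v)).contDiff.contDiffAt.comp x hw

theorem dual (h : SmoothQuadAt Q x) {k : ℕ} (ε : ℝ) (v : Fin k → GT V) :
    SmoothQuadAt (fun y => (Q y).dual ε v) x where
  Φ _ := contDiffAt_reflect v (h.Φ _)
  e₁ := (contDiffAt_reflect v h.e₂).const_smul ε
  e₂ := (contDiffAt_reflect v h.e₁).const_smul ε
  lam := h.lam.neg

omit [FiniteDimensional ℝ V] in
theorem perp (h : SmoothQuadAt Q x) {w : X → GT V} (hw : ContDiffAt ℝ ∞ w x) :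
    ContDiffAt ℝ ∞ (fun y => (Q y).perp (w y)) x :=
  (hw.sub ((contDiffAt_const.mul (contDiffAt_inGT hw h.e₂)).smul h.e₁)).sub
    ((contDiffAt_const.mul (contDiffAt_inGT hw h.e₁)).smul h.e₂)

theorem canonRe (h : SmoothQuadAt Q x) {a b : X → CE V} (ha : ContDiffAt ℝ ∞ a x)
    (hb : ContDiffAt ℝ ∞ b x) : ContDiffAt ℝ ∞ (fun y => (Q y).canonRe (a y) (b y)) x :=
  (((h.perp ha.fst).sub (h.apply (h.perp hb.fst))).const_smul (1 / 2 : ℝ)).prodMk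
    ((ha.snd.fst.add ((contDiffAt_const.mul ((contDiffAt_inGT ha.fst h.e₂).sub
      (h.lam.mul (contDiffAt_inGT hb.fst h.e₂)))).div h.mu (Q x).mu_pos.ne')).prodMk
    (ha.snd.snd.sub ((contDiffAt_const.mul ((contDiffAt_inGT ha.fst h.e₁).add
      (h.lam.mul (contDiffAt_inGT hb.fst h.e₁)))).div h.mu (Q x).mu_pos.ne')))

theorem canonIm (h : SmoothQuadAt Q x) {a b : X → CE V} (ha : ContDiffAt ℝ ∞ a x)
    (hb : ContDiffAt ℝ ∞ b x) : ContDiffAt ℝ ∞ (fun y => (Q y).canonIm (a y) (b y)) x :=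
  (((h.perp hb.fst).add (h.apply (h.perp ha.fst))).const_smul (1 / 2 : ℝ)).prodMk
    ((hb.snd.fst.add ((contDiffAt_const.mul ((contDiffAt_inGT hb.fst h.e₂).add
      (h.lam.mul (contDiffAt_inGT ha.fst h.e₂)))).div h.mu (Q x).mu_pos.ne')).prodMk
    (hb.snd.snd.sub ((contDiffAt_const.mul ((contDiffAt_inGT hb.fst h.e₁).sub
      (h.lam.mul (contDiffAt_inGT ha.fst h.e₁)))).div h.mu (Q x).mu_pos.ne')))

end SmoothQuadAt

namespace PointQuadruple

theorem map_perp (f : V ≃L[ℝ] W) (Q : PointQuadruple V) (v : GT V) :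
    (Q.map f).perp (gtMap f v) = gtMap f (Q.perp v) := by
  have hs : ∀ a b : GT V, gtMap f (a - b) = gtMap f a - gtMap f b := fun a b =>
    map_sub (gtEquiv f) a b
  show gtMap f v - (2 * inGT (gtMap f v) (gtMap f Q.e₂)) • gtMap f Q.e₁ -
    (2 * inGT (gtMap f v) (gtMap f Q.e₁)) • gtMap f Q.e₂ = gtMap f (Q.perp v)
  rw [inGT_gtMap, inGT_gtMap, perp, hs, hs, gtMap_smul, gtMap_smul]

theorem map_canonRe (f : V ≃L[ℝ] W) (Q : PointQuadruple V) (a b : CE V) :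
    (Q.map f).canonRe (ceMap f a) (ceMap f b) = ceMap f (Q.canonRe a b) := by
  have hs : ∀ a b : GT V, gtMap f (a - b) = gtMap f a - gtMap f b := fun a b =>
    map_sub (gtEquiv f) a b
  refine Prod.ext ?_ ?_
  · show (1 / 2 : ℝ) • ((Q.map f).perp (gtMap f a.1) - (Q.map f).Φ ((Q.map f).perp (gtMap f b.1))) =
      gtMap f ((1 / 2 : ℝ) • (Q.perp a.1 - Q.Φ (Q.perp b.1)))
    rw [map_perp, map_perp, map_Φ_gtMap, gtMap_smul, hs]
  · show (_, a.2.2 - 2 * (inGT (gtMap f a.1) (gtMap f Q.e₁) +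
      Q.lam * inGT (gtMap f b.1) (gtMap f Q.e₁)) / Q.mu) = _
    rw [inGT_gtMap, inGT_gtMap]
    refine Prod.ext ?_ rfl
    show a.2.1 + 2 * (inGT (gtMap f a.1) (gtMap f Q.e₂) -
      Q.lam * inGT (gtMap f b.1) (gtMap f Q.e₂)) / Q.mu = _
    rw [inGT_gtMap, inGT_gtMap]
    rfl

theorem map_canonIm (f : V ≃L[ℝ] W) (Q : PointQuadruple V) (a b : CE V) :
    (Q.map f).canonIm (ceMap f a) (ceMap f b) = ceMap f (Q.canonIm a b) := by
  refine Prod.ext ?_ ?_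
  · show (1 / 2 : ℝ) • ((Q.map f).perp (gtMap f b.1) + (Q.map f).Φ ((Q.map f).perp (gtMap f a.1))) =
      gtMap f ((1 / 2 : ℝ) • (Q.perp b.1 + Q.Φ (Q.perp a.1)))
    rw [map_perp, map_perp, map_Φ_gtMap, gtMap_smul, gtMap_add]
  · show (_, b.2.2 - 2 * (inGT (gtMap f b.1) (gtMap f Q.e₁) -
      Q.lam * inGT (gtMap f a.1) (gtMap f Q.e₁)) / Q.mu) = _
    rw [inGT_gtMap, inGT_gtMap]
    refine Prod.ext ?_ rfl
    show b.2.1 + 2 * (inGT (gtMap f b.1) (gtMap f Q.e₂) +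
      Q.lam * inGT (gtMap f a.1) (gtMap f Q.e₂)) / Q.mu = _
    rw [inGT_gtMap, inGT_gtMap]
    rfl

theorem perp_sub (Q : PointQuadruple V) (a b : GT V) : Q.perp (a - b) = Q.perp a - Q.perp b := by
  simp only [perp, inGT_sub_left]; module

theorem canonRe_sub (Q : PointQuadruple V) (a b a' b' : CE V) :
    Q.canonRe (a - a') (b - b') = Q.canonRe a b - Q.canonRe a' b' := by
  refine Prod.ext ?_ (Prod.ext ?_ ?_)
  · show (1 / 2 : ℝ) • (Q.perp (a.1 - a'.1) - Q.Φ (Q.perp (b.1 - b'.1))) =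
      (1 / 2 : ℝ) • (Q.perp a.1 - Q.Φ (Q.perp b.1)) - (1 / 2 : ℝ) • (Q.perp a'.1 - Q.Φ (Q.perp b'.1))
    rw [perp_sub, perp_sub, map_sub]; module
  · simp only [canonRe, Prod.fst_sub, Prod.snd_sub, inGT_sub_left]; ring
  · simp only [canonRe, Prod.fst_sub, Prod.snd_sub, inGT_sub_left]; ring

theorem canonIm_sub (Q : PointQuadruple V) (a b a' b' : CE V) :
    Q.canonIm (a - a') (b - b') = Q.canonIm a b - Q.canonIm a' b' := by
  refine Prod.ext ?_ (Prod.ext ?_ ?_)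
  · show (1 / 2 : ℝ) • (Q.perp (b.1 - b'.1) + Q.Φ (Q.perp (a.1 - a'.1))) =
      (1 / 2 : ℝ) • (Q.perp b.1 + Q.Φ (Q.perp a.1)) - (1 / 2 : ℝ) • (Q.perp b'.1 + Q.Φ (Q.perp a'.1))
    rw [perp_sub, perp_sub, map_sub]; module
  · simp only [canonIm, Prod.fst_sub, Prod.snd_sub, inGT_sub_left]; ring
  · simp only [canonIm, Prod.fst_sub, Prod.snd_sub, inGT_sub_left]; ring

theorem cliffPair_vsub (a a' : CE V) (p : PForm V × PForm V) :
    cliffPair (a - a') p = cliffPair a p - cliffPair a' p := by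
  refine Prod.ext ?_ ?_
  · show cliff (a.1 - a'.1) p.1 + (a.2.1 - a'.2.1) • p.2 =
      cliff a.1 p.1 + a.2.1 • p.2 - (cliff a'.1 p.1 + a'.2.1 • p.2)
    simp only [cliff_vsub, rsmul_eq_smul, Complex.ofReal_sub, pform_sub_smul]; abel
  · show (a.2.2 - a'.2.2) • p.1 - cliff (a.1 - a'.1) p.2 =
      a.2.2 • p.1 - cliff a.1 p.2 - (a'.2.2 • p.1 - cliff a'.1 p.2)
    simp only [cliff_vsub, rsmul_eq_smul, Complex.ofReal_sub, pform_sub_smul]; abel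

theorem IsSekiya.canon_eq {Q : PointQuadruple V} (h : Q.IsSekiya) {p : PForm V × PForm V}
    (hp : Q.IsMixedPair p) {a b a' b' : CE V} (hab : cliffPairC a b p = cliffPairC a' b' p) :
    Q.canonRe a b = Q.canonRe a' b' ∧ Q.canonIm a b = Q.canonIm a' b' := by
  have h0 : cliffPairC (a - a') (b - b') p = 0 := by
    have e : cliffPairC (a - a') (b - b') p = cliffPairC a b p - cliffPairC a' b' p := by
      simp only [cliffPairC, cliffPair_vsub, smul_sub]; abel
    rw [e, hab, sub_self]
  have h1 := h.canon_eq_zero hp h0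
  rw [canonRe_sub, canonIm_sub] at h1
  exact ⟨sub_eq_zero.1 h1.1, sub_eq_zero.1 h1.2⟩

end PointQuadruple

end Families

section Params

variable {V E N : Type*} [NormedAddCommGroup V] [NormedSpace ℝ V] [NormedAddCommGroup E]
  [NormedSpace ℝ E] [TopologicalSpace N] [ChartedSpace E N] [IsManifold 𝓘(ℝ, E) ∞ N]
  [FiniteDimensional ℝ V] [FiniteDimensional ℝ E]
  {Ψ : V → N} {d : V → V ≃L[ℝ] E} {z : V}

/-- Every generalised vector extends to a smooth section that is constant in a parametrization. -/
theorem exists_smoothGTOn_eq (h : ∀ᶠ y in nhds z, IsParam Ψ d y) (e : GT V) :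
    ∃ (U : Set N) (v : N → GT E), IsOpen U ∧ Ψ z ∈ U ∧ SmoothGTOn v U ∧
      ∀ᶠ y in nhds z, v (Ψ y) = gtMap (d y) e := by
  have : CompleteSpace V := FiniteDimensional.complete ℝ V
  obtain ⟨g, hg, hgz, hright, hleft⟩ := h.self_of_nhds.exists_localInverse'
  have hgc : Filter.Tendsto g (nhds (Ψ z)) (nhds z) := by
    have := hg.continuousAt.tendsto
    rwa [hgz] at this
  obtain ⟨U, hU, hUo, hz⟩ := eventually_nhds_iff.1
    (hright.and ((hgc.eventually h).and (hgc.eventually hleft.eventually_nhds)))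
  refine ⟨U, fun x => gtMap (d (g x)) e, hUo, hz, smoothGTOn_of_isParam fun x hx =>
    ⟨Ψ, d, g x, (hU x hx).1, (hU x hx).2.1, ?_⟩, hleft.mono fun y hy => by simp only [hy]⟩
  refine contDiffAt_const (c := e).congr_of_eventuallyEq ((hU x hx).2.2.mono fun y hy => ?_)
  simp only [hy, gtMap_symm_gtMap]

theorem Quadruple.IsSekiya.smoothQuadAt {S : Quadruple E N} (hS : S.IsSekiya)
    (h : ∀ᶠ y in nhds z, IsParam Ψ d y) :
    SmoothQuadAt (fun y => (S.at (Ψ y)).map (d y).symm) z where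
  Φ e := by
    obtain ⟨U, v, hU, hz, hv, he⟩ := exists_smoothGTOn_eq h e
    refine (h.self_of_nhds.contDiffAt_gtMap (hS.smooth_Φ U v hU hv) hU hz).congr_of_eventuallyEq
      (he.mono fun y hy => ?_)
    simp only [hy]
    rfl
  e₁ := h.self_of_nhds.contDiffAt_gtMap hS.smooth_e₁ isOpen_univ (Set.mem_univ _)
  e₂ := h.self_of_nhds.contDiffAt_gtMap hS.smooth_e₂ isOpen_univ (Set.mem_univ _)
  lam := h.self_of_nhds.contDiffAt_comp hS.smooth_lam isOpen_univ (Set.mem_univ _)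

omit [FiniteDimensional ℝ E] in
theorem Quadruple.IsSekiya.at {S : Quadruple E N} (hS : S.IsSekiya) (x : N) :
    (S.at x).IsSekiya :=
  ⟨hS.e₁_e₁ x, hS.e₂_e₂ x, hS.e₁_e₂ x, hS.skew x, hS.Φ_e₁ x, hS.Φ_e₂ x, hS.Φ_sq x⟩

variable (V) in
theorem Quadruple.isSekiya_of_isParam {S : Quadruple E N} (hS : ∀ x, (S.at x).IsSekiya)
    (H : ∀ x, ∃ (Ψ : V → N) (d : V → V ≃L[ℝ] E) (z : V), Ψ z = x ∧ IsParam Ψ d z ∧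
      SmoothQuadAt (fun y => (S.at (Ψ y)).map (d y).symm) z) : S.IsSekiya where
  smooth_Φ U v hU hv := smoothGTOn_of_isParam (V := V) fun x hx => by
    obtain ⟨Ψ, d, z, rfl, hp, hs⟩ := H x
    refine ⟨Ψ, d, z, rfl, hp, (hs.apply (hp.contDiffAt_gtMap hv hU hx)).congr_of_eventuallyEq
      (Filter.Eventually.of_forall fun y => ?_)⟩
    exact (PointQuadruple.map_Φ_gtMap (d y).symm (S.at (Ψ y)) (v (Ψ y))).symm
  smooth_e₁ := smoothGTOn_of_isParam (V := V) fun x _ => by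
    obtain ⟨Ψ, d, z, rfl, hp, hs⟩ := H x
    exact ⟨Ψ, d, z, rfl, hp, hs.e₁⟩
  smooth_e₂ := smoothGTOn_of_isParam (V := V) fun x _ => by
    obtain ⟨Ψ, d, z, rfl, hp, hs⟩ := H x
    exact ⟨Ψ, d, z, rfl, hp, hs.e₂⟩
  smooth_lam := smoothFunOn_of_isParam (V := V) fun x _ => by
    obtain ⟨Ψ, d, z, rfl, hp, hs⟩ := H x
    exact ⟨Ψ, d, z, rfl, hp, hs.lam⟩
  e₁_e₁ x := (hS x).e₁_e₁
  e₂_e₂ x := (hS x).e₂_e₂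
  e₁_e₂ x := (hS x).e₁_e₂
  skew x := (hS x).skew
  Φ_e₁ x := (hS x).Φ_e₁
  Φ_e₂ x := (hS x).Φ_e₂
  Φ_sq x := (hS x).Φ_sq

omit [FiniteDimensional ℝ E] in
theorem Quadruple.IsMixedPairOn.at {S : Quadruple E N} {U : Set N} {p : N → PForm E × PForm E}
    (h : S.IsMixedPairOn U p) {x : N} (hx : x ∈ U) : (S.at x).IsMixedPair (p x) :=
  ⟨h.nondegenerate x hx, h.e₁_snd x hx, h.e₁_fst x hx, h.e₂_fst x hx, h.e₂_snd x hx,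
    h.eigenspace x hx⟩

omit [FiniteDimensional ℝ V] [FiniteDimensional ℝ E] in
theorem IsParam.contDiffAt_ceMap [FiniteDimensional ℝ V] (h : IsParam Ψ d z) {a : N → CE E}
    {U : Set N} (ha : SmoothCEOn a U) (hU : IsOpen U) (hz : Ψ z ∈ U) :
    ContDiffAt ℝ ∞ (fun y => ceMap (d y).symm (a (Ψ y))) z :=
  (h.contDiffAt_gtMap ha.1 hU hz).prodMk
    ((h.contDiffAt_comp ha.2.1 hU hz).prodMk (h.contDiffAt_comp ha.2.2 hU hz))

theorem smoothCEOn_of_isParam {a : N → CE E} {U : Set N}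
    (H : ∀ x ∈ U, ∃ (Ψ : V → N) (d : V → V ≃L[ℝ] E) (z : V), Ψ z = x ∧
      IsParam Ψ d z ∧ ContDiffAt ℝ ∞ (fun y => ceMap (d y).symm (a (Ψ y))) z) :
    SmoothCEOn a U := by
  refine ⟨smoothGTOn_of_isParam (V := V) fun x hx => ?_,
    smoothFunOn_of_isParam (V := V) fun x hx => ?_, smoothFunOn_of_isParam (V := V) fun x hx => ?_⟩
  · obtain ⟨Ψ, d, z, hz, hp, hs⟩ := H x hx
    exact ⟨Ψ, d, z, hz, hp, hs.fst⟩
  · obtain ⟨Ψ, d, z, hz, hp, hs⟩ := H x hx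
    exact ⟨Ψ, d, z, hz, hp, hs.snd.fst⟩
  · obtain ⟨Ψ, d, z, hz, hp, hs⟩ := H x hx
    exact ⟨Ψ, d, z, hz, hp, hs.snd.snd⟩

/-- The twisted differential in a parametrization. -/
theorem IsParam.pullPair_d (h : IsParam Ψ d z) {t : Twist E N} {p : N → PForm E × PForm E}
    {U : Set N} (hU : IsOpen U) (hz : Ψ z ∈ U)
    (h₁ : SmoothFormOn 𝓘(ℝ, E) (fun x => (p x).1) U)
    (h₂ : SmoothFormOn 𝓘(ℝ, E) (fun x => (p x).2) U) :
    pullPair (d z : V →L[ℝ] E) (t.d p (Ψ z)) =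
      flatTwistD (fun y => pull (d y : V →L[ℝ] E) (ofReal 3 (t.H3 (Ψ y))))
        (fun y => pull (d y : V →L[ℝ] E) (ofReal 2 (t.H2 (Ψ y))))
        (fun y => pull (d y : V →L[ℝ] E) (ofReal 2 (t.F (Ψ y))))
        (fun y => pullPair (d y : V →L[ℝ] E) (p (Ψ y))) z := by
  refine Prod.ext ?_ ?_
  · simp only [pullPair, Twist.d, flatTwistD, pull_add, pull_wedge]
    rw [h.flatD_pull h₁ hU hz]
  · simp only [pullPair, Twist.d, flatTwistD, pull_sub, pull_wedge]
    rw [h.flatD_pull h₂ hU hz]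

omit [FiniteDimensional ℝ V] [FiniteDimensional ℝ E] in
theorem cliffPairC_pullPair {W : Type*} [NormedAddCommGroup W] [NormedSpace ℝ W] (f : V ≃L[ℝ] W)
    (a b : CE V) (p : PForm W × PForm W) :
    PointQuadruple.cliffPairC a b (pullPair (f : V →L[ℝ] W) p) =
      pullPair (f : V →L[ℝ] W) (PointQuadruple.cliffPairC (ceMap f a) (ceMap f b) p) := by
  rw [PointQuadruple.cliffPairC, cliffPair_pullPair, cliffPair_pullPair]
  rfl

theorem ceMap_symm_ceMap {W : Type*} [NormedAddCommGroup W] [NormedSpace ℝ W] (f : V ≃L[ℝ] W)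
    (a : CE V) : ceMap f.symm (ceMap f a) = a :=
  Prod.ext (gtMap_symm_gtMap a.1 f) rfl

variable (V) in
/-- Involutivity is local, because the section `V` with `dp = V · p` can be normalised. -/
theorem involutiveOn_of_isParam {S : Quadruple E N} (hS : S.IsSekiya) {t : Twist E N} {U : Set N}
    {p : N → PForm E × PForm E} (hU : IsOpen U) (hp : S.IsMixedPairOn U p)
    (H : ∀ x ∈ U, ∃ (Ψ : V → N) (d : V → V ≃L[ℝ] E) (z : V), Ψ z = x ∧
      (∀ᶠ y in nhds z, IsParam Ψ d y) ∧ ∃ a b : V → CE V, ContDiffAt ℝ ∞ a z ∧ ContDiffAt ℝ ∞ b z ∧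
        ∀ᶠ y in nhds z, pullPair (d y : V →L[ℝ] E) (t.d p (Ψ y)) =
          PointQuadruple.cliffPairC (a y) (b y) (pullPair (d y : V →L[ℝ] E) (p (Ψ y)))) :
    InvolutiveOn t U p := by
  have key : ∀ (Ψ : V → N) (d : V → V ≃L[ℝ] E) (y : V) (a b : CE V),
      pullPair (d y : V →L[ℝ] E) (t.d p (Ψ y)) =
        PointQuadruple.cliffPairC a b (pullPair (d y : V →L[ℝ] E) (p (Ψ y))) →
      t.d p (Ψ y) = PointQuadruple.cliffPairC (ceMap (d y) a) (ceMap (d y) b) (p (Ψ y)) := by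
    intro Ψ d y a b h
    rw [cliffPairC_pullPair] at h
    rw [← pullPair_symm_pullPair (d y) (t.d p (Ψ y)), h, pullPair_symm_pullPair]
  have hex : ∀ x, ∃ ab : CE E × CE E, x ∈ U →
      t.d p x = PointQuadruple.cliffPairC ab.1 ab.2 (p x) := by
    intro x
    by_cases hx : x ∈ U
    · obtain ⟨Ψ, d, z, rfl, -, a, b, -, -, he⟩ := H x hx
      exact ⟨⟨_, _⟩, fun _ => key Ψ d z _ _ he.self_of_nhds⟩
    · exact ⟨0, fun h => absurd h hx⟩
  choose ab hab using hex
  have hloc : ∀ x ∈ U, ∃ (Ψ : V → N) (d : V → V ≃L[ℝ] E) (z : V), Ψ z = x ∧ IsParam Ψ d z ∧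
      ContDiffAt ℝ ∞ (fun y => ceMap (d y).symm
        ((S.at (Ψ y)).canonRe (ab (Ψ y)).1 (ab (Ψ y)).2)) z ∧
      ContDiffAt ℝ ∞ (fun y => ceMap (d y).symm
        ((S.at (Ψ y)).canonIm (ab (Ψ y)).1 (ab (Ψ y)).2)) z := by
    intro x hx
    obtain ⟨Ψ, d, z, rfl, hpar, a, b, ha, hb, he⟩ := H x hx
    have hq := hS.smoothQuadAt hpar
    have hmem : ∀ᶠ y in nhds z, Ψ y ∈ U :=
      hpar.self_of_nhds.smooth.continuousAt.eventually_mem (hU.mem_nhds hx)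
    have hc := fun y (hy : Ψ y ∈ U) h => (hS.at (Ψ y)).canon_eq (hp.at hy)
      ((hab (Ψ y) hy).symm.trans (key Ψ d y (a y) (b y) h))
    refine ⟨Ψ, d, z, rfl, hpar.self_of_nhds, ?_, ?_⟩
    · refine (hq.canonRe ha hb).congr_of_eventuallyEq ?_
      filter_upwards [he, hmem] with y hy hm
      rw [(hc y hm hy).1, ← PointQuadruple.map_canonRe, ceMap_symm_ceMap, ceMap_symm_ceMap]
    · refine (hq.canonIm ha hb).congr_of_eventuallyEq ?_
      filter_upwards [he, hmem] with y hy hm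
      rw [(hc y hm hy).2, ← PointQuadruple.map_canonIm, ceMap_symm_ceMap, ceMap_symm_ceMap]
  refine ⟨fun x => (S.at x).canonRe (ab x).1 (ab x).2, fun x => (S.at x).canonIm (ab x).1 (ab x).2,
    smoothCEOn_of_isParam (V := V) fun x hx => ?_, smoothCEOn_of_isParam (V := V) fun x hx => ?_,
    fun x hx => ?_⟩
  · obtain ⟨Ψ, d, z, hz, hpar, h1, -⟩ := hloc x hx
    exact ⟨Ψ, d, z, hz, hpar, h1⟩
  · obtain ⟨Ψ, d, z, hz, hpar, -, h2⟩ := hloc x hx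
    exact ⟨Ψ, d, z, hz, hpar, h2⟩
  · rw [hab x hx]
    exact ((hS.at x).cliffPairC_canon (hp.at hx) _ _).symm

end Params

/-! ### Invariant quadruples and pairs in terms of families on the base -/

section Parity

variable {σ : ℝ}

theorem gradeInv_eq_self_iff (φ : PForm V) : gradeInv φ = (1 : ℝ) • φ ↔ ∀ k, Odd k → φ k = 0 := by
  refine ⟨fun h k hk => ?_, fun h => funext fun k => ?_⟩
  · ext v
    have h1 := DFunLike.congr_fun (congrFun h k) v
    rw [gradeInv_apply, hk.neg_one_pow] at h1
    have h2 : (-1 : ℝ) • φ k v = (1 : ℝ) • φ k v := h1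
    rw [neg_smul, one_smul] at h2
    exact self_eq_neg.1 h2.symm
  · rw [gradeInv_apply, Pi.smul_apply]
    rcases Nat.even_or_odd k with hk | hk
    · rw [hk.neg_one_pow]
    · rw [h k hk, form_rsmul_zero, form_rsmul_zero]

theorem gradeInv_eq_neg_iff (φ : PForm V) : gradeInv φ = (-1 : ℝ) • φ ↔ ∀ k, Even k → φ k = 0 := by
  refine ⟨fun h k hk => ?_, fun h => funext fun k => ?_⟩
  · ext v
    have h1 := DFunLike.congr_fun (congrFun h k) v
    rw [gradeInv_apply, hk.neg_one_pow] at h1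
    have h2 : (1 : ℝ) • φ k v = (-1 : ℝ) • φ k v := h1
    rw [neg_smul, one_smul] at h2
    exact self_eq_neg.1 h2
  · rw [gradeInv_apply, Pi.smul_apply]
    rcases Nat.even_or_odd k with hk | hk
    · rw [h k hk, form_rsmul_zero, form_rsmul_zero]
    · rw [hk.neg_one_pow]

/-- The first form of the pair has parity `σ`, the second one the opposite parity. -/
def PairParity (σ : ℝ) (p : PForm V × PForm V) : Prop :=
  gradeInv p.1 = σ • p.1 ∧ gradeInv p.2 = (-σ) • p.2

theorem PairParity.pullPair {p : PForm W × PForm W} (h : PairParity σ p) (f : V →L[ℝ] W) :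
    PairParity σ (pullPair f p) := by
  refine ⟨?_, ?_⟩
  · show gradeInv (pull f p.1) = σ • pull f p.1
    rw [← pull_gradeInv, h.1, pull_rsmul]
  · show gradeInv (pull f p.2) = (-σ) • pull f p.2
    rw [← pull_gradeInv, h.2, pull_rsmul]

theorem PairParity.dualPair {p : PForm V × PForm V} (h : PairParity σ p) (ε : ℝ) {k : ℕ}
    (v : Fin k → GT V) : PairParity (-(-1) ^ k * σ) (dualPair ε v p) := by
  have hc : ∀ (c : ℂ) (r s : ℝ) (φ : PForm V), gradeInv φ = s • φ → r = (-1 : ℝ) ^ k * s →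
      gradeInv (c • cliffProd v φ) = r • c • cliffProd v φ := by
    rintro c r s φ hs rfl
    rw [gradeInv_smul, gradeInv_cliffProd, hs]
    simp only [rsmul_eq_smul, cliffProd_smul, smul_smul]
    congr 1
    push_cast
    ring
  exact ⟨hc _ _ _ _ h.2 (by ring), hc _ _ _ _ h.1 (by ring)⟩

end Parity

theorem Quadruple.IsMixedPairOn.exists_pairParity {E M : Type*} [NormedAddCommGroup E]
    [NormedSpace ℝ E] [TopologicalSpace M] [ChartedSpace E M]
    {S : Quadruple E M} {U : Set M} {p : M → PForm E × PForm E} (h : S.IsMixedPairOn U p) :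
    ∃ σ : ℝ, (σ = 1 ∨ σ = -1) ∧ ∀ x ∈ U, PairParity σ (p x) := by
  rcases h.parity with hp | hp
  · refine ⟨1, Or.inl rfl, fun x hx => ⟨(gradeInv_eq_self_iff _).2 fun k => (hp x hx k).1,
      (gradeInv_eq_neg_iff _).2 fun k => (hp x hx k).2⟩⟩
  · refine ⟨-1, Or.inr rfl, fun x hx => ⟨(gradeInv_eq_neg_iff _).2 fun k => (hp x hx k).1, ?_⟩⟩
    rw [neg_neg]
    exact (gradeInv_eq_self_iff _).2 fun k => (hp x hx k).2

theorem Quadruple.isMixedPairOn_of_at {E M : Type*} [NormedAddCommGroup E]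
    [NormedSpace ℝ E] [TopologicalSpace M] [ChartedSpace E M]
    {S : Quadruple E M} {U : Set M} {p : M → PForm E × PForm E}
    (h₁ : SmoothFormOn 𝓘(ℝ, E) (fun x => (p x).1) U)
    (h₂ : SmoothFormOn 𝓘(ℝ, E) (fun x => (p x).2) U) {σ : ℝ} (hσ : σ = 1 ∨ σ = -1)
    (hp : ∀ x ∈ U, PairParity σ (p x)) (h : ∀ x ∈ U, (S.at x).IsMixedPair (p x)) :
    S.IsMixedPairOn U p where
  smooth_fst := h₁
  smooth_snd := h₂
  parity := by
    rcases hσ with rfl | rfl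
    · exact Or.inl fun x hx k => ⟨(gradeInv_eq_self_iff _).1 (hp x hx).1 k,
        (gradeInv_eq_neg_iff _).1 (hp x hx).2 k⟩
    · refine Or.inr fun x hx k => ⟨(gradeInv_eq_neg_iff _).1 (hp x hx).1 k,
        (gradeInv_eq_self_iff _).1 ?_ k⟩
      rw [(hp x hx).2, neg_neg]
  nondegenerate x hx := (h x hx).nondegenerate
  e₁_snd x hx := (h x hx).e₁_snd
  e₁_fst x hx := (h x hx).e₁_fst
  e₂_fst x hx := (h x hx).e₂_fst
  e₂_snd x hx := (h x hx).e₂_snd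
  eigenspace x hx := (h x hx).eigenspace

namespace BaseChart

variable (c : BaseChart EB B) {n : ℕ}

/-- The differential of the chart on the base, extended by the identity of the fibre. -/
def prodD (n : ℕ) (u : EB) : (EB × (Fin n → ℝ)) ≃L[ℝ] EB × (Fin n → ℝ) :=
  (c.D u).prodCongr (ContinuousLinearEquiv.refl ℝ (Fin n → ℝ))

/-- A family of quadruples on the base, in a chart. -/
def quadMap (Q : B → PointQuadruple (EB × (Fin n → ℝ))) (u : EB) :
    PointQuadruple (EB × (Fin n → ℝ)) := (Q (c.e.symm u)).map (c.prodD n u).symm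

/-- A family of pairs on the base, in a chart. -/
def pairMap (p : B → PForm (EB × (Fin n → ℝ)) × PForm (EB × (Fin n → ℝ))) (u : EB) :
    PForm (EB × (Fin n → ℝ)) × PForm (EB × (Fin n → ℝ)) :=
  pullPair (c.prodD n u : EB × (Fin n → ℝ) →L[ℝ] EB × (Fin n → ℝ)) (p (c.e.symm u))

theorem quadMap_dual (ε : ℝ) (Q : B → PointQuadruple (EB × (Fin n → ℝ))) (u : EB) :
    c.quadMap (fun b => (Q b).dual ε (torusVec EB)) u = (c.quadMap Q u).dual ε (torusVec EB) := by
  rw [quadMap, PointQuadruple.map_dual]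
  congr 1
  exact funext fun i => gtMap_torusVec _ (c.D u).symm i

theorem pairMap_dualPair (ε : ℝ) (p : B → PForm (EB × (Fin n → ℝ)) × PForm (EB × (Fin n → ℝ)))
    (u : EB) : c.pairMap (fun b => dualPair ε (torusVec EB) (p b)) u =
      dualPair ε (torusVec EB) (c.pairMap p u) := by
  rw [pairMap, pullPair_dualPair]
  congr 1
  exact funext fun i => gtMap_torusVec _ (c.D u).symm i

end BaseChart

section Base

variable {n : ℕ} {T : TorusBundle n EP P EB B} {f : T.Frame} {c : BaseChart EB B}
  (K : FrameChart f c) {Q : B → PointQuadruple (EB × (Fin n → ℝ))}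
  {p : B → PForm (EB × (Fin n → ℝ)) × PForm (EB × (Fin n → ℝ))}

theorem TorusBundle.Frame.liftQuad_quad (f : T.Frame) {S : Quadruple EP P}
    (hS : T.InvariantQuadruple S) : f.liftQuad (f.quad S) = S := by
  have h : ∀ x, (f.liftQuad (f.quad S)).at x = S.at x := fun x => by
    rw [f.at_liftQuad, ← f.map_at_eq_quad hS, PointQuadruple.map_map_symm]
  obtain ⟨Φ, e₁, e₂, lam⟩ := S
  refine Quadruple.mk.injEq .. |>.mpr ⟨?_, ?_, ?_, ?_⟩
  · exact funext fun x => congrArg PointQuadruple.Φ (h x)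
  · exact funext fun x => congrArg PointQuadruple.e₁ (h x)
  · exact funext fun x => congrArg PointQuadruple.e₂ (h x)
  · exact funext fun x => congrArg PointQuadruple.lam (h x)

namespace FrameChart

theorem map_nf_liftQuad (z : EB × (Fin n → ℝ)) (hz : z.1 ∈ c.e.target) :
    ((f.liftQuad Q).at (K.Ψ z)).map (K.nf z) = c.quadMap Q z.1 := by
  have h : T.proj (K.Ψ z) = c.e.symm z.1 := K.proj_Ψ _ hz z.2
  rw [f.at_liftQuad, nf, ← PointQuadruple.map_map, PointQuadruple.map_symm_map, h]
  rfl

theorem map_d_symm_liftQuad (z : EB × (Fin n → ℝ)) (hz : z.1 ∈ c.e.target) :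
    ((f.liftQuad Q).at (K.Ψ z)).map (K.d z).symm = (c.quadMap Q z.1).map (shear (K.θ z.1)).symm := by
  rw [← K.map_nf_liftQuad z hz]
  rfl

theorem pullPair_nf_symm_liftPair (z : EB × (Fin n → ℝ)) (hz : z.1 ∈ c.e.target) :
    pullPair ((K.nf z).symm : EB × (Fin n → ℝ) →L[ℝ] EP) (f.liftPair p (K.Ψ z)) =
      c.pairMap p z.1 := by
  have h : T.proj (K.Ψ z) = c.e.symm z.1 := K.proj_Ψ _ hz z.2
  have e : (f.fr (K.Ψ z) : EP →L[ℝ] EB × (Fin n → ℝ)).comp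
      ((K.nf z).symm : EB × (Fin n → ℝ) →L[ℝ] EP) = c.prodD n z.1 :=
    ContinuousLinearMap.ext fun v => (f.fr (K.Ψ z)).apply_symm_apply _
  rw [TorusBundle.Frame.liftPair, pullPair_pullPair, e, h]
  rfl

theorem pullPair_d_liftPair (z : EB × (Fin n → ℝ)) (hz : z.1 ∈ c.e.target) :
    pullPair (K.d z : EB × (Fin n → ℝ) →L[ℝ] EP) (f.liftPair p (K.Ψ z)) =
      pullPair (shearMap (K.θ z.1)) (c.pairMap p z.1) := by
  rw [← K.pullPair_nf_symm_liftPair z hz]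
  rfl

variable [FiniteDimensional ℝ EB]

theorem contDiffAt_shear {u : EB} (hu : u ∈ c.e.target) :
    ContDiffAt ℝ ∞ (fun y => (shear (K.θ y) : EB × (Fin n → ℝ) →L[ℝ] EB × (Fin n → ℝ))) u :=
  contDiffAt_shearMap (K.smooth_θ u hu)

theorem contDiffAt_shear_symm {u : EB} (hu : u ∈ c.e.target) : ContDiffAt ℝ ∞
    (fun y => ((shear (K.θ y)).symm : EB × (Fin n → ℝ) →L[ℝ] EB × (Fin n → ℝ))) u :=
  contDiffAt_shearMap (τ := fun y => -K.θ y) (K.smooth_θ u hu).neg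

variable [IsManifold 𝓘(ℝ, EP) ∞ P] [FiniteDimensional ℝ EP]

omit [FiniteDimensional ℝ EB] [IsManifold 𝓘(ℝ, EP) ∞ P] [FiniteDimensional ℝ EP] in
theorem eventually_isParam {u : EB} (hu : u ∈ c.e.target) (s : Fin n → ℝ) :
    ∀ᶠ y in nhds (u, s), IsParam K.Ψ K.d y :=
  (eventually_mem hu s).mono fun y hy => K.isParam hy y.2

theorem smoothQuadAt_quadMap (K : FrameChart f c) (hS : (f.liftQuad Q).IsSekiya) {u : EB} (hu : u ∈ c.e.target) :
    SmoothQuadAt (c.quadMap Q) u := by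
  have h1 := hS.smoothQuadAt (K.eventually_isParam hu 0)
  have h2 : SmoothQuadAt (fun y : EB => ((f.liftQuad Q).at (K.Ψ (y, 0))).map (K.d (y, 0)).symm) u :=
    SmoothQuadAt.comp (g := fun y : EB => (y, (0 : Fin n → ℝ))) (y := u) h1
      (contDiffAt_id.prodMk contDiffAt_const)
  have h3 := h2.map (f := fun y => shear (K.θ y)) (K.contDiffAt_shear hu) (K.contDiffAt_shear_symm hu)
  refine h3.congr ?_
  filter_upwards [c.e.open_target.mem_nhds hu] with y hy
  rw [K.map_d_symm_liftQuad (y, 0) hy, PointQuadruple.map_symm_map]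

omit [FiniteDimensional ℝ EP] in
theorem smoothFamAt_pairMap {U : Set P} (hU : IsOpen U)
    (h₁ : SmoothFormOn 𝓘(ℝ, EP) (fun x => (f.liftPair p x).1) U)
    (h₂ : SmoothFormOn 𝓘(ℝ, EP) (fun x => (f.liftPair p x).2) U)
    {u : EB} (hu : u ∈ c.e.target) (hm : K.Ψ (u, 0) ∈ U) :
    SmoothFamAt (fun y => (c.pairMap p y).1) u ∧ SmoothFamAt (fun y => (c.pairMap p y).2) u := by
  have he : ∀ᶠ y in nhds u, pullPair ((K.nf (y, 0)).symm : EB × (Fin n → ℝ) →L[ℝ] EP)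
      (f.liftPair p (K.Ψ (y, 0))) = c.pairMap p y := by
    filter_upwards [c.e.open_target.mem_nhds hu] with y hy
    exact K.pullPair_nf_symm_liftPair (y, 0) hy
  exact ⟨(K.smoothFamAt_nf h₁ hU hu 0 hm).congr (he.mono fun y hy => congrArg Prod.fst hy.symm),
    (K.smoothFamAt_nf h₂ hU hu 0 hm).congr (he.mono fun y hy => congrArg Prod.snd hy.symm)⟩

end FrameChart

variable [FiniteDimensional ℝ EB] [IsManifold 𝓘(ℝ, EP) ∞ P] [FiniteDimensional ℝ EP]

theorem isSekiya_liftQuad (hQ : ∀ b, (Q b).IsSekiya)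
    (H : ∀ b, ∃ (c : BaseChart EB B) (_ : FrameChart f c), b ∈ c.e.source ∧
      SmoothQuadAt (c.quadMap Q) (c.e b)) : (f.liftQuad Q).IsSekiya := by
  refine Quadruple.isSekiya_of_isParam (EB × (Fin n → ℝ)) (fun x => ?_) fun x => ?_
  · rw [f.at_liftQuad]
    exact (hQ _).map _
  · obtain ⟨c, K, hb, hs⟩ := H (T.proj x)
    obtain ⟨s, hx⟩ := K.exists_eq hb
    have hu := c.e.map_source hb
    refine ⟨K.Ψ, K.d, _, hx, K.isParam hu s, ?_⟩
    have h1 : SmoothQuadAt (fun z : EB × (Fin n → ℝ) => (c.quadMap Q z.1).map (shear (K.θ z.1)).symm)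
        (c.e (T.proj x), s) :=
      SmoothQuadAt.comp (Q := fun y => (c.quadMap Q y).map (shear (K.θ y)).symm)
        (g := Prod.fst) (y := (c.e (T.proj x), s))
        (hs.map (f := fun y => (shear (K.θ y)).symm) (K.contDiffAt_shear_symm hu)
          (K.contDiffAt_shear hu)) contDiffAt_fst
    exact h1.congr ((FrameChart.eventually_mem hu s).mono fun z hz => K.map_d_symm_liftQuad z hz)

theorem isMixedPairOn_liftPair {U : Set B} {σ : ℝ} (hσ : σ = 1 ∨ σ = -1)
    (hp : ∀ b ∈ U, PairParity σ (p b)) (hm : ∀ b ∈ U, (Q b).IsMixedPair (p b))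
    (H : ∀ b ∈ U, ∃ (c : BaseChart EB B) (_ : FrameChart f c), b ∈ c.e.source ∧
      SmoothFamAt (fun y => (c.pairMap p y).1) (c.e b) ∧
      SmoothFamAt (fun y => (c.pairMap p y).2) (c.e b)) :
    (f.liftQuad Q).IsMixedPairOn (T.proj ⁻¹' U) (f.liftPair p) := by
  refine Quadruple.isMixedPairOn_of_at ?_ ?_ hσ (fun x hx => (hp _ hx).pullPair _) fun x hx => ?_
  · refine smoothFormOn_of_isParam (V := EB × (Fin n → ℝ)) fun x hx => ?_
    obtain ⟨c, K, hb, hs, -⟩ := H (T.proj x) hx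
    obtain ⟨s, hx⟩ := K.exists_eq hb
    have hu := c.e.map_source hb
    refine ⟨K.Ψ, K.d, _, hx, K.isParam hu s, ?_⟩
    have h1 := SmoothFamAt.comp (f := Prod.fst) (y := (c.e (T.proj x), s))
      (SmoothFamAt.pull (K.contDiffAt_shear hu) hs) contDiffAt_fst
    exact h1.congr ((FrameChart.eventually_mem hu s).mono fun z hz =>
      congrArg Prod.fst (K.pullPair_d_liftPair z hz))
  · refine smoothFormOn_of_isParam (V := EB × (Fin n → ℝ)) fun x hx => ?_
    obtain ⟨c, K, hb, -, hs⟩ := H (T.proj x) hx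
    obtain ⟨s, hx⟩ := K.exists_eq hb
    have hu := c.e.map_source hb
    refine ⟨K.Ψ, K.d, _, hx, K.isParam hu s, ?_⟩
    have h1 := SmoothFamAt.comp (f := Prod.fst) (y := (c.e (T.proj x), s))
      (SmoothFamAt.pull (K.contDiffAt_shear hu) hs) contDiffAt_fst
    exact h1.congr ((FrameChart.eventually_mem hu s).mono fun z hz =>
      congrArg Prod.snd (K.pullPair_d_liftPair z hz))
  · rw [f.at_liftQuad]
    exact (hm _ hx).map (f.fr x).symm

end Base

open PointQuadruple (cliffPairC)

/-! ### Involutivity in terms of families on the base -/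

section Flat

/-- Clifford multiplication by a complex covector. -/
theorem cliffC_covector_eq_sum {ι : Type*} [Fintype ι] {e : ι → V} {f : ι → V →L[ℝ] ℝ}
    (hef : ∀ X, ∑ i, f i X • e i = X) (L : V →L[ℝ] ℂ) (φ : PForm V) :
    cliffC (0, Complex.reCLM.comp L) (0, Complex.imCLM.comp L) φ =
      ∑ i, L (e i) • wedge (ofCovector (f i)) φ := by
  have h : ∀ ξ : V →L[ℝ] ℝ, wedge (ofCovector ξ) φ =
      ∑ i, ((ξ (e i) : ℝ) : ℂ) • wedge (ofCovector (f i)) φ := fun ξ => by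
    have h1 : ξ = ∑ i, ξ (e i) • f i := by
      ext X
      conv_lhs => rw [← hef X, map_sum]
      simp only [map_smul, smul_eq_mul, sum_apply, smul_apply]
      exact Finset.sum_congr rfl fun i _ => mul_comm _ _
    have h2 : ∀ s : Finset ι, ofCovector (∑ i ∈ s, ξ (e i) • f i) =
        ∑ i ∈ s, ξ (e i) • ofCovector (f i) := fun s => by
      classical
      induction s using Finset.induction_on with
      | empty => simp
      | insert a s ha ih => rw [Finset.sum_insert ha, Finset.sum_insert ha, ofCovector_add,
          ofCovector_smul, ih]
    conv_lhs => rw [h1, h2, wedge_sum_left]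
    simp only [wedge_rsmul_left]
    simp only [rsmul_eq_smul]
  simp only [cliffC, cliff_covector]
  rw [h (Complex.reCLM.comp L), h (Complex.imCLM.comp L), Finset.smul_sum, ← Finset.sum_add_distrib]
  refine Finset.sum_congr rfl fun i _ => ?_
  rw [smul_smul, ← pform_add_smul]
  congr 1
  show ((L (e i)).re : ℂ) + Complex.I * ((L (e i)).im : ℂ) = L (e i)
  rw [mul_comm, Complex.re_add_im]

variable [FiniteDimensional ℝ V]

theorem flatD_smul {g : V → ℂ} {α : V → PForm V} {z : V} (hg : ContDiffAt ℝ ∞ g z)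
    (hα : SmoothFamAt α z) : flatD (fun y => g y • α y) z =
      cliffC (0, Complex.reCLM.comp (fderiv ℝ g z)) (0, Complex.imCLM.comp (fderiv ℝ g z)) (α z) +
        g z • flatD α z := by
  obtain ⟨e, f, hef⟩ := exists_dual_frame V
  rw [cliffC_covector_eq_sum hef, flatD_eq_sum e f hef (SmoothFamAt.smul hg hα),
    flatD_eq_sum e f hef hα, Finset.smul_sum, ← Finset.sum_add_distrib]
  refine Finset.sum_congr rfl fun i _ => ?_
  rw [pd_smul hα (e i) hg, wedge_add_right, wedge_smul_right, wedge_smul_right]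

theorem cliffC_covector_smul (c : ℂ) (L : V →L[ℝ] ℂ) (φ : PForm V) :
    cliffC (0, Complex.reCLM.comp (c • L)) (0, Complex.imCLM.comp (c • L)) φ =
      c • cliffC (0, Complex.reCLM.comp L) (0, Complex.imCLM.comp L) φ := by
  obtain ⟨e, f, hef⟩ := exists_dual_frame V
  rw [cliffC_covector_eq_sum hef, cliffC_covector_eq_sum hef, Finset.smul_sum]
  simp only [smul_smul]
  rfl

omit [FiniteDimensional ℝ V] in
theorem flatTwistD_congr {H3 H2 F : V → PForm V} {p q : V → PForm V × PForm V} {z : V}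
    (h : p =ᶠ[nhds z] q) : flatTwistD H3 H2 F p z = flatTwistD H3 H2 F q z := by
  rw [flatTwistD, flatTwistD, h.self_of_nhds, flatD_congr (h.mono fun y hy => congrArg Prod.fst hy),
    flatD_congr (h.mono fun y hy => congrArg Prod.snd hy)]

omit [FiniteDimensional ℝ V] in
theorem cliffPair_vadd (a a' : CE V) (p : PForm V × PForm V) :
    cliffPair (a + a') p = cliffPair a p + cliffPair a' p := by
  have h := PointQuadruple.cliffPair_vsub (a + a') a' p
  rw [add_sub_cancel_right] at h
  rw [h, sub_add_cancel]

omit [FiniteDimensional ℝ V] in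
theorem cliffPair_smul (a : CE V) (c : ℂ) (p : PForm V × PForm V) :
    cliffPair a (c • p) = c • cliffPair a p := by
  refine Prod.ext ?_ ?_
  · show cliff a.1 (c • p.1) + a.2.1 • c • p.2 = c • (cliff a.1 p.1 + a.2.1 • p.2)
    rw [cliff_smul, smul_add, smul_comm]
  · show a.2.2 • c • p.1 - cliff a.1 (c • p.2) = c • (a.2.2 • p.1 - cliff a.1 p.2)
    rw [cliff_smul, smul_sub, smul_comm]

omit [FiniteDimensional ℝ V] in
theorem cliffPairC_smul (a b : CE V) (c : ℂ) (p : PForm V × PForm V) :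
    cliffPairC a b (c • p) = c • cliffPairC a b p := by
  rw [cliffPairC, cliffPairC, cliffPair_smul, cliffPair_smul, smul_add, smul_comm c]

omit [FiniteDimensional ℝ V] in
theorem cliffPairC_vadd (a b a' b' : CE V) (p : PForm V × PForm V) :
    cliffPairC (a + a') (b + b') p = cliffPairC a b p + cliffPairC a' b' p := by
  rw [cliffPairC, cliffPairC, cliffPairC, cliffPair_vadd, cliffPair_vadd, smul_add]
  abel

/-- Multiples of involutive pairs are involutive. -/
theorem flatTwistD_smul {H3 H2 F : V → PForm V} {p : V → PForm V × PForm V} {g : V → ℂ} {z : V}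
    (hg : ContDiffAt ℝ ∞ g z) (hz : g z ≠ 0) (h₁ : SmoothFamAt (fun y => (p y).1) z)
    (h₂ : SmoothFamAt (fun y => (p y).2) z) {a b : CE V}
    (h : flatTwistD H3 H2 F p z = cliffPairC a b (p z)) :
    flatTwistD H3 H2 F (fun y => g y • p y) z =
      cliffPairC (a + ((0, Complex.reCLM.comp ((g z)⁻¹ • fderiv ℝ g z)), 0, 0))
        (b + ((0, Complex.imCLM.comp ((g z)⁻¹ • fderiv ℝ g z)), 0, 0)) (g z • p z) := by
  have e : fderiv ℝ g z = g z • ((g z)⁻¹ • fderiv ℝ g z) := by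
    rw [smul_smul, mul_inv_cancel₀ hz, one_smul]
  rw [cliffPairC_smul, cliffPairC_vadd, smul_add, ← h]
  have k₁ := flatD_smul hg h₁
  have k₂ := flatD_smul hg h₂
  rw [e, cliffC_covector_smul] at k₁ k₂
  have hc : ∀ (ξ η : V →L[ℝ] ℝ) (q : PForm V × PForm V),
      cliffPairC ((0, ξ), 0, 0) ((0, η), 0, 0) q =
        (cliffC (0, ξ) (0, η) q.1, -cliffC (0, ξ) (0, η) q.2) := fun ξ η q => by
    refine Prod.ext ?_ ?_
    · show cliff (0, ξ) q.1 + (0 : ℝ) • q.2 + Complex.I • (cliff (0, η) q.1 + (0 : ℝ) • q.2) = _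
      rw [pform_zero_rsmul, add_zero, add_zero]
      rfl
    · show (0 : ℝ) • q.1 - cliff (0, ξ) q.2 + Complex.I • ((0 : ℝ) • q.1 - cliff (0, η) q.2) =
        -(cliff (0, ξ) q.2 + Complex.I • cliff (0, η) q.2)
      rw [pform_zero_rsmul, zero_sub, zero_sub, smul_neg, neg_add]
  rw [hc]
  refine Prod.ext ?_ ?_
  · show flatD (fun y => g y • (p y).1) z + wedge (H3 z) (g z • (p z).1) +
      wedge (F z) (g z • (p z).2) = g z • (flatD (fun y => (p y).1) z + wedge (H3 z) (p z).1 +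
      wedge (F z) (p z).2) + g z • cliffC _ _ (p z).1
    rw [k₁, wedge_smul_right, wedge_smul_right, smul_add, smul_add]
    abel
  · show wedge (H2 z) (g z • (p z).1) - flatD (fun y => g y • (p y).2) z -
      wedge (H3 z) (g z • (p z).2) = g z • (wedge (H2 z) (p z).1 - flatD (fun y => (p y).2) z -
      wedge (H3 z) (p z).2) + g z • -cliffC _ _ (p z).2
    rw [k₂, wedge_smul_right, wedge_smul_right, smul_sub, smul_sub, smul_neg]
    abel

end Flat

section Base

variable {k : ℕ} [FiniteDimensional ℝ EB] {T : TorusBundle k EM M EB B} {f : T.Frame}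
  {c : BaseChart EB B} [IsManifold 𝓘(ℝ, EM) ∞ M] {K : FrameChart f c} {t : Twist EM M} {σ : ℝ}
  {F F' : EB → Fin (k + 1) → PForm EB} {η : EB → PForm EB}
  {p : B → PForm (EB × (Fin k → ℝ)) × PForm (EB × (Fin k → ℝ))}

namespace FrameChart

omit [IsManifold 𝓘(ℝ, EM) ∞ M] in
theorem HasTwist.flatTwistD_shearMap (H : K.HasTwist t σ F F' η) {z : EB × (Fin k → ℝ)}
    (hz : z.1 ∈ c.e.target) {w : EB → PForm (EB × (Fin k → ℝ)) × PForm (EB × (Fin k → ℝ))}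
    (h₁ : SmoothFamAt (fun y => (w y).1) z.1) (h₂ : SmoothFamAt (fun y => (w y).2) z.1) :
    flatTwistD (fun y => pull (K.d y : EB × (Fin k → ℝ) →L[ℝ] EM) (ofReal 3 (t.H3 (K.Ψ y))))
        (fun y => pull (K.d y : EB × (Fin k → ℝ) →L[ℝ] EM) (ofReal 2 (t.H2 (K.Ψ y))))
        (fun y => pull (K.d y : EB × (Fin k → ℝ) →L[ℝ] EM) (ofReal 2 (t.F (K.Ψ y))))
        (fun y => pullPair (shearMap (K.θ y.1)) (w y.1)) z =
      pullPair (shearMap (K.θ z.1)) (frameTwistD σ (F z.1) (F' z.1) (η z.1) w z.1) := by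
  have e : ∀ φ : PForm EM, pull (K.d z : EB × (Fin k → ℝ) →L[ℝ] EM) φ =
      pull (shearMap (K.θ z.1)) (pull ((K.nf z).symm : EB × (Fin k → ℝ) →L[ℝ] EM) φ) :=
    fun _ => rfl
  obtain ⟨u, s⟩ := z
  refine flatTwistD_pullPair_shearMap σ (K.smooth_θ u hz) (fun i => (H.curv_succ u hz i).symm)
    ?_ ?_ ?_ h₁ h₂
  · rw [e]
    exact congrArg (fun q => pull _ (Prod.fst q)) (H.twist u hz s)
  · rw [e]
    refine (congrArg (fun q => pull _ (Prod.snd q)) (H.twist u hz s)).trans ?_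
    rw [pull_rsmul, pull_shearMap_basic]
  · rw [e, H.curv u hz s, pull_rsmul, pull_shearMap_basic]

/-- An involutive invariant pair, in terms of the family on the base. -/
theorem HasTwist.exists_frameTwistD_eq [FiniteDimensional ℝ EM] (H : K.HasTwist t σ F F' η)
    {U : Set M} (hU : IsOpen U)
    (h₁ : SmoothFormOn 𝓘(ℝ, EM) (fun x => (f.liftPair p x).1) U)
    (h₂ : SmoothFormOn 𝓘(ℝ, EM) (fun x => (f.liftPair p x).2) U)
    (hi : InvolutiveOn t U (f.liftPair p)) {u : EB} (hu : u ∈ c.e.target) (hm : K.Ψ (u, 0) ∈ U) :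
    ∃ a b : EB → CE (EB × (Fin k → ℝ)), ContDiffAt ℝ ∞ a u ∧ ContDiffAt ℝ ∞ b u ∧
      ∀ᶠ y in nhds u, frameTwistD σ (F y) (F' y) (η y) (c.pairMap p) y =
        cliffPairC (a y) (b y) (c.pairMap p y) := by
  obtain ⟨V₁, V₂, hV₁, hV₂, hV⟩ := hi
  have hs : ∀ V : M → CE EM, SmoothCEOn V U →
      ContDiffAt ℝ ∞ (fun y : EB => ceMap (K.nf (y, 0)) (V (K.Ψ (y, 0)))) u := by
    intro V hV
    have h := (K.isParam hu 0).contDiffAt_ceMap hV hU hm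
    have h' : ContDiffAt ℝ ∞ (fun y : EB => ceMap (K.d (y, 0)).symm (V (K.Ψ (y, 0)))) u :=
      h.comp (f := fun y : EB => (y, (0 : Fin k → ℝ))) u (contDiffAt_id.prodMk contDiffAt_const)
    have e : (fun y : EB => ceMap (K.nf (y, 0)) (V (K.Ψ (y, 0)))) = fun y : EB =>
        ceMap (shear (K.θ y)) (ceMap (K.d (y, 0)).symm (V (K.Ψ (y, 0)))) := by
      funext y
      exact (ceMap_symm_ceMap (shear (K.θ y)).symm (ceMap (K.nf (y, 0)) (V (K.Ψ (y, 0))))).symm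
    rw [e]
    exact (contDiffAt_gtMap (K.contDiffAt_shear hu) (K.contDiffAt_shear_symm hu) h'.fst).prodMk
      h'.snd
  refine ⟨_, _, hs V₁ hV₁, hs V₂ hV₂, ?_⟩
  have hmem : ∀ᶠ y in nhds u, K.Ψ (y, 0) ∈ U := by
    have h1 : ContinuousAt (fun y : EB => K.Ψ (y, 0)) u :=
      ContinuousAt.comp (f := fun y : EB => (y, (0 : Fin k → ℝ))) (g := K.Ψ)
        (K.smooth u hu 0).continuousAt (by fun_prop)
    exact h1.eventually_mem (hU.mem_nhds hm)
  filter_upwards [hmem, c.e.open_target.mem_nhds hu] with y hy hyt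
  obtain ⟨s₁, s₂⟩ := K.smoothFamAt_pairMap hU h₁ h₂ hyt hy
  have e1 := (K.isParam hyt 0).pullPair_d (t := t) (p := f.liftPair p) hU hy h₁ h₂
  rw [flatTwistD_congr ((eventually_mem hyt 0).mono fun z hz => K.pullPair_d_liftPair z hz),
    H.flatTwistD_shearMap (z := (y, 0)) hyt s₁ s₂, hV _ hy] at e1
  have e2 := congrArg (pullPair
    ((shear (K.θ y)).symm : EB × (Fin k → ℝ) →L[ℝ] EB × (Fin k → ℝ))) e1
  have e3 := pullPair_symm_pullPair (shear (K.θ y)) (frameTwistD σ (F y) (F' y) (η y) (c.pairMap p) y)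
  have e4 := K.pullPair_nf_symm_liftPair (p := p) (y, 0) hyt
  refine e3.symm.trans (e2.symm.trans ?_)
  rw [← e4, cliffPairC_pullPair]
  have e5 : ∀ a : CE EM, ceMap (K.nf (y, 0)).symm (ceMap (K.nf (y, 0)) a) = a :=
    fun a => ceMap_symm_ceMap (K.nf (y, 0)) a
  rw [e5, e5]
  exact pullPair_symm_pullPair (shear (K.θ y)) (pullPair
    ((K.nf (y, 0)).symm : EB × (Fin k → ℝ) →L[ℝ] EM)
    (cliffPairC (V₁ (K.Ψ (y, 0))) (V₂ (K.Ψ (y, 0))) (f.liftPair p (K.Ψ (y, 0)))))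

/-- A mixed pair is involutive near a point if this holds for an invariant mixed pair. -/
theorem HasTwist.exists_pullPair_d_eq [FiniteDimensional ℝ EM] (H : K.HasTwist t σ F F' η)
    {S : Quadruple EM M} (hS : S.IsSekiya)
    {U W : Set M} (hU : IsOpen U) (hW : IsOpen W) (hp : S.IsMixedPairOn U (f.liftPair p))
    {q : M → PForm EM × PForm EM} (hq : S.IsMixedPairOn W q) {z : EB × (Fin k → ℝ)}
    (hz : z.1 ∈ c.e.target) (hzU : K.Ψ z ∈ U) (hzW : K.Ψ z ∈ W)
    (hs : ∀ᶠ y in nhds z.1, SmoothFamAt (fun y => (c.pairMap p y).1) y ∧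
      SmoothFamAt (fun y => (c.pairMap p y).2) y) {a b : EB → CE (EB × (Fin k → ℝ))}
    (ha : ContDiffAt ℝ ∞ a z.1) (hb : ContDiffAt ℝ ∞ b z.1)
    (hab : ∀ᶠ y in nhds z.1, frameTwistD σ (F y) (F' y) (η y) (c.pairMap p) y =
        cliffPairC (a y) (b y) (c.pairMap p y)) :
    ∃ a b : EB × (Fin k → ℝ) → CE (EB × (Fin k → ℝ)), ContDiffAt ℝ ∞ a z ∧ ContDiffAt ℝ ∞ b z ∧
      ∀ᶠ y in nhds z, pullPair (K.d y : EB × (Fin k → ℝ) →L[ℝ] EM) (t.d q (K.Ψ y)) =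
        cliffPairC (a y) (b y) (pullPair (K.d y : EB × (Fin k → ℝ) →L[ℝ] EM) (q (K.Ψ y))) := by
  have hpar : ∀ᶠ y in nhds z, IsParam K.Ψ K.d y := K.eventually_isParam hz z.2
  have hcont := hpar.self_of_nhds.smooth.continuousAt
  have hyU : ∀ᶠ y in nhds z, K.Ψ y ∈ U := hcont.eventually_mem (hU.mem_nhds hzU)
  have hyW : ∀ᶠ y in nhds z, K.Ψ y ∈ W := hcont.eventually_mem (hW.mem_nhds hzW)
  set P : EB × (Fin k → ℝ) → PForm (EB × (Fin k → ℝ)) × PForm (EB × (Fin k → ℝ)) := fun y =>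
    pullPair (K.d y : EB × (Fin k → ℝ) →L[ℝ] EM) (q (K.Ψ y)) with hP
  set w : EB × (Fin k → ℝ) → PForm (EB × (Fin k → ℝ)) × PForm (EB × (Fin k → ℝ)) := fun y =>
    pullPair (shearMap (K.θ y.1)) (c.pairMap p y.1) with hw
  have hwe : ∀ y : EB × (Fin k → ℝ), y.1 ∈ c.e.target →
      pullPair (K.d y : EB × (Fin k → ℝ) →L[ℝ] EM) (f.liftPair p (K.Ψ y)) = w y :=
    fun y hy => K.pullPair_d_liftPair y hy
  have hmix : ∀ y, K.Ψ y ∈ U → y.1 ∈ c.e.target →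
      ((S.at (K.Ψ y)).map (K.d y).symm).IsMixedPair (w y) := fun y hy hy' => by
    rw [← hwe y hy']
    exact (hp.at hy).map (K.d y).symm
  obtain ⟨n, v, hnv⟩ : ∃ n v, (w z).1 n v ≠ 0 := by
    by_contra! h
    refine (hmix z hzU hz).fst_ne_zero (funext fun n => ?_)
    ext v
    exact h n v
  have hsw : ∀ y : EB × (Fin k → ℝ), K.Ψ y ∈ U → IsParam K.Ψ K.d y → y.1 ∈ c.e.target →
      SmoothFamAt (fun y => (w y).1) y ∧ SmoothFamAt (fun y => (w y).2) y := fun y hy hy' hyt =>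
    ⟨(hy'.smoothFamAt hp.smooth_fst hU hy).congr ((eventually_mem (s := y.2) hyt).mono fun x hx =>
      congrArg Prod.fst (hwe x hx).symm), (hy'.smoothFamAt hp.smooth_snd hU hy).congr
      ((eventually_mem (s := y.2) hyt).mono fun x hx => congrArg Prod.snd (hwe x hx).symm)⟩
  set g : EB × (Fin k → ℝ) → ℂ := fun y => (P y).1 n v * ((w y).1 n v)⁻¹ with hg
  have hPw : ∀ y, K.Ψ y ∈ U → K.Ψ y ∈ W → y.1 ∈ c.e.target → (w y).1 n v ≠ 0 →
      P y = g y • w y ∧ g y ≠ 0 := by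
    intro y hyU hyW hyt hne
    obtain ⟨r, hr, h1, h2⟩ := ((hS.at (K.Ψ y)).map (K.d y).symm).exists_eq_smul (hmix y hyU hyt)
      ((hq.at hyW).map (K.d y).symm)
    have h3 : (P y).1 n v = r * (w y).1 n v := by
      have := congrArg (fun φ : PForm (EB × (Fin k → ℝ)) => φ n v) h1
      exact this
    have h4 : g y = r := by rw [hg]; simp only [h3]; exact mul_inv_cancel_right₀ hne r
    rw [h4]
    exact ⟨Prod.ext h1 h2, hr⟩
  have hgs : ∀ y, K.Ψ y ∈ U → K.Ψ y ∈ W → IsParam K.Ψ K.d y → y.1 ∈ c.e.target →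
      (w y).1 n v ≠ 0 → ContDiffAt ℝ ∞ g y := fun y hyU hyW hy hyt hne =>
    (contDiffAt_form_apply ((hy.smoothFamAt hq.smooth_fst hW hyW) n) v).mul
      ((contDiffAt_form_apply ((hsw y hyU hy hyt).1 n) v).inv hne)
  have hne : ∀ᶠ y in nhds z, (w y).1 n v ≠ 0 :=
    (contDiffAt_form_apply ((hsw z hzU hpar.self_of_nhds hz).1 n) v).continuousAt.eventually_ne hnv
  have hgz := hgs z hzU hzW hpar.self_of_nhds hz hnv
  have hLs : ContDiffAt ℝ ∞ (fun y => (g y)⁻¹ • fderiv ℝ g y) z :=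
    (hgz.inv (hPw z hzU hzW hz hnv).2).smul (hgz.fderiv_right (by simp))
  have hsm : ∀ a : EB → CE (EB × (Fin k → ℝ)), ContDiffAt ℝ ∞ a z.1 → ContDiffAt ℝ ∞
      (fun y : EB × (Fin k → ℝ) => ceMap (shear (K.θ y.1)).symm (a y.1)) z := by
    intro a ha
    refine ContDiffAt.comp (f := Prod.fst) (g := fun y : EB => ceMap (shear (K.θ y)).symm (a y)) z
      ?_ contDiffAt_fst
    exact (contDiffAt_gtMap (f := fun y => (shear (K.θ y)).symm) (K.contDiffAt_shear_symm hz)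
      (K.contDiffAt_shear hz) ha.fst).prodMk ha.snd
  refine ⟨fun y => ceMap (shear (K.θ y.1)).symm (a y.1) +
      ((0, Complex.reCLM.comp ((g y)⁻¹ • fderiv ℝ g y)), 0, 0),
    fun y => ceMap (shear (K.θ y.1)).symm (b y.1) +
      ((0, Complex.imCLM.comp ((g y)⁻¹ • fderiv ℝ g y)), 0, 0),
    (hsm a ha).add ((contDiffAt_const.prodMk (contDiffAt_const.clm_comp hLs)).prodMk
      contDiffAt_const),
    (hsm b hb).add ((contDiffAt_const.prodMk (contDiffAt_const.clm_comp hLs)).prodMk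
      contDiffAt_const), ?_⟩
  have hfst : Filter.Tendsto (Prod.fst : EB × (Fin k → ℝ) → EB) (nhds z) (nhds z.1) :=
    continuous_fst.continuousAt
  filter_upwards [hpar, hyU.eventually_nhds, hyW.eventually_nhds, hne.eventually_nhds,
    (eventually_mem (s := z.2) hz).eventually_nhds, hfst.eventually hs, hfst.eventually hab]
    with y h1 h2 h3 h4 h5 h6 h7
  have hev : P =ᶠ[nhds y] fun y => g y • w y := by
    filter_upwards [h2, h3, h4, h5] with x x2 x3 x4 x5
    exact (hPw x x2 x3 x5 x4).1
  rw [h1.pullPair_d hW h3.self_of_nhds hq.smooth_fst hq.smooth_snd, flatTwistD_congr hev,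
    show pullPair (K.d y : EB × (Fin k → ℝ) →L[ℝ] EM) (q (K.Ψ y)) = g y • w y from hev.self_of_nhds]
  have hsy := hsw y h2.self_of_nhds h1 h5.self_of_nhds
  refine flatTwistD_smul
    (hgs y h2.self_of_nhds h3.self_of_nhds h1 h5.self_of_nhds h4.self_of_nhds)
    (hPw y h2.self_of_nhds h3.self_of_nhds h5.self_of_nhds h4.self_of_nhds).2 hsy.1 hsy.2 ?_
  rw [hw, H.flatTwistD_shearMap h5.self_of_nhds h6.1 h6.2, h7]
  have e : ∀ a b : CE (EB × (Fin k → ℝ)), cliffPairC (ceMap (shear (K.θ y.1)).symm a)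
      (ceMap (shear (K.θ y.1)).symm b) (pullPair (shearMap (K.θ y.1)) (c.pairMap p y.1)) =
      pullPair (shearMap (K.θ y.1)) (cliffPairC a b (c.pairMap p y.1)) := fun a b => by
    refine (cliffPairC_pullPair (shear (K.θ y.1)) _ _ _).trans ?_
    have e5 : ∀ a : CE (EB × (Fin k → ℝ)),
        ceMap (shear (K.θ y.1)) (ceMap (shear (K.θ y.1)).symm a) = a :=
      fun a => ceMap_symm_ceMap (shear (K.θ y.1)).symm a
    rw [e5, e5]
    rfl
  exact (e _ _).symm

end FrameChart

end Base

open PointQuadruple (cliffPairC)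

/-! ### The dual of an invariant generalised contact structure -/

section Congr

variable {E M : Type*} [NormedAddCommGroup E] [NormedSpace ℝ E] [TopologicalSpace M]
  [ChartedSpace E M]

theorem SmoothFormOn.congr {φ χ : M → PForm E} {U : Set M} (h : SmoothFormOn 𝓘(ℝ, E) φ U)
    (e : ∀ x ∈ U, χ x = φ x) : SmoothFormOn 𝓘(ℝ, E) χ U := fun k x₀ =>
  (h k x₀).congr fun u hu => by
    simp only [chartRep]
    rw [e _ hu.2]

theorem Quadruple.IsMixedPairOn.congr [IsManifold 𝓘(ℝ, E) ∞ M] {S : Quadruple E M} {U : Set M} {p q : M → PForm E × PForm E}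
    (h : S.IsMixedPairOn U p) (e : ∀ x ∈ U, q x = p x) : S.IsMixedPairOn U q := by
  obtain ⟨σ, hσ, hp⟩ := h.exists_pairParity
  refine Quadruple.isMixedPairOn_of_at (h.smooth_fst.congr fun x hx => by rw [e x hx])
    (h.smooth_snd.congr fun x hx => by rw [e x hx]) hσ (fun x hx => ?_) fun x hx => ?_
  · rw [e x hx]; exact hp x hx
  · rw [e x hx]; exact h.at hx

end Congr

section Frame

variable {n : ℕ} {T : TorusBundle n EP P EB B} {f : T.Frame} {c : BaseChart EB B}
  {Q : B → PointQuadruple (EB × (Fin n → ℝ))}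
  {p : B → PForm (EB × (Fin n → ℝ)) × PForm (EB × (Fin n → ℝ))} {U : Set B}

theorem isSekiya_of_liftQuad (h : ∀ x, ((f.liftQuad Q).at x).IsSekiya) (b : B) :
    (Q b).IsSekiya := by
  have h1 := (h (T.pt b)).map (f.fr (T.pt b))
  rwa [f.at_liftQuad, PointQuadruple.map_symm_map, T.proj_pt] at h1

theorem isMixedPair_of_liftPair [IsManifold 𝓘(ℝ, EP) ∞ P] (h : (f.liftQuad Q).IsMixedPairOn (T.proj ⁻¹' U) (f.liftPair p))
    {b : B} (hb : b ∈ U) : (Q b).IsMixedPair (p b) := by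
  have hm : T.pt b ∈ T.proj ⁻¹' U := by rwa [Set.mem_preimage, T.proj_pt]
  have h1 := (h.at hm).map (f.fr (T.pt b))
  rw [f.at_liftQuad, PointQuadruple.map_symm_map] at h1
  have h2 := pullPair_symm_pullPair (f.fr (T.pt b)) (p (T.proj (T.pt b)))
  rw [TorusBundle.Frame.liftPair, h2, T.proj_pt] at h1
  exact h1

theorem exists_pairParity_of_liftPair
    (h : (f.liftQuad Q).IsMixedPairOn (T.proj ⁻¹' U) (f.liftPair p)) :
    ∃ σ : ℝ, (σ = 1 ∨ σ = -1) ∧ ∀ b ∈ U, PairParity σ (p b) := by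
  obtain ⟨σ, hσ, hp⟩ := h.exists_pairParity
  refine ⟨σ, hσ, fun b hb => ?_⟩
  have hm : T.pt b ∈ T.proj ⁻¹' U := by rwa [Set.mem_preimage, T.proj_pt]
  have h1 := (hp _ hm).pullPair ((f.fr (T.pt b)).symm : EB × (Fin n → ℝ) →L[ℝ] EP)
  rw [TorusBundle.Frame.liftPair, pullPair_symm_pullPair, T.proj_pt] at h1
  exact h1

theorem isOpen_preimage (T : TorusBundle n EP P EB B) (hU : IsOpen U) :
    IsOpen (T.proj ⁻¹' U) := hU.preimage T.smooth_proj.continuous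

variable [FiniteDimensional ℝ EB] [IsManifold 𝓘(ℝ, EP) ∞ P] [FiniteDimensional ℝ EP]

/-- Mixed pairs of an invariant quadruple can be chosen invariant. -/
theorem FrameChart.exists_liftPair (K : FrameChart f c) {b : B} (hb : b ∈ c.e.source)
    {W : Set P} (hW : IsOpen W) {q : P → PForm EP × PForm EP} (hm : K.Ψ (c.e b, 0) ∈ W)
    (hq : (f.liftQuad Q).IsMixedPairOn W q) :
    ∃ (U : Set B) (p : B → PForm (EB × (Fin n → ℝ)) × PForm (EB × (Fin n → ℝ))), IsOpen U ∧
      b ∈ U ∧ (f.liftQuad Q).IsMixedPairOn (T.proj ⁻¹' U) (f.liftPair p) := by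
  have hcont : ContinuousOn (fun b => K.Ψ (c.e b, 0)) c.e.source := by
    intro y hy
    refine ContinuousAt.continuousWithinAt ?_
    exact ContinuousAt.comp (f := fun b => (c.e b, (0 : Fin n → ℝ))) (g := K.Ψ)
      (K.smooth _ (c.e.map_source hy) 0).continuousAt
      ((c.e.continuousAt hy).prodMk continuousAt_const)
  have hpr : ∀ y ∈ c.e.source, T.proj (K.Ψ (c.e y, 0)) = y := fun y hy => by
    rw [K.proj_Ψ _ (c.e.map_source hy), c.e.left_inv hy]
  obtain ⟨σ, hσ, hpar⟩ := hq.exists_pairParity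
  refine ⟨c.e.source ∩ (fun b => K.Ψ (c.e b, 0)) ⁻¹' W, fun y =>
    pullPair ((f.fr (K.Ψ (c.e y, 0))).symm : EB × (Fin n → ℝ) →L[ℝ] EP) (q (K.Ψ (c.e y, 0))),
    hcont.isOpen_inter_preimage c.e.open_source hW, ⟨hb, hm⟩,
    isMixedPairOn_liftPair hσ (fun y hy => (hpar _ hy.2).pullPair _) (fun y hy => ?_)
      fun y hy => ?_⟩
  · have h1 := (hq.at hy.2).map (f.fr (K.Ψ (c.e y, 0)))
    rwa [f.at_liftQuad, PointQuadruple.map_symm_map, hpr y hy.1] at h1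
  · have hu := c.e.map_source hy.1
    have he : ∀ᶠ u in nhds (c.e y), c.pairMap (fun y => pullPair ((f.fr (K.Ψ (c.e y, 0))).symm :
        EB × (Fin n → ℝ) →L[ℝ] EP) (q (K.Ψ (c.e y, 0)))) u =
        pullPair ((K.nf (u, 0)).symm : EB × (Fin n → ℝ) →L[ℝ] EP) (q (K.Ψ (u, 0))) := by
      filter_upwards [c.e.open_target.mem_nhds hu] with u hu
      simp only [BaseChart.pairMap]
      rw [c.e.right_inv hu]
      rfl
    exact ⟨c, K, hy.1,
      (K.smoothFamAt_nf hq.smooth_fst hW hu 0 hy.2).congr (he.mono fun u hu => congrArg Prod.fst hu),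
      (K.smoothFamAt_nf hq.smooth_snd hW hu 0 hy.2).congr (he.mono fun u hu => congrArg Prod.snd hu)⟩

end Frame

theorem frameTwistD_dualPair_eq {W : Type*} [NormedAddCommGroup W] [NormedSpace ℝ W]
    [FiniteDimensional ℝ W] {k : ℕ} {ε : ℝ} (hε : ε * ε = 1) {F F' : Fin (k + 1) → PForm W}
    {h : PForm W} (hF : ∀ i, gradeInv (F i) = F i) (hF' : ∀ i, gradeInv (F' i) = F' i)
    (hh : gradeInv h = -h) {p : W → PForm (W × (Fin k → ℝ)) × PForm (W × (Fin k → ℝ))} {u : W}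
    (h₁ : SmoothFamAt (fun y => (p y).1) u) (h₂ : SmoothFamAt (fun y => (p y).2) u)
    {a b : CE (W × (Fin k → ℝ))} (hab : frameTwistD 1 F F' h p u = cliffPairC a b (p u)) :
    frameTwistD (-ε) F' F h (fun y => dualPair ε (torusVec W) (p y)) u =
      cliffPairC (reflect (torusVec W) a.1, -ε * a.2.2, -ε * a.2.1)
        (reflect (torusVec W) b.1, -ε * b.2.2, -ε * b.2.1) (dualPair ε (torusVec W) (p u)) := by
  have hv := torusVec_negOrthonormal W (n := k)
  have h1 : (-(-1 : ℝ) ^ k) * (-(-1) ^ k) = 1 := by rw [neg_mul_neg, ← mul_pow]; simp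
  have hadd : ∀ q q' : PForm (W × (Fin k → ℝ)) × PForm (W × (Fin k → ℝ)),
      dualPair ε (torusVec W) (q + Complex.I • q') =
        dualPair ε (torusVec W) q + Complex.I • dualPair ε (torusVec W) q' := fun q q' => by
    refine Prod.ext ?_ ?_
    · show _ • cliffProd _ (q.2 + Complex.I • q'.2) = _ • cliffProd _ q.2 + _ • _ • cliffProd _ q'.2
      rw [cliffProd_add, cliffProd_smul, smul_add, smul_comm]
    · show _ • cliffProd _ (q.1 + Complex.I • q'.1) = _ • cliffProd _ q.1 + _ • _ • cliffProd _ q'.1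
      rw [cliffProd_add, cliffProd_smul, smul_add, smul_comm]
  have hcancel : ∀ (r : ℝ), r * r = 1 → ∀ X Y : PForm (W × (Fin k → ℝ)) × PForm (W × (Fin k → ℝ)),
      r • (r • X + Complex.I • r • Y) = X + Complex.I • Y := by
    have hf : ∀ (r : ℝ), r * r = 1 → ∀ X Y : PForm (W × (Fin k → ℝ)),
        r • (r • X + Complex.I • r • Y) = X + Complex.I • Y := fun r hr X Y => by
      have hrc : (r : ℂ) * r = 1 := by exact_mod_cast hr
      simp only [rsmul_eq_smul, smul_add]
      rw [smul_comm Complex.I, smul_smul, smul_smul, hrc, one_smul, one_smul]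
    exact fun r hr X Y => Prod.ext (hf r hr X.1 Y.1) (hf r hr X.2 Y.2)
  rw [frameTwistD_dualPair hε hF hF' hh h₁ h₂, hab, cliffPairC, hadd, dualPair_cliffPair hv hε,
    dualPair_cliffPair hv hε, hcancel _ h1]
  rfl

section Dual

variable {k : ℕ} [FiniteDimensional ℝ EB] [IsManifold 𝓘(ℝ, EB) ∞ B] [FiniteDimensional ℝ EM]
  [IsManifold 𝓘(ℝ, EM) ∞ M] [FiniteDimensional ℝ EP] [IsManifold 𝓘(ℝ, EP) ∞ P]
  [FiniteDimensional ℝ EM'] [IsManifold 𝓘(ℝ, EM') ∞ M'] [FiniteDimensional ℝ EP']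
  [IsManifold 𝓘(ℝ, EP') ∞ P'] (R : Reduction k EB B EM M EP P) (R' : Reduction k EB B EM' M' EP' P')
  {ε : ℝ} {Q : B → PointQuadruple (EB × (Fin k → ℝ))}
  {p : B → PForm (EB × (Fin k → ℝ)) × PForm (EB × (Fin k → ℝ))} {U : Set B}

theorem Reduction.isSekiya_liftQuad_dual (hε : ε * ε = 1) (h : (R.frM.liftQuad Q).IsSekiya) :
    (R'.frM.liftQuad fun b => (Q b).dual ε (torusVec EB)).IsSekiya := by
  refine isSekiya_liftQuad (fun b => ?_) fun b => ?_
  · exact PointQuadruple.IsSekiya.dual (torusVec_negOrthonormal EB) hε (isSekiya_of_liftQuad h.at b)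
  · obtain ⟨c, K, K', hb, -⟩ := R.exists_charts R' isOpen_univ (Set.mem_univ b)
    refine ⟨c, R'.quotChart K', hb, ?_⟩
    have h1 := ((R.quotChart K).smoothQuadAt_quadMap h (c.e.map_source hb)).dual ε (torusVec EB)
    exact h1.congr (Filter.Eventually.of_forall fun u => c.quadMap_dual ε Q u)

theorem Reduction.isMixedPairOn_liftPair_dual (hε : ε * ε = 1) (hU : IsOpen U)
    (h : (R.frM.liftQuad Q).IsMixedPairOn (R.TM.proj ⁻¹' U) (R.frM.liftPair p)) :
    (R'.frM.liftQuad fun b => (Q b).dual ε (torusVec EB)).IsMixedPairOn (R'.TM.proj ⁻¹' U)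
      (R'.frM.liftPair fun b => dualPair ε (torusVec EB) (p b)) := by
  obtain ⟨σ, hσ, hp⟩ := exists_pairParity_of_liftPair h
  refine isMixedPairOn_liftPair (σ := -(-1) ^ k * σ) ?_ (fun b hb => (hp b hb).dualPair ε _)
    (fun b hb => ?_) fun b hb => ?_
  · rcases neg_one_pow_eq_or ℝ k with hk | hk <;> rcases hσ with rfl | rfl <;> rw [hk] <;> norm_num
  · exact (isMixedPair_of_liftPair h hb).dual (torusVec_negOrthonormal EB) hε
  · obtain ⟨c, K, K', hb', -⟩ := R.exists_charts R' hU hb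
    have hu := c.e.map_source hb'
    refine ⟨c, R'.quotChart K', hb', ?_⟩
    obtain ⟨h₁, h₂⟩ := (R.quotChart K).smoothFamAt_pairMap (isOpen_preimage R.TM hU)
      h.smooth_fst h.smooth_snd hu (by
        rw [Set.mem_preimage, (R.quotChart K).proj_Ψ _ hu, c.e.left_inv hb']; exact hb)
    have h3 := SmoothFamAt.pullPairLike (ε := ε) (torusVec EB) h₁ h₂
    exact ⟨h3.1.congr (Filter.Eventually.of_forall fun u =>
        congrArg Prod.fst (c.pairMap_dualPair ε p u)),
      h3.2.congr (Filter.Eventually.of_forall fun u =>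
        congrArg Prod.snd (c.pairMap_dualPair ε p u))⟩

variable {R R'} in
/-- The dual of an invariant generalised contact structure. -/
theorem IsTDual.isGenContact {t : Twist EM M} {t' : Twist EM' M'} (hd : IsTDual R R' t t')
    (hε : ε * ε = 1) (h : IsGenContact t (R.frM.liftQuad Q)) :
    IsGenContact (t'.scale (-ε)) (R'.frM.liftQuad fun b => (Q b).dual ε (torusVec EB)) := by
  have hloc : ∀ b, ∃ (c : BaseChart EB B) (K : FrameChart R.frP c) (K' : FrameChart R'.frP c)
      (U : Set B) (p : B → PForm (EB × (Fin k → ℝ)) × PForm (EB × (Fin k → ℝ))),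
      b ∈ c.e.source ∧ IsOpen U ∧ b ∈ U ∧
      (R.frM.liftQuad Q).IsMixedPairOn (R.TM.proj ⁻¹' U) (R.frM.liftPair p) := by
    intro b
    obtain ⟨c, K, K', hb, -⟩ := R.exists_charts R' isOpen_univ (Set.mem_univ b)
    obtain ⟨W, q, hW, hm, hq⟩ := h.exists_pair ((R.quotChart K).Ψ (c.e b, 0))
    obtain ⟨U, p, hU, hbU, hp⟩ := (R.quotChart K).exists_liftPair hb hW hm hq
    exact ⟨c, K, K', U, p, hb, hU, hbU, hp⟩
  have hS' := R.isSekiya_liftQuad_dual R' hε h.sekiya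
  refine ⟨hd.smooth'.scale _, hd.maurerCartan h.maurerCartan (by rw [neg_mul_neg, hε]), hS',
    fun x => ?_, fun W q hW hq => ?_⟩
  · obtain ⟨c, K, K', U, p, -, hU, hx, hp⟩ := hloc (R'.TM.proj x)
    exact ⟨_, _, isOpen_preimage R'.TM hU, hx,
      R.isMixedPairOn_liftPair_dual R' hε hU hp⟩
  · refine involutiveOn_of_isParam (EB × (Fin k → ℝ)) hS' hW hq fun x hx => ?_
    obtain ⟨c, K, K', U, p, hb, hU, hxU, hp⟩ := hloc (R'.TM.proj x)
    have hp' := R.isMixedPairOn_liftPair_dual R' hε hU hp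
    obtain ⟨s, hs⟩ := (R'.quotChart K').exists_eq hb
    have hu := c.e.map_source hb
    obtain ⟨η, H, H'⟩ := hd.exists_hasTwist K K'
    refine ⟨_, _, _, hs, (R'.quotChart K').eventually_isParam hu s, ?_⟩
    have hUo := isOpen_preimage R.TM hU
    have hmem : ∀ u ∈ c.e.target, c.e.symm u ∈ U → (R.quotChart K).Ψ (u, 0) ∈ R.TM.proj ⁻¹' U :=
      fun u hu hm => by rwa [Set.mem_preimage, (R.quotChart K).proj_Ψ _ hu]
    have hmb : c.e.symm (c.e (R'.TM.proj x)) ∈ U := by rwa [c.e.left_inv hb]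
    obtain ⟨a, b, ha, hb', hab⟩ := H.exists_frameTwistD_eq hUo hp.smooth_fst hp.smooth_snd
      (h.involutive _ _ hUo hp) hu (hmem _ hu hmb)
    have hev : ∀ᶠ y in nhds (c.e (R'.TM.proj x)), c.e.symm y ∈ U ∧ y ∈ c.e.target :=
      ((c.e.continuousAt_symm hu).eventually_mem (hU.mem_nhds hmb)).and
        (c.e.open_target.mem_nhds hu)
    have hs₀ : ∀ᶠ y in nhds (c.e (R'.TM.proj x)), SmoothFamAt (fun y => (c.pairMap p y).1) y ∧
        SmoothFamAt (fun y => (c.pairMap p y).2) y := by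
      filter_upwards [hev] with y hy
      exact (R.quotChart K).smoothFamAt_pairMap hUo hp.smooth_fst hp.smooth_snd hy.2
        (hmem y hy.2 hy.1)
    have he : c.pairMap (fun b => dualPair ε (torusVec EB) (p b)) =
        fun y => dualPair ε (torusVec EB) (c.pairMap p y) :=
      funext fun y => c.pairMap_dualPair ε p y
    have hrefl : ∀ a : EB → CE (EB × (Fin k → ℝ)), ContDiffAt ℝ ∞ a (c.e (R'.TM.proj x)) →
        ContDiffAt ℝ ∞ (fun y => ((reflect (torusVec EB) (a y).1, -ε * (a y).2.2,
          -ε * (a y).2.1) : CE (EB × (Fin k → ℝ)))) (c.e (R'.TM.proj x)) := fun a ha =>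
      (SmoothQuadAt.contDiffAt_reflect _ ha.fst).prodMk
        ((contDiffAt_const.mul ha.snd.snd).prodMk (contDiffAt_const.mul ha.snd.fst))
    refine (H' (-ε)).exists_pullPair_d_eq hS' (isOpen_preimage R'.TM hU) hW hp' hq
      (z := (c.e (R'.TM.proj x), s)) hu ?_ (by rwa [hs]) ?_ (hrefl a ha) (hrefl b hb') ?_
    · rwa [hs]
    · rw [he]
      filter_upwards [hs₀] with y hy
      exact SmoothFamAt.pullPairLike (torusVec EB) hy.1 hy.2
    · rw [he]
      filter_upwards [hs₀, hev, hab] with y h1 h2 h3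
      exact frameTwistD_dualPair_eq hε (H.even y h2.2) (H.even' y h2.2) (H.odd y h2.2) h1.1 h1.2 h3

end Dual

/-! ### The Fourier transform -/

section Fourier

variable {k : ℕ} [FiniteDimensional ℝ EB] [IsManifold 𝓘(ℝ, EB) ∞ B] [FiniteDimensional ℝ EM]
  [IsManifold 𝓘(ℝ, EM) ∞ M] [FiniteDimensional ℝ EP] [IsManifold 𝓘(ℝ, EP) ∞ P]
  [FiniteDimensional ℝ EM'] [IsManifold 𝓘(ℝ, EM') ∞ M'] [FiniteDimensional ℝ EP']
  [IsManifold 𝓘(ℝ, EP') ∞ P'] {R : Reduction k EB B EM M EP P} {R' : Reduction k EB B EM' M' EP' P'}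
  {c : BaseChart EB B}

omit [FiniteDimensional ℝ EM] [IsManifold 𝓘(ℝ, EM) ∞ M] [FiniteDimensional ℝ EM']
  [IsManifold 𝓘(ℝ, EM') ∞ M'] [IsManifold 𝓘(ℝ, EB) ∞ B] [IsManifold 𝓘(ℝ, EP) ∞ P]
  [IsManifold 𝓘(ℝ, EP') ∞ P'] in
theorem pull_corrTangent_fourierForm (K : FrameChart R.frP c) (K' : FrameChart R'.frP c)
    (z z' : EB × (Fin (k + 1) → ℝ)) :
    pull (corrTangent K K' z z') (fourierForm R R' (K.Ψ z, K'.Ψ z')) = linFourier EB (k + 1) := by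
  have e1 : ∀ φ, pull (corrTangent K K' z z') (pull (ContinuousLinearMap.fst ℝ EP EP') φ) =
      pull (corrFst EB (k + 1)) (pull ((K.nf z).symm : _ →L[ℝ] EP) φ) := fun φ => rfl
  have e2 : ∀ φ, pull (corrTangent K K' z z') (pull (ContinuousLinearMap.snd ℝ EP EP') φ) =
      pull (corrSnd EB (k + 1)) (pull ((K'.nf z').symm : _ →L[ℝ] EP') φ) := fun φ => rfl
  rw [fourierForm, pull_neg, pull_sum, linFourier]
  refine congrArg Neg.neg (Finset.sum_congr rfl fun i _ => ?_)
  rw [pull_wedge, e1, e2, R.pull_nf_symm_ofCovector_A K, R'.pull_nf_symm_ofCovector_A K',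
    pull_ofCovector, pull_ofCovector]
  rfl

omit [IsManifold 𝓘(ℝ, EB) ∞ B] [FiniteDimensional ℝ EM] [IsManifold 𝓘(ℝ, EM) ∞ M]
  [FiniteDimensional ℝ EM'] [IsManifold 𝓘(ℝ, EM') ∞ M'] [IsManifold 𝓘(ℝ, EP) ∞ P]
  [IsManifold 𝓘(ℝ, EP') ∞ P'] in
/-- The integrand of the Fourier transform in charts. -/
theorem expWedge_fourierForm_apply (K : FrameChart R.frP c) (K' : FrameChart R'.frP c) {u : EB}
    (s s' : Fin (k + 1) → ℝ) (ρ : PForm EP) {j : ℕ} (w : Fin j → EP')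
    (v : Fin j → EP)
    (hv : ∀ i, R.TP.dproj (K.Ψ (u, s)) (v i) = R'.TP.dproj (K'.Ψ (u, s')) (w i)) :
    expWedge (fourierForm R R' (K.Ψ (u, s), K'.Ψ (u, s')))
        (pull (ContinuousLinearMap.fst ℝ EP EP') ρ) (k + 1 + j)
        (Fin.append (fun i => (R.TP.gen i (K.Ψ (u, s)), (0 : EP'))) (fun i => (v i, w i))) =
      cliffProd (torusVec EB) (pull ((K.nf (u, s)).symm : EB × (Fin (k + 1) → ℝ) →L[ℝ] EP) ρ) j
        (fun i => K'.nf (u, s') (w i)) := by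
  set G := corrTangent K K' (u, s) (u, s') with hG
  set a : Fin j → EB × (Fin (k + 1) → ℝ) × (Fin (k + 1) → ℝ) := fun i =>
    ((K'.nf (u, s') (w i)).1, (K.nf (u, s) (v i)).2, (K'.nf (u, s') (w i)).2) with ha
  set X : Fin (k + 1) → EB × (Fin (k + 1) → ℝ) × (Fin (k + 1) → ℝ) :=
    fun i => (0, Pi.single i 1, 0) with hX
  have h1 : ∀ i, (K.nf (u, s) (v i)).1 = (K'.nf (u, s') (w i)).1 := fun i => by
    have e1 : (K.nf (u, s) (v i)).1 = (c.D u).symm (R.TP.dproj (K.Ψ (u, s)) (v i)) :=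
      congrArg (c.D u).symm (R.frP.fst_fr _ _)
    have e2 : (K'.nf (u, s') (w i)).1 = (c.D u).symm (R'.TP.dproj (K'.Ψ (u, s')) (w i)) :=
      congrArg (c.D u).symm (R'.frP.fst_fr _ _)
    rw [e1, e2, hv]
  have hGa : ∀ i, G (a i) = (v i, w i) := fun i => by
    refine Prod.ext ?_ ?_
    · show (K.nf (u, s)).symm ((K'.nf (u, s') (w i)).1, (K.nf (u, s) (v i)).2) = v i
      rw [← h1 i]
      exact (K.nf (u, s)).symm_apply_apply (v i)
    · exact (K'.nf (u, s')).symm_apply_apply (w i)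
  have hGX : ∀ i, G (X i) = (R.TP.gen i (K.Ψ (u, s)), 0) := fun i => by
    refine Prod.ext ?_ ?_
    · show (K.nf (u, s)).symm (0, Pi.single i 1) = _
      rw [ContinuousLinearEquiv.symm_apply_eq, ← R.TP.orb_single]
      show _ = ((c.D u).symm.prodCongr (ContinuousLinearEquiv.refl ℝ (Fin (k + 1) → ℝ)))
        (R.frP.fr (K.Ψ (u, s)) (R.TP.orb (K.Ψ (u, s)) (Pi.single i 1)))
      rw [R.frP.fr_orb]
      exact Prod.ext (map_zero (c.D u).symm).symm rfl
    · show (K'.nf (u, s')).symm (0, 0) = 0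
      exact map_zero (K'.nf (u, s')).symm
  have hap : Fin.append (fun i => (R.TP.gen i (K.Ψ (u, s)), (0 : EP'))) (fun i => (v i, w i)) =
      fun i => G (Fin.append X a i) := by
    funext i
    refine Fin.addCases (fun i => ?_) (fun i => ?_) i
    · rw [Fin.append_left, Fin.append_left, hGX]
    · rw [Fin.append_right, Fin.append_right, hGa]
  rw [hap]
  have h2 := pull_expWedge (F := fourierForm R R' (K.Ψ (u, s), K'.Ψ (u, s'))) G
    (pull (ContinuousLinearMap.fst ℝ EP EP') ρ)
  rw [pull_corrTangent_fourierForm] at h2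
  have h3 : expWedge (fourierForm R R' (K.Ψ (u, s), K'.Ψ (u, s')))
      (pull (ContinuousLinearMap.fst ℝ EP EP') ρ) (k + 1 + j) (fun i => G (Fin.append X a i)) =
      expWedge (linFourier EB (k + 1)) (pull (corrFst EB (k + 1))
        (pull ((K.nf (u, s)).symm : EB × (Fin (k + 1) → ℝ) →L[ℝ] EP) ρ)) (k + 1 + j)
        (Fin.append X a) :=
    congrArg (fun φ : PForm _ => φ (k + 1 + j) (Fin.append X a)) h2
  rw [h3, ← cliffProd_vector_apply, hX, cliffProd_expWedge_linFourier]
  rfl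

/-- The Fourier transform of an invariant pair is the dual pair. -/
theorem isTDualPairOn_liftPair {ε : ℝ} (hε : ε * ε = 1) {U : Set B} (hU : IsOpen U)
    {p : B → PForm (EB × (Fin k → ℝ)) × PForm (EB × (Fin k → ℝ))}
    {q : M → PForm EM × PForm EM} (hq : ∀ x ∈ R.TM.proj ⁻¹' U, q x = R.frM.liftPair p x) :
    IsTDualPairOn R R' ε U q
      (R'.frM.liftPair fun b => dualPair ε (torusVec EB) (p b)) := by
  intro x y hxy hy j w v hv
  obtain ⟨c, K, K', hb, -⟩ := R.exists_charts R' hU hy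
  have hu := c.e.map_source hb
  set u := c.e (R'.TP.proj y) with hudef
  obtain ⟨s₀, hs₀⟩ := K.exists_eq (x := x) (by rwa [hxy])
  obtain ⟨s', hs'⟩ := K'.exists_eq hb
  rw [hxy] at hs₀
  have hx : ∀ s, R.TP.act s x = K.Ψ (u, s + s₀) := fun s => by rw [← hs₀, K.act_Ψ]
  have e1 : ∀ s, pull ((K.nf (u, s)).symm : EB × (Fin (k + 1) → ℝ) →L[ℝ] EP)
      (R.lift Complex.I q (K.Ψ (u, s))) = linLift Complex.I (c.pairMap p u) := fun s => by
    have hm : (R.quotChart K).Ψ (u, Fin.tail s) ∈ R.TM.proj ⁻¹' U := by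
      rw [Set.mem_preimage, (R.quotChart K).proj_Ψ _ hu, hudef, c.e.left_inv hb]
      exact hy
    rw [R.pull_nf_symm_lift K, hq _ hm, (R.quotChart K).pullPair_nf_symm_liftPair _ hu]
  have e2 : pull ((K'.nf (u, s')).symm : EB × (Fin (k + 1) → ℝ) →L[ℝ] EP')
      (R'.lift (ε * Complex.I) (R'.frM.liftPair fun b => dualPair ε (torusVec EB) (p b))
        (K'.Ψ (u, s'))) = cliffProd (torusVec EB) (linLift Complex.I (c.pairMap p u)) := by
    rw [R'.pull_nf_symm_lift K', (R'.quotChart K').pullPair_nf_symm_liftPair _ hu,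
      c.pairMap_dualPair]
    exact (cliffProd_torusVec_lift EB hε (c.pairMap p u)).symm
  have e3 : ∀ s, expWedge (fourierForm R R' (R.TP.act s x, y))
      (pull (ContinuousLinearMap.fst ℝ EP EP') (R.lift Complex.I q (R.TP.act s x))) (k + 1 + j)
      (Fin.append (fun i => (R.TP.gen i (R.TP.act s x), (0 : EP'))) (fun i => (v s i, w i))) =
      cliffProd (torusVec EB) (linLift Complex.I (c.pairMap p u)) j
        (fun i => K'.nf (u, s') (w i)) := fun s => by
    have h := expWedge_fourierForm_apply K K' (s + s₀) s'
      (R.lift Complex.I q (K.Ψ (u, s + s₀))) w (v s) (by rw [← hx, hs']; exact hv s)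
    rw [e1, ← hx, hs'] at h
    exact h
  simp only [e3]
  rw [MeasureTheory.setIntegral_const, MeasureTheory.measureReal_def, Real.volume_Icc_pi_toReal
    (a := 0) (b := 1) (fun _ => zero_le_one)]
  simp only [Pi.one_apply, Pi.zero_apply, sub_zero, Finset.prod_const_one, one_smul]
  rw [← e2, pull_apply, hs']
  refine congrArg _ (funext fun i => ?_)
  exact ((K'.nf (u, s')).symm_apply_apply (w i)).symm

end Fourier

/-! ### Pairs of dual structures -/

section Lengths

theorem pairing_pullPair_eq_smul_iff (f : V ≃L[ℝ] W) (c : ℝ) (p q : PForm W × PForm W) :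
    pairing (pullPair (f : V →L[ℝ] W) p) (conjPair (pullPair (f : V →L[ℝ] W) p)) =
      c • pairing (pullPair (f : V →L[ℝ] W) q) (conjPair (pullPair (f : V →L[ℝ] W) q)) ↔
    pairing p (conjPair p) = c • pairing q (conjPair q) := by
  have h : ∀ X Y : PForm W, (pull (f : V →L[ℝ] W) X) (Module.finrank ℝ V) =
      c • (pull (f : V →L[ℝ] W) Y) (Module.finrank ℝ V) ↔
      X (Module.finrank ℝ W) = c • Y (Module.finrank ℝ W) := by
    intro X Y
    have h1 := pull_apply_eq_zero_iff f (X - c • Y) (Module.finrank ℝ V)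
    rw [f.toLinearEquiv.finrank_eq] at h1 ⊢
    rw [← sub_eq_zero, ← sub_eq_zero (b := c • Y _)]
    exact h1
  rw [conjPair_pullPair, conjPair_pullPair, pairing_pullPair, pairing_pullPair, h, ← pairing_eq,
    ← pairing_eq]

end Lengths

section Frame

variable {n : ℕ} [FiniteDimensional ℝ EP] [FiniteDimensional ℝ EB] {T : TorusBundle n EP P EB B}
  (f : T.Frame) (Q Q₁ Q₂ : B → PointQuadruple (EB × (Fin n → ℝ)))

namespace TorusBundle.Frame

theorem J_liftQuad (x : P) (a : CE (EB × (Fin n → ℝ))) :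
    (f.liftQuad Q).J x (ceMap (f.fr x).symm a) = ceMap (f.fr x).symm ((Q (T.proj x)).J a) :=
  PointQuadruple.J_map (f.fr x).symm (Q (T.proj x)) a

theorem exists_ceMap_symm_eq (x : P) (a : CE EP) : ∃ b, ceMap (f.fr x).symm b = a :=
  ⟨ceMap (f.fr x) a, ceMap_symm_ceMap (f.fr x) a⟩

theorem ceMap_fr_symm_injective (x : P) : Function.Injective
    (ceMap (f.fr x).symm : CE (EB × (Fin n → ℝ)) → CE EP) :=
  Function.LeftInverse.injective (g := ceMap (f.fr x)) fun a => ceMap_symm_ceMap (f.fr x).symm a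

theorem J_comm_liftQuad_iff :
    (∀ x a, (f.liftQuad Q₁).J x ((f.liftQuad Q₂).J x a) =
      (f.liftQuad Q₂).J x ((f.liftQuad Q₁).J x a)) ↔
    ∀ b a, (Q₁ b).J ((Q₂ b).J a) = (Q₂ b).J ((Q₁ b).J a) := by
  refine ⟨fun h b a => ?_, fun h x a => ?_⟩
  · have h1 := h (T.pt b) (ceMap (f.fr (T.pt b)).symm a)
    rw [J_liftQuad, J_liftQuad, J_liftQuad, J_liftQuad, T.proj_pt] at h1
    exact f.ceMap_fr_symm_injective _ h1
  · obtain ⟨a, rfl⟩ := f.exists_ceMap_symm_eq x a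
    rw [J_liftQuad, J_liftQuad, J_liftQuad, J_liftQuad, h]

theorem ceMap_neg (x : P) (a : CE (EB × (Fin n → ℝ))) :
    ceMap (f.fr x).symm (-a) = -ceMap (f.fr x).symm a :=
  Prod.ext (map_neg (gtEquiv (f.fr x).symm) a.1) rfl

theorem J_pos_liftQuad_iff :
    (∀ x a, a ≠ 0 → 0 < inCE (-((f.liftQuad Q₁).J x ((f.liftQuad Q₂).J x a))) a) ↔
    ∀ b a, a ≠ 0 → 0 < inCE (-((Q₁ b).J ((Q₂ b).J a))) a := by
  have h0 : ∀ x, ceMap (f.fr x).symm (0 : CE (EB × (Fin n → ℝ))) = 0 := fun x =>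
    Prod.ext (map_zero (gtEquiv (f.fr x).symm)) rfl
  refine ⟨fun h b a ha => ?_, fun h x a ha => ?_⟩
  · have h1 := h (T.pt b) (ceMap (f.fr (T.pt b)).symm a)
      fun h => ha (f.ceMap_fr_symm_injective _ (h.trans (h0 _).symm))
    rwa [J_liftQuad, J_liftQuad, T.proj_pt, ← ceMap_neg, inCE_ceMap] at h1
  · obtain ⟨a, rfl⟩ := f.exists_ceMap_symm_eq x a
    rw [J_liftQuad, J_liftQuad, ← ceMap_neg, inCE_ceMap]
    exact h _ _ fun h => ha (by rw [h, h0])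

theorem length_liftPair_iff (c : ℝ)
    (p q : B → PForm (EB × (Fin n → ℝ)) × PForm (EB × (Fin n → ℝ))) :
    (∀ x, pairing (f.liftPair p x) (conjPair (f.liftPair p x)) =
      c • pairing (f.liftPair q x) (conjPair (f.liftPair q x))) ↔
    ∀ b, pairing (p b) (conjPair (p b)) = c • pairing (q b) (conjPair (q b)) := by
  refine ⟨fun h b => ?_, fun h x => ?_⟩
  · have h1 := (pairing_pullPair_eq_smul_iff (f.fr (T.pt b)) c _ _).1 (h (T.pt b))
    rwa [T.proj_pt] at h1
  · exact (pairing_pullPair_eq_smul_iff (f.fr x) c _ _).2 (h _)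

end TorusBundle.Frame

end Frame

section Dual

variable {k : ℕ} {v : Fin k → GT V} {ε : ℝ} {Q₁ Q₂ : PointQuadruple V}

theorem PointQuadruple.J_comm_dual (hv : NegOrthonormal v) (hε : ε * ε = 1)
    (h : ∀ a, Q₁.J (Q₂.J a) = Q₂.J (Q₁.J a)) (a : CE V) :
    (Q₁.dual ε v).J ((Q₂.dual ε v).J a) = (Q₂.dual ε v).J ((Q₁.dual ε v).J a) := by
  rw [← reflectCE_reflectCE hv hε a, J_dual hv hε, J_dual hv hε, J_dual hv hε, J_dual hv hε, h]

theorem PointQuadruple.J_pos_dual (hv : NegOrthonormal v) (hε : ε * ε = 1)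
    (h : ∀ a, a ≠ 0 → 0 < inCE (-(Q₁.J (Q₂.J a))) a) (a : CE V) (ha : a ≠ 0) :
    0 < inCE (-((Q₁.dual ε v).J ((Q₂.dual ε v).J a))) a := by
  have hneg : ∀ b : CE V, -reflectCE ε v b = reflectCE ε v (-b) := fun b =>
    Prod.ext (map_neg (reflect v) b.1).symm (Prod.ext (mul_neg ε b.2.2).symm (mul_neg ε b.2.1).symm)
  have h0 : reflectCE ε v (0 : CE V) = 0 :=
    Prod.ext (map_zero (reflect v)) (Prod.ext (mul_zero ε) (mul_zero ε))
  have h1 := h (reflectCE ε v a) fun h1 => ha (by rw [← reflectCE_reflectCE hv hε a, h1, h0])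
  rw [← reflectCE_reflectCE hv hε a, J_dual hv hε, J_dual hv hε, hneg, inCE_reflectCE hv hε]
  exact h1

theorem pairing_dualPair_eq_smul [FiniteDimensional ℝ V] (hv : NegOrthonormal v) {c : ℝ}
    {p q : PForm V × PForm V} (h : pairing p (conjPair p) = c • pairing q (conjPair q)) :
    pairing (dualPair ε v p) (conjPair (dualPair ε v p)) =
      c • pairing (dualPair ε v q) (conjPair (dualPair ε v q)) := by
  rw [← dualPair_conjPair, ← dualPair_conjPair, pairing_dualPair hv, pairing_dualPair hv, h,
    smul_comm]

end Dual

section Main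

variable {k : ℕ} [FiniteDimensional ℝ EB] [IsManifold 𝓘(ℝ, EB) ∞ B] [FiniteDimensional ℝ EM]
  [IsManifold 𝓘(ℝ, EM) ∞ M] [FiniteDimensional ℝ EP] [IsManifold 𝓘(ℝ, EP) ∞ P]
  [FiniteDimensional ℝ EM'] [IsManifold 𝓘(ℝ, EM') ∞ M'] [FiniteDimensional ℝ EP']
  [IsManifold 𝓘(ℝ, EP') ∞ P'] (R : Reduction k EB B EM M EP P) (R' : Reduction k EB B EM' M' EP' P')
  (ε : ℝ)

/-- The T-dual of an invariant quadruple. -/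
def dualQuadruple (S : Quadruple EM M) : Quadruple EM' M' :=
  R'.frM.liftQuad fun b => (R.frM.quad S b).dual ε (torusVec EB)

/-- The T-dual of an invariant pair. -/
def dualPairField (p : M → PForm EM × PForm EM) : M' → PForm EM' × PForm EM' :=
  R'.frM.liftPair fun b => dualPair ε (torusVec EB) (R.frM.basePair p b)

variable {R R' ε} {t : Twist EM M} {t' : Twist EM' M'} {S S₁ S₂ : Quadruple EM M}
  {p p₁ p₂ : M → PForm EM × PForm EM} {U : Set B} {c : ℝ}

theorem IsTDual.isGenContact_dualQuadruple (hd : IsTDual R R' t t') (hε : ε * ε = 1)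
    (hS : R.TM.InvariantQuadruple S) (h : IsGenContact t S) :
    IsGenContact (t'.scale (-ε)) (dualQuadruple R R' ε S) := by
  rw [← R.frM.liftQuad_quad hS] at h
  exact hd.isGenContact hε h

theorem isMixedPairOn_dualPairField (hε : ε * ε = 1) (hS : R.TM.InvariantQuadruple S)
    (hU : IsOpen U) (hp : S.IsMixedPairOn (R.TM.proj ⁻¹' U) p)
    (hi : R.TM.InvariantPairOn (R.TM.proj ⁻¹' U) p) :
    (dualQuadruple R R' ε S).IsMixedPairOn (R'.TM.proj ⁻¹' U) (dualPairField R R' ε p) := by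
  rw [← R.frM.liftQuad_quad hS] at hp
  exact R.isMixedPairOn_liftPair_dual R' hε hU (hp.congr fun x hx => R.frM.liftPair_basePair hi hx)

theorem isTDualPairOn_dualPairField (hε : ε * ε = 1) (hU : IsOpen U)
    (hi : R.TM.InvariantPairOn (R.TM.proj ⁻¹' U) p) :
    IsTDualPairOn R R' ε U p (dualPairField R R' ε p) :=
  isTDualPairOn_liftPair hε hU fun _ hx => (R.frM.liftPair_basePair hi hx).symm

theorem isTDualQuadruple_dualQuadruple (hε : ε * ε = 1) (hS : R.TM.InvariantQuadruple S) :
    IsTDualQuadruple R R' ε S (dualQuadruple R R' ε S) := fun _ p hU hp hi =>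
  ⟨dualPairField R R' ε p, isTDualPairOn_dualPairField hε hU hi,
    isMixedPairOn_dualPairField hε hS hU hp hi, R'.frM.invariantPairOn_liftPair _ _⟩

theorem IsTDual.isGenCoKahler_dualQuadruple (hd : IsTDual R R' t t') (hε : ε * ε = 1)
    (hS₁ : R.TM.InvariantQuadruple S₁) (hS₂ : R.TM.InvariantQuadruple S₂)
    (h : IsGenCoKahler t S₁ S₂) :
    IsGenCoKahler (t'.scale (-ε)) (dualQuadruple R R' ε S₁) (dualQuadruple R R' ε S₂) := by
  have hc := h.comm
  have hp := h.pos
  rw [← R.frM.liftQuad_quad hS₁, ← R.frM.liftQuad_quad hS₂] at hc hp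
  rw [R.frM.J_comm_liftQuad_iff] at hc
  rw [R.frM.J_pos_liftQuad_iff] at hp
  exact ⟨hd.isGenContact_dualQuadruple hε hS₁ h.contact₁,
    hd.isGenContact_dualQuadruple hε hS₂ h.contact₂,
    (R'.frM.J_comm_liftQuad_iff _ _).2 fun b =>
      PointQuadruple.J_comm_dual (torusVec_negOrthonormal EB) hε (hc b),
    (R'.frM.J_pos_liftQuad_iff _ _).2 fun b =>
      PointQuadruple.J_pos_dual (torusVec_negOrthonormal EB) hε (hp b)⟩

theorem IsTDual.isEinsteinPair_dualQuadruple (hd : IsTDual R R' t t') (hε : ε * ε = 1)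
    (hS₁ : R.TM.InvariantQuadruple S₁) (hS₂ : R.TM.InvariantQuadruple S₂)
    (hp₁ : R.TM.InvariantPairOn Set.univ p₁) (hp₂ : R.TM.InvariantPairOn Set.univ p₂)
    (h : IsEinsteinPair t c S₁ S₂ p₁ p₂) :
    IsEinsteinPair (t'.scale (-ε)) c (dualQuadruple R R' ε S₁) (dualQuadruple R R' ε S₂)
      (dualPairField R R' ε p₁) (dualPairField R R' ε p₂) := by
  have hl : ∀ x, pairing (R.frM.liftPair (R.frM.basePair p₁) x)
      (conjPair (R.frM.liftPair (R.frM.basePair p₁) x)) =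
      c • pairing (R.frM.liftPair (R.frM.basePair p₂) x)
        (conjPair (R.frM.liftPair (R.frM.basePair p₂) x)) := fun x => by
    rw [R.frM.liftPair_basePair (U := Set.univ) hp₁ trivial,
      R.frM.liftPair_basePair (U := Set.univ) hp₂ trivial]
    exact h.length x
  rw [R.frM.length_liftPair_iff] at hl
  exact ⟨hd.isGenContact_dualQuadruple hε hS₁ h.contact₁,
    hd.isGenContact_dualQuadruple hε hS₂ h.contact₂,
    isMixedPairOn_dualPairField hε hS₁ isOpen_univ h.mixed₁ hp₁,
    isMixedPairOn_dualPairField hε hS₂ isOpen_univ h.mixed₂ hp₂,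
    (R'.frM.length_liftPair_iff _ _ _).2 fun b =>
      pairing_dualPair_eq_smul (torusVec_negOrthonormal EB) (hl b)⟩

omit [IsManifold 𝓘(ℝ, EB) ∞ B] [IsManifold 𝓘(ℝ, EP) ∞ P] [IsManifold 𝓘(ℝ, EP') ∞ P'] in
theorem dualQuadruple_e₁_congr (h : S₁.e₂ = S₂.e₂) :
    (dualQuadruple R R' ε S₁).e₁ = (dualQuadruple R R' ε S₂).e₁ := by
  funext x
  show gtMap (R'.frM.fr x).symm (ε • reflect _ (gtMap _ (S₁.e₂ _))) =
    gtMap (R'.frM.fr x).symm (ε • reflect _ (gtMap _ (S₂.e₂ _)))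
  rw [h]

omit [IsManifold 𝓘(ℝ, EB) ∞ B] [IsManifold 𝓘(ℝ, EP) ∞ P] [IsManifold 𝓘(ℝ, EP') ∞ P'] in
theorem dualQuadruple_e₂_congr (h : S₁.e₁ = S₂.e₁) :
    (dualQuadruple R R' ε S₁).e₂ = (dualQuadruple R R' ε S₂).e₂ := by
  funext x
  show gtMap (R'.frM.fr x).symm (ε • reflect _ (gtMap _ (S₁.e₁ _))) =
    gtMap (R'.frM.fr x).symm (ε • reflect _ (gtMap _ (S₂.e₁ _)))
  rw [h]

end Main

end GenGeom

end

theorem mainTheorem3 {k : ℕ} {EB B EM M EP P EM' M' EP' P' : Type*}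
    [NormedAddCommGroup EB] [NormedSpace ℝ EB] [FiniteDimensional ℝ EB]
    [TopologicalSpace B] [T2Space B] [SecondCountableTopology B]
    [ChartedSpace EB B] [IsManifold 𝓘(ℝ, EB) ∞ B]
    [NormedAddCommGroup EM] [NormedSpace ℝ EM] [FiniteDimensional ℝ EM]
    [TopologicalSpace M] [T2Space M] [SecondCountableTopology M]
    [ChartedSpace EM M] [IsManifold 𝓘(ℝ, EM) ∞ M]
    [NormedAddCommGroup EP] [NormedSpace ℝ EP] [FiniteDimensional ℝ EP]
    [TopologicalSpace P] [T2Space P] [SecondCountableTopology P]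
    [ChartedSpace EP P] [IsManifold 𝓘(ℝ, EP) ∞ P]
    [NormedAddCommGroup EM'] [NormedSpace ℝ EM'] [FiniteDimensional ℝ EM']
    [TopologicalSpace M'] [T2Space M'] [SecondCountableTopology M']
    [ChartedSpace EM' M'] [IsManifold 𝓘(ℝ, EM') ∞ M']
    [NormedAddCommGroup EP'] [NormedSpace ℝ EP'] [FiniteDimensional ℝ EP']
    [TopologicalSpace P'] [T2Space P'] [SecondCountableTopology P']
    [ChartedSpace EP' P'] [IsManifold 𝓘(ℝ, EP') ∞ P']
    (R : GenGeom.Reduction k EB B EM M EP P)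
    (R' : GenGeom.Reduction k EB B EM' M' EP' P')
    (t : GenGeom.Twist EM M) (t' : GenGeom.Twist EM' M')
    (hodd : Odd (Module.finrank ℝ EM))
    (hdual : GenGeom.IsTDual R R' t t')
    (ε : ℝ) (hε : ε = 1 ∨ ε = -1) :
    -- generalised coKähler structures
    (∀ S₁ S₂ : GenGeom.Quadruple EM M,
      R.TM.InvariantQuadruple S₁ → R.TM.InvariantQuadruple S₂ →
      GenGeom.IsGenCoKahler t S₁ S₂ →
      ∃ S₁' S₂' : GenGeom.Quadruple EM' M',
        R'.TM.InvariantQuadruple S₁' ∧ R'.TM.InvariantQuadruple S₂' ∧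
        GenGeom.IsGenCoKahler (t'.scale (-ε)) S₁' S₂' ∧
        GenGeom.IsTDualQuadruple R R' ε S₁ S₁' ∧ GenGeom.IsTDualQuadruple R R' ε S₂ S₂') ∧
    -- generalised coKähler–Einstein structures
    (∀ (c : ℝ) (S₁ S₂ : GenGeom.Quadruple EM M)
        (p₁ p₂ : M → GenGeom.PForm EM × GenGeom.PForm EM),
      R.TM.InvariantQuadruple S₁ → R.TM.InvariantQuadruple S₂ →
      R.TM.InvariantPairOn Set.univ p₁ → R.TM.InvariantPairOn Set.univ p₂ →
      GenGeom.IsGenCoKahlerEinstein t c S₁ S₂ p₁ p₂ →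
      ∃ (S₁' S₂' : GenGeom.Quadruple EM' M')
        (p₁' p₂' : M' → GenGeom.PForm EM' × GenGeom.PForm EM'),
        R'.TM.InvariantQuadruple S₁' ∧ R'.TM.InvariantQuadruple S₂' ∧
        R'.TM.InvariantPairOn Set.univ p₁' ∧ R'.TM.InvariantPairOn Set.univ p₂' ∧
        GenGeom.IsGenCoKahlerEinstein (t'.scale (-ε)) c S₁' S₂' p₁' p₂' ∧
        GenGeom.IsTDualPairOn R R' ε Set.univ p₁ p₁' ∧
        GenGeom.IsTDualPairOn R R' ε Set.univ p₂ p₂') ∧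
    -- pairs of generalised contact structures with proportional lengths (and common sections)
    (∀ (c : ℝ) (S₁ S₂ : GenGeom.Quadruple EM M)
        (p₁ p₂ : M → GenGeom.PForm EM × GenGeom.PForm EM),
      R.TM.InvariantQuadruple S₁ → R.TM.InvariantQuadruple S₂ →
      R.TM.InvariantPairOn Set.univ p₁ → R.TM.InvariantPairOn Set.univ p₂ →
      GenGeom.IsEinsteinPair t c S₁ S₂ p₁ p₂ →
      ∃ (S₁' S₂' : GenGeom.Quadruple EM' M')
        (p₁' p₂' : M' → GenGeom.PForm EM' × GenGeom.PForm EM'),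
        R'.TM.InvariantQuadruple S₁' ∧ R'.TM.InvariantQuadruple S₂' ∧
        R'.TM.InvariantPairOn Set.univ p₁' ∧ R'.TM.InvariantPairOn Set.univ p₂' ∧
        GenGeom.IsEinsteinPair (t'.scale (-ε)) c S₁' S₂' p₁' p₂' ∧
        GenGeom.IsTDualPairOn R R' ε Set.univ p₁ p₁' ∧
        GenGeom.IsTDualPairOn R R' ε Set.univ p₂ p₂' ∧
        (S₁.e₁ = S₂.e₁ ∧ S₁.e₂ = S₂.e₂ → S₁'.e₁ = S₂'.e₁ ∧ S₁'.e₂ = S₂'.e₂)) := by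
  have hεε : ε * ε = 1 := by rcases hε with rfl | rfl <;> norm_num
  refine ⟨fun S₁ S₂ h₁ h₂ h => ?_, fun c S₁ S₂ p₁ p₂ h₁ h₂ i₁ i₂ h => ?_,
    fun c S₁ S₂ p₁ p₂ h₁ h₂ i₁ i₂ h => ?_⟩
  · exact ⟨GenGeom.dualQuadruple R R' ε S₁, GenGeom.dualQuadruple R R' ε S₂,
      R'.frM.invariantQuadruple_liftQuad _, R'.frM.invariantQuadruple_liftQuad _,
      hdual.isGenCoKahler_dualQuadruple hεε h₁ h₂ h,
      GenGeom.isTDualQuadruple_dualQuadruple hεε h₁, GenGeom.isTDualQuadruple_dualQuadruple hεε h₂⟩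
  · exact ⟨GenGeom.dualQuadruple R R' ε S₁, GenGeom.dualQuadruple R R' ε S₂,
      GenGeom.dualPairField R R' ε p₁, GenGeom.dualPairField R R' ε p₂,
      R'.frM.invariantQuadruple_liftQuad _, R'.frM.invariantQuadruple_liftQuad _,
      R'.frM.invariantPairOn_liftPair _ _, R'.frM.invariantPairOn_liftPair _ _,
      ⟨hdual.isGenCoKahler_dualQuadruple hεε h₁ h₂ h.coKahler,
        hdual.isEinsteinPair_dualQuadruple hεε h₁ h₂ i₁ i₂ h.einstein⟩,
      GenGeom.isTDualPairOn_dualPairField hεε isOpen_univ i₁,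
      GenGeom.isTDualPairOn_dualPairField hεε isOpen_univ i₂⟩
  · exact ⟨GenGeom.dualQuadruple R R' ε S₁, GenGeom.dualQuadruple R R' ε S₂,
      GenGeom.dualPairField R R' ε p₁, GenGeom.dualPairField R R' ε p₂,
      R'.frM.invariantQuadruple_liftQuad _, R'.frM.invariantQuadruple_liftQuad _,
      R'.frM.invariantPairOn_liftPair _ _, R'.frM.invariantPairOn_liftPair _ _,
      hdual.isEinsteinPair_dualQuadruple hεε h₁ h₂ i₁ i₂ h,
      GenGeom.isTDualPairOn_dualPairField hεε isOpen_univ i₁,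
      GenGeom.isTDualPairOn_dualPairField hεε isOpen_univ i₂,
      fun he => ⟨GenGeom.dualQuadruple_e₁_congr he.2, GenGeom.dualQuadruple_e₂_congr he.1⟩⟩
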